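/- Let $0\le a<b\le\infty$. A weight on $(a,b)$ is a measurable function that is positive and finite a.e. on $(a,b)$; $\mathcal M^+$ is the set of non-negative measurable functions on $(a,b)$. For weights $v,w$ and $a\le x<y\le b$ put $$V_r(x,y)=\Big(\int_x^y v^{\frac1{1-r}}\Big)^{\frac{1-r}{r}}\ (0<r<1),\qquad V_1(x,y)=\operatorname*{ess\,sup}_{s\in(x,y)}v(s),\qquad \mathcal W(x)=\int_x^b w .$$ Let $0<r\le1$, $0<p,q<\infty$, and let $u,v,w$ be weights on $(a,b)$ with $0<\mathcal W(x)<\infty$ for all $x\in(a,b)$. Consider the inequality $$\Big(\int_a^b\Big(\int_a^t f(s)^r v(s)\,ds\Big)^{\frac qr}u(t)\,dt\Big)^{\frac1q}\le C\Big(\int_a^b\Big(\int_a^t f(s)\,ds\Big)^{p}w(t)\,dt\Big)^{\frac1p}.\qquad(\ast)$$ Define $$C_1=\operatorname*{ess\,sup}_{x\in(a,b)}\mathcal W(x)^{-\frac1p}\operatorname*{ess\,sup}_{t\in(x,b)}\Big(\int_t^bu\Big)^{\frac1q}V_r(x,t),$$ $$C_2=\sup_{x\in(a,b)}\mathcal W(x)^{-\frac1p}\Big(\int_x^b\Big(\int_t^bu\Big)^{\frac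 q{1-q}}u(t)V_r(x,t)^{\frac q{1-q}}dt\Big)^{\frac{1-q}q},$$ $$C_3=\sup_{x\in(a,b)}\Big(\int_x^bu\Big)^{\frac1q}\Big(\int_a^x\mathcal W(t)^{-\frac p{p-r}}w(t)V_r(t,x)^{\frac{pr}{p-r}}dt\Big)^{\frac{p-r}{pr}},$$ $$C_4=\Big(\int_a^b\Big(\int_x^bu\Big)^{\frac q{p-q}}u(x)\operatorname*{ess\,sup}_{t\in(a,x)}\mathcal W(t)^{-\frac q{p-q}}V_r(t,x)^{\frac{pq}{p-q}}dx\Big)^{\frac{p-q}{pq}},$$ $$C_5=\Big(\int_a^bw(x)\operatorname*{ess\,sup}_{y\in(a,x)}\mathcal W(y)^{-\frac p{p-q}}\Big(\int_y^x\Big(\int_t^xu\Big)^{\frac q{1-q}}u(t)V_r(y,t)^{\frac q{1-q}}dt\Big)^{\frac{p(1-q)}{p-q}}dx\Big)^{\frac{p-q}{pq}},$$ $$C_6=\Big(\int_a^bw(x)\operatorname*{ess\,sup}_{y\in(a,x)}\mathcal W(y)^{-1}\Big(\int_y^x\Big(\int_t^bu\Big)^{\frac q{p-q}}u(t)dt\Big)\Big(\int_a^y\mathcal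 W(t)^{-\frac p{p-r}}w(t)V_r(t,y)^{\frac{pr}{p-r}}dt\Big)^{\frac{q(p-r)}{r(p-q)}}dx\Big)^{\frac{p-q}{pq}},$$ $$C_7=\Big(\int_a^bw(x)\operatorname*{ess\,sup}_{y\in(a,x)}\mathcal W(y)^{-\frac p{p-q}}\operatorname*{ess\,sup}_{t\in(y,x)}\Big(\int_t^xu\Big)^{\frac p{p-q}}V_r(y,t)^{\frac{pq}{p-q}}dx\Big)^{\frac{p-q}{pq}}.$$ Then $(\ast)$ holds with some finite $C$ for all $f\in\mathcal M^+$ if and only if - (i) $C_1<\infty$, when $p\le r\le1\le q$; - (ii) $C_2<\infty$, when $p\le q<1$ and $p\le r\le 1$; - (iii) $\max\{C_1,C_3\}<\infty$, when $r<p\le q$ and $r\le 1\le q$; - (iv) $\max\{C_2,C_3\}<\infty$, when $r<p\le q<1$; - (v) $\max\{C_4,C_5\}<\infty$, when $q<p\le r\le1$; - (vi) $\max\{C_1,C_5,C_6\}<\infty$, when $q<p$, $q<1$, $r<p$ and $r\le1$; - (vii) $\max\{C_1,C_6,C_7\}<\infty$, when $r\le1\le q<p$. (These seven cases exhaust all admissible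 parameters.) Moreover, the best constant $C\in[0,\infty]$ in $(\ast)$ is equivalent, with multiplicative constants depending only on $p,q,r$, to $C_1$, $C_2$, $C_1+C_3$, $C_2+C_3$, $C_4+C_5$, $C_1+C_5+C_6$, $C_1+C_6+C_7$ in the cases (i)–(vii), respectively. Consequently, let $0<p_1,q_1,p_2,q_2<\infty$ and let $u_1,v_1,u_2,v_2$ be weights on $(a,b)$ with $0<\int_x^bu_1^{q_1}<\infty$ for all $x\in(a,b)$. Put $\|f\|_{\mathrm{Ces}_{p,q}(u,v)}=\big(\int_a^b(\int_a^t f^pv^p)^{q/p}u(t)^q\,dt\big)^{1/q}$, and let $c\in[0,\infty]$ be the best constant in $\|f\|_{\mathrm{Ces}_{p_2,q_2}(u_2,v_2)}\le c\,\|f\|_{\mathrm{Ces}_{p_1,q_1}(u_1,v_1)}$, $f\in\mathcal M^+$; the embedding $\mathrm{Ces}_{p_1,q_1}(u_1,v_1)\hookrightarrow\mathrm{Ces}_{p_2,q_2}(u_2,v_2)$ means that this inequality holds for all $f\in\mathcal M^+$ with some finite constant. If $p_2\le p_1$, the embedding holds if and only if $(\ast)$ holds with some finite constant for $r=p_2/p_1$,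 $p=q_1/p_1$, $q=q_2/p_1$, $u=u_2^{q_2}$, $v=(v_2/v_1)^{p_2}$, $w=u_1^{q_1}$; in every case $c^{p_1}$ equals the best constant in $(\ast)$ for these data, so that (i)–(vii) characterize the embedding. If $p_1<p_2$, the embedding never holds. -/

import Mathlib

open MeasureTheory Set
open scoped ENNReal NNReal

namespace CesHardy

noncomputable section

/-- The open interval `(x, y)` of real numbers, with extended real end points. -/
def ival (x y : EReal) : Set ℝ := {t : ℝ | x < (t : EReal) ∧ (t : EReal) < y}

/-- Lebesgue measure on `(x, y)`. -/
def leb (x y : EReal) : Measure ℝ := volume.restrict (ival x y)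

/-- `∫_x^y g`. -/
def integ (g : ℝ → ℝ≥0∞) (x y : EReal) : ℝ≥0∞ := ∫⁻ t, g t ∂(leb x y)

/-- `𝓜⁺(a,b)`: the non-negative (Lebesgue) measurable functions on `(a, b)`. -/
def MPlus (a b : EReal) (f : ℝ → ℝ≥0∞) : Prop := AEMeasurable f (leb a b)

/-- A weight on `(a, b)`: measurable, and positive and finite almost everywhere on `(a, b)`. -/
structure IsWeight (a b : EReal) (g : ℝ → ℝ≥0∞) : Prop where
  meas : AEMeasurable g (leb a b)
  pos : ∀ᵐ t ∂(leb a b), 0 < g t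
  fin : ∀ᵐ t ∂(leb a b), g t < ∞

/-- `V_r(x, y)`, used for `0 < r ≤ 1`. -/
def V (r : ℝ) (v : ℝ → ℝ≥0∞) (x y : EReal) : ℝ≥0∞ :=
  if r < 1 then (∫⁻ s, v s ^ (1 / (1 - r)) ∂(leb x y)) ^ ((1 - r) / r)
  else essSup v (leb x y)

/-- The inequality with constant `C`, for all non-negative measurable `f` on `(a, b)`. -/
def HardyIneq (a b : EReal) (r p q : ℝ) (u v w : ℝ → ℝ≥0∞) (C : ℝ≥0∞) : Prop :=
  ∀ f : ℝ → ℝ≥0∞, MPlus a b f →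
    (∫⁻ t, (∫⁻ s, f s ^ r * v s ∂(leb a t)) ^ (q / r) * u t ∂(leb a b)) ^ (1 / q)
      ≤ C * (∫⁻ t, (∫⁻ s, f s ∂(leb a t)) ^ p * w t ∂(leb a b)) ^ (1 / p)

/-- The inequality holds with some finite constant. -/
def HardyHolds (a b : EReal) (r p q : ℝ) (u v w : ℝ → ℝ≥0∞) : Prop :=
  ∃ C : ℝ≥0, HardyIneq a b r p q u v w C

/-- The best constant in the inequality (`∞` if no finite constant is admissible). -/
def bestConst (a b : EReal) (r p q : ℝ) (u v w : ℝ → ℝ≥0∞) : ℝ≥0∞ :=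
  sInf {C : ℝ≥0∞ | HardyIneq a b r p q u v w C}

/-- The (quasi-)norm of `Ces_{p,q}(u, v)` on `(a, b)`, for non-negative `f`. -/
def cesNorm (a b : EReal) (p q : ℝ) (u v f : ℝ → ℝ≥0∞) : ℝ≥0∞ :=
  (∫⁻ t, (∫⁻ s, f s ^ p * v s ^ p ∂(leb a t)) ^ (q / p) * u t ^ q ∂(leb a b)) ^ (1 / q)

/-- The norm inequality of the embedding `Ces_{p₁,q₁}(u₁,v₁) ↪ Ces_{p₂,q₂}(u₂,v₂)` with
constant `c`. -/
def CesIneq (a b : EReal) (p₁ q₁ p₂ q₂ : ℝ) (u₁ v₁ u₂ v₂ : ℝ → ℝ≥0∞) (c : ℝ≥0∞) : Prop :=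
  ∀ f : ℝ → ℝ≥0∞, MPlus a b f →
    cesNorm a b p₂ q₂ u₂ v₂ f ≤ c * cesNorm a b p₁ q₁ u₁ v₁ f

/-- The embedding `Ces_{p₁,q₁}(u₁,v₁) ↪ Ces_{p₂,q₂}(u₂,v₂)`. -/
def CesEmbeds (a b : EReal) (p₁ q₁ p₂ q₂ : ℝ) (u₁ v₁ u₂ v₂ : ℝ → ℝ≥0∞) : Prop :=
  ∃ c : ℝ≥0, CesIneq a b p₁ q₁ p₂ q₂ u₁ v₁ u₂ v₂ c

/-- The optimal constant of the embedding. -/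
def cesConst (a b : EReal) (p₁ q₁ p₂ q₂ : ℝ) (u₁ v₁ u₂ v₂ : ℝ → ℝ≥0∞) : ℝ≥0∞ :=
  sInf {c : ℝ≥0∞ | CesIneq a b p₁ q₁ p₂ q₂ u₁ v₁ u₂ v₂ c}

/-! The quantities `C₁, …, C₇`; throughout `𝒲(x) = ∫_x^b w = integ w x b`. -/

def C1 (a b : EReal) (r p q : ℝ) (u v w : ℝ → ℝ≥0∞) : ℝ≥0∞ :=
  essSup (fun x : ℝ => integ w x b ^ (-(1 / p)) *
    essSup (fun t : ℝ => integ u t b ^ (1 / q) * V r v x t) (leb x b)) (leb a b)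

def C2 (a b : EReal) (r p q : ℝ) (u v w : ℝ → ℝ≥0∞) : ℝ≥0∞ :=
  ⨆ x ∈ ival a b, integ w (x : ℝ) b ^ (-(1 / p)) *
    (∫⁻ t, integ u t b ^ (q / (1 - q)) * u t * V r v x t ^ (q / (1 - q)) ∂(leb x b))
      ^ ((1 - q) / q)

def C3 (a b : EReal) (r p q : ℝ) (u v w : ℝ → ℝ≥0∞) : ℝ≥0∞ :=
  ⨆ x ∈ ival a b, integ u (x : ℝ) b ^ (1 / q) *
    (∫⁻ t, integ w t b ^ (-(p / (p - r))) * w t * V r v t x ^ (p * r / (p - r)) ∂(leb a x))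
      ^ ((p - r) / (p * r))

def C4 (a b : EReal) (r p q : ℝ) (u v w : ℝ → ℝ≥0∞) : ℝ≥0∞ :=
  (∫⁻ x, integ u x b ^ (q / (p - q)) * u x *
    essSup (fun t : ℝ => integ w t b ^ (-(q / (p - q))) * V r v t x ^ (p * q / (p - q)))
      (leb a x) ∂(leb a b)) ^ ((p - q) / (p * q))

def C5 (a b : EReal) (r p q : ℝ) (u v w : ℝ → ℝ≥0∞) : ℝ≥0∞ :=
  (∫⁻ x, w x *
    essSup (fun y : ℝ => integ w y b ^ (-(p / (p - q))) *
      (∫⁻ t, integ u t x ^ (q / (1 - q)) * u t * V r v y t ^ (q / (1 - q)) ∂(leb y x))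
        ^ (p * (1 - q) / (p - q))) (leb a x) ∂(leb a b)) ^ ((p - q) / (p * q))

def C6 (a b : EReal) (r p q : ℝ) (u v w : ℝ → ℝ≥0∞) : ℝ≥0∞ :=
  (∫⁻ x, w x *
    essSup (fun y : ℝ => integ w y b ^ (-1 : ℝ) *
      (∫⁻ t, integ u t b ^ (q / (p - q)) * u t ∂(leb y x)) *
      (∫⁻ t, integ w t b ^ (-(p / (p - r))) * w t * V r v t y ^ (p * r / (p - r)) ∂(leb a y))
        ^ (q * (p - r) / (r * (p - q)))) (leb a x) ∂(leb a b)) ^ ((p - q) / (p * q))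

def C7 (a b : EReal) (r p q : ℝ) (u v w : ℝ → ℝ≥0∞) : ℝ≥0∞ :=
  (∫⁻ x, w x *
    essSup (fun y : ℝ => integ w y b ^ (-(p / (p - q))) *
      essSup (fun t : ℝ => integ u t x ^ (p / (p - q)) * V r v y t ^ (p * q / (p - q)))
        (leb y x)) (leb a x) ∂(leb a b)) ^ ((p - q) / (p * q))

/-- `A ≈ B` with multiplicative constant `K`. -/
def EquivWith (K : ℝ≥0) (A B : ℝ≥0∞) : Prop := A ≤ K * B ∧ B ≤ K * A

end

end CesHardy

namespace CesHardy

/-! ### Sums of powers -/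

/-! The inequality is discretized twice. Dyadic points `x k` of the tail of `w`, at which 𝒲 takes
values `ω k` halved at each step, turn the right-hand side into an ℓ^p norm: ∫ (∫_a^t f)^p w is
comparable to the sum of `ω k` times the p-th power of the mass of f on the k-th block. The earlier
blocks, which also enter ∫_a^t f, are absorbed because the weights `ω k` decay geometrically
(`geom_hardy`, `dyadic_upper`, `Dyadic.lower`).

The left-hand side splits accordingly (`hardyInt_split`). Inside one block of `w` only the L¹ norm
of f matters; there the best constant of the Hardy inequality with L¹ on the right is equivalent to
`locConst` (`hardyInt_le`, `locConst_le`). Between blocks, f^r v on a block may be replaced by an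
atom at the right end of the block; a second dyadic sequence `t n`, for the tail of `u`, then makes
the left-hand side a sequence norm as well. The function V enters through Hölder's inequality for ∫
f^r v and its sharpness (`lintegral_le_V`, `exists_lt_lintegral_V`).

What remains are norms of multiplication operators between sequence spaces, `blockConst` and
`chainConst`, which together suffice for the inequality (`hardyInt_le_blocks`). By Hölder and its
converse such a norm is a supremum or an ℓ^ρ norm (`mulNorm`). Hence the cases: p against q for the
outer operator, p against r for the operator inside a block of `u`, q against 1 for the local
inequality.

Two comparisons finish the characterization. The dyadic constants are bounded by the relevant Cᵢ;
conversely each Cᵢ is bounded by any admissible constant, by testing with superposed near-extremal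
functions (`exists_glue`, `test_chain`, `mulNorm_chain_le`, `blockConst_le`). They are combined in
`exists_characterizes`.

For the embedding, the substitution g = (f v₁)^p₁ gives exactly the Hardy inequality. If p₁ < p₂,
functions 1_E / v₁ with |E| small violate every constant, since |E|^(1/p₁) is negligible against
|E|^(1/p₂). -/

lemma tsum_rpow_le_rpow_tsum {ι : Type*} (c : ι → ℝ≥0∞) {s : ℝ} (hs : 1 ≤ s) :
    ∑' k, c k ^ s ≤ (∑' k, c k) ^ s := by
  have h1 : ∀ x : ℝ≥0∞, x ^ s = x * x ^ (s - 1) := fun x => by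
    conv_lhs => rw [show s = 1 + (s - 1) by ring]
    rw [ENNReal.rpow_add_of_nonneg _ _ zero_le_one (by linarith), ENNReal.rpow_one]
  calc ∑' k, c k ^ s ≤ ∑' k, c k * (∑' k, c k) ^ (s - 1) := by
        refine ENNReal.tsum_le_tsum fun k => ?_
        rw [h1]
        gcongr
        exact ENNReal.le_tsum k
    _ = (∑' k, c k) ^ s := by rw [ENNReal.tsum_mul_right, ← h1]

lemma rpow_tsum_le_tsum_rpow {ι : Type*} (c : ι → ℝ≥0∞) {s : ℝ} (hs0 : 0 < s) (hs : s ≤ 1) :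
    (∑' k, c k) ^ s ≤ ∑' k, c k ^ s := by
  have h := tsum_rpow_le_rpow_tsum (fun k => c k ^ s) (s := s⁻¹) ((one_le_inv₀ hs0).2 hs)
  simp only [ENNReal.rpow_rpow_inv hs0.ne'] at h
  calc (∑' k, c k) ^ s ≤ ((∑' k, c k ^ s) ^ s⁻¹) ^ s := by gcongr
    _ = _ := ENNReal.rpow_inv_rpow hs0.ne' _

lemma tsum_mul_le_Lp_mul_Lq (f g : ℤ → ℝ≥0∞) {p q : ℝ} (hpq : p.HolderConjugate q) :
    ∑' k, f k * g k ≤ (∑' k, f k ^ p) ^ (1 / p) * (∑' k, g k ^ q) ^ (1 / q) := by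
  have h := ENNReal.lintegral_mul_le_Lp_mul_Lq (Measure.count : Measure ℤ) hpq
    (f := f) (g := g) (measurable_of_countable _).aemeasurable
    (measurable_of_countable _).aemeasurable
  simpa only [lintegral_count, Pi.mul_apply] using h

/-! ### Geometric weights -/

lemma tsum_two_rpow_ne_top {δ : ℝ} (hδ : 0 < δ) :
    ∑' i : ℕ, (2 : ℝ≥0∞) ^ (-(δ * i)) ≠ ∞ := by
  have h : ∀ i : ℕ, (2 : ℝ≥0∞) ^ (-(δ * i)) = ((2 : ℝ≥0∞) ^ (-δ)) ^ i := fun i => by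
    rw [← ENNReal.rpow_natCast, ← ENNReal.rpow_mul]; ring_nf
  simp_rw [h, ENNReal.tsum_geometric]
  rw [Ne, ENNReal.inv_eq_top, tsub_eq_zero_iff_le, not_le]
  exact ENNReal.rpow_lt_one_of_one_lt_of_neg (by norm_num) (by linarith)

lemma two_rpow_cancel (x : ℝ) : (2 : ℝ≥0∞) ^ (-x) * 2 ^ x = 1 := by
  rw [← ENNReal.rpow_add _ _ (by norm_num) (by norm_num)]; simp

lemma tsum_le_iSup_weighted {δ : ℝ} (c : ℕ → ℝ≥0∞) :
    ∑' i, c i ≤ (⨆ i : ℕ, 2 ^ (δ * i) * c i) * ∑' i : ℕ, (2 : ℝ≥0∞) ^ (-(δ * i)) := by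
  rw [← ENNReal.tsum_mul_left]
  refine ENNReal.tsum_le_tsum fun i => ?_
  calc c i = (2 ^ (δ * i) * c i) * 2 ^ (-(δ * i)) := by
        rw [mul_comm, ← mul_assoc, two_rpow_cancel, one_mul]
    _ ≤ _ := by gcongr; exact le_iSup (fun i : ℕ => 2 ^ (δ * i) * c i) i

/-- Passing through a weighted supremum treats β ≤ 1 and β > 1 alike. The price is a slowly growing
weight, which `geom_hardy` pays out of the decay of η. -/
lemma rpow_tsum_le_weighted {ε β : ℝ} (hε : 0 < ε) (hβ : 0 < β) :
    ∃ K : ℝ≥0∞, K ≠ ∞ ∧ ∀ c : ℕ → ℝ≥0∞,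
      (∑' i, c i) ^ β ≤ K * ∑' i : ℕ, 2 ^ (ε * i) * c i ^ β := by
  refine ⟨(∑' i : ℕ, (2 : ℝ≥0∞) ^ (-((ε / β) * i))) ^ β,
    ENNReal.rpow_ne_top_of_nonneg hβ.le (tsum_two_rpow_ne_top (by positivity)), fun c => ?_⟩
  calc (∑' i, c i) ^ β
      ≤ ((⨆ i : ℕ, 2 ^ ((ε / β) * i) * c i) * ∑' i : ℕ, (2 : ℝ≥0∞) ^ (-((ε / β) * i))) ^ β := by
        gcongr; exact tsum_le_iSup_weighted c
    _ = (∑' i : ℕ, (2 : ℝ≥0∞) ^ (-((ε / β) * i))) ^ β *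
          (⨆ i : ℕ, 2 ^ ((ε / β) * i) * c i) ^ β := by
        rw [ENNReal.mul_rpow_of_nonneg _ _ hβ.le, mul_comm]
    _ ≤ _ := by
        gcongr
        rw [← ENNReal.le_rpow_inv_iff hβ]
        refine iSup_le fun i => ?_
        rw [ENNReal.le_rpow_inv_iff hβ, ENNReal.mul_rpow_of_nonneg _ _ hβ.le, ← ENNReal.rpow_mul,
          show ε / β * i * β = ε * i by field_simp]
        exact ENNReal.le_tsum (f := fun i : ℕ => 2 ^ (ε * i) * c i ^ β) i

/-- Half of the decay rate α pays for moving the power β inside the inner sum; the other half makes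
the sum over the shifts i converge once the order of summation is exchanged. This is how the
contribution of all earlier blocks is reduced to that of the current one. -/
lemma geom_hardy {α β : ℝ} (hα : 0 < α) (hβ : 0 < β) :
    ∃ K : ℝ≥0∞, K ≠ ∞ ∧ ∀ η : ℤ → ℝ≥0∞, (∀ (n : ℤ) (i : ℕ), η (n + i) ≤ 2 ^ (-(α * i)) * η n) →
      ∀ c : ℤ → ℝ≥0∞,
        ∑' n, η n * (∑' i : ℕ, c (n - i)) ^ β ≤ K * ∑' n, η n * c n ^ β := by
  obtain ⟨K, hK, h⟩ := rpow_tsum_le_weighted (ε := α / 2) (half_pos hα) hβ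
  refine ⟨K * ∑' i : ℕ, (2 : ℝ≥0∞) ^ (-(α / 2 * i)),
    ENNReal.mul_ne_top hK (tsum_two_rpow_ne_top (half_pos hα)), fun η hη c => ?_⟩
  calc ∑' n, η n * (∑' i : ℕ, c (n - i)) ^ β
      ≤ ∑' n, η n * (K * ∑' i : ℕ, 2 ^ (α / 2 * i) * c (n - i) ^ β) := by
        gcongr with n; exact h _
    _ = K * ∑' i : ℕ, ∑' n, η n * (2 ^ (α / 2 * i) * c (n - i) ^ β) := by
        rw [ENNReal.tsum_comm, ← ENNReal.tsum_mul_left]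
        refine tsum_congr fun n => ?_
        rw [ENNReal.tsum_mul_left]; ring
    _ ≤ K * ∑' i : ℕ, 2 ^ (-(α / 2 * i)) * ∑' n, η n * c n ^ β := by
        gcongr with i
        rw [← (Equiv.addRight (i : ℤ)).tsum_eq, ← ENNReal.tsum_mul_left]
        refine ENNReal.tsum_le_tsum fun n => ?_
        simp only [Equiv.coe_addRight, add_sub_cancel_right]
        calc η (n + i) * (2 ^ (α / 2 * i) * c n ^ β)
            ≤ 2 ^ (-(α * i)) * η n * (2 ^ (α / 2 * i) * c n ^ β) := by gcongr; exact hη n i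
          _ = 2 ^ (-(α * i)) * 2 ^ (α / 2 * i) * (η n * c n ^ β) := by ring
          _ = _ := by
            rw [← ENNReal.rpow_add _ _ (by norm_num) (by norm_num)]
            congr 2; ring
    _ = _ := by rw [ENNReal.tsum_mul_right, mul_assoc]

lemma geom_hardy_rev {α β : ℝ} (hα : 0 < α) (hβ : 0 < β) :
    ∃ K : ℝ≥0∞, K ≠ ∞ ∧ ∀ η : ℤ → ℝ≥0∞, (∀ (n : ℤ) (i : ℕ), η (n - i) ≤ 2 ^ (-(α * i)) * η n) →
      ∀ c : ℤ → ℝ≥0∞,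
        ∑' n, η n * (∑' i : ℕ, c (n + i)) ^ β ≤ K * ∑' n, η n * c n ^ β := by
  obtain ⟨K, hK, h⟩ := geom_hardy hα hβ
  refine ⟨K, hK, fun η hη c => ?_⟩
  have := h (fun n => η (-n)) (fun n i => by
    have := hη (-n) i
    rwa [show -n - (i : ℤ) = -(n + i) by ring] at this) (fun n => c (-n))
  rw [← (Equiv.neg ℤ).tsum_eq, ← (Equiv.neg ℤ).tsum_eq (fun n => η n * c n ^ β)]
  simp only [Equiv.neg_apply]
  convert this using 6 with n
  ext i; congr 1; ring

/-- A positive sequence halved at each step. -/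
structure Halving (ω : ℤ → ℝ≥0∞) : Prop where
  half : ∀ n, ω n = 2 * ω (n + 1)
  pos : ∀ n, 0 < ω n
  ne_top : ∀ n, ω n ≠ ∞

namespace Halving
variable {ω : ℤ → ℝ≥0∞}

lemma ne_zero (h : Halving ω) (n : ℤ) : ω n ≠ 0 := (h.pos n).ne'

lemma pred (h : Halving ω) (n : ℤ) : ω (n - 1) = 2 * ω n := by rw [h.half, sub_add_cancel]

lemma add_nat (h : Halving ω) (n : ℤ) (i : ℕ) : ω n = 2 ^ (i : ℝ) * ω (n + i) := by
  induction i with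
  | zero => simp
  | succ i ih =>
    rw [ih, h.half (n + i), Nat.cast_succ, Nat.cast_succ,
      ENNReal.rpow_add _ _ (by norm_num) (by norm_num), ENNReal.rpow_one, add_assoc]
    ring

lemma rpow_add_nat (h : Halving ω) (α : ℝ) (n : ℤ) (i : ℕ) :
    ω (n + i) ^ α = 2 ^ (-(α * i)) * ω n ^ α := by
  rw [h.add_nat n i, ENNReal.mul_rpow_of_ne_zero (by simp) (h.ne_zero _),
    ← ENNReal.rpow_mul, ← mul_assoc, mul_comm α, two_rpow_cancel, one_mul]

lemma rpow_sub_nat (h : Halving ω) (α : ℝ) (n : ℤ) (i : ℕ) :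
    ω (n - i) ^ (-α) = 2 ^ (-(α * i)) * ω n ^ (-α) := by
  have := h.rpow_add_nat (-α) (n - i) i
  rw [sub_add_cancel] at this
  rw [this, ← mul_assoc, show -(-α * (i : ℝ)) = α * i by ring, two_rpow_cancel, one_mul]

lemma anti (h : Halving ω) {m n : ℤ} (hmn : m ≤ n) : ω n ≤ ω m := by
  obtain ⟨i, rfl⟩ := Int.le.dest hmn
  rw [h.add_nat m i]
  refine le_mul_of_one_le_left' ?_
  rw [ENNReal.rpow_natCast]
  exact one_le_pow₀ (by norm_num)

end Halving

/-! ### Multipliers from `ℓ^p` to `ℓ^q` -/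

/-- The norm of the multiplication operator by `m` from `ℓ^p(ℤ)` to `ℓ^q(ℤ)`. -/
noncomputable def mulNorm (p q : ℝ) (m : ℤ → ℝ≥0∞) : ℝ≥0∞ :=
  if p ≤ q then ⨆ k, m k else (∑' k, m k ^ (p * q / (p - q))) ^ ((p - q) / (p * q))

lemma mulNorm_of_le {p q : ℝ} (h : p ≤ q) (m : ℤ → ℝ≥0∞) : mulNorm p q m = ⨆ k, m k := if_pos h

lemma mulNorm_of_lt {p q : ℝ} (h : q < p) (m : ℤ → ℝ≥0∞) :
    mulNorm p q m = (∑' k, m k ^ (p * q / (p - q))) ^ ((p - q) / (p * q)) := if_neg h.not_ge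

lemma rho_pos {p q : ℝ} (hp : 0 < p) (hq : 0 < q) (h : q < p) : 0 < p * q / (p - q) :=
  div_pos (mul_pos hp hq) (by linarith)

lemma rho_inv {p q : ℝ} : (p - q) / (p * q) = (p * q / (p - q))⁻¹ := (inv_div _ _).symm

lemma mulNorm_rpow {p q : ℝ} (hp : 0 < p) (hq : 0 < q) (h : q < p) (m : ℤ → ℝ≥0∞) :
    mulNorm p q m ^ (p * q / (p - q)) = ∑' k, m k ^ (p * q / (p - q)) := by
  rw [mulNorm_of_lt h, rho_inv, ENNReal.rpow_inv_rpow (rho_pos hp hq h).ne']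

lemma le_mulNorm {p q : ℝ} (hp : 0 < p) (hq : 0 < q) (m : ℤ → ℝ≥0∞) (k : ℤ) :
    m k ≤ mulNorm p q m := by
  rcases le_or_gt p q with h | h
  · rw [mulNorm_of_le h]; exact le_iSup m k
  · rw [← ENNReal.rpow_le_rpow_iff (rho_pos hp hq h), mulNorm_rpow hp hq h]
    exact ENNReal.le_tsum (f := fun k => m k ^ _) k

lemma mulNorm_mono {p q : ℝ} (hp : 0 < p) (hq : 0 < q) {m m' : ℤ → ℝ≥0∞} (hm : ∀ k, m k ≤ m' k) :
    mulNorm p q m ≤ mulNorm p q m' := by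
  rcases le_or_gt p q with h | h
  · rw [mulNorm_of_le h, mulNorm_of_le h]; exact iSup_mono hm
  · rw [← ENNReal.rpow_le_rpow_iff (rho_pos hp hq h), mulNorm_rpow hp hq h, mulNorm_rpow hp hq h]
    have := (rho_pos hp hq h).le
    gcongr with k; exact hm k

lemma mulNorm_const_mul {p q : ℝ} (hp : 0 < p) (hq : 0 < q) (c : ℝ≥0∞) (m : ℤ → ℝ≥0∞) :
    mulNorm p q (fun k => c * m k) = c * mulNorm p q m := by
  rcases le_or_gt p q with h | h
  · rw [mulNorm_of_le h, mulNorm_of_le h, ENNReal.mul_iSup]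
  · have hρ := rho_pos hp hq h
    refine (ENNReal.rpow_left_injective hρ.ne') ?_
    simp only [ENNReal.mul_rpow_of_nonneg _ _ hρ.le, mulNorm_rpow hp hq h, ENNReal.tsum_mul_left]

/-- The exponent for which `mulNorm p q` is subadditive over disjoint supports. -/
noncomputable def mulExp (p q : ℝ) : ℝ := if p ≤ q then 1 else p * q / (p - q)

lemma mulExp_pos {p q : ℝ} (hp : 0 < p) (hq : 0 < q) : 0 < mulExp p q := by
  unfold mulExp; split_ifs with h
  · exact one_pos
  · exact rho_pos hp hq (not_le.1 h)

/-- A supremum is at most a sum, and for q < p the ρ-th power of the norm is itself a sum over k,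
each term of which occurs for some i. The lemma serves to cut a multiplier into blocks. -/
lemma mulNorm_rpow_le_tsum {ι : Type*} {p q : ℝ} (hp : 0 < p) (hq : 0 < q) (m : ℤ → ℝ≥0∞)
    (m' : ι → ℤ → ℝ≥0∞) (h : ∀ k, m k = 0 ∨ ∃ i, m k ≤ m' i k) :
    mulNorm p q m ^ mulExp p q ≤ ∑' i, mulNorm p q (m' i) ^ mulExp p q := by
  rcases le_or_gt p q with hpq | hpq
  · simp only [mulExp, if_pos hpq, ENNReal.rpow_one]
    rw [mulNorm_of_le hpq]
    refine iSup_le fun k => ?_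
    rcases h k with h0 | ⟨i, hi⟩
    · rw [h0]; exact zero_le
    · exact hi.trans ((le_mulNorm hp hq _ k).trans (ENNReal.le_tsum i))
  · have hρ := rho_pos hp hq hpq
    simp only [mulExp, if_neg hpq.not_ge, mulNorm_rpow hp hq hpq]
    rw [ENNReal.tsum_comm]
    refine ENNReal.tsum_le_tsum fun k => ?_
    rcases h k with h0 | ⟨i, hi⟩
    · rw [h0, ENNReal.zero_rpow_of_pos hρ]; exact zero_le
    · exact (ENNReal.rpow_le_rpow hi hρ.le).trans
        (ENNReal.le_tsum (f := fun i => m' i k ^ (p * q / (p - q))) i)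

/-- For p ≤ q this is the inclusion of ℓ^p in ℓ^q, for q < p it is Hölder's inequality with
exponents p/(p-q) and p/q. -/
lemma tsum_mul_rpow_le_mulNorm {p q : ℝ} (hp : 0 < p) (hq : 0 < q) (m z : ℤ → ℝ≥0∞) :
    ∑' k, (m k * z k) ^ q ≤ mulNorm p q m ^ q * (∑' k, z k ^ p) ^ (q / p) := by
  rcases le_or_gt p q with h | h
  · calc ∑' k, (m k * z k) ^ q ≤ ∑' k, mulNorm p q m ^ q * (z k ^ p) ^ (q / p) := by
          refine ENNReal.tsum_le_tsum fun k => ?_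
          rw [ENNReal.mul_rpow_of_nonneg _ _ hq.le, ← ENNReal.rpow_mul,
            show p * (q / p) = q by field_simp]
          gcongr
          exact le_mulNorm hp hq m k
      _ ≤ _ := by
          rw [ENNReal.tsum_mul_left]
          gcongr
          exact tsum_rpow_le_rpow_tsum _ ((one_le_div hp).2 h)
  · have hpq : (p / (p - q)).HolderConjugate (p / q) := by
      rw [Real.holderConjugate_iff]
      constructor
      · rw [lt_div_iff₀ (by linarith)]; linarith
      · have : p - q ≠ 0 := by linarith
        field_simp; ring
    have hd : 0 < p - q := by linarith
    calc ∑' k, (m k * z k) ^ q = ∑' k, m k ^ q * z k ^ q := by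
          simp only [ENNReal.mul_rpow_of_nonneg _ _ hq.le]
      _ ≤ _ := tsum_mul_le_Lp_mul_Lq _ _ hpq
      _ = _ := by
          simp only [← ENNReal.rpow_mul]
          rw [mulNorm_of_lt h, ← ENNReal.rpow_mul]
          congr 2
          · congr 1; ext k; congr 1; field_simp
          · field_simp
          · congr 1; ext k; congr 1; field_simp
          · field_simp

/-- Converse of Hölder. Unit sequences give the supremum, and with it finiteness of every `m k`. For
q < p the extremal sequence is z = m^(q/(p-q)), for which (m z)^q = z^p = m^ρ; it is cut off to a
finite set so that the common sum is finite and can be cancelled. -/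
lemma mulNorm_le_of_forall {p q : ℝ} (hp : 0 < p) (hq : 0 < q) {m : ℤ → ℝ≥0∞} {C : ℝ≥0∞}
    (h : ∀ z : ℤ → ℝ≥0∞, ∑' k, (m k * z k) ^ q ≤ C ^ q * (∑' k, z k ^ p) ^ (q / p)) :
    mulNorm p q m ≤ C := by
  have hm : ∀ k, m k ≤ C := fun k => by
    have := h (Pi.single k 1)
    rw [tsum_eq_single k (fun j hj => by simp [hj, hq]),
      tsum_eq_single k (fun j hj => by simp [hj, hp])] at this
    simpa [ENNReal.rpow_le_rpow_iff hq] using this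
  rcases le_or_gt p q with hpq | hpq
  · rw [mulNorm_of_le hpq]; exact iSup_le hm
  rcases eq_or_ne C ∞ with rfl | hC
  · exact le_top
  have hρ := rho_pos hp hq hpq
  have hd : 0 < p - q := by linarith
  have hfin : ∀ k, m k ≠ ∞ := fun k => ne_top_of_le_ne_top hC (hm k)
  rw [← ENNReal.rpow_le_rpow_iff hρ, mulNorm_rpow hp hq hpq, ENNReal.tsum_eq_iSup_sum]
  refine iSup_le fun s => ?_
  set S := ∑ k ∈ s, m k ^ (p * q / (p - q)) with hS
  have hSfin : S ≠ ∞ := ENNReal.sum_ne_top.2 fun k _ =>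
    ENNReal.rpow_ne_top_of_nonneg hρ.le (hfin k)
  rcases eq_or_ne S 0 with h0 | h0
  · rw [h0]; exact zero_le
  have := h (fun k => if k ∈ s then m k ^ (q / (p - q)) else 0)
  rw [tsum_eq_sum (s := s) (fun k hk => by simp [hk, hq]),
    tsum_eq_sum (s := s) (fun k hk => by simp [hk, hp])] at this
  have e1 : ∑ k ∈ s, (m k * if k ∈ s then m k ^ (q / (p - q)) else 0) ^ q = S := by
    refine Finset.sum_congr rfl fun k hk => ?_
    rw [if_pos hk, ENNReal.mul_rpow_of_nonneg _ _ hq.le, ← ENNReal.rpow_mul,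
      ← ENNReal.rpow_add_of_nonneg _ _ hq.le (by positivity)]
    congr 1; field_simp; ring
  have e2 : ∑ k ∈ s, (if k ∈ s then m k ^ (q / (p - q)) else 0) ^ p = S := by
    refine Finset.sum_congr rfl fun k hk => ?_
    rw [if_pos hk, ← ENNReal.rpow_mul]
    congr 1; field_simp
  rw [e1, e2] at this
  have h3 : S ^ ((p - q) / p) ≤ C ^ q := by
    rw [show (p - q) / p = 1 - q / p by field_simp, ENNReal.rpow_sub _ _ h0 hSfin,
      ENNReal.rpow_one]
    exact ENNReal.div_le_of_le_mul this
  calc S = (S ^ ((p - q) / p)) ^ (p / (p - q)) := by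
        rw [← ENNReal.rpow_mul, show (p - q) / p * (p / (p - q)) = 1 by field_simp,
          ENNReal.rpow_one]
    _ ≤ (C ^ q) ^ (p / (p - q)) := by gcongr
    _ = _ := by rw [← ENNReal.rpow_mul]; congr 1; field_simp

/-- If no such z existed, homogeneity would give the operator bound with half the norm. The support
condition is what allows near-extremals of disjoint blocks to be superposed. -/
lemma exists_near_mulNorm {p q : ℝ} (hp : 0 < p) (hq : 0 < q) {m : ℤ → ℝ≥0∞}
    (hm : mulNorm p q m ≠ ∞) :
    ∃ z : ℤ → ℝ≥0∞, ∑' k, z k ^ p ≤ 1 ∧ (∀ k, m k = 0 → z k = 0) ∧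
      (mulNorm p q m / 2) ^ q ≤ ∑' k, (m k * z k) ^ q := by
  rcases eq_or_ne (mulNorm p q m) 0 with h0 | h0
  · exact ⟨0, by simp [hp], by simp, by simp [h0, hq]⟩
  have hlt : mulNorm p q m / 2 < mulNorm p q m := ENNReal.half_lt_self h0 hm
  by_contra! hcon
  refine hlt.not_ge (mulNorm_le_of_forall hp hq fun z => ?_)
  set S := ∑' k, z k ^ p with hS
  rcases eq_or_ne S 0 with hS0 | hS0
  · have : ∀ k, z k = 0 := fun k => by
      have := (ENNReal.tsum_eq_zero.1 hS0) k
      rwa [ENNReal.rpow_eq_zero_iff_of_pos hp] at this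
    simp [this, hq]
  rcases eq_or_ne S ∞ with hST | hST
  · rw [hST, ENNReal.top_rpow_of_pos (by positivity), ENNReal.mul_top]
    · exact le_top
    · rw [Ne, ENNReal.rpow_eq_zero_iff_of_pos hq]; simpa using h0
  have hSp0 : S ^ (1 / p) ≠ 0 := by rw [Ne, ENNReal.rpow_eq_zero_iff_of_pos (by positivity)]; exact hS0
  have hSpT : S ^ (1 / p) ≠ ∞ := ENNReal.rpow_ne_top_of_nonneg (by positivity) hST
  have hle : ∑' k, (m k * (if m k = 0 then 0 else z k / S ^ (1 / p))) ^ q ≤ (mulNorm p q m / 2) ^ q := by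
    refine (hcon _ ?_ (fun k hk => by simp [hk])).le
    calc ∑' k, (if m k = 0 then 0 else z k / S ^ (1 / p)) ^ p ≤ ∑' k, z k ^ p * S⁻¹ := by
          refine ENNReal.tsum_le_tsum fun k => ?_
          split_ifs
          · simp [hp]
          · rw [ENNReal.div_rpow_of_nonneg _ _ hp.le, ← ENNReal.rpow_mul, one_div_mul_cancel hp.ne',
              ENNReal.rpow_one]; rfl
      _ = 1 := by rw [ENNReal.tsum_mul_right]; exact ENNReal.mul_inv_cancel hS0 hST
  calc ∑' k, (m k * z k) ^ q
      = ∑' k, (m k * (if m k = 0 then 0 else z k / S ^ (1 / p))) ^ q * S ^ (q / p) := by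
        refine tsum_congr fun k => ?_
        rw [show q / p = 1 / p * q by ring, ENNReal.rpow_mul, ← ENNReal.mul_rpow_of_nonneg _ _ hq.le]
        split_ifs with hk
        · simp [hk]
        · rw [mul_assoc, ENNReal.div_mul_cancel hSp0 hSpT]
    _ ≤ _ := by rw [ENNReal.tsum_mul_right]; gcongr

lemma rpow_tsum_of_unique {ι : Type*} {p : ℝ} (hp : 0 < p) (c : ι → ℝ≥0∞)
    (h : ∀ i j, c i ≠ 0 → c j ≠ 0 → i = j) : (∑' i, c i) ^ p = ∑' i, c i ^ p := by
  by_cases h0 : ∃ i, c i ≠ 0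
  · obtain ⟨i, hi⟩ := h0
    have : ∀ j, j ≠ i → c j = 0 := fun j hj => by
      by_contra hc; exact hj (h j i hc hi)
    rw [tsum_eq_single i this, tsum_eq_single i (fun j hj => by simp [this j hj, hp])]
  · push Not at h0
    simp [h0, hp]

/-- Composition of block multipliers. -/
lemma mulNorm_comp_le {p q r : ℝ} (hp : 0 < p) (hq : 0 < q) (hr : 0 < r) {θ : ℤ → ℝ≥0∞}
    (hθ : Halving θ) {μ : ℤ → ℝ≥0∞} {R : ℤ → Set ℤ} (hR : Pairwise (Function.onFun Disjoint R))
    {C : ℝ≥0∞} (hC : C ≠ ∞)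
    (h : ∀ z : ℤ → ℝ≥0∞, ∑' n, θ n * (∑' j, ((R n).indicator μ j * z j) ^ r) ^ (q / r)
      ≤ C ^ q * (∑' k, z k ^ p) ^ (q / p)) :
    mulNorm p q (fun n => θ n ^ (1 / q) * mulNorm p r ((R n).indicator μ)) ≤ 2 * C := by
  classical
  have hqr : 0 < q / r := by positivity
  have hθ0 : ∀ n (s : ℝ), θ n ^ s ≠ 0 := fun n s =>
    (ENNReal.rpow_pos (hθ.pos n) (hθ.ne_top n)).ne'
  have hθT : ∀ n (s : ℝ), θ n ^ s ≠ ∞ := fun n s =>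
    ENNReal.rpow_ne_top_of_ne_zero (hθ.ne_zero n) (hθ.ne_top n)
  -- Near-extremals are available only for finite norms; keeping the single term n of the hypothesis
  -- gives the finiteness.
  have hfin : ∀ n, mulNorm p r ((R n).indicator μ) ≠ ∞ := fun n => by
    refine ne_top_of_le_ne_top (b := C / θ n ^ (1 / q)) (ENNReal.div_ne_top hC (hθ0 n _)) ?_
    refine mulNorm_le_of_forall hp hr fun z => ?_
    rw [ENNReal.div_rpow_of_nonneg _ _ hr.le, ← ENNReal.rpow_mul]
    have h1 : θ n * (∑' j, ((R n).indicator μ j * z j) ^ r) ^ (q / r)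
        ≤ C ^ q * (∑' k, z k ^ p) ^ (q / p) :=
      (ENNReal.le_tsum (f := fun n => θ n * (∑' j, ((R n).indicator μ j * z j) ^ r) ^ (q / r))
        n).trans (h z)
    have h2 := ENNReal.rpow_le_rpow h1 (z := r / q) (by positivity)
    rw [ENNReal.mul_rpow_of_nonneg _ _ (by positivity),
      ENNReal.mul_rpow_of_nonneg _ _ (by positivity),
      ← ENNReal.rpow_mul, ← ENNReal.rpow_mul, ← ENNReal.rpow_mul,
      show q / r * (r / q) = 1 by field_simp,
      show q * (r / q) = r by field_simp, show q / p * (r / q) = r / p by field_simp,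
      ENNReal.rpow_one] at h2
    rw [show 1 / q * r = r / q by ring, ← ENNReal.mul_div_right_comm,
      ENNReal.le_div_iff_mul_le (Or.inl (hθ0 n _)) (Or.inl (hθT n _))]
    rwa [mul_comm]
  -- The test sequence is ∑ s_n ζ_n with ζ_n near-extremal for the n-th block. As the sets `R n` are
  -- disjoint, its ℓ^p norm is at most that of s.
  choose ζ hζ1 hζ0 hζ2 using fun n => exists_near_mulNorm hp hr (hfin n)
  have key : mulNorm p q (fun n => 2⁻¹ * (θ n ^ (1 / q) * mulNorm p r ((R n).indicator μ))) ≤ C := by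
    refine mulNorm_le_of_forall hp hq fun s => ?_
    have hz := h (fun j => ∑' n, s n * ζ n j)
    have hu : ∀ j n n', s n * ζ n j ≠ 0 → s n' * ζ n' j ≠ 0 → n = n' := by
      intro j n n' h1 h2
      by_contra hne
      have m1 : j ∈ R n := by
        by_contra hj; exact h1 (by simp [hζ0 n j (by simp [hj])])
      have m2 : j ∈ R n' := by
        by_contra hj; exact h2 (by simp [hζ0 n' j (by simp [hj])])
      exact Set.disjoint_left.1 (hR hne) m1 m2
    have hzp : ∑' k, (∑' n, s n * ζ n k) ^ p ≤ ∑' n, s n ^ p := by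
      calc ∑' k, (∑' n, s n * ζ n k) ^ p = ∑' k, ∑' n, (s n * ζ n k) ^ p :=
            tsum_congr fun k => rpow_tsum_of_unique hp _ (hu k)
        _ = ∑' n, s n ^ p * ∑' k, ζ n k ^ p := by
            rw [ENNReal.tsum_comm]
            simp only [ENNReal.mul_rpow_of_nonneg _ _ hp.le, ENNReal.tsum_mul_left]
        _ ≤ _ := by
            refine ENNReal.tsum_le_tsum fun n => ?_
            exact mul_le_of_le_one_right' (hζ1 n)
    refine le_trans (ENNReal.tsum_le_tsum fun n => ?_) (hz.trans (by gcongr))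
    calc (2⁻¹ * (θ n ^ (1 / q) * mulNorm p r ((R n).indicator μ)) * s n) ^ q
        = θ n * ((mulNorm p r ((R n).indicator μ) / 2) ^ r * s n ^ r) ^ (q / r) := by
          rw [show 2⁻¹ * (θ n ^ (1 / q) * mulNorm p r ((R n).indicator μ)) * s n =
            θ n ^ (1 / q) * (mulNorm p r ((R n).indicator μ) / 2 * s n) by
              rw [ENNReal.div_eq_inv_mul]; ring, ENNReal.mul_rpow_of_nonneg _ _ hq.le,
            ← ENNReal.mul_rpow_of_nonneg _ _ hr.le, ← ENNReal.rpow_mul, ← ENNReal.rpow_mul,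
            one_div_mul_cancel hq.ne', ENNReal.rpow_one, show r * (q / r) = q by field_simp]
      _ ≤ θ n * ((∑' j, ((R n).indicator μ j * ζ n j) ^ r) * s n ^ r) ^ (q / r) := by
          gcongr; exact hζ2 n
      _ ≤ _ := by
          rw [← ENNReal.tsum_mul_right]
          gcongr with j
          rw [← ENNReal.mul_rpow_of_nonneg _ _ hr.le, mul_assoc, mul_comm (ζ n j)]
          gcongr
          exact ENNReal.le_tsum (f := fun n => s n * ζ n j) n
  rw [mulNorm_const_mul hp hq] at key
  calc _ = 2 * (2⁻¹ * mulNorm p q (fun n => θ n ^ (1 / q) * mulNorm p r ((R n).indicator μ))) := by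
        rw [← mul_assoc, ENNReal.mul_inv_cancel (by norm_num) (by norm_num), one_mul]
    _ ≤ _ := by gcongr


/-! ### Intervals -/

lemma mem_ival {x y : EReal} {t : ℝ} : t ∈ ival x y ↔ x < (t : EReal) ∧ (t : EReal) < y := Iff.rfl

lemma measurableSet_ival (x y : EReal) : MeasurableSet (ival x y) :=
  (measurableSet_Ioo (a := x) (b := y)).preimage measurable_coe_real_ereal

lemma ival_mono {x x' y y' : EReal} (hx : x' ≤ x) (hy : y ≤ y') : ival x y ⊆ ival x' y' :=
  fun _ ht => ⟨hx.trans_lt ht.1, ht.2.trans_le hy⟩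

lemma ival_coe (x y : ℝ) : ival x y = Ioo x y := by
  ext t; simp [mem_ival]

lemma leb_mono {x x' y y' : EReal} (hx : x' ≤ x) (hy : y ≤ y') : leb x y ≤ leb x' y' :=
  Measure.restrict_mono (ival_mono hx hy) le_rfl

lemma leb_coe (x y : ℝ) : leb x y = volume.restrict (Ioc x y) := by
  rw [leb, ival_coe]; exact Measure.restrict_congr_set Ioo_ae_eq_Ioc

lemma leb_of_le {x y : EReal} (h : y ≤ x) : leb x y = 0 := by
  rw [leb, show ival x y = ∅ from ?_, Measure.restrict_empty]
  exact Set.eq_empty_of_forall_notMem fun t ht => (ht.1.trans (ht.2.trans_le h)).false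

lemma lintegral_leb_coe (x y : ℝ) (f : ℝ → ℝ≥0∞) :
    ∫⁻ t, f t ∂(leb x y) = ∫⁻ t in Ioc x y, f t := by rw [leb_coe]

lemma integ_mono {x x' y y' : EReal} (hx : x' ≤ x) (hy : y ≤ y') (g : ℝ → ℝ≥0∞) :
    integ g x y ≤ integ g x' y' := lintegral_mono' (leb_mono hx hy) le_rfl

lemma integ_eq_withDensity (g : ℝ → ℝ≥0∞) (x y : EReal) :
    integ g x y = volume.withDensity g (ival x y) :=
  (withDensity_apply _ (measurableSet_ival x y)).symm

lemma exists_real_btwn {x y : EReal} (h : x < y) : ∃ t : ℝ, x < t ∧ (t : EReal) < y :=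
  EReal.lt_iff_exists_real_btwn.1 h

lemma ival_split {c : EReal} {t : ℝ} {d : EReal} (hc : c ≤ t) (hd : (t : EReal) < d) :
    ival c d = {s : ℝ | c < (s : EReal) ∧ s ≤ t} ∪ ival t d := by
  ext s
  simp only [mem_ival, mem_union, mem_ofPred_eq]
  constructor
  · rintro ⟨h1, h2⟩
    rcases le_or_gt s t with h | h
    · exact Or.inl ⟨h1, h⟩
    · exact Or.inr ⟨by exact_mod_cast h, h2⟩
  · rintro (⟨h1, h2⟩ | ⟨h1, h2⟩)
    · exact ⟨h1, lt_of_le_of_lt (by exact_mod_cast h2) hd⟩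
    · exact ⟨hc.trans_lt h1, h2⟩

lemma lintegral_leb_split {c t : ℝ} {d : EReal} (hc : c ≤ t) (hd : (t : EReal) < d)
    (f : ℝ → ℝ≥0∞) :
    ∫⁻ s, f s ∂(leb c d) = (∫⁻ s in Ioc c t, f s) + ∫⁻ s, f s ∂(leb t d) := by
  have h : ival c d = Ioc c t ∪ ival t d := by
    rw [ival_split (by exact_mod_cast hc) hd]; congr 1; ext s; simp
  rw [leb, h, lintegral_union (measurableSet_ival _ _)]
  · rfl
  · rw [Set.disjoint_left]
    rintro s ⟨_, h2⟩ ⟨h3, _⟩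
    exact absurd h2 (not_le.2 (by exact_mod_cast h3))

lemma integ_split {c t : ℝ} {d : EReal} (hc : c ≤ t) (hd : (t : EReal) < d) (g : ℝ → ℝ≥0∞) :
    integ g c d = (∫⁻ s in Ioc c t, g s) + integ g t d := lintegral_leb_split hc hd g

/-- Inner approximation of the measure of an interval. -/
lemma exists_lt_measure_ival (μ : Measure ℝ) {x y : EReal} {l : ℝ≥0∞} (h : l < μ (ival x y)) :
    ∃ x' y' : ℝ, x < x' ∧ x' < y' ∧ (y' : EReal) < y ∧ l < μ (ival x' y') := by
  have hne : (ival x y).Nonempty := nonempty_of_measure_ne_zero (ne_bot_of_gt h)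
  obtain ⟨t, ht1, ht2⟩ := hne
  obtain ⟨xs, hxs, hxs', hxs''⟩ := exists_seq_strictAnti_tendsto' ht1
  obtain ⟨ys, hys, hys', hys''⟩ := exists_seq_strictMono_tendsto' ht2
  have hU : ival x y = ⋃ n, ival (xs n) (ys n) := by
    ext s
    simp only [mem_iUnion, mem_ival]
    constructor
    · rintro ⟨h1, h2⟩
      have e1 := hxs''.eventually (gt_mem_nhds h1)
      have e2 := hys''.eventually (lt_mem_nhds h2)
      exact (e1.and e2).exists
    · rintro ⟨n, h1, h2⟩
      exact ⟨(hxs' n).1.trans h1, h2.trans (hys' n).2⟩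
  have hm : Monotone fun n => ival (xs n) (ys n) := fun m n hmn =>
    ival_mono (hxs.antitone hmn) (hys.monotone hmn)
  rw [hU, hm.measure_iUnion] at h
  obtain ⟨n, hn⟩ := lt_iSup_iff.1 h
  obtain ⟨x', h1, h2⟩ := exists_real_btwn (hxs' n).1
  obtain ⟨y', h3, h4⟩ := exists_real_btwn (hys' n).2
  refine ⟨x', y', h1, ?_, h4, hn.trans_le (measure_mono (ival_mono h2.le h3.le))⟩
  have := h2.trans ((hxs' n).2.trans ((hys' n).1.trans h3))
  exact_mod_cast this

/-- An inner interval can be chosen to carry more than the total mass minus ε; what lies to the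
right of its end then has mass less than ε. -/
lemma exists_small_right (μ : Measure ℝ) {t : ℝ} {e : EReal} (h : (t : EReal) < e)
    (hfin : μ (ival t e) ≠ ∞) {ε : ℝ≥0∞} (hε : 0 < ε) :
    ∃ y : ℝ, t < y ∧ (y : EReal) < e ∧ μ (ival y e) < ε := by
  rcases lt_or_ge (μ (ival t e)) ε with h1 | h1
  · obtain ⟨y, hy1, hy2⟩ := exists_real_btwn h
    exact ⟨y, by exact_mod_cast hy1, hy2, (measure_mono (ival_mono hy1.le le_rfl)).trans_lt h1⟩
  · have : μ (ival t e) - ε < μ (ival t e) :=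
      ENNReal.sub_lt_self hfin (hε.trans_le h1).ne' hε.ne'
    obtain ⟨x', y', hx, hxy, hy, hlt⟩ := exists_lt_measure_ival μ this
    refine ⟨y', lt_trans (by exact_mod_cast hx) hxy, hy, ?_⟩
    by_contra! hcon
    refine hlt.not_ge (ENNReal.le_sub_of_add_le_right (ne_top_of_le_ne_top hfin h1) ?_)
    calc μ (ival x' y') + ε ≤ μ (ival x' y') + μ (ival y' e) := by gcongr
      _ = μ (ival x' y' ∪ ival y' e) := by
          rw [measure_union _ (measurableSet_ival _ _)]
          rw [Set.disjoint_left]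
          rintro s ⟨_, h2⟩ ⟨h3, _⟩
          exact (h2.trans h3).false
      _ ≤ _ := measure_mono (union_subset (ival_mono hx.le hy.le)
          (ival_mono (by exact (hx.trans (by exact_mod_cast hxy)).le) le_rfl))

/-- The tail of an integral takes all intermediate values. -/
lemma exists_integ_eq {c : ℝ} {d : EReal} {g : ℝ → ℝ≥0∞}
    (hfin : ∀ t ∈ ival c d, integ g (t : ℝ) d < ∞) {l : ℝ≥0∞} (hl : 0 < l) (hlc : l < integ g c d) :
    ∃ t ∈ ival c d, integ g (t : ℝ) d = l := by
  rw [integ_eq_withDensity] at hlc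
  set μ := volume.withDensity g with hμ
  obtain ⟨t1, y1, h1, h2, h3, h4⟩ := exists_lt_measure_ival μ hlc
  have ht1d : (t1 : EReal) < d := lt_trans (by exact_mod_cast h2) h3
  have hG1 : l < integ g t1 d := by
    rw [integ_eq_withDensity]; exact h4.trans_le (measure_mono (ival_mono le_rfl h3.le))
  have ht1 : t1 ∈ ival c d := ⟨h1, ht1d⟩
  have hf1 : μ (ival t1 d) ≠ ∞ := by rw [← integ_eq_withDensity]; exact (hfin t1 ht1).ne
  obtain ⟨t2, h5, h6, h7⟩ := exists_small_right μ ht1d hf1 hl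
  rw [← integ_eq_withDensity] at h7
  -- The point sought is the last one whose tail is at least l. If the tail at s exceeded l, inner
  -- approximation would put a point to the right of s into A; if it were below l, the mass just to
  -- the left of s would be too small for A to contain points close to s.
  set A := {t : ℝ | t1 ≤ t ∧ t ≤ t2 ∧ l ≤ integ g t d} with hA
  have hA1 : t1 ∈ A := ⟨le_rfl, h5.le, hG1.le⟩
  have hAb : BddAbove A := ⟨t2, fun t ht => ht.2.1⟩
  set s := sSup A with hs
  have hs1 : t1 ≤ s := le_csSup hAb hA1
  have hs2 : s ≤ t2 := csSup_le ⟨t1, hA1⟩ fun t ht => ht.2.1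
  have hsd : (s : EReal) < d := lt_of_le_of_lt (by exact_mod_cast hs2) h6
  refine ⟨s, ⟨lt_of_lt_of_le h1 (by exact_mod_cast hs1), hsd⟩, le_antisymm ?_ ?_⟩
  · by_contra! hcon
    rw [integ_eq_withDensity] at hcon
    obtain ⟨x', y', hx, hxy, hy, hlt⟩ := exists_lt_measure_ival μ hcon
    have hx'G : l < integ g x' d := by
      rw [integ_eq_withDensity]; exact hlt.trans_le (measure_mono (ival_mono le_rfl hy.le))
    have hx' : s < x' := by exact_mod_cast hx
    have hx2 : x' ≤ t2 := by
      by_contra! hh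
      have : integ g x' d ≤ integ g t2 d := integ_mono (by exact_mod_cast hh.le) le_rfl g
      exact (hx'G.trans_le (this.trans h7.le)).false
    exact absurd (le_csSup hAb (show x' ∈ A from ⟨hs1.trans hx'.le, hx2, hx'G.le⟩)) (not_le.2 hx')
  · by_contra! hcon
    have hlt : t1 < s := by
      rcases hs1.lt_or_eq with h | h
      · exact h
      · rw [← h] at hcon; exact absurd hG1 (not_lt.2 hcon.le)
    have hfin' : μ (ival t1 s) ≠ ∞ :=
      ne_top_of_le_ne_top hf1 (measure_mono (ival_mono le_rfl hsd.le))
    obtain ⟨y, hy1, hy2, hy3⟩ := exists_small_right μ (by exact_mod_cast hlt) hfin'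
      (tsub_pos_of_lt hcon)
    have hys : y < s := by exact_mod_cast hy2
    obtain ⟨z, hzA, hz⟩ := exists_lt_of_lt_csSup ⟨t1, hA1⟩ hys
    have hGy : l ≤ integ g y d := hzA.2.2.trans (integ_mono (by exact_mod_cast hz.le) le_rfl g)
    rw [integ_split hys.le hsd, ← lintegral_leb_coe] at hGy
    rw [← integ_eq_withDensity] at hy3
    have h8 : integ g y s + integ g s d < l := by
      have := ENNReal.add_lt_add_right (hcon.trans_le le_top).ne hy3
      rwa [tsub_add_cancel_of_le hcon.le] at this
    exact (hGy.trans_lt h8).false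

/-! ### Dyadic points of a tail function -/

lemma Halving.exists_lt {ω : ℤ → ℝ≥0∞} (h : Halving ω) {ε : ℝ≥0∞} (hε : 0 < ε) :
    ∃ n, ω n < ε := by
  obtain ⟨i, hi⟩ := ENNReal.exists_inv_two_pow_lt (a := ε / ω 0)
    (ENNReal.div_pos hε.ne' (h.ne_top 0)).ne'
  refine ⟨i, ?_⟩
  rw [ENNReal.lt_div_iff_mul_lt (Or.inl (h.ne_zero 0)) (Or.inl (h.ne_top 0)), h.add_nat 0 i,
    ENNReal.rpow_natCast, ← mul_assoc, ← mul_pow, ENNReal.inv_mul_cancel (by norm_num) (by norm_num),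
    one_pow, one_mul, zero_add] at hi
  exact hi

lemma Halving.exists_gt {ω : ℤ → ℝ≥0∞} (h : Halving ω) {M : ℝ≥0∞} (hM : M ≠ ∞) :
    ∃ n, M < ω n := by
  obtain ⟨i, hi⟩ := ENNReal.exists_nat_gt (r := M / ω 0) (ENNReal.div_ne_top hM (h.ne_zero 0))
  refine ⟨-i, ?_⟩
  rw [ENNReal.div_lt_iff (Or.inl (h.ne_zero 0)) (Or.inl (h.ne_top 0))] at hi
  refine hi.trans_le ?_
  rw [h.add_nat (-i) i, neg_add_cancel]
  gcongr
  rw [ENNReal.rpow_natCast]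
  exact_mod_cast Nat.lt_two_pow_self.le

lemma halving_mul_two_rpow {L : ℝ≥0∞} (h0 : L ≠ 0) (hT : L ≠ ∞) :
    Halving fun n : ℤ => L * 2 ^ (-(n : ℝ)) where
  half n := by
    rw [mul_left_comm]
    congr 1
    push_cast
    rw [show -(n : ℝ) = 1 + -((n : ℝ) + 1) by ring,
      ENNReal.rpow_add _ _ (by norm_num) (by norm_num), ENNReal.rpow_one]
  pos n := ENNReal.mul_pos h0 (ENNReal.rpow_pos (by norm_num) (by norm_num)).ne'
  ne_top n := ENNReal.mul_ne_top hT (ENNReal.rpow_ne_top_of_ne_zero (by norm_num) (by norm_num))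

/-- Points `x n` of `[c, d)` at which the tail `∫_t^d g` takes the dyadic values `ω n`
(or `x n = c`, where `ω n` is at least the total mass). -/
structure Dyadic (c : ℝ) (d : EReal) (g : ℝ → ℝ≥0∞) (x : ℤ → ℝ) (ω : ℤ → ℝ≥0∞) : Prop where
  halving : Halving ω
  mono : Monotone x
  left_le : ∀ n, c ≤ x n
  lt_right : ∀ n, (x n : EReal) < d
  tail : ∀ n, c < x n → integ g (x n) d = ω n
  tail_pred : ∀ n, c < x n → integ g (x (n - 1)) d = 2 * ω n
  block : ∀ n, c < x n → ∫⁻ t in Ioc (x (n - 1)) (x n), g t = ω n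
  cover : ⋃ n, Ioc (x (n - 1)) (x n) = ival c d

/-- The tail takes every intermediate value (`exists_integ_eq`), so each `ω n` below the value at c
is attained; all other indices are sent to c. -/
lemma exists_dyadic {c : ℝ} {d : EReal} (hcd : (c : EReal) < d) {g : ℝ → ℝ≥0∞}
    (hpos : ∀ t ∈ ival c d, 0 < integ g (t : ℝ) d) (hfin : ∀ t ∈ ival c d, integ g (t : ℝ) d < ∞) :
    ∃ x ω, Dyadic c d g x ω := by
  classical
  set G : ℝ → ℝ≥0∞ := fun t => integ g t d with hG
  have hGanti : Antitone G := fun s t hst => integ_mono (by exact_mod_cast hst) le_rfl g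
  have hGc : 0 < G c := by
    obtain ⟨t, h1, h2⟩ := exists_real_btwn hcd
    exact (hpos t ⟨h1, h2⟩).trans_le (hGanti (by exact_mod_cast h1.le))
  -- If the total mass is finite, the scale is normalized so that `ω 0` equals it. This keeps
  -- `tail_pred` exact for the first block, the one that starts at c. If the mass is infinite, every
  -- value is attained and any scale will do.
  set L : ℝ≥0∞ := if G c = ∞ then 1 else G c with hL
  have hL0 : L ≠ 0 := by rw [hL]; split_ifs; exacts [one_ne_zero, hGc.ne']
  have hLT : L ≠ ∞ := by rw [hL]; split_ifs with h; exacts [ENNReal.one_ne_top, h]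
  set ω : ℤ → ℝ≥0∞ := fun n => L * 2 ^ (-(n : ℝ)) with hω
  have hH : Halving ω := halving_mul_two_rpow hL0 hLT
  have hex : ∀ n, ω n < G c → ∃ t ∈ ival c d, G t = ω n := fun n hn =>
    exists_integ_eq hfin (hH.pos n) hn
  set x : ℤ → ℝ := fun n => if h : ω n < G c then (hex n h).choose else c with hx
  have hx1 : ∀ n, ω n < G c → x n ∈ ival c d ∧ G (x n) = ω n := fun n hn => by
    simp only [hx, dif_pos hn]; exact (hex n hn).choose_spec
  have hx2 : ∀ n, ¬ ω n < G c → x n = c := fun n hn => by simp only [hx, dif_neg hn]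
  have hlt : ∀ n, c < x n → ω n < G c := fun n hn => by
    by_contra h; rw [hx2 n h] at hn; exact hn.false
  have hleft : ∀ n, c ≤ x n := fun n => by
    by_cases h : ω n < G c
    · exact_mod_cast (hx1 n h).1.1.le
    · exact (hx2 n h).ge
  have hright : ∀ n, (x n : EReal) < d := fun n => by
    by_cases h : ω n < G c
    · exact (hx1 n h).1.2
    · rw [hx2 n h]; exact hcd
  have hmono : Monotone x := by
    refine monotone_int_of_le_succ fun n => ?_
    by_cases h : ω n < G c
    · have hs : ω (n + 1) < ω n := by
        have := hH.half n
        rw [this, two_mul]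
        exact ENNReal.lt_add_right (hH.ne_top _) (hH.ne_zero _)
      by_contra! hcon
      have := hGanti hcon.le
      rw [(hx1 n h).2, (hx1 _ (hs.trans h)).2] at this
      exact (hs.trans_le this).false
    · rw [hx2 n h]; exact hleft _
  have htail : ∀ n, c < x n → G (x n) = ω n := fun n hn => (hx1 n (hlt n hn)).2
  have htailp : ∀ n, c < x n → G (x (n - 1)) = 2 * ω n := fun n hn => by
    rw [← hH.pred]
    by_cases h : ω (n - 1) < G c
    · exact (hx1 _ h).2
    · rw [hx2 _ h]
      push Not at h
      have hn' := hlt n hn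
      -- Here x (n-1) = c, so G c ≤ ω (n-1) and the mass is finite. Since ω n < G c = ω 0 forces n ≥
      -- 1, the reverse inequality holds too.
      have hne : G c ≠ ∞ := ne_top_of_le_ne_top (hH.ne_top _) h
      have hLe : L = G c := by rw [hL, if_neg hne]
      have e0 : ω 0 = G c := by simp [hω, hLe]
      have hn0 : 0 < n := by
        by_contra! hcon
        have := hH.anti hcon
        rw [e0] at this
        exact (this.trans_lt hn').false
      refine le_antisymm h ?_
      rw [← e0]
      exact hH.anti (by omega)
  refine ⟨x, ω, hH, hmono, hleft, hright, htail, htailp, fun n hn => ?_, ?_⟩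
  · have h1 := integ_split (hmono (show n - 1 ≤ n by omega)) (hright n) g
    change G (x (n - 1)) = _ + G (x n) at h1
    rw [htail n hn, htailp n hn, two_mul] at h1
    exact ((ENNReal.add_left_inj (hH.ne_top n)).1 h1).symm
  · ext t
    simp only [mem_iUnion]
    constructor
    · rintro ⟨n, h1, h2⟩
      exact ⟨by exact_mod_cast (hleft _).trans_lt h1,
        lt_of_le_of_lt (by exact_mod_cast h2) (hright n)⟩
    · intro ht
      have hGt0 := hpos t ht
      have hGtT := hfin t ht
      have hct : c < t := by exact_mod_cast ht.1
      obtain ⟨m, hm⟩ := hH.exists_gt hGtT.ne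
      obtain ⟨n, hn⟩ := hH.exists_lt hGt0
      have hP : ∃ k, t ≤ x k := by
        refine ⟨n, ?_⟩
        have h1 : ω n < G c := hn.trans_le (hGanti hct.le)
        by_contra! hcon
        have := hGanti hcon.le
        rw [(hx1 n h1).2] at this
        exact (hn.trans_le this).false
      have hB : ∀ k, t ≤ x k → m ≤ k := by
        intro k hk
        by_contra! hcon
        have h1 : ω k < G c := hlt k (hct.trans_le hk)
        have := hGanti hk
        rw [(hx1 k h1).2] at this
        exact (hm.trans_le ((hH.anti hcon.le).trans this)).false
      obtain ⟨k, hk1, hk2⟩ := Int.exists_least_of_bdd ⟨m, hB⟩ hP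
      refine ⟨k, ?_, hk1⟩
      by_contra! hcon
      have := hk2 _ hcon
      omega


lemma Halving.rpow_pos {ω : ℤ → ℝ≥0∞} (h : Halving ω) (n : ℤ) (s : ℝ) : 0 < ω n ^ s :=
  ENNReal.rpow_pos (h.pos n) (h.ne_top n)

namespace Dyadic
variable {c : ℝ} {d : EReal} {g : ℝ → ℝ≥0∞} {x : ℤ → ℝ} {ω : ℤ → ℝ≥0∞}

lemma pairwise_disjoint (h : Dyadic c d g x ω) :
    Pairwise (Function.onFun Disjoint fun n => Ioc (x (n - 1)) (x n)) :=
  h.mono.pairwise_disjoint_on_Ioc_pred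

lemma le_of_lt (h : Dyadic c d g x ω) {m n : ℤ} (hmn : x m < x n) : m < n := by
  by_contra! hcon
  exact (h.mono hcon).not_gt hmn

lemma left_lt_of_mem (h : Dyadic c d g x ω) {n : ℤ} {t : ℝ} (ht : t ∈ Ioc (x (n - 1)) (x n)) :
    c < x n := ((h.left_le _).trans_lt ht.1).trans_le ht.2

lemma block_eq_empty (h : Dyadic c d g x ω) {n : ℤ} (hn : ¬ c < x n) :
    Ioc (x (n - 1)) (x n) = ∅ :=
  Set.eq_empty_of_forall_notMem fun _ ht => hn (h.left_lt_of_mem ht)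

lemma pred_lt (h : Dyadic c d g x ω) {n : ℤ} (hn : c < x n) : x (n - 1) < x n := by
  by_contra! hcon
  have h1 := h.block n hn
  rw [Ioc_eq_empty (not_lt.2 hcon)] at h1
  simp only [Measure.restrict_empty, lintegral_zero_measure] at h1
  exact h.halving.ne_zero n h1.symm

lemma block_le (h : Dyadic c d g x ω) (n : ℤ) : ∫⁻ t in Ioc (x (n - 1)) (x n), g t ≤ ω n := by
  by_cases hn : c < x n
  · exact (h.block n hn).le
  · rw [h.block_eq_empty hn]; simp

lemma block_subset (h : Dyadic c d g x ω) (n : ℤ) : Ioc (x (n - 1)) (x n) ⊆ ival c d := by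
  rw [← h.cover]; exact subset_iUnion (fun n => Ioc (x (n - 1)) (x n)) n

lemma lintegral_eq (h : Dyadic c d g x ω) (f : ℝ → ℝ≥0∞) :
    ∫⁻ t, f t ∂(leb c d) = ∑' n, ∫⁻ t in Ioc (x (n - 1)) (x n), f t := by
  rw [leb, ← h.cover, lintegral_iUnion (fun _ => measurableSet_Ioc) h.pairwise_disjoint]

lemma exists_mem (h : Dyadic c d g x ω) {t : ℝ} (ht : t ∈ ival c d) :
    ∃ n, t ∈ Ioc (x (n - 1)) (x n) := by
  rw [← h.cover] at ht; exact mem_iUnion.1 ht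

lemma tail_le (h : Dyadic c d g x ω) {n : ℤ} {t : ℝ} (ht : t ∈ Ioc (x (n - 1)) (x n)) :
    integ g t d ≤ 2 * ω n := by
  rw [← h.tail_pred n (h.left_lt_of_mem ht)]
  exact integ_mono (by exact_mod_cast ht.1.le) le_rfl g

lemma le_tail (h : Dyadic c d g x ω) {n : ℤ} {t : ℝ} (ht : t ∈ Ioc (x (n - 1)) (x n)) :
    ω n ≤ integ g t d := by
  rw [← h.tail n (h.left_lt_of_mem ht)]
  exact integ_mono (by exact_mod_cast ht.2) le_rfl g

lemma Ioc_eq_iUnion (h : Dyadic c d g x ω) (n : ℤ) :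
    Ioc c (x n) = ⋃ i : ℕ, Ioc (x (n - i - 1)) (x (n - i)) := by
  ext t
  simp only [mem_iUnion]
  constructor
  · rintro ⟨h1, h2⟩
    obtain ⟨k, hk⟩ := h.exists_mem (t := t)
      ⟨by exact_mod_cast h1, lt_of_le_of_lt (by exact_mod_cast h2) (h.lt_right n)⟩
    have hkn : k ≤ n := by
      have := h.le_of_lt (hk.1.trans_le h2)
      omega
    obtain ⟨i, rfl⟩ := Int.le.dest hkn
    exact ⟨i, by simpa using hk⟩
  · rintro ⟨i, h1, h2⟩
    exact ⟨(h.left_le _).trans_lt h1, h2.trans (h.mono (by omega))⟩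

lemma measure_Ioc (h : Dyadic c d g x ω) (ν : Measure ℝ) (n : ℤ) :
    ν (Ioc c (x n)) = ∑' i : ℕ, ν (Ioc (x (n - i - 1)) (x (n - i))) := by
  rw [h.Ioc_eq_iUnion n, measure_iUnion _ (fun _ => measurableSet_Ioc)]
  intro i j hij
  exact h.pairwise_disjoint (show n - (i : ℤ) ≠ n - j by omega)

lemma aemeasurable_block (h : Dyadic c d g x ω) {f : ℝ → ℝ≥0∞} (hf : AEMeasurable f (leb c d))
    (n : ℤ) : AEMeasurable f (volume.restrict (Ioc (x (n - 1)) (x n))) :=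
  hf.mono_measure (Measure.restrict_mono (h.block_subset n) le_rfl)

/-- On a block the tail of g lies between `ω n` and `2 * ω n` while g has mass at most `ω n`, so the
weight tail^γ g has mass of order ω^(1+γ). -/
lemma block_upper (h : Dyadic c d g x ω) (hg : AEMeasurable g (leb c d)) {γ : ℝ} (hγ : 0 ≤ γ)
    (n : ℤ) {f : ℝ → ℝ≥0∞} {a : ℝ≥0∞} (hf : ∀ t ∈ Ioc (x (n - 1)) (x n), f t ≤ a) :
    ∫⁻ t in Ioc (x (n - 1)) (x n), f t * (integ g t d ^ γ * g t) ≤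
      2 ^ γ * (ω n ^ (1 + γ) * a) := by
  calc ∫⁻ t in Ioc (x (n - 1)) (x n), f t * (integ g t d ^ γ * g t)
      ≤ ∫⁻ t in Ioc (x (n - 1)) (x n), (a * (2 * ω n) ^ γ) * g t := by
        refine setLIntegral_mono_ae' measurableSet_Ioc (Filter.Eventually.of_forall fun t ht => ?_)
        rw [mul_assoc]
        gcongr
        · exact hf t ht
        · exact h.tail_le ht
    _ = (a * (2 * ω n) ^ γ) * ∫⁻ t in Ioc (x (n - 1)) (x n), g t :=
        lintegral_const_mul'' _ (h.aemeasurable_block hg n)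
    _ ≤ (a * (2 * ω n) ^ γ) * ω n := by gcongr; exact h.block_le n
    _ = _ := by
        rw [ENNReal.mul_rpow_of_nonneg _ _ hγ, ENNReal.rpow_add_of_nonneg _ _ zero_le_one hγ,
          ENNReal.rpow_one]; ring

/-- Degenerate blocks are empty and carry no mass, which is why `a = 0` is demanded of them. -/
lemma block_lower (h : Dyadic c d g x ω) {γ : ℝ} (hγ : 0 ≤ γ)
    (n : ℤ) {f : ℝ → ℝ≥0∞} {a : ℝ≥0∞} (hn : c < x n ∨ a = 0)
    (hf : ∀ t ∈ Ioc (x (n - 1)) (x n), a ≤ f t) :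
    ω n ^ (1 + γ) * a ≤ ∫⁻ t in Ioc (x (n - 1)) (x n), f t * (integ g t d ^ γ * g t) := by
  rcases hn with hn | rfl
  · calc ω n ^ (1 + γ) * a = (a * ω n ^ γ) * ∫⁻ t in Ioc (x (n - 1)) (x n), g t := by
          rw [h.block n hn, ENNReal.rpow_add_of_nonneg _ _ zero_le_one hγ, ENNReal.rpow_one]; ring
      _ ≤ ∫⁻ t in Ioc (x (n - 1)) (x n), (a * ω n ^ γ) * g t := lintegral_const_mul_le _ _
      _ ≤ _ := by
          refine setLIntegral_mono_ae' measurableSet_Ioc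
            (Filter.Eventually.of_forall fun t ht => ?_)
          rw [mul_assoc]
          gcongr
          · exact hf t ht
          · exact h.le_tail ht
  · simp

lemma step_upper (h : Dyadic c d g x ω) (hg : AEMeasurable g (leb c d)) {γ : ℝ} (hγ : 0 ≤ γ)
    {f : ℝ → ℝ≥0∞} {a : ℤ → ℝ≥0∞} (hf : ∀ n, ∀ t ∈ Ioc (x (n - 1)) (x n), f t ≤ a n) :
    ∫⁻ t, f t * (integ g t d ^ γ * g t) ∂(leb c d) ≤ 2 ^ γ * ∑' n, ω n ^ (1 + γ) * a n := by
  rw [h.lintegral_eq, ← ENNReal.tsum_mul_left]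
  exact ENNReal.tsum_le_tsum fun n => h.block_upper hg hγ n (hf n)

lemma step_lower (h : Dyadic c d g x ω) {γ : ℝ} (hγ : 0 ≤ γ)
    {f : ℝ → ℝ≥0∞} {a : ℤ → ℝ≥0∞} (hn : ∀ n, c < x n ∨ a n = 0)
    (hf : ∀ n, ∀ t ∈ Ioc (x (n - 1)) (x n), a n ≤ f t) :
    ∑' n, ω n ^ (1 + γ) * a n ≤ ∫⁻ t, f t * (integ g t d ^ γ * g t) ∂(leb c d) := by
  rw [h.lintegral_eq]
  exact ENNReal.tsum_le_tsum fun n => h.block_lower hγ n (hn n) (hf n)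

lemma geom (h : Dyadic c d g x ω) {α : ℝ} (n : ℤ) (i : ℕ) :
    ω (n + i) ^ α ≤ 2 ^ (-(α * i)) * ω n ^ α := (h.halving.rpow_add_nat α n i).le

/-- Shift by one block. -/
lemma tsum_shift (h : Dyadic c d g x ω) {α : ℝ} (a : ℤ → ℝ≥0∞) :
    ∑' n, ω n ^ α * a n = 2 ^ α * ∑' n, ω n ^ α * a (n - 1) := by
  rw [← (Equiv.addRight (1 : ℤ)).tsum_eq (fun n => ω n ^ α * a (n - 1)), ← ENNReal.tsum_mul_left]
  refine tsum_congr fun n => ?_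
  simp only [Equiv.coe_addRight, add_sub_cancel_right]
  have := h.halving.rpow_add_nat α n 1
  push_cast at this
  rw [this, ← mul_assoc, ← mul_assoc, mul_one, mul_comm (2 ^ α), two_rpow_cancel, one_mul]

lemma ival_subset_of_mem {n : ℤ} {t : ℝ} (ht : t ∈ Ioc (x (n - 1)) (x n)) :
    ival c t ⊆ Ioc c (x n) := by
  rw [ival_coe]; exact fun s hs => ⟨hs.1, hs.2.le.trans ht.2⟩

lemma block_subset_ival (h : Dyadic c d g x ω) {n : ℤ} {t : ℝ}
    (ht : t ∈ Ioc (x (n - 1)) (x n)) : Ioc (x (n - 1 - 1)) (x (n - 1)) ⊆ ival c t := by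
  rw [ival_coe]
  exact fun s hs => ⟨(h.left_le _).trans_lt hs.1, hs.2.trans_lt ht.1⟩

end Dyadic

/-- For t in block n, the measure of (c, t) is at most the sum of the measures of all blocks up to
n; the weights ω^(1+γ) are geometric, so `geom_hardy` leaves only block n. -/
lemma dyadic_upper {β γ : ℝ} (hβ : 0 < β) (hγ : 0 ≤ γ) :
    ∃ K : ℝ≥0∞, K ≠ ∞ ∧ ∀ (c : ℝ) (d : EReal) (g : ℝ → ℝ≥0∞) (x : ℤ → ℝ) (ω : ℤ → ℝ≥0∞),
      Dyadic c d g x ω → AEMeasurable g (leb c d) → ∀ ν : Measure ℝ,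
        ∫⁻ t : ℝ, ν (ival c t) ^ β * (integ g t d ^ γ * g t) ∂(leb c d) ≤
          K * ∑' n, ω n ^ (1 + γ) * ν (Ioc (x (n - 1)) (x n)) ^ β := by
  obtain ⟨K, hK, hG⟩ := geom_hardy (α := 1 + γ) (by linarith) hβ
  refine ⟨2 ^ γ * K, ENNReal.mul_ne_top (ENNReal.rpow_ne_top_of_nonneg hγ (by norm_num)) hK,
    fun c d g x ω h hg ν => ?_⟩
  calc _ ≤ 2 ^ γ * ∑' n, ω n ^ (1 + γ) *
          (∑' i : ℕ, ν (Ioc (x (n - i - 1)) (x (n - i)))) ^ β := by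
        refine h.step_upper hg hγ fun n t ht => ?_
        rw [← h.measure_Ioc ν n]
        gcongr
        exact Dyadic.ival_subset_of_mem ht
    _ ≤ 2 ^ γ * (K * ∑' n, ω n ^ (1 + γ) * ν (Ioc (x (n - 1)) (x n)) ^ β) := by
        gcongr
        exact hG (fun n => ω n ^ (1 + γ)) (fun n i => h.geom n i)
          (fun n => ν (Ioc (x (n - 1)) (x n)))
    _ = _ := (mul_assoc _ _ _).symm

/-- For t in block n the interval (c, t) contains all of block n-1. Shifting the sum by one block
costs the factor `2 ^ (1 + γ)`. -/
lemma Dyadic.lower {c : ℝ} {d : EReal} {g : ℝ → ℝ≥0∞} {x : ℤ → ℝ} {ω : ℤ → ℝ≥0∞}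
    (h : Dyadic c d g x ω) {β γ : ℝ} (hβ : 0 < β) (hγ : 0 ≤ γ) (ν : Measure ℝ) :
    ∑' n, ω n ^ (1 + γ) * ν (Ioc (x (n - 1)) (x n)) ^ β ≤
      2 ^ (1 + γ) * ∫⁻ t : ℝ, ν (ival c t) ^ β * (integ g t d ^ γ * g t) ∂(leb c d) := by
  rw [h.tsum_shift]
  gcongr
  refine h.step_lower hγ (fun n => ?_) fun n t ht => ?_
  · by_cases hn : c < x n
    · exact Or.inl hn
    · right
      rw [h.block_eq_empty fun h' => hn (h'.trans_le (h.mono (by omega)))]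
      simp [hβ]
  · gcongr
    exact h.block_subset_ival ht


/-! ### The function `V` -/

section V
variable {r : ℝ} {v : ℝ → ℝ≥0∞}

lemma V_of_lt (h : r < 1) (x y : EReal) :
    V r v x y = (∫⁻ s, v s ^ (1 / (1 - r)) ∂(leb x y)) ^ ((1 - r) / r) := if_pos h

lemma V_one (x y : EReal) : V 1 v x y = essSup v (leb x y) := if_neg (lt_irrefl _)

lemma V_mono (hr : 0 < r) (hr1 : r ≤ 1) {x x' y y' : EReal} (hx : x' ≤ x) (hy : y ≤ y') :
    V r v x y ≤ V r v x' y' := by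
  rcases hr1.lt_or_eq with h | rfl
  · rw [V_of_lt h, V_of_lt h]
    have : 0 ≤ (1 - r) / r := div_nonneg (by linarith) hr.le
    gcongr
    exact leb_mono hx hy
  · rw [V_one, V_one]
    exact essSup_mono_measure (leb_mono hx hy).absolutelyContinuous

lemma V_of_le (hr : 0 < r) (hr1 : r ≤ 1) {x y : EReal} (h : y ≤ x) : V r v x y = 0 := by
  rcases hr1.lt_or_eq with h1 | rfl
  · rw [V_of_lt h1, leb_of_le h, lintegral_zero_measure,
      ENNReal.zero_rpow_of_pos (div_pos (by linarith) hr)]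
  · rw [V_one, leb_of_le h, essSup_measure_zero]; rfl

/-- Hölder's inequality with exponents 1/r and 1/(1-r); for r = 1 the bound of v by its essential
supremum. -/
lemma lintegral_le_V (hr : 0 < r) (hr1 : r ≤ 1) {x y : EReal} (hv : AEMeasurable v (leb x y))
    {f : ℝ → ℝ≥0∞} (hf : AEMeasurable f (leb x y)) :
    ∫⁻ s, f s ^ r * v s ∂(leb x y) ≤ (V r v x y * ∫⁻ s, f s ∂(leb x y)) ^ r := by
  rw [ENNReal.mul_rpow_of_nonneg _ _ hr.le, mul_comm]
  rcases hr1.lt_or_eq with h | rfl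
  · have hc : (1 / r).HolderConjugate (1 / (1 - r)) := by
      rw [Real.holderConjugate_iff]
      exact ⟨by rw [lt_div_iff₀ hr]; linarith, by simp⟩
    have := ENNReal.lintegral_mul_le_Lp_mul_Lq (leb x y) hc (hf.pow_const r) hv
    simp only [Pi.mul_apply, ← ENNReal.rpow_mul, mul_one_div_cancel hr.ne', ENNReal.rpow_one,
      one_div_one_div] at this
    rw [V_of_lt h, ← ENNReal.rpow_mul, div_mul_cancel₀ _ hr.ne']
    exact this
  · simp only [ENNReal.rpow_one, V_one]
    rw [← lintegral_mul_const'' _ hf]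
    refine lintegral_mono_ae ?_
    filter_upwards [ENNReal.ae_le_essSup v] with s hs
    gcongr

/-- Sharpness of Hölder: the extremal f is proportional to v^(1/(1-r)). For r = 1 it is the
normalized indicator of a set of finite measure on which v > l. -/
lemma exists_lt_lintegral_V (hr : 0 < r) (hr1 : r ≤ 1) {x y : EReal}
    (hv : AEMeasurable v (leb x y)) {l : ℝ≥0∞} (hl : l < V r v x y) :
    ∃ f : ℝ → ℝ≥0∞, Measurable f ∧ ∫⁻ s, f s ∂(leb x y) ≤ 1 ∧
      l ^ r ≤ ∫⁻ s, f s ^ r * v s ∂(leb x y) := by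
  rcases hr1.lt_or_eq with h | rfl
  · rw [V_of_lt h] at hl
    have h1r : 0 < 1 - r := by linarith
    have hl' : l ^ (r / (1 - r)) < ∫⁻ s, v s ^ (1 / (1 - r)) ∂(leb x y) := by
      have := ENNReal.rpow_lt_rpow hl (z := r / (1 - r)) (by positivity)
      rwa [← ENNReal.rpow_mul, show (1 - r) / r * (r / (1 - r)) = 1 by field_simp,
        ENNReal.rpow_one] at this
    -- The integral of v^(1/(1-r)) may be infinite, so it is approximated from below by a simple
    -- function g whose integral S is finite; f is then g / S.
    rw [lintegral_eq_nnreal] at hl'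
    obtain ⟨φ, hφ⟩ := lt_iSup_iff.1 hl'
    obtain ⟨hφle, hφ⟩ := lt_iSup_iff.1 hφ
    rw [← SimpleFunc.lintegral_eq_lintegral] at hφ
    have : SigmaFinite (leb x y) := by unfold leb; infer_instance
    obtain ⟨g, hg1, hg2, hg3⟩ := SimpleFunc.exists_lt_lintegral_simpleFunc_of_lt_lintegral
      (μ := leb x y) (f := φ) hφ
    set S := ∫⁻ s, (g s : ℝ≥0∞) ∂(leb x y) with hS
    have hS0 : S ≠ 0 := (zero_le.trans_lt hg3).ne'
    have hgv : ∀ s, (g s : ℝ≥0∞) ^ (1 - r) ≤ v s := fun s => by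
      calc (g s : ℝ≥0∞) ^ (1 - r) ≤ (v s ^ (1 / (1 - r))) ^ (1 - r) := by
            gcongr
            exact (ENNReal.coe_le_coe.2 (hg1 s)).trans (hφle s)
        _ = v s := by rw [← ENNReal.rpow_mul, one_div_mul_cancel h1r.ne', ENNReal.rpow_one]
    have hgm : Measurable fun s => (g s : ℝ≥0∞) := g.measurable.coe_nnreal_ennreal
    refine ⟨fun s => S⁻¹ * g s, hgm.const_mul _, ?_, ?_⟩
    · rw [lintegral_const_mul _ hgm, ENNReal.inv_mul_cancel hS0 hg2.ne]
    · calc l ^ r = (l ^ (r / (1 - r))) ^ (1 - r) := by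
            rw [← ENNReal.rpow_mul]; congr 1; field_simp
        _ ≤ S ^ (1 - r) := by gcongr
        _ = S⁻¹ ^ r * S := by
            rw [ENNReal.inv_rpow, ← ENNReal.rpow_neg]
            conv_rhs => rw [← ENNReal.rpow_one S, ← ENNReal.rpow_mul,
              ← ENNReal.rpow_add _ _ hS0 hg2.ne]
            congr 1; ring
        _ = ∫⁻ s, S⁻¹ ^ r * g s ∂(leb x y) := (lintegral_const_mul _ hgm).symm
        _ ≤ _ := by
            refine lintegral_mono fun s => ?_
            simp only
            rw [ENNReal.mul_rpow_of_nonneg _ _ hr.le, mul_assoc]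
            gcongr
            calc (g s : ℝ≥0∞) = (g s : ℝ≥0∞) ^ r * (g s : ℝ≥0∞) ^ (1 - r) := by
                  rw [← ENNReal.rpow_add_of_nonneg _ _ hr.le h1r.le]; simp
              _ ≤ _ := by gcongr; exact hgv s
  · rw [V_one] at hl
    simp only [ENNReal.rpow_one]
    have hE : MeasurableSet {s | l < hv.mk v s} := measurableSet_lt measurable_const hv.measurable_mk
    have hpos : 0 < leb x y {s | l < hv.mk v s} := by
      rw [pos_iff_ne_zero]
      intro h0
      refine hl.not_ge (essSup_le_of_ae_le _ ?_)
      have : ∀ᵐ s ∂(leb x y), hv.mk v s ≤ l := by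
        rw [ae_iff]; simpa only [not_le] using h0
      filter_upwards [this, hv.ae_eq_mk] with s h1 h2
      rwa [h2]
    have : SigmaFinite (leb x y) := by unfold leb; infer_instance
    obtain ⟨E, hEm, hEs, hE1, hE2⟩ := Measure.exists_subset_measure_lt_top hE hpos
    refine ⟨E.indicator fun _ => (leb x y E)⁻¹, measurable_const.indicator hEm, ?_, ?_⟩
    · rw [lintegral_indicator_const hEm, ENNReal.inv_mul_cancel hE1.ne' hE2.ne]
    · calc l = ∫⁻ s, E.indicator (fun _ => (leb x y E)⁻¹ * l) s ∂(leb x y) := by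
            rw [lintegral_indicator_const hEm, mul_right_comm, ENNReal.inv_mul_cancel hE1.ne' hE2.ne,
              one_mul]
        _ ≤ _ := by
            refine lintegral_mono_ae ?_
            filter_upwards [hv.ae_eq_mk] with s hs
            by_cases hsE : s ∈ E
            · simp only [indicator_of_mem hsE]
              gcongr
              rw [hs]; exact (hEs hsE).le
            · simp [hsE]

/-- The exponent for which `V` is countably subadditive. -/
noncomputable def kap (r : ℝ) : ℝ := if r < 1 then r / (1 - r) else 1

lemma kap_pos (hr : 0 < r) : 0 < kap r := by
  unfold kap; split_ifs with h
  · exact div_pos hr (by linarith)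
  · exact one_pos

/-- For r < 1 the power `kap r` undoes the outer exponent of V and leaves the integral of
v^(1/(1-r)), a measure of the interval. For r = 1, almost every point of the interval lies in some
covering interval and v is bounded there by its essential supremum. -/
lemma V_rpow_kap_le (hr : 0 < r) (hr1 : r ≤ 1) {ι : Type*} [Countable ι] {x y : EReal}
    {s t : ι → ℝ} (h : ival x y ⊆ ⋃ i, Ioc (s i) (t i)) :
    V r v x y ^ kap r ≤ ∑' i, V r v (s i) (t i) ^ kap r := by
  rcases hr1.lt_or_eq with h1 | rfl
  · have h1r : 0 < 1 - r := by linarith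
    have e : ∀ z : ℝ≥0∞, (z ^ ((1 - r) / r)) ^ kap r = z := fun z => by
      rw [← ENNReal.rpow_mul, kap, if_pos h1, show (1 - r) / r * (r / (1 - r)) = 1 by field_simp,
        ENNReal.rpow_one]
    simp only [V_of_lt h1, e, lintegral_leb_coe]
    exact (lintegral_mono_set h).trans (lintegral_iUnion_le _ _)
  · simp only [kap, lt_irrefl, if_false, ENNReal.rpow_one, V_one]
    refine essSup_le_of_ae_le _ ?_
    have hi : ∀ i, ∀ᵐ u : ℝ, u ∈ Ioc (s i) (t i) → v u ≤ essSup v (leb (s i) (t i)) := fun i => by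
      have := ENNReal.ae_le_essSup (μ := leb (s i) (t i)) v
      rw [leb_coe, ae_restrict_iff' measurableSet_Ioc] at this
      rw [leb_coe]; exact this
    rw [leb, Filter.EventuallyLE, ae_restrict_iff' (measurableSet_ival x y)]
    filter_upwards [ae_all_iff.2 hi] with u hu hux
    obtain ⟨i, hi⟩ := mem_iUnion.1 (h hux)
    exact (hu i hi).trans (ENNReal.le_tsum (f := fun i => essSup v (leb (s i) (t i))) i)

/-- Inner approximation of `V`. -/
lemma exists_lt_V (hr : 0 < r) (hr1 : r ≤ 1) {x y : EReal} {l : ℝ≥0∞} (hl : l < V r v x y) :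
    ∃ x' y' : ℝ, x < x' ∧ x' < y' ∧ (y' : EReal) < y ∧ l < V r v x' y' := by
  rcases hr1.lt_or_eq with h | rfl
  · have h1r : 0 < 1 - r := by linarith
    have e : ∀ x y : EReal, l < V r v x y ↔
        l ^ (r / (1 - r)) < volume.withDensity (fun s => v s ^ (1 / (1 - r))) (ival x y) := by
      intro x y
      rw [← integ_eq_withDensity, V_of_lt h, ← ENNReal.rpow_lt_rpow_iff (z := r / (1 - r))
        (by positivity), ← ENNReal.rpow_mul, show (1 - r) / r * (r / (1 - r)) = 1 by field_simp,
        ENNReal.rpow_one]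
      rfl
    rw [e] at hl
    obtain ⟨x', y', h1, h2, h3, h4⟩ := exists_lt_measure_ival _ hl
    exact ⟨x', y', h1, h2, h3, (e _ _).2 h4⟩
  · rw [V_one] at hl
    -- For r = 1 the inner approximation is applied to Lebesgue measure on the superlevel set of an
    -- intermediate l', so that the essential supremum on the smaller interval is at least l' and
    -- hence strictly above l.
    obtain ⟨l', hl1, hl2⟩ := exists_between hl
    have hpos : 0 < volume.restrict {s | l' < v s} (ival x y) := by
      rw [pos_iff_ne_zero]
      intro h0
      rw [Measure.restrict_apply (measurableSet_ival x y)] at h0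
      refine hl2.not_ge (essSup_le_of_ae_le _ ?_)
      rw [leb, Filter.EventuallyLE, ae_restrict_iff' (measurableSet_ival x y), ae_iff]
      convert h0 using 2
      ext s; simp
    obtain ⟨x', y', h1, h2, h3, h4⟩ := exists_lt_measure_ival _ hpos
    refine ⟨x', y', h1, h2, h3, hl1.trans_le ?_⟩
    rw [V_one]
    by_contra! hcon
    rw [Measure.restrict_apply (measurableSet_ival _ _)] at h4
    refine h4.ne' ?_
    have := ENNReal.ae_le_essSup (μ := leb x' y') v
    rw [leb, ae_restrict_iff' (measurableSet_ival _ _), ae_iff] at this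
    refine measure_mono_null (fun s hs => ?_) this
    simp only [mem_ofPred_eq, Classical.not_imp, not_le]
    exact ⟨hs.1, hcon.trans hs.2⟩

lemma leb_ne_zero {x y : EReal} (h : x < y) : leb x y ≠ 0 := by
  obtain ⟨s, h1, h2⟩ := exists_real_btwn h
  obtain ⟨t, h3, h4⟩ := exists_real_btwn h2
  have h3' : s < t := by exact_mod_cast h3
  rw [leb, Ne, Measure.restrict_eq_zero]
  intro h0
  have : volume (Ioo s t) = 0 :=
    measure_mono_null (by rw [← ival_coe]; exact ival_mono h1.le h4.le) h0
  rw [Real.volume_Ioo, ENNReal.ofReal_eq_zero] at this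
  linarith

lemma V_pos (hr : 0 < r) (hr1 : r ≤ 1) {x y : EReal} (h : x < y)
    (hv : AEMeasurable v (leb x y)) (hv0 : ∀ᵐ t ∂(leb x y), 0 < v t) : 0 < V r v x y := by
  have hne := leb_ne_zero h
  rw [pos_iff_ne_zero]
  intro h0
  have : ∀ᵐ t ∂(leb x y), v t = 0 := by
    rcases hr1.lt_or_eq with h1 | rfl
    · have h1r : 0 < 1 - r := by linarith
      rw [V_of_lt h1, ENNReal.rpow_eq_zero_iff_of_pos (by positivity),
        lintegral_eq_zero_iff' (hv.pow_const _)] at h0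
      filter_upwards [h0] with t ht
      simpa [ENNReal.rpow_eq_zero_iff_of_pos (show 0 < (1 - r)⁻¹ by positivity)] using ht
    · rw [V_one] at h0
      filter_upwards [ENNReal.ae_le_essSup (μ := leb x y) v] with t ht
      rw [h0] at ht; simpa using ht
  have hF : ∀ᵐ t ∂(leb x y), False := by
    filter_upwards [this, hv0] with t h1 h2
    exact h2.ne' h1
  rw [Filter.eventually_false_iff_eq_bot, ae_eq_bot] at hF
  exact hne hF

lemma measurable_V (hr : 0 < r) (hr1 : r ≤ 1) (x : EReal) : Measurable fun t : ℝ => V r v x t :=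
  Monotone.measurable fun _ _ h => V_mono hr hr1 le_rfl (by exact_mod_cast h)

end V

lemma measurable_integ (g : ℝ → ℝ≥0∞) (y : EReal) : Measurable fun t : ℝ => integ g t y :=
  Antitone.measurable fun _ _ h => integ_mono (by exact_mod_cast h) le_rfl g


/-! ### Gluing test functions -/

/-- The function equal to `z n * f n` on the `n`-th of a sequence of disjoint sets. -/
noncomputable def glue (S : ℤ → Set ℝ) (z : ℤ → ℝ≥0∞) (f : ℤ → ℝ → ℝ≥0∞) (x : ℝ) : ℝ≥0∞ :=
  ∑' n, (S n).indicator (fun x => z n * f n x) x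

section glue
variable {S : ℤ → Set ℝ} {z : ℤ → ℝ≥0∞} {f : ℤ → ℝ → ℝ≥0∞}

lemma measurable_glue (hS : ∀ n, MeasurableSet (S n)) (hf : ∀ n, Measurable (f n)) :
    Measurable (glue S z f) :=
  Measurable.tsum fun n => ((hf n).const_mul _).indicator (hS n)

lemma glue_eq (hd : Pairwise (Function.onFun Disjoint S)) {n : ℤ} {x : ℝ} (hx : x ∈ S n) :
    glue S z f x = z n * f n x := by
  rw [glue, tsum_eq_single n, indicator_of_mem hx]
  intro m hm
  exact indicator_of_notMem (fun hx' => Set.disjoint_left.1 (hd hm) hx' hx) _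

lemma lintegral_glue (hS : ∀ n, MeasurableSet (S n)) (hf : ∀ n, Measurable (f n))
    (μ : Measure ℝ) :
    ∫⁻ x, glue S z f x ∂μ = ∑' n, z n * ∫⁻ x in S n, f n x ∂μ := by
  simp only [glue]
  rw [lintegral_tsum fun n => (((hf n).const_mul _).indicator (hS n)).aemeasurable]
  refine tsum_congr fun n => ?_
  rw [lintegral_indicator (hS n), lintegral_const_mul _ (hf n)]

end glue

lemma exists_near_V {r : ℝ} {v : ℝ → ℝ≥0∞} (hr : 0 < r) (hr1 : r ≤ 1) {x y : EReal}
    (hv : AEMeasurable v (leb x y)) (hV : V r v x y ≠ ∞) :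
    ∃ f : ℝ → ℝ≥0∞, Measurable f ∧ ∫⁻ s, f s ∂(leb x y) ≤ 1 ∧
      (V r v x y / 2) ^ r ≤ ∫⁻ s, f s ^ r * v s ∂(leb x y) := by
  rcases eq_or_ne (V r v x y) 0 with h0 | h0
  · exact ⟨0, measurable_const, by simp, by simp [h0, hr]⟩
  · exact exists_lt_lintegral_V hr hr1 hv (ENNReal.half_lt_self h0 hV)

/-- The function is the superposition of `z n` times a near-extremal of V on the n-th interval. The
bound over an arbitrary set E, by the masses of the intervals that meet E, is what later allows
several intervals to share a block of `w`. -/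
lemma exists_glue {r : ℝ} {v : ℝ → ℝ≥0∞} (hr : 0 < r) (hr1 : r ≤ 1) {s t : ℤ → ℝ}
    (hd : Pairwise (Function.onFun Disjoint fun n => Ioc (s n) (t n)))
    (hv : ∀ n, AEMeasurable v (leb (s n) (t n))) (hV : ∀ n, V r v (s n) (t n) ≠ ∞)
    (z : ℤ → ℝ≥0∞) :
    ∃ f : ℝ → ℝ≥0∞, Measurable f ∧
      (∀ E, MeasurableSet E → ∫⁻ x in E, f x ≤
        ∑' n, {n | (E ∩ Ioc (s n) (t n)).Nonempty}.indicator z n) ∧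
      ∀ n, (V r v (s n) (t n) / 2 * z n) ^ r ≤ ∫⁻ x, f x ^ r * v x ∂(leb (s n) (t n)) := by
  choose f hf hf1 hf2 using fun n => exists_near_V hr hr1 (hv n) (hV n)
  refine ⟨glue (fun n => Ioc (s n) (t n)) z f, measurable_glue (fun _ => measurableSet_Ioc) hf,
    fun E hE => ?_, fun n => ?_⟩
  · rw [lintegral_glue (fun _ => measurableSet_Ioc) hf]
    refine ENNReal.tsum_le_tsum fun n => ?_
    by_cases hn : (E ∩ Ioc (s n) (t n)).Nonempty
    · rw [indicator_of_mem (show n ∈ {n | (E ∩ Ioc (s n) (t n)).Nonempty} from hn)]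
      refine mul_le_of_le_one_right' (le_trans ?_ (hf1 n))
      rw [leb_coe]
      refine lintegral_mono' ?_ le_rfl
      rw [Measure.restrict_restrict measurableSet_Ioc]
      exact Measure.restrict_mono inter_subset_left le_rfl
    · rw [indicator_of_notMem (show n ∉ {n | (E ∩ Ioc (s n) (t n)).Nonempty} from hn),
        Measure.restrict_restrict measurableSet_Ioc, inter_comm, not_nonempty_iff_eq_empty.1 hn]
      simp
  · rw [ENNReal.mul_rpow_of_nonneg _ _ hr.le, mul_comm]
    calc _ ≤ z n ^ r * ∫⁻ x, f n x ^ r * v x ∂(leb (s n) (t n)) := by gcongr; exact hf2 n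
      _ ≤ ∫⁻ x, z n ^ r * (f n x ^ r * v x) ∂(leb (s n) (t n)) := lintegral_const_mul_le _ _
      _ ≤ _ := by
        rw [lintegral_leb_coe, lintegral_leb_coe]
        refine setLIntegral_mono_ae' measurableSet_Ioc (Filter.Eventually.of_forall fun x hx => ?_)
        rw [glue_eq hd hx, ENNReal.mul_rpow_of_nonneg _ _ hr.le, mul_assoc]

/-! ### The Hardy inequality on one interval -/

/-- `∫_c^d (∫_c^t f^r v)^{q/r} u(t) dt`. -/
noncomputable def hardyInt (r q : ℝ) (u v : ℝ → ℝ≥0∞) (c : ℝ) (d : EReal) (f : ℝ → ℝ≥0∞) : ℝ≥0∞ :=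
  ∫⁻ t : ℝ, (∫⁻ s, f s ^ r * v s ∂(leb c t)) ^ (q / r) * u t ∂(leb c d)

/-- Characterizing constant of the local inequality for `1 ≤ q`. -/
noncomputable def supConst (r q : ℝ) (u v : ℝ → ℝ≥0∞) (c : ℝ) (d : EReal) : ℝ≥0∞ :=
  ⨆ t ∈ ival c d, integ u (t : ℝ) d ^ (1 / q) * V r v c t

/-- Characterizing constant of the local inequality for `q < 1`. -/
noncomputable def intConst (r q : ℝ) (u v : ℝ → ℝ≥0∞) (c : ℝ) (d : EReal) : ℝ≥0∞ :=
  (∫⁻ t : ℝ, integ u t d ^ (q / (1 - q)) * u t * V r v c t ^ (q / (1 - q)) ∂(leb c d)) ^ ((1 - q) / q)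

/-- Characterizing constant of the local inequality. -/
noncomputable def locConst (r q : ℝ) (u v : ℝ → ℝ≥0∞) (c : ℝ) (d : EReal) : ℝ≥0∞ :=
  if q < 1 then intConst r q u v c d else supConst r q u v c d

/-- The tails of `u` on `(c, d)` are positive and finite. -/
def TailOK (c : ℝ) (d : EReal) (u : ℝ → ℝ≥0∞) : Prop :=
  ∀ t ∈ ival c d, 0 < integ u (t : ℝ) d ∧ integ u (t : ℝ) d < ∞

lemma TailOK.exists_dyadic {c : ℝ} {d : EReal} {u : ℝ → ℝ≥0∞} (h : TailOK c d u)
    (hcd : (c : EReal) < d) : ∃ x ω, Dyadic c d u x ω :=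
  CesHardy.exists_dyadic hcd (fun t ht => (h t ht).1) fun t ht => (h t ht).2

/-- The form required by `dyadic_upper` and `Dyadic.lower` with γ = 0. -/
lemma hardyInt_eq (r q : ℝ) (u v : ℝ → ℝ≥0∞) (c : ℝ) (d : EReal) (f : ℝ → ℝ≥0∞) :
    hardyInt r q u v c d f = ∫⁻ t : ℝ, volume.withDensity (fun s => f s ^ r * v s) (ival c t) ^ (q / r)
      * (integ u t d ^ (0 : ℝ) * u t) ∂(leb c d) := by
  refine lintegral_congr fun t => ?_
  rw [withDensity_apply _ (measurableSet_ival _ _), ENNReal.rpow_zero, one_mul]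
  rfl

lemma withDensity_block {x : ℤ → ℝ} (n : ℤ) (f : ℝ → ℝ≥0∞) :
    volume.withDensity f (Ioc (x (n - 1)) (x n)) = ∫⁻ t, f t ∂(leb (x (n - 1)) (x n)) := by
  rw [withDensity_apply _ measurableSet_Ioc, lintegral_leb_coe]

lemma Dyadic.leb_block_le {c : ℝ} {d : EReal} {g : ℝ → ℝ≥0∞} {x : ℤ → ℝ} {ω : ℤ → ℝ≥0∞}
    (h : Dyadic c d g x ω) (n : ℤ) : leb (x (n - 1)) (x n) ≤ leb c d :=
  leb_mono (by exact_mod_cast h.left_le _) (h.lt_right n).le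

lemma mul_rpow_mul_rpow {a b : ℝ≥0∞} {q s : ℝ} (hs : 0 ≤ s) :
    (a ^ (1 / q) * b) ^ s = a ^ (s / q) * b ^ s := by
  rw [ENNReal.mul_rpow_of_nonneg _ _ hs, ← ENNReal.rpow_mul]; congr 2; ring

section local_hardy
variable {r q : ℝ} {u v : ℝ → ℝ≥0∞} {c : ℝ} {d : EReal} {x : ℤ → ℝ} {ω : ℤ → ℝ≥0∞}

/-- For maps from ℓ¹ to ℓ^q the exponent ρ is q/(1-q), the one in `intConst`. If q < 1, the value V
(c, t) at t in block n dominates V of block n-1, whence a shift by one block; if q ≥ 1, the supremum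
is evaluated at t = x n, where the tail is `ω n`. -/
lemma Dyadic.mulNorm_le_locConst (hr : 0 < r) (hr1 : r ≤ 1) (hq : 0 < q) (h : Dyadic c d u x ω) :
    mulNorm 1 q (fun n => ω n ^ (1 / q) * V r v (x (n - 1)) (x n)) ≤ 2 ^ (1 / q) * locConst r q u v c d := by
  rcases le_or_gt 1 q with h1 | h1
  · rw [mulNorm_of_le h1, locConst, if_neg h1.not_gt]
    refine iSup_le fun n => le_trans ?_ (le_mul_of_one_le_left' (ENNReal.one_le_rpow (by norm_num)
      (by positivity)))
    by_cases hn : c < x n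
    · have hm : x n ∈ ival c d := ⟨by exact_mod_cast hn, h.lt_right n⟩
      refine le_trans ?_ (le_iSup₂ (f := fun (t : ℝ) (_ : t ∈ ival c d) =>
        integ u (t : ℝ) d ^ (1 / q) * V r v c t) (x n) hm)
      rw [h.tail n hn]
      gcongr
      exact V_mono hr hr1 (by exact_mod_cast h.left_le _) le_rfl
    · rw [V_of_le hr hr1]
      · simp
      · exact_mod_cast (not_lt.1 hn).trans (h.left_le _)
  · have hq1 : 0 < 1 - q := by linarith
    set α := q / (1 - q) with hα
    have hα0 : 0 < α := by positivity
    have e1 : 1 + α = α / q := by rw [hα]; field_simp; ring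
    rw [← ENNReal.rpow_le_rpow_iff (z := α) hα0]
    have := mulNorm_rpow one_pos hq h1 (fun n => ω n ^ (1 / q) * V r v (x (n - 1)) (x n))
    simp only [one_mul, ← hα] at this
    rw [this, locConst, if_pos h1, ENNReal.mul_rpow_of_nonneg _ _ hα0.le, intConst,
      ← ENNReal.rpow_mul, ← ENNReal.rpow_mul, show (1 - q) / q * α = 1 by rw [hα]; field_simp,
      ENNReal.rpow_one, show 1 / q * α = 1 + α by rw [e1]; ring]
    simp only [mul_rpow_mul_rpow hα0.le, ← e1]
    rw [h.tsum_shift]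
    gcongr
    refine (h.step_lower (γ := α) hα0.le (f := fun t => V r v c t ^ α) (fun n => ?_)
      fun n t ht => ?_).trans (le_of_eq ?_)
    · by_cases hn : c < x n
      · exact Or.inl hn
      · right
        rw [V_of_le hr hr1, ENNReal.zero_rpow_of_pos hα0]
        have : x (n - 1) ≤ x n := h.mono (by omega)
        exact_mod_cast this.trans ((not_lt.1 hn).trans (h.left_le _))
    · gcongr
      exact V_mono hr hr1 (by exact_mod_cast h.left_le _) (by exact_mod_cast ht.1.le)
    · exact lintegral_congr fun t => by rw [mul_comm]

/-- The left-hand side is discretized along the tail of `u`, `lintegral_le_V` is applied on each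
block, and a multiplier from ℓ¹ to ℓ^q remains. -/
lemma hardyInt_le {r q : ℝ} (hr : 0 < r) (hr1 : r ≤ 1) (hq : 0 < q) :
    ∃ K : ℝ≥0∞, K ≠ ∞ ∧ ∀ (u v : ℝ → ℝ≥0∞) (c : ℝ) (d : EReal), (c : EReal) < d → TailOK c d u →
      AEMeasurable u (leb c d) → AEMeasurable v (leb c d) → ∀ f, AEMeasurable f (leb c d) →
        hardyInt r q u v c d f ≤ K * (locConst r q u v c d * ∫⁻ t, f t ∂(leb c d)) ^ q := by
  obtain ⟨K, hK, hD⟩ := dyadic_upper (β := q / r) (γ := 0) (by positivity) le_rfl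
  refine ⟨K * 2, ENNReal.mul_ne_top hK (by norm_num), fun u v c d hcd hT hu hv f hf => ?_⟩
  obtain ⟨x, ω, h⟩ := hT.exists_dyadic hcd
  rw [hardyInt_eq, mul_assoc]
  refine (hD c d u x ω h hu _).trans ?_
  gcongr
  calc _ ≤ ∑' n, (ω n ^ (1 / q) * V r v (x (n - 1)) (x n) *
          ∫⁻ t, f t ∂(leb (x (n - 1)) (x n))) ^ q := by
        refine ENNReal.tsum_le_tsum fun n => ?_
        rw [add_zero, ENNReal.rpow_one, mul_assoc, mul_rpow_mul_rpow hq.le, div_self hq.ne',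
          ENNReal.rpow_one, withDensity_block]
        gcongr
        have hle := lintegral_le_V hr hr1 (hv.mono_measure (h.leb_block_le n))
          (hf.mono_measure (h.leb_block_le n))
        calc _ ≤ ((V r v (x (n - 1)) (x n) * ∫⁻ t, f t ∂(leb (x (n - 1)) (x n))) ^ r) ^ (q / r) := by
              gcongr
          _ = _ := by rw [← ENNReal.rpow_mul]; congr 1; field_simp
    _ ≤ mulNorm 1 q (fun n => ω n ^ (1 / q) * V r v (x (n - 1)) (x n)) ^ q *
          (∑' n, (∫⁻ t, f t ∂(leb (x (n - 1)) (x n))) ^ (1 : ℝ)) ^ (q / 1) :=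
        tsum_mul_rpow_le_mulNorm one_pos hq _ _
    _ ≤ (2 ^ (1 / q) * locConst r q u v c d) ^ q * (∫⁻ t, f t ∂(leb c d)) ^ q := by
        simp only [ENNReal.rpow_one, div_one]
        rw [h.lintegral_eq f]
        simp only [lintegral_leb_coe]
        gcongr
        exact h.mulNorm_le_locConst hr hr1 hq
    _ = _ := by
        rw [mul_rpow_mul_rpow hq.le, div_self hq.ne', ENNReal.rpow_one,
          ENNReal.mul_rpow_of_nonneg _ _ hq.le, mul_assoc]

lemma le_of_forall_lt_mul {a b R : ℝ≥0∞} (hR : R ≠ ∞) (h : ∀ l < b, a * l ≤ R) : a * b ≤ R := by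
  rcases eq_or_ne a 0 with rfl | ha
  · simp
  rw [mul_comm, ← ENNReal.le_div_iff_mul_le (Or.inl ha) (Or.inr hR)]
  refine le_of_forall_lt fun l hl => ?_
  obtain ⟨l', h1, h2⟩ := exists_between hl
  refine h1.trans_le ?_
  rw [ENNReal.le_div_iff_mul_le (Or.inl ha) (Or.inr hR), mul_comm]
  exact h l' h2

/-- Any constant in the local inequality dominates the supremal condition. -/
lemma tail_mul_V_le (hr : 0 < r) (hr1 : r ≤ 1) (hq : 0 < q) (hv : AEMeasurable v (leb c d))
    {B : ℝ≥0∞} (hB : B ≠ ∞)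
    (h : ∀ f, Measurable f → hardyInt r q u v c d f ≤ (B * ∫⁻ t, f t ∂(leb c d)) ^ q)
    {t : ℝ} (ht : t ∈ ival c d) : integ u t d ^ (1 / q) * V r v c t ≤ B := by
  refine le_of_forall_lt_mul hB fun l hl => ?_
  have hle : leb c t ≤ leb c d := leb_mono le_rfl ht.2.le
  obtain ⟨f, hf, hf1, hf2⟩ := exists_lt_lintegral_V hr hr1 (hv.mono_measure hle) hl
  -- The test function is a near-extremal of V on (c, t), cut off at t. Beyond t its inner integral
  -- stays at least l^r, so the whole tail of `u` at t contributes.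
  have hI := h ((ival c t).indicator f) (hf.indicator (measurableSet_ival _ _))
  have e1 : ∫⁻ s, (ival c t).indicator f s ∂(leb c d) ≤ 1 := by
    refine le_trans ?_ hf1
    rw [lintegral_indicator (measurableSet_ival _ _)]
    refine lintegral_mono' ?_ le_rfl
    rw [leb, Measure.restrict_restrict (measurableSet_ival _ _)]
    exact Measure.restrict_mono inter_subset_left le_rfl
  have e2 : (l ^ r) ^ (q / r) * integ u t d ≤ hardyInt r q u v c d ((ival c t).indicator f) := by
    calc (l ^ r) ^ (q / r) * integ u t d ≤ ∫⁻ s, (l ^ r) ^ (q / r) * u s ∂(leb t d) :=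
          lintegral_const_mul_le _ _
      _ ≤ ∫⁻ s : ℝ, (∫⁻ s', (ival c t).indicator f s' ^ r * v s' ∂(leb c s)) ^ (q / r) * u s
            ∂(leb t d) := by
          refine setLIntegral_mono_ae' (measurableSet_ival _ _)
            (Filter.Eventually.of_forall fun s hs => ?_)
          have : 0 ≤ q / r := by positivity
          gcongr
          refine hf2.trans ?_
          calc _ = ∫⁻ s', (ival c t).indicator f s' ^ r * v s' ∂(leb c t) := by
                refine setLIntegral_congr_fun (measurableSet_ival _ _) fun s' hs' => ?_
                simp only [indicator_of_mem hs']
            _ ≤ _ := lintegral_mono' (leb_mono le_rfl hs.1.le) le_rfl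
      _ ≤ _ := lintegral_mono' (leb_mono ht.1.le le_rfl) le_rfl
  rw [← ENNReal.rpow_mul, show r * (q / r) = q by field_simp] at e2
  have e3 : l ^ q * integ u t d ≤ B ^ q := by
    refine e2.trans (hI.trans ?_)
    gcongr
    exact mul_le_of_le_one_right' e1
  rw [← ENNReal.rpow_le_rpow_iff hq, mul_rpow_mul_rpow hq.le, div_self hq.ne', ENNReal.rpow_one,
    mul_comm]
  exact e3

lemma Dyadic.V_rpow_le (hr : 0 < r) (hr1 : r ≤ 1) (h : Dyadic c d u x ω) (n : ℤ) :
    V r v c (x n) ^ kap r ≤ ∑' i : ℕ, V r v (x (n - i - 1)) (x (n - i)) ^ kap r := by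
  refine V_rpow_kap_le hr hr1 (s := fun i : ℕ => x (n - i - 1)) (t := fun i : ℕ => x (n - i)) ?_
  rw [← h.Ioc_eq_iUnion, ival_coe]
  exact Ioo_subset_Ioc_self

/-- Any constant in the local inequality dominates `locConst`. -/
lemma locConst_le {r q : ℝ} (hr : 0 < r) (hr1 : r ≤ 1) (hq : 0 < q) :
    ∃ K : ℝ≥0∞, K ≠ ∞ ∧ ∀ (u v : ℝ → ℝ≥0∞) (c : ℝ) (d : EReal), (c : EReal) < d → TailOK c d u →
      AEMeasurable u (leb c d) → AEMeasurable v (leb c d) → ∀ B : ℝ≥0∞, B ≠ ∞ →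
        (∀ f, Measurable f → hardyInt r q u v c d f ≤ (B * ∫⁻ t, f t ∂(leb c d)) ^ q) →
          locConst r q u v c d ≤ K * B := by
  rcases le_or_gt 1 q with h1 | h1
  · refine ⟨1, by norm_num, fun u v c d hcd hT hu hv B hB h => ?_⟩
    rw [locConst, if_neg h1.not_gt, one_mul]
    exact iSup₂_le fun t ht => tail_mul_V_le hr hr1 hq hv hB h ht
  have hq1 : 0 < 1 - q := by linarith
  set α := q / (1 - q) with hα
  have hα0 : 0 < α := by positivity
  have hκ := kap_pos hr
  have e1 : 1 + α = α / q := by rw [hα]; field_simp; ring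
  obtain ⟨K, hK, hG⟩ := geom_hardy (α := 1 + α) (β := α / kap r) (by positivity) (by positivity)
  have h2T : ∀ s : ℝ, (2 : ℝ≥0∞) ^ s ≠ ∞ := fun s =>
    ENNReal.rpow_ne_top_of_ne_zero (by norm_num) (by norm_num)
  refine ⟨(2 ^ α * K) ^ (1 / α) * (2 * 2 ^ (1 / q)),
    ENNReal.mul_ne_top (ENNReal.rpow_ne_top_of_nonneg (by positivity)
      (ENNReal.mul_ne_top (h2T _) hK)) (ENNReal.mul_ne_top (by norm_num) (h2T _)),
    fun u v c d hcd hT hu hv B hB h => ?_⟩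
  obtain ⟨x, ω, hx⟩ := hT.exists_dyadic hcd
  set Vn : ℤ → ℝ≥0∞ := fun n => V r v (x (n - 1)) (x n) with hVn
  -- Gluing near-extremals requires V to be finite on every block; an infinite value would
  -- contradict the supremal condition at x n.
  have hVfin : ∀ n, Vn n ≠ ∞ := fun n => by
    by_cases hn : c < x n
    · have := tail_mul_V_le hr hr1 hq hv hB h (t := x n) ⟨by exact_mod_cast hn, hx.lt_right n⟩
      rw [hx.tail n hn] at this
      intro hcon
      have h2 : V r v c (x n) = ∞ :=
        top_le_iff.1 (hcon ▸ V_mono hr hr1 (by exact_mod_cast hx.left_le _) le_rfl)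
      rw [h2, ENNReal.mul_top (hx.halving.rpow_pos n _).ne'] at this
      exact hB (top_le_iff.1 this)
    · simp only [hVn]
      rw [V_of_le hr hr1]
      · simp
      · exact_mod_cast (not_lt.1 hn).trans (hx.left_le _)
  -- The operator bound comes from testing with near-extremals of V on the blocks, carrying the
  -- masses `z n`; the factor 1/2 is the loss of near-extremality.
  have hN : mulNorm 1 q (fun n => 2⁻¹ * (ω n ^ (1 / q) * Vn n)) ≤ 2 ^ (1 / q) * B := by
    refine mulNorm_le_of_forall one_pos hq fun z => ?_
    obtain ⟨f, hf, hf1, hf2⟩ := exists_glue hr hr1 hx.pairwise_disjoint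
      (fun n => hv.mono_measure (hx.leb_block_le n)) hVfin z
    have hfz : ∫⁻ t, f t ∂(leb c d) ≤ ∑' n, z n := by
      refine (hf1 (ival c d) (measurableSet_ival _ _)).trans (ENNReal.tsum_le_tsum fun n => ?_)
      exact indicator_le_self _ _ _
    calc _ ≤ ∑' n, ω n ^ (1 + (0 : ℝ)) *
          volume.withDensity (fun s => f s ^ r * v s) (Ioc (x (n - 1)) (x n)) ^ (q / r) := by
          refine ENNReal.tsum_le_tsum fun n => ?_
          rw [withDensity_block, add_zero, ENNReal.rpow_one,
            show 2⁻¹ * (ω n ^ (1 / q) * Vn n) * z n = ω n ^ (1 / q) * (Vn n / 2 * z n) by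
              rw [ENNReal.div_eq_inv_mul]; ring, mul_rpow_mul_rpow hq.le, div_self hq.ne',
            ENNReal.rpow_one]
          gcongr
          calc (Vn n / 2 * z n) ^ q = ((Vn n / 2 * z n) ^ r) ^ (q / r) := by
                rw [← ENNReal.rpow_mul]; congr 1; field_simp
            _ ≤ _ := by gcongr; exact hf2 n
      _ ≤ 2 ^ (1 + (0 : ℝ)) * hardyInt r q u v c d f := by
          rw [hardyInt_eq]; exact hx.lower (by positivity) le_rfl _
      _ ≤ 2 * (B * ∫⁻ t, f t ∂(leb c d)) ^ q := by
          rw [add_zero, ENNReal.rpow_one]; gcongr; exact h f hf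
      _ ≤ _ := by
          rw [mul_rpow_mul_rpow hq.le, div_self hq.ne', ENNReal.rpow_one, mul_assoc,
            ENNReal.mul_rpow_of_nonneg _ _ hq.le]
          simp only [ENNReal.rpow_one, div_one]
          gcongr
  rw [mulNorm_const_mul one_pos hq] at hN
  have hN' : mulNorm 1 q (fun n => ω n ^ (1 / q) * Vn n) ≤ 2 * 2 ^ (1 / q) * B := by
    calc _ = 2 * (2⁻¹ * mulNorm 1 q (fun n => ω n ^ (1 / q) * Vn n)) := by
          rw [← mul_assoc, ENNReal.mul_inv_cancel (by norm_num) (by norm_num), one_mul]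
      _ ≤ _ := by rw [mul_assoc]; gcongr
  have hmn := mulNorm_rpow one_pos hq h1 (fun n => ω n ^ (1 / q) * Vn n)
  simp only [one_mul, ← hα, mul_rpow_mul_rpow hα0.le, ← e1] at hmn
  rw [← ENNReal.rpow_le_rpow_iff (z := α) hα0, mul_assoc, ENNReal.mul_rpow_of_nonneg _ _ hα0.le,
    ← ENNReal.rpow_mul, one_div_mul_cancel hα0.ne', ENNReal.rpow_one]
  calc locConst r q u v c d ^ α
      = ∫⁻ t : ℝ, V r v c t ^ α * (integ u t d ^ α * u t) ∂(leb c d) := by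
        rw [locConst, if_pos h1, intConst, ← ENNReal.rpow_mul,
          show (1 - q) / q * α = 1 by rw [hα]; field_simp, ENNReal.rpow_one]
        exact lintegral_congr fun t => by rw [mul_comm]
    -- V (c, x n) involves all earlier blocks; subadditivity of V^κ, with κ = `kap r`, followed by
    -- `geom_hardy`, leaves the last one.
    _ ≤ 2 ^ α * ∑' n, ω n ^ (1 + α) * (∑' i : ℕ, Vn (n - i) ^ kap r) ^ (α / kap r) := by
        refine hx.step_upper hu hα0.le fun n t ht => ?_
        calc V r v c t ^ α ≤ V r v c (x n) ^ α := by
              gcongr; exact V_mono hr hr1 le_rfl (by exact_mod_cast ht.2)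
          _ = (V r v c (x n) ^ kap r) ^ (α / kap r) := by
              rw [← ENNReal.rpow_mul]; congr 1; field_simp
          _ ≤ _ := by gcongr; exact hx.V_rpow_le hr hr1 n
    _ ≤ 2 ^ α * (K * ∑' n, ω n ^ (1 + α) * (Vn n ^ kap r) ^ (α / kap r)) := by
        gcongr
        exact hG (fun n => ω n ^ (1 + α)) (fun n i => hx.geom n i) (fun n => Vn n ^ kap r)
    _ = 2 ^ α * K * mulNorm 1 q (fun n => ω n ^ (1 / q) * Vn n) ^ α := by
        rw [hmn, mul_assoc]
        congr 3; ext n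
        rw [← ENNReal.rpow_mul]; congr 2; field_simp
    _ ≤ _ := by gcongr

end local_hardy


/-! ### Sufficiency in terms of the dyadic blocks -/

lemma tsum_indicator_le {R : ℤ → Set ℤ} (hR : Pairwise (Function.onFun Disjoint R)) (c : ℤ → ℝ≥0∞) :
    ∑' n, ∑' j, (R n).indicator c j ≤ ∑' j, c j := by
  rw [ENNReal.tsum_comm]
  refine ENNReal.tsum_le_tsum fun j => ?_
  by_cases h : ∃ n, j ∈ R n
  · obtain ⟨n, hn⟩ := h
    rw [tsum_eq_single n]
    · exact indicator_le_self _ _ _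
    · exact fun m hm => indicator_of_notMem (fun hj => Set.disjoint_left.1 (hR hm) hj hn) _
  · push Not at h
    simp [h]

/-- Two applications of `tsum_mul_rpow_le_mulNorm`: from ℓ^p to ℓ^r inside each `R n`, then from ℓ^p
to ℓ^q for the sequence of ℓ^p norms Z n. Disjointness of the `R n` recombines the latter. -/
lemma tsum_blocks_le_mulNorm {p q r : ℝ} (hp : 0 < p) (hq : 0 < q) (hr : 0 < r)
    {R : ℤ → Set ℤ} (hR : Pairwise (Function.onFun Disjoint R)) (θ μ z : ℤ → ℝ≥0∞) :
    ∑' n, θ n * (∑' j, ((R n).indicator μ j * z j) ^ r) ^ (q / r) ≤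
      mulNorm p q (fun n => θ n ^ (1 / q) * mulNorm p r ((R n).indicator μ)) ^ q *
        (∑' k, z k ^ p) ^ (q / p) := by
  set Z : ℤ → ℝ≥0∞ := fun n => (∑' j, (R n).indicator (fun j => z j ^ p) j) ^ (1 / p) with hZ
  calc _ ≤ ∑' n, (θ n ^ (1 / q) * mulNorm p r ((R n).indicator μ) * Z n) ^ q := by
        refine ENNReal.tsum_le_tsum fun n => ?_
        rw [mul_assoc, mul_rpow_mul_rpow hq.le, div_self hq.ne', ENNReal.rpow_one]
        gcongr
        have h1 : ∑' j, ((R n).indicator μ j * z j) ^ r =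
            ∑' j, ((R n).indicator μ j * (R n).indicator z j) ^ r := by
          refine tsum_congr fun j => ?_
          by_cases hj : j ∈ R n <;> simp [hj]
        have h2 : ∑' j, (R n).indicator z j ^ p = ∑' j, (R n).indicator (fun j => z j ^ p) j := by
          refine tsum_congr fun j => ?_
          by_cases hj : j ∈ R n <;> simp [hj, hp]
        have h3 := tsum_mul_rpow_le_mulNorm hp hr ((R n).indicator μ) ((R n).indicator z)
        rw [← h1, h2] at h3
        calc _ ≤ _ := ENNReal.rpow_le_rpow h3 (show 0 ≤ q / r by positivity)
          _ = _ := by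
            rw [ENNReal.mul_rpow_of_nonneg _ _ (by positivity), ENNReal.mul_rpow_of_nonneg _ _ hq.le,
              hZ]
            simp only [← ENNReal.rpow_mul]
            congr 2 <;> field_simp
    _ ≤ _ := tsum_mul_rpow_le_mulNorm hp hq _ Z
    _ ≤ _ := by
        have h4 : ∑' n, Z n ^ p ≤ ∑' k, z k ^ p := by
          simp only [hZ, ← ENNReal.rpow_mul, one_div_mul_cancel hp.ne', ENNReal.rpow_one]
          exact tsum_indicator_le hR _
        exact mul_le_mul_right (ENNReal.rpow_le_rpow h4 (by positivity)) _

/-- The purely atomic measure with masses `c j` at the points `y j`. -/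
noncomputable def atoms (c : ℤ → ℝ≥0∞) (y : ℤ → ℝ) : Measure ℝ :=
  Measure.sum fun j => c j • Measure.dirac (y j)

lemma atoms_apply (c : ℤ → ℝ≥0∞) (y : ℤ → ℝ) {E : Set ℝ} (hE : MeasurableSet E) :
    atoms c y E = ∑' j, {j | y j ∈ E}.indicator c j := by
  rw [atoms, Measure.sum_apply _ hE]
  refine tsum_congr fun j => ?_
  rw [Measure.smul_apply, Measure.dirac_apply' _ hE, smul_eq_mul]
  by_cases h : y j ∈ E
  · rw [indicator_of_mem h, indicator_of_mem (show j ∈ {j | y j ∈ E} from h)]; simp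
  · rw [indicator_of_notMem h, indicator_of_notMem (show j ∉ {j | y j ∈ E} from h)]; simp

lemma IsWeight.integ_pos {a b : EReal} {u : ℝ → ℝ≥0∞} (hu : IsWeight a b u) {x y : EReal}
    (hx : a ≤ x) (hxy : x < y) (hy : y ≤ b) : 0 < integ u x y := by
  have hle := leb_mono hx hy
  rw [pos_iff_ne_zero]
  intro h0
  rw [integ, lintegral_eq_zero_iff' (hu.meas.mono_measure hle)] at h0
  have hF : ∀ᵐ t ∂(leb x y), False := by
    filter_upwards [h0, ae_mono hle hu.pos] with t h1 h2
    exact h2.ne' h1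
  rw [Filter.eventually_false_iff_eq_bot, ae_eq_bot] at hF
  exact leb_ne_zero hxy hF

/-- The standing assumptions, with finite tails of `u`. -/
structure Setup (a : ℝ) (b : EReal) (u v w : ℝ → ℝ≥0∞) : Prop where
  hab : (a : EReal) < b
  hu : IsWeight a b u
  hv : IsWeight a b v
  hw : IsWeight a b w
  hW : TailOK a b w
  hU : TailOK a b u

lemma Setup.tailOK {a : ℝ} {b : EReal} {u v w : ℝ → ℝ≥0∞} (S : Setup a b u v w) {c : ℝ} {d : EReal}
    (hc : a ≤ c) (hd : d ≤ b) : TailOK c d u := fun t ht =>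
  ⟨S.hu.integ_pos (le_trans (by exact_mod_cast hc) ht.1.le) ht.2 hd,
    (integ_mono le_rfl hd u).trans_lt
      (S.hU t ⟨lt_of_le_of_lt (by exact_mod_cast hc) ht.1, ht.2.trans_le hd⟩).2⟩

/-- The multiplier `ω_j^{-1/p} V(x_{j-1}, x_j)`. -/
noncomputable def cell (r p : ℝ) (v : ℝ → ℝ≥0∞) (x : ℤ → ℝ) (ω : ℤ → ℝ≥0∞) (j : ℤ) : ℝ≥0∞ :=
  ω j ^ (-(1 / p)) * V r v (x (j - 1)) (x j)

/-- The constant of the inequality inside the blocks. -/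
noncomputable def blockConst (r p q : ℝ) (u v : ℝ → ℝ≥0∞) (x : ℤ → ℝ) (ω : ℤ → ℝ≥0∞) : ℝ≥0∞ :=
  mulNorm p q fun k => ω k ^ (-(1 / p)) * locConst r q u v (x (k - 1)) (x k)

/-- The constant of the inequality between the blocks. -/
noncomputable def chainConst (r p q : ℝ) (v : ℝ → ℝ≥0∞) (x : ℤ → ℝ) (ω : ℤ → ℝ≥0∞) (t : ℤ → ℝ)
    (θ : ℤ → ℝ≥0∞) : ℝ≥0∞ :=
  mulNorm p q fun n => θ n ^ (1 / q) *
    mulNorm p r ({j | x j ∈ Ioc (t (n - 1)) (t n)}.indicator (cell r p v x ω))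

lemma Dyadic.pairwise_disjoint_preimage {c : ℝ} {d : EReal} {g : ℝ → ℝ≥0∞} {t : ℤ → ℝ}
    {θ : ℤ → ℝ≥0∞} (h : Dyadic c d g t θ) (y : ℤ → ℝ) :
    Pairwise (Function.onFun Disjoint fun n => {j | y j ∈ Ioc (t (n - 1)) (t n)}) := by
  intro m n hmn
  rw [Function.onFun, Set.disjoint_left]
  exact fun j h1 h2 => Set.disjoint_left.1 (h.pairwise_disjoint hmn) h1 h2

lemma Halving.neg_mul_cancel {ω : ℤ → ℝ≥0∞} (h : Halving ω) (n : ℤ) (s : ℝ) :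
    ω n ^ (-s) * ω n ^ s = 1 := by
  rw [← ENNReal.rpow_add _ _ (h.ne_zero n) (h.ne_top n)]; simp

lemma Halving.mul_mul_cancel {ω : ℤ → ℝ≥0∞} (h : Halving ω) (n : ℤ) (s : ℝ) (a b : ℝ≥0∞) :
    ω n ^ (-s) * a * (ω n ^ s * b) = a * b := by
  rw [mul_mul_mul_comm, h.neg_mul_cancel, one_mul]

/-- For t in block k the inner integral is the part from x (k-1) to t plus complete earlier blocks.
The mass of each earlier block is placed at its right end point, so the second part becomes a Hardy
integral of an atomic measure, which can be discretized along `u` regardless of how the two dyadic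
sequences interlace. -/
lemma hardyInt_split {r q : ℝ} (hr : 0 < r) (hq : 0 < q) {a : ℝ} {b : EReal} {u v w : ℝ → ℝ≥0∞}
    (S : Setup a b u v w) {x : ℤ → ℝ} {ω : ℤ → ℝ≥0∞} (hx : Dyadic a b w x ω) (f : ℝ → ℝ≥0∞) :
    hardyInt r q u v a b f ≤ 2 ^ (q / r) *
      ((∑' k, hardyInt r q u v (x (k - 1)) (x k) f) +
      ∫⁻ t : ℝ, atoms (fun j => ∫⁻ s, f s ^ r * v s ∂(leb (x (j - 1)) (x j))) x (ival a t) ^ (q / r) *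
        u t ∂(leb a b)) := by
  set ν := volume.withDensity (fun s => f s ^ r * v s) with hν
  set ν' := atoms (fun j => ∫⁻ s, f s ^ r * v s ∂(leb (x (j - 1)) (x j))) x with hν'
  have hqr : 0 < q / r := by positivity
  have hmeas : Measurable fun t : ℝ => ν' (ival a t) ^ (q / r) := by
    refine (Monotone.measurable fun s t hst => ?_).pow_const _
    exact measure_mono (ival_mono le_rfl (by exact_mod_cast hst))
  rw [hardyInt, hx.lintegral_eq, hx.lintegral_eq (fun t => ν' (ival a t) ^ (q / r) * u t),
    ← ENNReal.tsum_add, ← ENNReal.tsum_mul_left]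
  refine ENNReal.tsum_le_tsum fun k => ?_
  have hum := hx.aemeasurable_block S.hu.meas k
  calc _ ≤ ∫⁻ t in Ioc (x (k - 1)) (x k), 2 ^ (q / r) *
        ((∫⁻ s, f s ^ r * v s ∂(leb (x (k - 1)) t)) ^ (q / r) * u t +
          ν' (ival a t) ^ (q / r) * u t) := by
        refine setLIntegral_mono_ae' measurableSet_Ioc (Filter.Eventually.of_forall fun t ht => ?_)
        rw [← add_mul, ← mul_assoc]
        gcongr
        refine le_trans ?_ (ENNReal.add_rpow_le_two_rpow_mul_rpow_add_rpow _ _ hqr.le)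
        gcongr
        rw [lintegral_leb_split (hx.left_le (k - 1)) (by exact_mod_cast ht.1), add_comm]
        gcongr
        rw [← withDensity_apply _ measurableSet_Ioc, hx.measure_Ioc,
          hν', atoms_apply _ _ (measurableSet_ival _ _)]
        -- The i-th block to the left of x (k-1) belongs to the atom of index k-1-i. Its right end
        -- lies in (a, t) unless it equals a, and then the block is empty.
        refine le_trans (ENNReal.tsum_le_tsum fun i => ?_)
          (ENNReal.tsum_comp_le_tsum_of_injective (f := fun i : ℕ => k - 1 - (i : ℤ))
            (fun i j hij => by simpa using hij) _)
        by_cases hi : a < x (k - 1 - i)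
        · rw [indicator_of_mem, withDensity_block]
          refine ⟨by exact_mod_cast hi, ?_⟩
          have : x (k - 1 - i) < t := (hx.mono (by omega)).trans_lt ht.1
          exact_mod_cast this
        · rw [hx.block_eq_empty hi, measure_empty]; exact zero_le
    _ = 2 ^ (q / r) * ∫⁻ t in Ioc (x (k - 1)) (x k),
        ((∫⁻ s, f s ^ r * v s ∂(leb (x (k - 1)) t)) ^ (q / r) * u t +
          ν' (ival a t) ^ (q / r) * u t) :=
        lintegral_const_mul' _ _ (ENNReal.rpow_ne_top_of_nonneg hqr.le (by norm_num))
    _ = _ := by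
        have hm2 : AEMeasurable (fun t : ℝ => ν' (ival a t) ^ (q / r) * u t)
            (volume.restrict (Ioc (x (k - 1)) (x k))) := hmeas.aemeasurable.mul hum
        rw [lintegral_add_right' _ hm2, hardyInt, leb_coe]

/-- By `Dyadic.lower`, the sequence ω^(1/p) y, with `y k` the mass of f on block k, has ℓ^p norm
controlled by the right-hand side. The parts inside the blocks form a multiplier applied to it, by
`hardyInt_le`; the atomic part is discretized along `u` and treated by `tsum_blocks_le_mulNorm`. -/
lemma hardyInt_le_blocks {r p q : ℝ} (hr : 0 < r) (hr1 : r ≤ 1) (hp : 0 < p) (hq : 0 < q) :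
    ∃ K : ℝ≥0∞, K ≠ ∞ ∧ ∀ (a : ℝ) (b : EReal) (u v w : ℝ → ℝ≥0∞) (x t : ℤ → ℝ) (ω θ : ℤ → ℝ≥0∞),
      Setup a b u v w → Dyadic a b w x ω → Dyadic a b u t θ →
        HardyIneq a b r p q u v w
          (K * (blockConst r p q u v x ω + chainConst r p q v x ω t θ)) := by
  obtain ⟨K₁, hK₁, h₁⟩ := hardyInt_le hr hr1 hq
  obtain ⟨K₂, hK₂, h₂⟩ := dyadic_upper (β := q / r) (γ := 0) (by positivity) le_rfl
  have h2T : ∀ s : ℝ, (2 : ℝ≥0∞) ^ s ≠ ∞ := fun s =>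
    ENNReal.rpow_ne_top_of_ne_zero (by norm_num) (by norm_num)
  refine ⟨(2 ^ (q / r) * (K₁ + K₂) * 2 ^ (q / p)) ^ (1 / q), ENNReal.rpow_ne_top_of_nonneg (by positivity)
    (ENNReal.mul_ne_top (ENNReal.mul_ne_top (h2T _) (ENNReal.add_ne_top.2 ⟨hK₁, hK₂⟩)) (h2T _)),
    fun a b u v w x t ω θ S hx ht f hf => ?_⟩
  set A := blockConst r p q u v x ω with hA
  set B := chainConst r p q v x ω t θ with hB
  set R := ∫⁻ t : ℝ, (∫⁻ s, f s ∂(leb a t)) ^ p * w t ∂(leb a b) with hR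
  change hardyInt r q u v a b f ^ (1 / q) ≤ _ * R ^ (1 / p)
  set y : ℤ → ℝ≥0∞ := fun k => ∫⁻ s, f s ∂(leb (x (k - 1)) (x k)) with hy
  have hfm : ∀ k, AEMeasurable f (leb (x (k - 1)) (x k)) := fun k =>
    AEMeasurable.mono_measure hf (hx.leb_block_le k)
  have hvm : ∀ k, AEMeasurable v (leb (x (k - 1)) (x k)) := fun k =>
    AEMeasurable.mono_measure S.hv.meas (hx.leb_block_le k)
  set Y := ∑' k, (ω k ^ (1 / p) * y k) ^ p with hY
  have hYR : Y ≤ 2 * R := by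
    have := hx.lower hp le_rfl (volume.withDensity f)
    simp only [add_zero, ENNReal.rpow_one, ENNReal.rpow_zero, one_mul, withDensity_block,
      withDensity_apply _ (measurableSet_ival _ _)] at this
    calc Y = ∑' k, ω k * y k ^ p := by
          simp only [hY, mul_rpow_mul_rpow hp.le, div_self hp.ne', ENNReal.rpow_one]
      _ ≤ _ := this
  have hpart1 : ∑' k, hardyInt r q u v (x (k - 1)) (x k) f ≤ K₁ * (A ^ q * Y ^ (q / p)) := by
    calc _ ≤ ∑' k, K₁ * ((ω k ^ (-(1 / p)) * locConst r q u v (x (k - 1)) (x k)) *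
            (ω k ^ (1 / p) * y k)) ^ q := by
          refine ENNReal.tsum_le_tsum fun k => ?_
          rw [hx.halving.mul_mul_cancel]
          by_cases hk : a < x k
          · exact h₁ u v _ _ (by exact_mod_cast hx.pred_lt hk)
              (S.tailOK (hx.left_le _) (hx.lt_right k).le)
              (S.hu.meas.mono_measure (hx.leb_block_le k)) (hvm k) f (hfm k)
          · rw [hardyInt, leb_of_le, lintegral_zero_measure]
            · exact zero_le
            · exact_mod_cast (not_lt.1 hk).trans (hx.left_le _)
      _ ≤ _ := by
          rw [ENNReal.tsum_mul_left]
          gcongr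
          exact tsum_mul_rpow_le_mulNorm hp hq _ _
  have hpart2 : ∫⁻ s : ℝ, atoms (fun j => ∫⁻ s, f s ^ r * v s ∂(leb (x (j - 1)) (x j))) x
      (ival a s) ^ (q / r) * u s ∂(leb a b) ≤ K₂ * (B ^ q * Y ^ (q / p)) := by
    have := h₂ a b u t θ ht S.hu.meas
      (atoms (fun j => ∫⁻ s, f s ^ r * v s ∂(leb (x (j - 1)) (x j))) x)
    simp only [add_zero, ENNReal.rpow_one, ENNReal.rpow_zero, one_mul] at this
    refine this.trans ?_
    gcongr
    refine le_trans (ENNReal.tsum_le_tsum fun n => ?_)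
      (tsum_blocks_le_mulNorm hp hq hr (ht.pairwise_disjoint_preimage x) θ (cell r p v x ω)
        fun k => ω k ^ (1 / p) * y k)
    rw [atoms_apply _ _ measurableSet_Ioc]
    gcongr with j
    by_cases hj : j ∈ {j | x j ∈ Ioc (t (n - 1)) (t n)}
    · rw [indicator_of_mem hj, indicator_of_mem hj, cell, hx.halving.mul_mul_cancel]
      exact lintegral_le_V hr hr1 (hvm j) (hfm j)
    · rw [indicator_of_notMem hj]; exact zero_le
  have htot : hardyInt r q u v a b f ≤
      2 ^ (q / r) * (K₁ + K₂) * 2 ^ (q / p) * ((A + B) ^ q * R ^ (q / p)) := by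
    calc _ ≤ 2 ^ (q / r) * (K₁ * (A ^ q * Y ^ (q / p)) + K₂ * (B ^ q * Y ^ (q / p))) :=
          (hardyInt_split hr hq S hx f).trans (by gcongr)
      _ ≤ 2 ^ (q / r) * (K₁ * ((A + B) ^ q * (2 * R) ^ (q / p)) +
            K₂ * ((A + B) ^ q * (2 * R) ^ (q / p))) := by
          gcongr <;> simp
      _ = _ := by
          rw [ENNReal.mul_rpow_of_nonneg _ _ (show 0 ≤ q / p by positivity)]; ring
  calc _ ≤ _ := ENNReal.rpow_le_rpow htot (show 0 ≤ 1 / q by positivity)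
    _ = _ := by
        rw [ENNReal.mul_rpow_of_nonneg _ _ (show 0 ≤ 1 / q by positivity),
          ENNReal.mul_rpow_of_nonneg ((A + B) ^ q) _ (show 0 ≤ 1 / q by positivity),
          ← ENNReal.rpow_mul (A + B), ← ENNReal.rpow_mul R, mul_one_div_cancel hq.ne', ENNReal.rpow_one,
          show q / p * (1 / q) = 1 / p by field_simp, ← mul_assoc]


/-! ### Lower bounds for essential suprema -/

/-- Essential suprema see only sets of positive measure, so a lower bound needs a whole interval on
which it holds. -/
lemma le_essSup_leb {φ : ℝ → ℝ≥0∞} {x y s t : EReal} (hst : s < t) (hxs : x ≤ s) (hty : t ≤ y)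
    {l : ℝ≥0∞} (h : ∀ z ∈ ival s t, l ≤ φ z) : l ≤ essSup φ (leb x y) := by
  have h1 : ∀ᵐ z ∂(leb s t), φ z ≤ essSup φ (leb x y) :=
    ae_mono (leb_mono hxs hty) (ENNReal.ae_le_essSup (μ := leb x y) φ)
  have h2 : ∀ᵐ z ∂(leb s t), z ∈ ival s t := ae_restrict_mem (measurableSet_ival s t)
  have : NeZero (leb s t) := ⟨leb_ne_zero hst⟩
  obtain ⟨z, hz1, hz2⟩ := (h1.and h2).exists
  exact (h z hz2).trans hz1

lemma le_of_forall_lt_mul_rpow {a X R : ℝ≥0∞} {τ : ℝ} (hτ : 0 < τ)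
    (h : ∀ l < X, a * l ^ τ ≤ R) : a * X ^ τ ≤ R := by
  rcases eq_or_ne R ∞ with rfl | hR
  · exact le_top
  refine le_of_forall_lt_mul hR fun l hl => ?_
  have := h (l ^ τ⁻¹) ((ENNReal.rpow_inv_lt_iff hτ).2 hl)
  rwa [ENNReal.rpow_inv_rpow hτ.ne'] at this

section lower
variable {r : ℝ} {v : ℝ → ℝ≥0∞}

/-- A value at the single point s is invisible to the essential supremum. But V (s, x) is nearly
attained on some (x', y') with s < x', and then all z between s and x' do as well as s, A being no
smaller there. -/
lemma le_essSup_V (hr : 0 < r) (hr1 : r ≤ 1) {a s x : ℝ} (has : a ≤ s) {A : ℝ → ℝ≥0∞}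
    (hA : ∀ z, s < z → z < x → A s ≤ A z) {ρ : ℝ} (hρ : 0 < ρ) :
    A s * V r v s x ^ ρ ≤ essSup (fun z : ℝ => A z * V r v z x ^ ρ) (leb a x) := by
  refine le_of_forall_lt_mul_rpow hρ fun l hl => ?_
  obtain ⟨x', y', h1, h2, h3, h4⟩ := exists_lt_V hr hr1 hl
  have hx'x : (x' : EReal) < x := lt_trans (by exact_mod_cast h2) h3
  refine le_essSup_leb h1 (by exact_mod_cast has) hx'x.le fun z hz => ?_
  gcongr
  · exact hA z (by exact_mod_cast hz.1) (by exact_mod_cast hz.2.trans hx'x)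
  · exact h4.le.trans (V_mono hr hr1 hz.2.le h3.le)

lemma le_essSup_essSup_V (hr : 0 < r) (hr1 : r ≤ 1) {a x t : ℝ} {d : EReal} (hax : a ≤ x)
    (htd : (t : EReal) < d) {A B : ℝ → ℝ≥0∞} (hA : ∀ z, x < z → z < t → A x ≤ A z)
    (hB : ∀ s, x < s → s < t → B t ≤ B s) {ρ : ℝ} (hρ : 0 < ρ) :
    A x * (B t * V r v x t ^ ρ) ≤
      essSup (fun z : ℝ => A z * essSup (fun s : ℝ => B s * V r v z s ^ ρ) (leb z d)) (leb a d) := by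
  rw [← mul_assoc]
  refine le_of_forall_lt_mul_rpow hρ fun l hl => ?_
  obtain ⟨x', t', h1, h2, h3, h4⟩ := exists_lt_V hr hr1 hl
  have h2' : (x' : EReal) < t' := by exact_mod_cast h2
  refine le_essSup_leb h1 (by exact_mod_cast hax) (h2'.trans (h3.trans htd)).le fun z hz => ?_
  rw [mul_assoc]
  gcongr
  · exact hA z (by exact_mod_cast hz.1) (by exact_mod_cast hz.2.trans (h2'.trans h3))
  refine le_essSup_leb h3 (hz.2.trans h2').le htd.le fun s hs => ?_
  gcongr
  · exact hB s (by exact_mod_cast h1.trans (h2'.trans hs.1)) (by exact_mod_cast hs.2)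
  · exact h4.le.trans (V_mono hr hr1 hz.2.le hs.1.le)

/-- Monotone convergence along points decreasing to c: V (c, t) is the supremum of V (cs n, t) by
inner approximation. -/
lemma exists_lt_lintegral_V_right (hr : 0 < r) (hr1 : r ≤ 1) {α : ℝ} (hα : 0 < α) {c : ℝ}
    {d : EReal} (hcd : (c : EReal) < d) {g : ℝ → ℝ≥0∞} (hg : AEMeasurable g (leb c d)) {l : ℝ≥0∞}
    (hl : l < ∫⁻ t : ℝ, g t * V r v c t ^ α ∂(leb c d)) :
    ∃ c' : ℝ, c < c' ∧ (c' : EReal) < d ∧ l < ∫⁻ t : ℝ, g t * V r v c' t ^ α ∂(leb c' d) := by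
  obtain ⟨e, he1, he2⟩ := exists_real_btwn hcd
  obtain ⟨cs, hcs, hcs', hcs''⟩ := exists_seq_strictAnti_tendsto' (show c < e by exact_mod_cast he1)
  have hle : ∫⁻ t : ℝ, g t * V r v c t ^ α ∂(leb c d) ≤
      ∫⁻ t : ℝ, ⨆ n, g t * V r v (cs n) t ^ α ∂(leb c d) := by
    refine lintegral_mono fun t => ?_
    refine le_of_forall_lt_mul_rpow hα fun l hl => ?_
    obtain ⟨x', y', h1, h2, h3, h4⟩ := exists_lt_V hr hr1 hl
    obtain ⟨n, hn⟩ := (hcs''.eventually (gt_mem_nhds (show c < x' by exact_mod_cast h1))).exists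
    refine le_trans ?_ (le_iSup (fun n => g t * V r v (cs n) t ^ α) n)
    gcongr
    exact h4.le.trans (V_mono hr hr1 (by exact_mod_cast hn.le) h3.le)
  rw [lintegral_iSup'] at hle
  · obtain ⟨n, hn⟩ := lt_iSup_iff.1 (hl.trans_le hle)
    have hnd : (cs n : EReal) < d := lt_trans (by exact_mod_cast (hcs' n).2) he2
    refine ⟨cs n, (hcs' n).1, hnd, hn.trans_le ?_⟩
    rw [lintegral_leb_split (hcs' n).1.le hnd]
    refine le_of_eq ?_
    have : ∫⁻ t in Ioc c (cs n), g t * V r v (cs n) t ^ α = 0 := by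
      rw [setLIntegral_congr_fun (g := fun _ => 0) measurableSet_Ioc, lintegral_zero]
      intro t ht
      simp only
      rw [V_of_le hr hr1 (by exact_mod_cast ht.2), ENNReal.zero_rpow_of_pos hα, mul_zero]
    rw [this, zero_add]
  · exact fun n => hg.mul ((measurable_V hr hr1 _).pow_const _).aemeasurable
  · refine Filter.Eventually.of_forall fun t m n hmn => ?_
    have := hcs.antitone hmn
    simp only
    gcongr
    exact V_mono hr hr1 (by exact_mod_cast this) le_rfl

lemma le_essSup_lintegral_V (hr : 0 < r) (hr1 : r ≤ 1) {α τ : ℝ} (hα : 0 < α) (hτ : 0 < τ)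
    {a s x : ℝ} (has : a ≤ s) (hsx : s < x) {g A : ℝ → ℝ≥0∞} (hg : AEMeasurable g (leb s x))
    (hA : ∀ z, s < z → z < x → A s ≤ A z) :
    A s * (∫⁻ t : ℝ, g t * V r v s t ^ α ∂(leb s x)) ^ τ ≤
      essSup (fun z : ℝ => A z * (∫⁻ t : ℝ, g t * V r v z t ^ α ∂(leb z x)) ^ τ) (leb a x) := by
  refine le_of_forall_lt_mul_rpow hτ fun l hl => ?_
  obtain ⟨c', h1, h2, h3⟩ := exists_lt_lintegral_V_right hr hr1 hα (by exact_mod_cast hsx) hg hl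
  refine le_essSup_leb (s := s) (t := c') (by exact_mod_cast h1) (by exact_mod_cast has) h2.le
    fun z hz => ?_
  gcongr
  · exact hA z (by exact_mod_cast hz.1) (by exact_mod_cast hz.2.trans h2)
  · refine h3.le.trans (lintegral_mono' (leb_mono hz.2.le le_rfl) fun t => ?_)
    gcongr
    exact V_mono hr hr1 hz.2.le le_rfl

end lower

lemma integ_rpow_neg_mono {w : ℝ → ℝ≥0∞} {b : EReal} {s : ℝ} (hs : 0 ≤ s) {x y : ℝ} (h : x ≤ y) :
    integ w x b ^ (-s) ≤ integ w y b ^ (-s) := by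
  rw [ENNReal.rpow_neg, ENNReal.rpow_neg, ENNReal.inv_le_inv]
  exact ENNReal.rpow_le_rpow (integ_mono (by exact_mod_cast h) le_rfl w) hs

/-- A substitute for integrating the derivative of tail^(1+γ): up to the point where the tail has
dropped to one half, the tail is at least half of its initial value and `u` has half of its mass. -/
lemma integ_rpow_le {c : ℝ} {d : EReal} {u : ℝ → ℝ≥0∞} (hcd : (c : EReal) < d) {γ : ℝ} (hγ : 0 ≤ γ)
    (hT : TailOK c d u) (hc : integ u c d ≠ ∞) :
    integ u c d ^ (1 + γ) ≤ 2 ^ (1 + γ) * ∫⁻ t : ℝ, integ u t d ^ γ * u t ∂(leb c d) := by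
  have hpos : 0 < integ u c d := by
    obtain ⟨t, h1, h2⟩ := exists_real_btwn hcd
    exact (hT t ⟨h1, h2⟩).1.trans_le (integ_mono h1.le le_rfl u)
  set I := integ u c d with hI
  obtain ⟨t, ht, hte⟩ := exists_integ_eq (fun t ht => (hT t ht).2) (ENNReal.half_pos hpos.ne')
    (ENNReal.half_lt_self hpos.ne' hc)
  have hsp := integ_split (c := c) (by exact_mod_cast ht.1.le) ht.2 u
  have hb : ∫⁻ s in Ioc c t, u s = I / 2 := by
    rw [hte, ← hI] at hsp
    have : I / 2 + I / 2 = (∫⁻ s in Ioc c t, u s) + I / 2 := by rw [ENNReal.add_halves]; exact hsp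
    exact ((ENNReal.add_left_inj (ENNReal.div_ne_top hc (by norm_num))).1 this).symm
  calc I ^ (1 + γ) = 2 ^ (1 + γ) * ((I / 2) ^ γ * (I / 2)) := by
        have e : (I / 2) ^ γ * (I / 2) = (I / 2) ^ (1 + γ) := by
          rw [ENNReal.rpow_add_of_nonneg _ _ zero_le_one hγ, ENNReal.rpow_one, mul_comm]
        rw [e, ← ENNReal.mul_rpow_of_nonneg _ _ (by linarith),
          ENNReal.mul_div_cancel (by norm_num) (by norm_num)]
    _ ≤ _ := by
        gcongr
        rw [lintegral_leb_split (c := c) (by exact_mod_cast ht.1.le) ht.2]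
        refine le_trans ?_ le_self_add
        rw [← hb]
        refine (lintegral_const_mul_le _ _).trans ?_
        refine setLIntegral_mono_ae' measurableSet_Ioc (Filter.Eventually.of_forall fun s hs => ?_)
        gcongr
        rw [hb, ← hte]
        exact integ_mono (by exact_mod_cast hs.2) le_rfl u


/-! ### The dyadic constants are dominated by `C₁, …, C₇` -/

lemma two_rpow_ne_top (s : ℝ) : (2 : ℝ≥0∞) ^ s ≠ ∞ :=
  ENNReal.rpow_ne_top_of_ne_zero (by norm_num) (by norm_num)

lemma rpow_neg_anti {y z : ℝ≥0∞} (h : y ≤ z) {s : ℝ} (hs : 0 ≤ s) : z ^ (-s) ≤ y ^ (-s) := by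
  rw [ENNReal.rpow_neg, ENNReal.rpow_neg, ENNReal.inv_le_inv]
  exact ENNReal.rpow_le_rpow h hs

lemma mulNorm_zero {p q : ℝ} (hp : 0 < p) (hq : 0 < q) : mulNorm p q (fun _ => 0) = 0 := by
  rcases le_or_gt p q with h | h
  · rw [mulNorm_of_le h]; simp
  · have := rho_pos hp hq h
    rw [mulNorm_of_lt h, ENNReal.zero_rpow_of_pos this, tsum_zero, ENNReal.zero_rpow_of_pos]
    rw [rho_inv]; positivity

section comparison
variable {r p q : ℝ} {a : ℝ} {b : EReal} {u v w : ℝ → ℝ≥0∞} {x t : ℤ → ℝ} {ω θ : ℤ → ℝ≥0∞}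

lemma Dyadic.rpow_neg_eq (hx : Dyadic a b w x ω) (s : ℝ) {k : ℤ} (hk : a < x k) :
    ω k ^ (-s) = 2 ^ s * integ w (x (k - 1)) b ^ (-s) := by
  rw [hx.tail_pred k hk, ENNReal.mul_rpow_of_ne_zero (by norm_num) (hx.halving.ne_zero k),
    ← mul_assoc, mul_comm (2 ^ s), two_rpow_cancel, one_mul]

lemma locConst_of_le (hq : 0 < q) {c : ℝ} {d : EReal} (h : d ≤ c) : locConst r q u v c d = 0 := by
  unfold locConst
  split_ifs with h1
  · rw [intConst, leb_of_le h, lintegral_zero_measure,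
      ENNReal.zero_rpow_of_pos (div_pos (by linarith) hq)]
  · rw [supConst]
    simp only [ENNReal.iSup_eq_zero]
    intro t ht
    exact absurd (ht.1.trans (ht.2.trans_le h)) (lt_irrefl _)

lemma locConst_mono (hr : 0 < r) (hr1 : r ≤ 1) (hq : 0 < q) {c c' : ℝ} {d d' : EReal} (hc : c' ≤ c)
    (hd : d ≤ d') : locConst r q u v c d ≤ locConst r q u v c' d' := by
  have hc' : (c' : EReal) ≤ c := by exact_mod_cast hc
  unfold locConst
  split_ifs with h1
  · have h2 : 0 < 1 - q := by linarith
    unfold intConst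
    refine ENNReal.rpow_le_rpow (lintegral_mono' (leb_mono hc' hd) fun t => ?_) (by positivity)
    gcongr
    · exact integ_mono le_rfl hd u
    · exact V_mono hr hr1 hc' le_rfl
  · refine iSup₂_le fun t ht => ?_
    refine le_trans ?_ (le_iSup₂ (f := fun (t : ℝ) (_ : t ∈ ival c' d') =>
      integ u (t : ℝ) d' ^ (1 / q) * V r v c' t) t (ival_mono hc' hd ht))
    gcongr
    · exact integ_mono le_rfl hd u
    · exact V_mono hr hr1 hc' le_rfl

/-- The essential suprema in `C1` thus control the expression at every pair of points, with y = a
included. -/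
lemma C1_lower (hr : 0 < r) (hr1 : r ≤ 1) (hp : 0 < p) (hq : 0 < q) {y z : ℝ} (hay : a ≤ y)
    (hzb : (z : EReal) < b) :
    integ w y b ^ (-(1 / p)) * (integ u z b ^ (1 / q) * V r v y z) ≤ C1 a b r p q u v w := by
  have := le_essSup_essSup_V (v := v) hr hr1 hay hzb
    (A := fun z => integ w z b ^ (-(1 / p))) (B := fun s => integ u s b ^ (1 / q))
    (fun z hz _ => integ_rpow_neg_mono (by positivity) hz.le)
    (fun s _ hs => ENNReal.rpow_le_rpow (integ_mono (by exact_mod_cast hs.le) le_rfl u)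
      (by positivity)) one_pos
  simp only [ENNReal.rpow_one] at this
  exact this

lemma C2_lower (hr : 0 < r) (hr1 : r ≤ 1) (hp : 0 < p) (hq : 0 < q) (hq1 : q < 1)
    (hu : AEMeasurable u (leb a b)) {y : ℝ} (hay : a ≤ y) (hyb : (y : EReal) < b) :
    integ w y b ^ (-(1 / p)) * intConst r q u v y b ≤ C2 a b r p q u v w := by
  have h2 : 0 < 1 - q := by linarith
  refine le_of_forall_lt_mul_rpow (by positivity) fun l hl => ?_
  obtain ⟨c', h3, h4, h5⟩ := exists_lt_lintegral_V_right hr hr1 (α := q / (1 - q)) (by positivity) hyb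
    (g := fun t : ℝ => integ u t b ^ (q / (1 - q)) * u t)
    (((measurable_integ u b).pow_const _).aemeasurable.mul
      (hu.mono_measure (leb_mono (by exact_mod_cast hay) le_rfl))) hl
  have hm : c' ∈ ival a b := ⟨by exact_mod_cast hay.trans_lt h3, h4⟩
  refine le_trans ?_ (le_iSup₂ (f := fun (x : ℝ) (_ : x ∈ ival a b) =>
    integ w (x : ℝ) b ^ (-(1 / p)) * (∫⁻ t : ℝ, integ u t b ^ (q / (1 - q)) * u t *
      V r v x t ^ (q / (1 - q)) ∂(leb x b)) ^ ((1 - q) / q)) c' hm)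
  exact mul_le_mul' (integ_rpow_neg_mono (one_div_nonneg.2 hp.le) h3.le)
    (ENNReal.rpow_le_rpow h5.le (by positivity))

lemma blockConst_le_of (hq : 0 < q) (hpq : p ≤ q) (hx : Dyadic a b w x ω) {D : ℝ≥0∞}
    (h : ∀ k, a < x k → integ w (x (k - 1)) b ^ (-(1 / p)) * locConst r q u v (x (k - 1)) b ≤ D)
    (hr : 0 < r) (hr1 : r ≤ 1) :
    blockConst r p q u v x ω ≤ 2 ^ (1 / p) * D := by
  rw [blockConst, mulNorm_of_le hpq]
  refine iSup_le fun k => ?_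
  by_cases hk : a < x k
  · rw [hx.rpow_neg_eq _ hk, mul_assoc]
    gcongr
    refine le_trans ?_ (h k hk)
    gcongr
    exact locConst_mono hr hr1 hq le_rfl (hx.lt_right k).le
  · rw [locConst_of_le hq]
    · simp
    · exact_mod_cast (not_lt.1 hk).trans (hx.left_le _)

lemma blockConst_le_C1 (hr : 0 < r) (hr1 : r ≤ 1) (hp : 0 < p) (hq : 1 ≤ q) (hpq : p ≤ q)
    (hx : Dyadic a b w x ω) : blockConst r p q u v x ω ≤ 2 ^ (1 / p) * C1 a b r p q u v w := by
  have hq0 : 0 < q := by linarith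
  refine blockConst_le_of hq0 hpq hx (fun k hk => ?_) hr hr1
  rw [locConst, if_neg hq.not_gt, supConst]
  simp only [ENNReal.mul_iSup]
  exact iSup₂_le fun t ht => C1_lower hr hr1 hp hq0 (hx.left_le _) ht.2

lemma blockConst_le_C2 (hr : 0 < r) (hr1 : r ≤ 1) (hp : 0 < p) (hq : 0 < q) (hq1 : q < 1)
    (hpq : p ≤ q) (hu : AEMeasurable u (leb a b)) (hx : Dyadic a b w x ω) :
    blockConst r p q u v x ω ≤ 2 ^ (1 / p) * C2 a b r p q u v w := by
  refine blockConst_le_of hq hpq hx (fun k hk => ?_) hr hr1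
  rw [locConst, if_pos hq1]
  exact C2_lower hr hr1 hp hq hq1 hu (hx.left_le _) (hx.lt_right _)

/-- This supplies the bound D on single cells required by `chainConst_le_of_le`, `chainConst_le_C3`
and `chainConst_le_C6`. -/
lemma cell_le_C1 (hr : 0 < r) (hr1 : r ≤ 1) (hp : 0 < p) (hq : 0 < q)
    (hx : Dyadic a b w x ω) (j : ℤ) (hj : a < x j) :
    integ u (x j) b ^ (1 / q) * cell r p v x ω j ≤ 2 ^ (1 / p) * C1 a b r p q u v w := by
  rw [cell, hx.rpow_neg_eq _ hj]
  calc _ = 2 ^ (1 / p) * (integ w (x (j - 1)) b ^ (-(1 / p)) *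
        (integ u (x j) b ^ (1 / q) * V r v (x (j - 1)) (x j))) := by ring
    _ ≤ _ := by gcongr; exact C1_lower hr hr1 hp hq (hx.left_le _) (hx.lt_right j)

/-- `C2` has no supremum over t. `integ_rpow_le` recovers the power of the tail at x j from the
integral over (x j, b), where V (x (j-1), t) is at least V of the cell. -/
lemma cell_le_C2 (hr : 0 < r) (hr1 : r ≤ 1) (hp : 0 < p) (hq : 0 < q) (hq1 : q < 1)
    (S : Setup a b u v w) (hx : Dyadic a b w x ω) (j : ℤ) (hj : a < x j) :
    integ u (x j) b ^ (1 / q) * cell r p v x ω j ≤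
      2 ^ (1 / q) * 2 ^ (1 / p) * C2 a b r p q u v w := by
  have h2 : 0 < 1 - q := by linarith
  rw [cell, hx.rpow_neg_eq _ hj]
  set α := q / (1 - q) with hα
  have hα0 : 0 < α := by positivity
  have e1 : 1 + α = α / q := by rw [hα]; field_simp; ring
  have key : integ u (x j) b ^ (1 / q) * V r v (x (j - 1)) (x j) ≤
      2 ^ (1 / q) * intConst r q u v (x (j - 1)) b := by
    rw [← ENNReal.rpow_le_rpow_iff hα0, mul_rpow_mul_rpow hα0.le, mul_rpow_mul_rpow hα0.le, intConst,
      ← ENNReal.rpow_mul, show (1 - q) / q * α = 1 by rw [hα]; field_simp, ENNReal.rpow_one, ← e1]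
    have h3 := integ_rpow_le (hx.lt_right j) hα0.le (S.tailOK (hx.left_le j) le_rfl)
      (S.hU (x j) ⟨by exact_mod_cast hj, hx.lt_right j⟩).2.ne
    calc _ ≤ (2 ^ (1 + α) * ∫⁻ t : ℝ, integ u t b ^ α * u t ∂(leb (x j) b)) *
          V r v (x (j - 1)) (x j) ^ α := by gcongr
      _ ≤ _ := by
        rw [mul_assoc]
        gcongr
        refine (lintegral_mul_const_le _ _).trans ?_
        have hle : leb (x j) b ≤ leb (x (j - 1)) b :=
          leb_mono (by exact_mod_cast hx.mono (by omega)) le_rfl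
        refine le_trans (setLIntegral_mono_ae' (measurableSet_ival _ _)
          (Filter.Eventually.of_forall fun s hs => ?_)) (lintegral_mono' hle le_rfl)
        gcongr
        exact V_mono hr hr1 le_rfl hs.1.le
  calc _ = 2 ^ (1 / p) * (integ w (x (j - 1)) b ^ (-(1 / p)) *
        (integ u (x j) b ^ (1 / q) * V r v (x (j - 1)) (x j))) := by ring
    _ ≤ 2 ^ (1 / p) * (integ w (x (j - 1)) b ^ (-(1 / p)) *
        (2 ^ (1 / q) * intConst r q u v (x (j - 1)) b)) := by gcongr
    _ = 2 ^ (1 / q) * 2 ^ (1 / p) *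
        (integ w (x (j - 1)) b ^ (-(1 / p)) * intConst r q u v (x (j - 1)) b) := by ring
    _ ≤ _ := by
        gcongr
        exact C2_lower hr hr1 hp hq hq1 S.hu.meas (hx.left_le _) (hx.lt_right _)

lemma Dyadic.theta_le (ht : Dyadic a b u t θ) {n : ℤ} {y : ℝ} (hy : y ∈ Ioc (t (n - 1)) (t n)) :
    θ n ≤ integ u y b := ht.le_tail hy

/-- When p ≤ q and p ≤ r both operator norms are suprema, so only single cells matter. -/
lemma chainConst_le_of_le (hq : 0 < q) (hpq : p ≤ q) (hpr : p ≤ r)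
    (ht : Dyadic a b u t θ) {D : ℝ≥0∞}
    (hD : ∀ j, a < x j → integ u (x j) b ^ (1 / q) * cell r p v x ω j ≤ D) :
    chainConst r p q v x ω t θ ≤ D := by
  rw [chainConst, mulNorm_of_le hpq]
  refine iSup_le fun n => ?_
  rw [mulNorm_of_le hpr, ENNReal.mul_iSup]
  refine iSup_le fun j => ?_
  by_cases hj : j ∈ {j | x j ∈ Ioc (t (n - 1)) (t n)}
  · rw [indicator_of_mem hj]
    refine le_trans ?_ (hD j ((ht.left_le _).trans_lt hj.1))
    gcongr
    exact ht.theta_le hj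
  · rw [indicator_of_notMem hj, mul_zero]; exact zero_le

/-- `∫_a^y 𝒲^{-p/(p-r)} w V(·,y)^{pr/(p-r)}`. -/
noncomputable def gInt (r p : ℝ) (v w : ℝ → ℝ≥0∞) (a : ℝ) (b : EReal) (y : ℝ) : ℝ≥0∞ :=
  ∫⁻ t : ℝ, integ w t b ^ (-(p / (p - r))) * w t * V r v t y ^ (p * r / (p - r)) ∂(leb a y)

/-- Cell j is compared with the part of `gInt` over the preceding block: for s there, V (s, y)
dominates V of cell j, 𝒲 is at most 4 ω_j, and `w` has mass 2 ω_j. A cell that starts at a has no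
preceding block, hence the condition a < x (j-1). -/
lemma tsum_cell_le_gInt (hr : 0 < r) (hr1 : r ≤ 1) (hrp : r < p) (hx : Dyadic a b w x ω) (y : ℝ) :
    ∑' j, {j | x j ≤ y ∧ a < x (j - 1)}.indicator
        (fun j => cell r p v x ω j ^ (p * r / (p - r))) j ≤
      4 ^ (p / (p - r)) * gInt r p v w a b y := by
  have hp : 0 < p := hr.trans hrp
  have hd : 0 < p - r := by linarith
  set σ := p * r / (p - r) with hσ
  have hσ0 : 0 < σ := by positivity
  set τ := p / (p - r) with hτ
  have hτ0 : 0 < τ := by positivity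
  have e1 : σ / p = τ - 1 := by rw [hσ, hτ]; field_simp; ring
  calc _ ≤ ∑' j, 4 ^ τ * ∫⁻ s in {s | s ∈ Ioc (x (j - 1 - 1)) (x (j - 1)) ∧ s < y},
        integ w s b ^ (-τ) * w s * V r v s y ^ σ := by
        refine ENNReal.tsum_le_tsum fun j => ?_
        by_cases hj : j ∈ {j | x j ≤ y ∧ a < x (j - 1)}
        · rw [indicator_of_mem hj]
          have hjx : x (j - 1) < x j := hx.pred_lt (hj.2.trans_le (hx.mono (by omega)))
          have hset : {s | s ∈ Ioc (x (j - 1 - 1)) (x (j - 1)) ∧ s < y} =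
              Ioc (x (j - 1 - 1)) (x (j - 1)) := by
            ext s; constructor
            · exact fun h => h.1
            · exact fun h => ⟨h, h.2.trans_lt (hjx.trans_le hj.1)⟩
          rw [hset]
          have hb := hx.block (j - 1) hj.2
          have h1 : cell r p v x ω j ^ σ = ω j ^ (-(σ / p)) * V r v (x (j - 1)) (x j) ^ σ := by
            rw [cell, ENNReal.mul_rpow_of_nonneg _ _ hσ0.le, ← ENNReal.rpow_mul]
            congr 2; ring
          have h2 : (4 : ℝ≥0∞) ^ τ * (2 * ω (j - 1)) ^ (-τ) = ω j ^ (-τ) := by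
            rw [hx.halving.pred j, ← mul_assoc, show (2 : ℝ≥0∞) * 2 = 4 by norm_num,
              ENNReal.mul_rpow_of_ne_zero (by norm_num) (hx.halving.ne_zero j), ← mul_assoc,
              ← ENNReal.rpow_add _ _ (by norm_num) (by norm_num)]
            simp
          calc cell r p v x ω j ^ σ = ω j ^ (-τ) * (ω j * V r v (x (j - 1)) (x j) ^ σ) := by
                rw [h1, ← mul_assoc, e1]
                congr 1
                nth_rw 3 [← ENNReal.rpow_one (ω j)]
                rw [← ENNReal.rpow_add _ _ (hx.halving.ne_zero j) (hx.halving.ne_top j)]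
                congr 1; ring
            _ ≤ ω j ^ (-τ) * (ω (j - 1) * V r v (x (j - 1)) (x j) ^ σ) := by
                gcongr
                exact hx.halving.anti (by omega)
            _ = 4 ^ τ * (((2 * ω (j - 1)) ^ (-τ) * V r v (x (j - 1)) (x j) ^ σ) *
                  ∫⁻ s in Ioc (x (j - 1 - 1)) (x (j - 1)), w s) := by
                rw [hb, ← h2]; ring
            _ ≤ _ := by
                gcongr
                refine (lintegral_const_mul_le _ _).trans ?_
                refine setLIntegral_mono_ae' measurableSet_Ioc
                  (Filter.Eventually.of_forall fun s hs => ?_)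
                rw [mul_right_comm (integ w s b ^ (-τ))]
                exact mul_le_mul_left (mul_le_mul' (rpow_neg_anti (hx.tail_le hs) hτ0.le)
                  (ENNReal.rpow_le_rpow (V_mono hr hr1
                    (show (s : EReal) ≤ x (j - 1) by exact_mod_cast hs.2)
                    (show (x j : EReal) ≤ y by exact_mod_cast hj.1)) hσ0.le)) _
        · rw [indicator_of_notMem hj]; exact zero_le
    _ = 4 ^ τ * ∫⁻ s in ⋃ j, {s | s ∈ Ioc (x (j - 1 - 1)) (x (j - 1)) ∧ s < y},
        integ w s b ^ (-τ) * w s * V r v s y ^ σ := by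
        rw [ENNReal.tsum_mul_left, lintegral_iUnion]
        · exact fun j => measurableSet_Ioc.inter measurableSet_Iio
        · intro i j hij
          exact (hx.pairwise_disjoint (show i - 1 ≠ j - 1 by omega)).mono
            (fun s hs => hs.1) (fun s hs => hs.1)
    _ ≤ _ := by
        gcongr
        refine lintegral_mono_set ?_
        refine iUnion_subset fun j s hs => ?_
        rw [ival_coe]
        exact ⟨(hx.left_le _).trans_lt hs.1.1, hs.2⟩

lemma tsum_le_of_unique {ι : Type*} {c : ι → ℝ≥0∞} {D : ℝ≥0∞}
    (h : ∀ i j, c i ≠ 0 → c j ≠ 0 → i = j) (hD : ∀ i, c i ≤ D) : ∑' i, c i ≤ D := by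
  by_cases h0 : ∃ i, c i ≠ 0
  · obtain ⟨i, hi⟩ := h0
    rw [tsum_eq_single i fun j hj => by by_contra hc; exact hj (h j i hc hi)]
    exact hD i
  · push Not at h0
    simp [h0]

/-- The exceptional cell, whose left end point is `a`. -/
noncomputable def firstCell (r p : ℝ) (v : ℝ → ℝ≥0∞) (a : ℝ) (x : ℤ → ℝ) (ω : ℤ → ℝ≥0∞) (j : ℤ) :
    ℝ≥0∞ := {j | a < x j ∧ ¬ a < x (j - 1)}.indicator (cell r p v x ω) j

lemma Dyadic.first_unique (hx : Dyadic a b w x ω) {i j : ℤ} (hi : a < x i ∧ ¬ a < x (i - 1))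
    (hj : a < x j ∧ ¬ a < x (j - 1)) : i = j := by
  have h1 := hx.le_of_lt ((not_lt.1 hj.2).trans_lt hi.1)
  have h2 := hx.le_of_lt ((not_lt.1 hi.2).trans_lt hj.1)
  omega

/-- The cell that starts at a escapes `tsum_cell_le_gInt` and is split off; the other cells are
enlarged to all those ending before t n. -/
lemma mulNorm_block_le (hr : 0 < r) (hrp : r < p)
    (ht : Dyadic a b u t θ) (n : ℤ) :
    mulNorm p r ({j | x j ∈ Ioc (t (n - 1)) (t n)}.indicator (cell r p v x ω)) ^
        (p * r / (p - r)) ≤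
      (∑' j, {j | x j ≤ t n ∧ a < x (j - 1)}.indicator
        (fun j => cell r p v x ω j ^ (p * r / (p - r))) j) +
      ∑' j, {j | x j ∈ Ioc (t (n - 1)) (t n)}.indicator
        (fun j => firstCell r p v a x ω j ^ (p * r / (p - r))) j := by
  have hp : 0 < p := hr.trans hrp
  have hσ0 := rho_pos hp hr hrp
  rw [mulNorm_rpow hp hr hrp, ← ENNReal.tsum_add]
  refine ENNReal.tsum_le_tsum fun j => ?_
  by_cases hj : j ∈ {j | x j ∈ Ioc (t (n - 1)) (t n)}
  · rw [indicator_of_mem hj]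
    by_cases h1 : a < x (j - 1)
    · refine le_trans ?_ le_self_add
      rw [indicator_of_mem (show j ∈ {j | x j ≤ t n ∧ a < x (j - 1)} from ⟨hj.2, h1⟩)]
    · refine le_trans ?_ le_add_self
      rw [indicator_of_mem hj, firstCell, indicator_of_mem]
      exact ⟨(ht.left_le _).trans_lt hj.1, h1⟩
  · rw [indicator_of_notMem hj, ENNReal.zero_rpow_of_pos hσ0]; exact zero_le

/-- There is at most one cell starting at a, so the sum has at most one term and the bound D on
single cells suffices. -/
lemma firstCell_block_le (hr : 0 < r) (hrp : r < p) (hq : 0 < q) (hx : Dyadic a b w x ω)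
    (ht : Dyadic a b u t θ) {D : ℝ≥0∞}
    (hD : ∀ j, a < x j → integ u (x j) b ^ (1 / q) * cell r p v x ω j ≤ D) (n : ℤ) :
    θ n ^ (1 / q) * (∑' j, {j | x j ∈ Ioc (t (n - 1)) (t n)}.indicator
        (fun j => firstCell r p v a x ω j ^ (p * r / (p - r))) j) ^ ((p - r) / (p * r)) ≤ D := by
  have hp : 0 < p := hr.trans hrp
  have hσ0 := rho_pos hp hr hrp
  set σ := p * r / (p - r) with hσ
  have hcn : ∀ j, {j | x j ∈ Ioc (t (n - 1)) (t n)}.indicator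
      (fun j => firstCell r p v a x ω j ^ σ) j ≠ 0 →
      x j ∈ Ioc (t (n - 1)) (t n) ∧ a < x j ∧ ¬ a < x (j - 1) := by
    intro j hj
    by_cases h1 : j ∈ {j | x j ∈ Ioc (t (n - 1)) (t n)}
    · refine ⟨h1, ?_⟩
      by_contra h2
      rw [indicator_of_mem h1, firstCell, indicator_of_notMem (show j ∉ {j | a < x j ∧ ¬ a < x (j - 1)} from h2), ENNReal.zero_rpow_of_pos hσ0] at hj
      exact hj rfl
    · rw [indicator_of_notMem h1] at hj; exact absurd rfl hj
  have hT := hx.halving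
  rw [rho_inv, ← ENNReal.rpow_le_rpow_iff hσ0, ENNReal.mul_rpow_of_nonneg _ _ hσ0.le,
    ENNReal.rpow_inv_rpow hσ0.ne', ← ENNReal.tsum_mul_left]
  refine tsum_le_of_unique (fun i j hi hj => ?_) fun j => ?_
  · exact hx.first_unique (hcn i (right_ne_zero_of_mul hi)).2 (hcn j (right_ne_zero_of_mul hj)).2
  · by_cases h0 : {j | x j ∈ Ioc (t (n - 1)) (t n)}.indicator
      (fun j => firstCell r p v a x ω j ^ σ) j = 0
    · rw [h0, mul_zero]; exact zero_le
    · obtain ⟨h1, h2⟩ := hcn j h0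
      rw [indicator_of_mem (show j ∈ {j | x j ∈ Ioc (t (n - 1)) (t n)} from h1), firstCell,
        indicator_of_mem (show j ∈ {j | a < x j ∧ ¬ a < x (j - 1)} from h2),
        ← ENNReal.mul_rpow_of_nonneg _ _ hσ0.le]
      refine ENNReal.rpow_le_rpow (le_trans ?_ (hD j h2.1)) hσ0.le
      gcongr
      exact ht.theta_le h1

/-- For r < p the inner norm is an ℓ^σ sum of cells, bounded by `gInt` at t n; there the tail of `u`
equals `θ n` and the product is the expression in `C3`. D takes care of the cell that starts at a.
-/
lemma chainConst_le_C3 (hr : 0 < r) (hr1 : r ≤ 1) (hrp : r < p) (hq : 0 < q) (hpq : p ≤ q) :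
    ∃ K : ℝ≥0∞, K ≠ ∞ ∧ ∀ (a : ℝ) (b : EReal) (u v w : ℝ → ℝ≥0∞) (x t : ℤ → ℝ) (ω θ : ℤ → ℝ≥0∞),
      Dyadic a b w x ω → Dyadic a b u t θ → ∀ D : ℝ≥0∞,
        (∀ j, a < x j → integ u (x j) b ^ (1 / q) * cell r p v x ω j ≤ D) →
        chainConst r p q v x ω t θ ≤ K * (C3 a b r p q u v w + D) := by
  have hp : 0 < p := hr.trans hrp
  have hσ0 := rho_pos hp hr hrp
  have hd : 0 < p - r := by linarith
  set σ := p * r / (p - r) with hσ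
  have hσi : (0 : ℝ) ≤ σ⁻¹ := by positivity
  refine ⟨2 ^ σ⁻¹ * ((4 ^ (p / (p - r))) ^ σ⁻¹ + 1), ?_, ?_⟩
  · refine ENNReal.mul_ne_top (two_rpow_ne_top _) (ENNReal.add_ne_top.2 ⟨?_, by norm_num⟩)
    exact ENNReal.rpow_ne_top_of_nonneg hσi (ENNReal.rpow_ne_top_of_nonneg (by positivity)
      (by norm_num))
  intro a b u v w x t ω θ hx ht D hD
  rw [chainConst, mulNorm_of_le hpq]
  refine iSup_le fun n => ?_
  have h1 := mulNorm_block_le (v := v) (x := x) (ω := ω) hr hrp ht n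
  rw [← hσ] at h1
  have h2 := ENNReal.rpow_le_rpow h1 hσi
  rw [ENNReal.rpow_rpow_inv hσ0.ne'] at h2
  have h3 := firstCell_block_le hr hrp hq hx ht hD n
  rw [rho_inv, ← hσ] at h3
  by_cases hn : a < t n
  · have hC3 : θ n ^ (1 / q) * gInt r p v w a b (t n) ^ σ⁻¹ ≤ C3 a b r p q u v w := by
      rw [hσ, ← rho_inv, ← ht.tail n hn]
      exact le_iSup₂ (f := fun (x : ℝ) (_ : x ∈ ival a b) => integ u (x : ℝ) b ^ (1 / q) *
        (∫⁻ t : ℝ, integ w t b ^ (-(p / (p - r))) * w t * V r v t x ^ (p * r / (p - r)) ∂(leb a x))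
          ^ ((p - r) / (p * r))) (t n) ⟨by exact_mod_cast hn, ht.lt_right n⟩
    calc _ ≤ θ n ^ (1 / q) * (2 ^ σ⁻¹ * ((4 ^ (p / (p - r)) * gInt r p v w a b (t n)) ^ σ⁻¹ +
          (∑' j, {j | x j ∈ Ioc (t (n - 1)) (t n)}.indicator
            (fun j => firstCell r p v a x ω j ^ σ) j) ^ σ⁻¹)) := by
          gcongr
          refine h2.trans ((ENNReal.add_rpow_le_two_rpow_mul_rpow_add_rpow _ _ hσi).trans ?_)
          gcongr
          exact tsum_cell_le_gInt hr hr1 hrp hx (t n)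
      _ = 2 ^ σ⁻¹ * ((4 ^ (p / (p - r))) ^ σ⁻¹ * (θ n ^ (1 / q) * gInt r p v w a b (t n) ^ σ⁻¹) +
          θ n ^ (1 / q) * (∑' j, {j | x j ∈ Ioc (t (n - 1)) (t n)}.indicator
            (fun j => firstCell r p v a x ω j ^ σ) j) ^ σ⁻¹) := by
          rw [ENNReal.mul_rpow_of_nonneg _ _ hσi]; ring
      _ ≤ 2 ^ σ⁻¹ * ((4 ^ (p / (p - r))) ^ σ⁻¹ * C3 a b r p q u v w + D) := by gcongr
      _ ≤ 2 ^ σ⁻¹ * ((4 ^ (p / (p - r))) ^ σ⁻¹ * (C3 a b r p q u v w + D) +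
            (C3 a b r p q u v w + D)) := by
          gcongr
          · exact le_self_add
          · exact le_add_self
      _ = _ := by ring
  · have : {j | x j ∈ Ioc (t (n - 1)) (t n)} = ∅ := by
      rw [ht.block_eq_empty hn]; simp
    rw [this, indicator_empty, mulNorm_zero hp hr, mul_zero]
    exact zero_le

end comparison

/-! ### Comparison of the dyadic constants with `C4`, `C5`, `C6` and `C7` when q < p. -/

section comparison
variable {r p q : ℝ} {a : ℝ} {b : EReal} {u v w : ℝ → ℝ≥0∞} {x t : ℤ → ℝ} {ω θ : ℤ → ℝ≥0∞}

/-- The quantity of block n is compared with f on block n+1, whose points lie to the right of x n;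
monotone quantities attached to x n are therefore available there. -/
lemma Dyadic.shift_lower {c : ℝ} {d : EReal} {g : ℝ → ℝ≥0∞} (h : Dyadic c d g x ω) {γ : ℝ}
    (hγ : 0 ≤ γ) {f : ℝ → ℝ≥0∞} {A : ℤ → ℝ≥0∞} (h0 : ∀ n, ¬ c < x n → A n = 0)
    (hf : ∀ n, c < x n → ∀ t ∈ Ioc (x n) (x (n + 1)), A n ≤ f t) :
    ∑' n, ω n ^ (1 + γ) * A n ≤
      2 ^ (1 + γ) * ∫⁻ t, f t * (integ g t d ^ γ * g t) ∂(leb c d) := by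
  rw [h.tsum_shift]
  gcongr
  refine h.step_lower hγ (fun n => ?_) fun n t ht => ?_
  · by_cases hn : c < x n
    · exact Or.inl hn
    · exact Or.inr (h0 _ fun h' => hn (h'.trans_le (h.mono (by omega))))
  · by_cases hn : c < x (n - 1)
    · exact hf _ hn t (by rwa [sub_add_cancel])
    · rw [h0 _ hn]; exact zero_le

lemma exists_lt_integ_right {g : ℝ → ℝ≥0∞} {c d : EReal} {l : ℝ≥0∞} (h : l < integ g c d) :
    ∃ c' : ℝ, c < c' ∧ (c' : EReal) < d ∧ l < integ g c' d := by
  rw [integ_eq_withDensity] at h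
  obtain ⟨x', y', h1, h2, h3, h4⟩ := exists_lt_measure_ival _ h
  refine ⟨x', h1, lt_trans (by exact_mod_cast h2) h3, ?_⟩
  rw [integ_eq_withDensity]
  exact h4.trans_le (measure_mono (ival_mono le_rfl h3.le))

lemma rho_exponents (hp : 0 < p) (hq : 0 < q) (h : q < p) :
    p * q / (p - q) / q = 1 + q / (p - q) ∧ p * q / (p - q) / p = q / (p - q) ∧
      0 < q / (p - q) ∧ 1 + q / (p - q) = p / (p - q) := by
  have hd : p - q ≠ 0 := by linarith
  have hd' : 0 < p - q := by linarith
  refine ⟨?_, ?_, by positivity, ?_⟩ <;> field_simp <;> ring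

lemma iSup_rpow {ι : Sort*} (f : ι → ℝ≥0∞) {s : ℝ} (hs : 0 < s) : (⨆ i, f i) ^ s = ⨆ i, f i ^ s :=
  (ENNReal.orderIsoRpow s hs).map_iSup f

/-- For p ≤ r the inner norm is a supremum of cells with x j ≤ t n. With y in the next block of `u`,
each such cell lies in (a, y), and `le_essSup_V` puts it under the essential supremum of `C4`. -/
lemma chainConst_le_C4 (hr : 0 < r) (hr1 : r ≤ 1) (hp : 0 < p) (hq : 0 < q) (hqp : q < p)
    (hpr : p ≤ r) (hx : Dyadic a b w x ω) (ht : Dyadic a b u t θ) :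
    chainConst r p q v x ω t θ ≤
      (2 ^ (1 + q / (p - q)) * 2 ^ (q / (p - q))) ^ ((p - q) / (p * q)) * C4 a b r p q u v w := by
  obtain ⟨e1, e2, hγ, -⟩ := rho_exponents hp hq hqp
  have hρ := rho_pos hp hq hqp
  set γ := q / (p - q) with hγd
  set ρ := p * q / (p - q) with hρd
  rw [← ENNReal.rpow_le_rpow_iff hρ, ENNReal.mul_rpow_of_nonneg _ _ hρ.le, chainConst,
    mulNorm_rpow hp hq hqp, C4, rho_inv, ← hρd, ENNReal.rpow_inv_rpow hρ.ne',
    ENNReal.rpow_inv_rpow hρ.ne']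
  have key := ht.shift_lower (γ := γ) hγ.le (f := fun y : ℝ => 2 ^ γ *
      essSup (fun t : ℝ => integ w t b ^ (-γ) * V r v t y ^ ρ) (leb a y))
    (A := fun n => mulNorm p r ({j | x j ∈ Ioc (t (n - 1)) (t n)}.indicator (cell r p v x ω)) ^ ρ)
    (fun n hn => by
      have : {j | x j ∈ Ioc (t (n - 1)) (t n)} = ∅ := by rw [ht.block_eq_empty hn]; simp
      simp only [this, indicator_empty]
      rw [mulNorm_zero hp hr, ENNReal.zero_rpow_of_pos hρ])
    (fun n hn y hy => by
      rw [mulNorm_of_le hpr, iSup_rpow _ hρ]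
      refine iSup_le fun j => ?_
      by_cases hj : j ∈ {j | x j ∈ Ioc (t (n - 1)) (t n)}
      · rw [indicator_of_mem hj, cell, ENNReal.mul_rpow_of_nonneg _ _ hρ.le, ← ENNReal.rpow_mul,
          show -(1 / p) * ρ = -γ by rw [← e2]; ring,
          hx.rpow_neg_eq _ ((ht.left_le _).trans_lt hj.1), mul_assoc]
        gcongr
        refine le_trans ?_ (le_essSup_V (v := v) hr hr1 (hx.left_le (j - 1))
          (A := fun z : ℝ => integ w z b ^ (-γ))
          (fun z hz _ => integ_rpow_neg_mono hγ.le hz.le) hρ)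
        gcongr
        exact V_mono hr hr1 le_rfl (by exact_mod_cast hj.2.trans hy.1.le)
      · rw [indicator_of_notMem hj, ENNReal.zero_rpow_of_pos hρ]; exact zero_le)
  calc _ = _ := tsum_congr fun n => by rw [mul_rpow_mul_rpow hρ.le, e1]
    _ ≤ _ := key
    _ = 2 ^ (1 + γ) * (2 ^ γ * _) := by
        rw [← lintegral_const_mul' _ _ (two_rpow_ne_top γ)]
        congr 1
        refine lintegral_congr fun y => ?_
        ring
    _ = _ := (mul_assoc _ _ _).symm

/-- E stands for the inner essential supremum of `C5` or of `C7`. It is evaluated at y in the next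
block of `w`, so that (x (k-1), y) contains block k. -/
lemma blockConst_le_of_lt (hp : 0 < p) (hq : 0 < q) (hqp : q < p)
    (hx : Dyadic a b w x ω) {E : ℝ → ℝ≥0∞}
    (hE : ∀ s y : ℝ, a ≤ s → s < y → (y : EReal) < b → integ w s b ^ (-(p / (p - q))) *
      locConst r q u v s y ^ (p * q / (p - q)) ≤ E y) (hr : 0 < r) (hr1 : r ≤ 1) :
    blockConst r p q u v x ω ≤ (2 * 2 ^ (p / (p - q))) ^ ((p - q) / (p * q)) *
      (∫⁻ y, w y * E y ∂(leb a b)) ^ ((p - q) / (p * q)) := by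
  obtain ⟨e1, e2, hγ, e3⟩ := rho_exponents hp hq hqp
  have hρ := rho_pos hp hq hqp
  set ρ := p * q / (p - q) with hρd
  set τ := p / (p - q) with hτd
  rw [← ENNReal.rpow_le_rpow_iff hρ, ENNReal.mul_rpow_of_nonneg _ _ hρ.le, blockConst,
    mulNorm_rpow hp hq hqp, rho_inv, ← hρd, ENNReal.rpow_inv_rpow hρ.ne',
    ENNReal.rpow_inv_rpow hρ.ne']
  have key := hx.shift_lower (γ := 0) le_rfl (f := fun y : ℝ => 2 ^ τ * E y)
    (A := fun k => ω k ^ (-τ) * locConst r q u v (x (k - 1)) (x k) ^ ρ)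
    (fun k hk => by
      rw [locConst_of_le hq, ENNReal.zero_rpow_of_pos hρ, mul_zero]
      exact_mod_cast (not_lt.1 hk).trans (hx.left_le _))
    (fun k hk y hy => by
      rw [hx.rpow_neg_eq _ hk, mul_assoc]
      gcongr
      refine le_trans ?_ (hE (x (k - 1)) y (hx.left_le _) ((hx.pred_lt hk).trans hy.1)
        (lt_of_le_of_lt (by exact_mod_cast hy.2) (hx.lt_right (k + 1))))
      gcongr
      exact locConst_mono hr hr1 hq le_rfl (by exact_mod_cast hy.1.le))
  calc _ = _ := tsum_congr fun k => by
        rw [ENNReal.mul_rpow_of_nonneg _ _ hρ.le, ← ENNReal.rpow_mul, ← mul_assoc,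
          ← ENNReal.rpow_add _ _ (hx.halving.ne_zero k) (hx.halving.ne_top k)]
        congr 2
        rw [← e3, ← e2]; ring
    _ ≤ _ := key
    _ = 2 * (2 ^ τ * _) := by
        rw [← lintegral_const_mul' _ _ (two_rpow_ne_top τ), add_zero, ENNReal.rpow_one]
        congr 1
        refine lintegral_congr fun y => ?_
        rw [ENNReal.rpow_zero]
        ring
    _ = _ := (mul_assoc _ _ _).symm

lemma blockConst_le_C5 (hr : 0 < r) (hr1 : r ≤ 1) (hp : 0 < p) (hq : 0 < q) (hqp : q < p)
    (hq1 : q < 1) (hu : AEMeasurable u (leb a b)) (hx : Dyadic a b w x ω) :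
    blockConst r p q u v x ω ≤ (2 * 2 ^ (p / (p - q))) ^ ((p - q) / (p * q)) *
      C5 a b r p q u v w := by
  have h1 : 0 < 1 - q := by linarith
  have h2 : 0 < p - q := by linarith
  refine blockConst_le_of_lt hp hq hqp hx (fun s y has hsy hyb => ?_) hr hr1
  rw [locConst, if_pos hq1, intConst, ← ENNReal.rpow_mul,
    show (1 - q) / q * (p * q / (p - q)) = p * (1 - q) / (p - q) by field_simp]
  exact le_essSup_lintegral_V (v := v) hr hr1 (by positivity) (by positivity) has hsy
    (g := fun t : ℝ => integ u t y ^ (q / (1 - q)) * u t)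
    (A := fun z : ℝ => integ w z b ^ (-(p / (p - q))))
    (((measurable_integ u y).pow_const _).aemeasurable.mul
      (hu.mono_measure (leb_mono (by exact_mod_cast has) hyb.le)))
    (fun z hz _ => integ_rpow_neg_mono (by positivity) hz.le)

lemma blockConst_le_C7 (hr : 0 < r) (hr1 : r ≤ 1) (hp : 0 < p) (hq : 1 ≤ q) (hqp : q < p)
    (hx : Dyadic a b w x ω) :
    blockConst r p q u v x ω ≤ (2 * 2 ^ (p / (p - q))) ^ ((p - q) / (p * q)) *
      C7 a b r p q u v w := by
  have hq0 : 0 < q := by linarith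
  have h2 : 0 < p - q := by linarith
  have hρ := rho_pos hp hq0 hqp
  refine blockConst_le_of_lt hp hq0 hqp hx (fun s y has hsy hyb => ?_) hr hr1
  rw [locConst, if_neg hq.not_gt, supConst, iSup_rpow _ hρ, ENNReal.mul_iSup]
  refine iSup_le fun t => ?_
  rw [iSup_rpow _ hρ, ENNReal.mul_iSup]
  refine iSup_le fun hty => ?_
  rw [mul_rpow_mul_rpow hρ.le, show p * q / (p - q) / q = p / (p - q) by field_simp]
  exact le_essSup_essSup_V (v := v) hr hr1 has hty.2
    (A := fun z : ℝ => integ w z b ^ (-(p / (p - q)))) (B := fun t : ℝ => integ u t y ^ (p / (p - q)))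
    (fun z hz _ => integ_rpow_neg_mono (by positivity) hz.le)
    (fun z _ hz => ENNReal.rpow_le_rpow (integ_mono (by exact_mod_cast hz.le) le_rfl u)
      (by positivity)) hρ

lemma gInt_mono (hr : 0 < r) (hr1 : r ≤ 1) (hrp : r < p) {y z : ℝ} (h : y ≤ z) :
    gInt r p v w a b y ≤ gInt r p v w a b z := by
  have hp : 0 < p := hr.trans hrp
  have hyz : (y : EReal) ≤ z := by exact_mod_cast h
  refine lintegral_mono' (leb_mono le_rfl hyz) fun t => ?_
  exact mul_le_mul_right (ENNReal.rpow_le_rpow (V_mono hr hr1 le_rfl hyz)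
    (rho_pos hp hr hrp).le) _

lemma gInt_left (y : ℝ) (h : y ≤ a) : gInt r p v w a b y = 0 := by
  rw [gInt, leb_of_le (by exact_mod_cast h), lintegral_zero_measure]

/-- The outer sum over the blocks of `w` is controlled by `C₆`. -/
lemma tsum_gInt_le_C6 (hr : 0 < r) (hr1 : r ≤ 1) (hrp : r < p) (hq : 0 < q) (hqp : q < p)
    (hx : Dyadic a b w x ω) :
    ∑' k, (∫⁻ t in Ioc (x (k - 1)) (x k), integ u t b ^ (q / (p - q)) * u t) *
        gInt r p v w a b (x (k - 1)) ^ (q * (p - r) / (r * (p - q))) ≤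
      4 * C6 a b r p q u v w ^ (p * q / (p - q)) := by
  have hp : 0 < p := hr.trans hrp
  have hρ := rho_pos hp hq hqp
  have h1 : 0 < p - q := by linarith
  have h2 : 0 < p - r := by linarith
  set τ := q * (p - r) / (r * (p - q)) with hτ
  have hτ0 : 0 < τ := by positivity
  rw [C6, rho_inv, ENNReal.rpow_inv_rpow hρ.ne']
  set φ : ℤ → ℝ≥0∞ := fun k => ∫⁻ t in Ioc (x (k - 1)) (x k), integ u t b ^ (q / (p - q)) * u t
    with hφ
  set E : ℝ → ℝ≥0∞ := fun z => essSup (fun y : ℝ => integ w y b ^ (-1 : ℝ) *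
      (∫⁻ t : ℝ, integ u t b ^ (q / (p - q)) * u t ∂(leb y z)) *
      (∫⁻ t : ℝ, integ w t b ^ (-(p / (p - r))) * w t * V r v t y ^ (p * r / (p - r)) ∂(leb a y))
        ^ τ) (leb a z) with hE
  -- The factor `ω k ^ (-1)` in A is 2 / 𝒲(x (k-1)); it cancels the weight `ω k` of the discretized
  -- outer integral.
  have key := hx.shift_lower (γ := 0) le_rfl (f := fun y : ℝ => 2 * E y)
    (A := fun k => (ω k ^ (-1 : ℝ) * gInt r p v w a b (x (k - 1)) ^ τ) * φ k)
    (fun k hk => by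
      rw [gInt_left _ ((hx.mono (by omega : k - 1 ≤ k)).trans (not_lt.1 hk)),
        ENNReal.zero_rpow_of_pos hτ0, mul_zero, zero_mul])
    (fun k hk z hz => by
      have hzb : (z : EReal) < b :=
        lt_of_le_of_lt (by exact_mod_cast hz.2) (hx.lt_right (k + 1))
      rw [← ENNReal.rpow_one (φ k)]
      refine le_of_forall_lt_mul_rpow one_pos fun l hl => ?_
      rw [ENNReal.rpow_one]
      have hlt : x (k - 1) < z := (hx.pred_lt hk).trans hz.1
      have hl' : l < ∫⁻ t : ℝ, integ u t b ^ (q / (p - q)) * u t ∂(leb (x (k - 1)) z) := by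
        refine hl.trans_le (lintegral_mono' ?_ le_rfl)
        rw [leb_coe]
        exact Measure.restrict_mono (Ioc_subset_Ioc le_rfl hz.1.le) le_rfl
      obtain ⟨y', hy1, hy2, hy3⟩ : ∃ y' : ℝ, x (k - 1) < y' ∧ y' < z ∧
          l < ∫⁻ t : ℝ, integ u t b ^ (q / (p - q)) * u t ∂(leb y' z) := by
        obtain ⟨c, h3, h4, h5⟩ := exists_lt_integ_right hl'
        exact ⟨c, by exact_mod_cast h3, by exact_mod_cast h4, h5⟩
      rw [hx.rpow_neg_eq _ hk, ENNReal.rpow_one, mul_assoc, mul_assoc]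
      refine mul_le_mul_right ?_ _
      -- The single point x (k-1) is replaced by all y in (x (k-1), y'); y' was chosen so that the
      -- integral over (y', z) still exceeds l.
      refine le_essSup_leb (s := x (k - 1)) (t := y') (by exact_mod_cast hy1)
        (by exact_mod_cast hx.left_le _) (by exact_mod_cast hy2.le) fun y hy => ?_
      rw [mul_assoc]
      have hy' : x (k - 1) ≤ y := by exact_mod_cast hy.1.le
      refine mul_le_mul' (integ_rpow_neg_mono zero_le_one hy') ?_
      rw [mul_comm]
      refine mul_le_mul' ?_ (ENNReal.rpow_le_rpow (gInt_mono hr hr1 hrp hy') hτ0.le)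
      exact hy3.le.trans (lintegral_mono' (leb_mono hy.2.le le_rfl) le_rfl))
  calc _ = _ := tsum_congr fun k => by
        rw [add_zero, ENNReal.rpow_one, ← mul_assoc, ← mul_assoc, ENNReal.rpow_neg_one,
          ENNReal.mul_inv_cancel (hx.halving.ne_zero k) (hx.halving.ne_top k), one_mul, mul_comm]
    _ ≤ _ := key
    _ = 2 * (2 * ∫⁻ z, w z * E z ∂(leb a b)) := by
        rw [← lintegral_const_mul' 2 (fun z => w z * E z) (by norm_num), add_zero,
          ENNReal.rpow_one]
        congr 1
        refine lintegral_congr fun y => ?_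
        rw [ENNReal.rpow_zero]
        ring
    _ = _ := by rw [← mul_assoc, show (2 : ℝ≥0∞) * 2 = 4 by norm_num]

/-- The sum of `cell ^ σ` over the cells to the left of `y`, without the first one. -/
noncomputable def cellSum (r p : ℝ) (v : ℝ → ℝ≥0∞) (a : ℝ) (x : ℤ → ℝ) (ω : ℤ → ℝ≥0∞) (y : ℝ) :
    ℝ≥0∞ :=
  ∑' j, {j | x j ≤ y ∧ a < x (j - 1)}.indicator (fun j => cell r p v x ω j ^ (p * r / (p - r))) j

/-- The sum along `u` becomes an integral over y by a shift of one block, and this integral is cut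
along the blocks of `w`. For y in the k-th of these, the cells ending before y end by x (k-1), so
`tsum_cell_le_gInt` applies at that point. -/
lemma tsum_cellSum_le_C6 (hr : 0 < r) (hr1 : r ≤ 1) (hrp : r < p) (hq : 0 < q) (hqp : q < p)
    (hu : AEMeasurable u (leb a b)) (hx : Dyadic a b w x ω) (ht : Dyadic a b u t θ) :
    ∑' n, θ n ^ (1 + q / (p - q)) * cellSum r p v a x ω (t n) ^ (q * (p - r) / (r * (p - q))) ≤
      2 ^ (1 + q / (p - q)) * ((4 ^ (p / (p - r))) ^ (q * (p - r) / (r * (p - q))) *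
        (4 * C6 a b r p q u v w ^ (p * q / (p - q)))) := by
  have hp : 0 < p := hr.trans hrp
  have h1 : 0 < p - q := by linarith
  have h2 : 0 < p - r := by linarith
  set τ := q * (p - r) / (r * (p - q)) with hτ
  have hτ0 : 0 < τ := by positivity
  have hσ := rho_pos hp hr hrp
  set κ : ℝ≥0∞ := (4 ^ (p / (p - r))) ^ τ with hκ
  have hκt : κ ≠ ∞ := ENNReal.rpow_ne_top_of_nonneg hτ0.le
    (ENNReal.rpow_ne_top_of_nonneg (by positivity) (by norm_num))
  set f : ℝ → ℝ≥0∞ := fun y => (∑' j, {j | x j < y ∧ a < x (j - 1)}.indicator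
      (fun j => cell r p v x ω j ^ (p * r / (p - r))) j) ^ τ with hf
  refine (ht.shift_lower (γ := q / (p - q)) (by positivity) (f := f)
    (A := fun n => cellSum r p v a x ω (t n) ^ τ) (fun n hn => ?_) (fun n hn y hy => ?_)).trans ?_
  · rw [cellSum, ENNReal.tsum_eq_zero.2 fun j => indicator_of_notMem ?_ _,
      ENNReal.zero_rpow_of_pos hτ0]
    intro hj
    exact hn (hj.2.trans_le ((hx.mono (by omega : j - 1 ≤ j)).trans hj.1))
  · refine ENNReal.rpow_le_rpow (ENNReal.tsum_le_tsum fun j => ?_) hτ0.le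
    refine indicator_le_indicator_of_subset ?_ (fun _ => zero_le) j
    exact fun j hj => ⟨hj.1.trans_lt hy.1, hj.2⟩
  · gcongr
    rw [hx.lintegral_eq]
    refine le_trans ?_ (mul_le_mul_right (tsum_gInt_le_C6 (v := v) hr hr1 hrp hq hqp hx) κ)
    rw [← ENNReal.tsum_mul_left]
    refine ENNReal.tsum_le_tsum fun k => ?_
    calc _ ≤ ∫⁻ y in Ioc (x (k - 1)) (x k), (κ * gInt r p v w a b (x (k - 1)) ^ τ) *
          (integ u y b ^ (q / (p - q)) * u y) := by
          refine setLIntegral_mono_ae' measurableSet_Ioc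
            (Filter.Eventually.of_forall fun y hy => ?_)
          refine mul_le_mul_left ?_ _
          rw [hf, hκ, ← ENNReal.mul_rpow_of_nonneg _ _ hτ0.le]
          refine ENNReal.rpow_le_rpow (le_trans (ENNReal.tsum_le_tsum fun j => ?_)
            (tsum_cell_le_gInt hr hr1 hrp hx (x (k - 1)))) hτ0.le
          refine indicator_le_indicator_of_subset ?_ (fun _ => zero_le) j
          refine fun j hj => ⟨hx.mono ?_, hj.2⟩
          have := hx.le_of_lt (hj.1.trans_le hy.2)
          omega
      _ = _ := by
          rw [lintegral_const_mul'']
          · ring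
          · exact hx.aemeasurable_block
              (((measurable_integ u b).pow_const _).aemeasurable.mul hu) k

/-- The right end of the only cell starting at a lies in a single block of `u`, so the outer sum
also has at most one term. -/
lemma tsum_firstCell_le (hr : 0 < r) (hrp : r < p) (hq : 0 < q) (hqp : q < p)
    (hx : Dyadic a b w x ω) (ht : Dyadic a b u t θ) {D : ℝ≥0∞}
    (hD : ∀ j, a < x j → integ u (x j) b ^ (1 / q) * cell r p v x ω j ≤ D) :
    ∑' n, (θ n ^ (1 / q) * (∑' j, {j | x j ∈ Ioc (t (n - 1)) (t n)}.indicator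
        (fun j => firstCell r p v a x ω j ^ (p * r / (p - r))) j) ^ ((p - r) / (p * r))) ^
          (p * q / (p - q)) ≤ D ^ (p * q / (p - q)) := by
  have hp : 0 < p := hr.trans hrp
  have hρ := rho_pos hp hq hqp
  have hσ := rho_pos hp hr hrp
  have hσ' : 0 < (p - r) / (p * r) := by rw [rho_inv]; positivity
  refine tsum_le_of_unique (fun n m hn hm => ?_) fun n =>
    ENNReal.rpow_le_rpow (firstCell_block_le hr hrp hq hx ht hD n) hρ.le
  have key : ∀ n, (θ n ^ (1 / q) * (∑' j, {j | x j ∈ Ioc (t (n - 1)) (t n)}.indicator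
        (fun j => firstCell r p v a x ω j ^ (p * r / (p - r))) j) ^ ((p - r) / (p * r))) ^
          (p * q / (p - q)) ≠ 0 →
      ∃ j, x j ∈ Ioc (t (n - 1)) (t n) ∧ a < x j ∧ ¬ a < x (j - 1) := by
    intro n hn
    by_contra! hcon
    refine hn ?_
    rw [ENNReal.tsum_eq_zero.2 fun j => ?_, ENNReal.zero_rpow_of_pos hσ', mul_zero,
      ENNReal.zero_rpow_of_pos hρ]
    by_cases hj : j ∈ {j | x j ∈ Ioc (t (n - 1)) (t n)}
    · rw [indicator_of_mem hj, firstCell, indicator_of_notMem, ENNReal.zero_rpow_of_pos hσ]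
      exact fun h => h.2 (hcon j hj h.1)
    · exact indicator_of_notMem hj _
  obtain ⟨i, hi1, hi2⟩ := key n hn
  obtain ⟨j, hj1, hj2⟩ := key m hm
  obtain rfl := hx.first_unique hi2 hj2
  by_contra hnm
  exact Set.disjoint_left.1 (ht.pairwise_disjoint hnm) hi1 hj1

lemma chainConst_le_C6 (hr : 0 < r) (hr1 : r ≤ 1) (hrp : r < p) (hq : 0 < q) (hqp : q < p) :
    ∃ K : ℝ≥0∞, K ≠ ∞ ∧ ∀ (a : ℝ) (b : EReal) (u v w : ℝ → ℝ≥0∞) (x t : ℤ → ℝ) (ω θ : ℤ → ℝ≥0∞),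
      AEMeasurable u (leb a b) → Dyadic a b w x ω → Dyadic a b u t θ → ∀ D : ℝ≥0∞,
        (∀ j, a < x j → integ u (x j) b ^ (1 / q) * cell r p v x ω j ≤ D) →
        chainConst r p q v x ω t θ ≤ K * (C6 a b r p q u v w + D) := by
  have hp : 0 < p := hr.trans hrp
  obtain ⟨e1, e2, hγ, -⟩ := rho_exponents hp hq hqp
  have hρ := rho_pos hp hq hqp
  have hσ := rho_pos hp hr hrp
  have h1 : 0 < p - q := by linarith
  have h2 : 0 < p - r := by linarith
  set τ := q * (p - r) / (r * (p - q)) with hτ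
  have hτ0 : 0 < τ := by positivity
  set σ := p * r / (p - r) with hσd
  set ρ := p * q / (p - q) with hρd
  have e4 : σ⁻¹ * ρ = τ := by rw [hσd, hρd, hτ]; field_simp
  have hσi : 0 < σ⁻¹ := by positivity
  set κ : ℝ≥0∞ := 2 ^ (1 + q / (p - q)) * ((4 ^ (p / (p - r))) ^ τ * 4) with hκ
  have hκt : κ ≠ ∞ := ENNReal.mul_ne_top (two_rpow_ne_top _) (ENNReal.mul_ne_top
    (ENNReal.rpow_ne_top_of_nonneg hτ0.le (ENNReal.rpow_ne_top_of_nonneg (by positivity)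
      (by norm_num))) (by norm_num))
  refine ⟨(2 ^ τ * (κ + 1)) ^ ρ⁻¹, ENNReal.rpow_ne_top_of_nonneg (by positivity)
    (ENNReal.mul_ne_top (two_rpow_ne_top _) (ENNReal.add_ne_top.2 ⟨hκt, by norm_num⟩)), ?_⟩
  intro a b u v w x t ω θ hu hx ht D hD
  rw [← ENNReal.rpow_le_rpow_iff hρ, ENNReal.mul_rpow_of_nonneg _ _ hρ.le,
    ENNReal.rpow_inv_rpow hρ.ne', chainConst, mulNorm_rpow hp hq hqp]
  set F : ℤ → ℝ≥0∞ := fun n => ∑' j, {j | x j ∈ Ioc (t (n - 1)) (t n)}.indicator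
        (fun j => firstCell r p v a x ω j ^ σ) j with hF
  have hfirst := tsum_firstCell_le (v := v) hr hrp hq hqp hx ht hD
  rw [rho_inv] at hfirst
  calc _ ≤ ∑' n, 2 ^ τ * (θ n ^ (1 + q / (p - q)) * cellSum r p v a x ω (t n) ^ τ +
        (θ n ^ (1 / q) * F n ^ σ⁻¹) ^ ρ) := by
        refine ENNReal.tsum_le_tsum fun n => ?_
        have h3 := mulNorm_block_le (v := v) (x := x) (ω := ω) hr hrp ht n
        have h4 := ENNReal.rpow_le_rpow h3 hτ0.le
        rw [← ENNReal.rpow_mul, ← hσd, show σ * τ = ρ by rw [← e4]; field_simp] at h4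
        rw [mul_rpow_mul_rpow hρ.le, mul_rpow_mul_rpow hρ.le, e1, ← mul_add, mul_left_comm,
          ← ENNReal.rpow_mul, e4]
        gcongr
        exact h4.trans (ENNReal.add_rpow_le_two_rpow_mul_rpow_add_rpow _ _ hτ0.le)
    _ = 2 ^ τ * ((∑' n, θ n ^ (1 + q / (p - q)) * cellSum r p v a x ω (t n) ^ τ) +
        ∑' n, (θ n ^ (1 / q) * F n ^ σ⁻¹) ^ ρ) := by
        rw [ENNReal.tsum_mul_left, ENNReal.tsum_add]
    _ ≤ 2 ^ τ * (κ * C6 a b r p q u v w ^ ρ + D ^ ρ) := by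
        gcongr
        refine (tsum_cellSum_le_C6 hr hr1 hrp hq hqp hu hx ht).trans (le_of_eq ?_)
        rw [hκ]; ring
    _ ≤ 2 ^ τ * (κ * (C6 a b r p q u v w + D) ^ ρ + (C6 a b r p q u v w + D) ^ ρ) := by
        gcongr
        · exact le_self_add
        · exact le_add_self
    _ = _ := by ring

end comparison

/-! ### Necessary conditions -/

lemma essSup_leb_le {φ : ℝ → ℝ≥0∞} {x y : EReal} {M : ℝ≥0∞} (h : ∀ z ∈ ival x y, φ z ≤ M) :
    essSup φ (leb x y) ≤ M :=
  essSup_le_of_ae_le M ((ae_restrict_mem (measurableSet_ival x y)).mono h)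

section necessity
variable {r p q : ℝ} {a : ℝ} {b : EReal} {u v w : ℝ → ℝ≥0∞} {C : ℝ≥0∞}

/-- For f supported in (c, b) the integral ∫_a^t f vanishes for t ≤ c and is at most the total mass
of f otherwise, so the right-hand side sees only 𝒲(c). -/
lemma HardyIneq.local_le (hr : 0 < r) (hp : 0 < p) (hq : 0 < q) (H : HardyIneq a b r p q u v w C)
    {c : ℝ} (hac : a ≤ c) (hcb : (c : EReal) < b) (hw : AEMeasurable w (leb a b)) {f : ℝ → ℝ≥0∞}
    (hf : Measurable f) :
    hardyInt r q u v c b f ≤ (C * integ w c b ^ (1 / p) * ∫⁻ t, f t ∂(leb c b)) ^ q := by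
  have hac' : (a : EReal) ≤ c := by exact_mod_cast hac
  have h1 := H ((Ioi c).indicator f) (hf.indicator measurableSet_Ioi).aemeasurable
  rw [one_div, ENNReal.rpow_inv_le_iff hq] at h1
  refine le_trans ?_ (h1.trans (ENNReal.rpow_le_rpow ?_ hq.le))
  · refine lintegral_mono' (leb_mono hac' le_rfl) fun t => ?_
    gcongr ?_ ^ (q / r) * u t
    refine le_trans ?_ (lintegral_mono' (leb_mono hac' le_rfl) le_rfl)
    refine setLIntegral_mono_ae' (measurableSet_ival _ _)
      (Filter.Eventually.of_forall fun s hs => ?_)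
    rw [indicator_of_mem (show s ∈ Ioi c by exact_mod_cast hs.1)]
  · rw [mul_assoc]
    refine mul_le_mul_right ?_ _
    set F := ∫⁻ t, f t ∂(leb c b) with hF
    have hle : ∫⁻ t : ℝ, (∫⁻ s, (Ioi c).indicator f s ∂(leb a t)) ^ p * w t ∂(leb a b) ≤
        F ^ p * integ w c b := by
      rw [lintegral_leb_split hac hcb]
      have h0 : ∫⁻ t in Ioc a c, (∫⁻ s, (Ioi c).indicator f s ∂(leb a t)) ^ p * w t = 0 := by
        rw [setLIntegral_congr_fun (g := fun _ => 0) measurableSet_Ioc, lintegral_zero]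
        intro t ht
        simp only
        have : ∫⁻ s, (Ioi c).indicator f s ∂(leb a t) = 0 := by
          rw [leb, setLIntegral_congr_fun (g := fun _ => 0) (measurableSet_ival _ _),
            lintegral_zero]
          intro s hs
          have : s < t := by exact_mod_cast hs.2
          exact indicator_of_notMem (not_lt.2 (this.le.trans ht.2)) _
        rw [this, ENNReal.zero_rpow_of_pos hp, zero_mul]
      rw [h0, zero_add]
      calc _ ≤ ∫⁻ t, F ^ p * w t ∂(leb c b) := by
            refine setLIntegral_mono_ae' (measurableSet_ival _ _)
              (Filter.Eventually.of_forall fun t ht => ?_)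
            gcongr
            rw [lintegral_indicator measurableSet_Ioi, hF]
            refine lintegral_mono' ?_ le_rfl
            rw [leb, Measure.restrict_restrict measurableSet_Ioi]
            have hsub : Ioi c ∩ ival a t ⊆ ival c b := fun s hs =>
              ⟨by exact_mod_cast hs.1, hs.2.2.trans ht.2⟩
            exact Measure.restrict_mono hsub le_rfl
        _ ≤ _ := by
            rw [lintegral_const_mul'' _ (hw.mono_measure (leb_mono hac' le_rfl)), integ]
    calc _ ≤ _ := ENNReal.rpow_le_rpow hle (by positivity)
      _ = _ := by
        rw [ENNReal.mul_rpow_of_nonneg _ _ (by positivity), ← ENNReal.rpow_mul,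
          mul_one_div_cancel hp.ne', ENNReal.rpow_one, mul_comm]

lemma HardyIneq.tail_V_le (hr : 0 < r) (hr1 : r ≤ 1) (hp : 0 < p) (hq : 0 < q)
    (H : HardyIneq a b r p q u v w C) (hC : C ≠ ∞) (hv : AEMeasurable v (leb a b))
    (hw : AEMeasurable w (leb a b)) {c t : ℝ} (hac : a ≤ c) (hct : c < t) (htb : (t : EReal) < b)
    (hW : integ w c b ≠ ∞) : integ u t b ^ (1 / q) * V r v c t ≤ C * integ w c b ^ (1 / p) := by
  have hct' : (c : EReal) < t := by exact_mod_cast hct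
  exact tail_mul_V_le hr hr1 hq (hv.mono_measure (leb_mono (by exact_mod_cast hac) le_rfl))
    (ENNReal.mul_ne_top hC (ENNReal.rpow_ne_top_of_nonneg (by positivity) hW))
    (fun f hf => H.local_le hr hp hq hac (hct'.trans htb) hw hf) ⟨hct', htb⟩

/-- Between a and t there is room for an interval (c, t) with V (c, t) > 0; the supremal condition
then bounds the tail of `u` at t. -/
lemma HardyIneq.tailOK (hr : 0 < r) (hr1 : r ≤ 1) (hp : 0 < p) (hq : 0 < q)
    (H : HardyIneq a b r p q u v w C) (hC : C ≠ ∞) (hu : IsWeight a b u) (hv : IsWeight a b v)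
    (hw : AEMeasurable w (leb a b)) (hW : TailOK a b w) : TailOK a b u := by
  intro t ht
  refine ⟨hu.integ_pos ht.1.le ht.2 le_rfl, ?_⟩
  obtain ⟨c, hc1, hc2⟩ := exists_real_btwn ht.1
  have hcW := (hW c ⟨hc1, hc2.trans ht.2⟩).2.ne
  have h1 := H.tail_V_le hr hr1 hp hq hC hv.meas hw (by exact_mod_cast hc1.le)
    (by exact_mod_cast hc2) ht.2 hcW
  have hle : leb c t ≤ leb a b := leb_mono hc1.le ht.2.le
  have hV := V_pos hr hr1 hc2 (hv.meas.mono_measure hle) (ae_mono hle hv.pos)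
  by_contra hcon
  rw [not_lt, top_le_iff] at hcon
  rw [hcon, ENNReal.top_rpow_of_pos (by positivity), ENNReal.top_mul hV.ne', top_le_iff] at h1
  exact ENNReal.mul_ne_top hC (ENNReal.rpow_ne_top_of_nonneg (by positivity) hcW) h1

lemma rpow_neg_mul_le {W X R : ℝ≥0∞} {s : ℝ} (h0 : W ≠ 0) (hT : W ≠ ∞) (h : X ≤ R * W ^ s) :
    W ^ (-s) * X ≤ R := by
  calc _ ≤ W ^ (-s) * (R * W ^ s) := by gcongr
    _ = R := by
      rw [mul_left_comm, ← ENNReal.rpow_add _ _ h0 hT]; simp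

lemma C1_le (hr : 0 < r) (hr1 : r ≤ 1) (hp : 0 < p) (hq : 0 < q)
    (H : HardyIneq a b r p q u v w C) (hC : C ≠ ∞) (S : Setup a b u v w) :
    C1 a b r p q u v w ≤ C := by
  refine essSup_leb_le fun x hx => ?_
  have hWx := S.hW x hx
  refine rpow_neg_mul_le hWx.1.ne' hWx.2.ne (essSup_leb_le fun t ht => ?_)
  exact H.tail_V_le hr hr1 hp hq hC S.hv.meas S.hw.meas (by exact_mod_cast hx.1.le)
    (by exact_mod_cast ht.1) ht.2 hWx.2.ne

lemma locConst_tail_le (hr : 0 < r) (hr1 : r ≤ 1) (hp : 0 < p) (hq : 0 < q) :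
    ∃ K : ℝ≥0∞, K ≠ ∞ ∧ ∀ (a : ℝ) (b : EReal) (u v w : ℝ → ℝ≥0∞) (C : ℝ≥0∞),
      HardyIneq a b r p q u v w C → C ≠ ∞ → Setup a b u v w → ∀ c : ℝ, a ≤ c → (c : EReal) < b →
        integ w c b ≠ ∞ → locConst r q u v c b ≤ K * C * integ w c b ^ (1 / p) := by
  obtain ⟨K, hK, h⟩ := locConst_le hr hr1 hq
  refine ⟨K, hK, fun a b u v w C H hC S c hac hcb hW => ?_⟩
  have hle : leb c b ≤ leb a b := leb_mono (by exact_mod_cast hac) le_rfl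
  rw [mul_assoc]
  exact h u v c b hcb (S.tailOK hac le_rfl) (S.hu.meas.mono_measure hle)
    (S.hv.meas.mono_measure hle) _
    (ENNReal.mul_ne_top hC (ENNReal.rpow_ne_top_of_nonneg (by positivity) hW))
    (fun f hf => H.local_le hr hp hq hac hcb S.hw.meas hf)

lemma C2_le (hr : 0 < r) (hr1 : r ≤ 1) (hp : 0 < p) (hq : 0 < q) (hq1 : q < 1) :
    ∃ K : ℝ≥0∞, K ≠ ∞ ∧ ∀ (a : ℝ) (b : EReal) (u v w : ℝ → ℝ≥0∞) (C : ℝ≥0∞),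
      HardyIneq a b r p q u v w C → C ≠ ∞ → Setup a b u v w → C2 a b r p q u v w ≤ K * C := by
  obtain ⟨K, hK, h⟩ := locConst_tail_le hr hr1 hp hq
  refine ⟨K, hK, fun a b u v w C H hC S => iSup₂_le fun x hx => ?_⟩
  have hWx := S.hW x hx
  refine rpow_neg_mul_le hWx.1.ne' hWx.2.ne ?_
  have := h a b u v w C H hC S x (by exact_mod_cast hx.1.le) hx.2 hWx.2.ne
  rwa [locConst, if_pos hq1] at this

/-- Necessity arguments start here: for any test function the right-hand side may be replaced by its
discretization along `w`. -/
lemma hardyInt_le_tsum (hp : 0 < p) (hq : 0 < q) :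
    ∃ K : ℝ≥0∞, K ≠ ∞ ∧ ∀ (r a : ℝ) (b : EReal) (u v w : ℝ → ℝ≥0∞) (C : ℝ≥0∞) (x : ℤ → ℝ)
      (ω : ℤ → ℝ≥0∞), HardyIneq a b r p q u v w C → AEMeasurable w (leb a b) → Dyadic a b w x ω →
        ∀ f, Measurable f → hardyInt r q u v a b f ≤
          (K * C) ^ q * (∑' k, ω k * (∫⁻ s in Ioc (x (k - 1)) (x k), f s) ^ p) ^ (q / p) := by
  obtain ⟨K, hK, h⟩ := dyadic_upper (β := p) (γ := 0) hp le_rfl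
  refine ⟨K ^ (1 / p), ENNReal.rpow_ne_top_of_nonneg (by positivity) hK,
    fun r a b u v w C x ω H hw hx f hf => ?_⟩
  have h1 := h a b w x ω hx hw (volume.withDensity f)
  simp only [add_zero, ENNReal.rpow_one, ENNReal.rpow_zero, one_mul, withDensity_apply _
    (measurableSet_ival _ _), withDensity_apply _ measurableSet_Ioc] at h1
  have h2 := H f hf.aemeasurable
  rw [one_div, ENNReal.rpow_inv_le_iff hq] at h2
  refine h2.trans ?_
  calc _ ≤ (C * (K * ∑' k, ω k * (∫⁻ s in Ioc (x (k - 1)) (x k), f s) ^ p) ^ (1 / p)) ^ q := by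
        gcongr
        exact h1
    _ = _ := by
        rw [ENNReal.mul_rpow_of_nonneg _ _ (show 0 ≤ 1 / p by positivity), ← mul_assoc,
          ENNReal.mul_rpow_of_nonneg _ _ hq.le, mul_comm C, ← ENNReal.rpow_mul (∑' k, _)]
        congr 2
        ring

lemma V_block_ne_top (hr : 0 < r) (hr1 : r ≤ 1) (hp : 0 < p) (hq : 0 < q)
    (H : HardyIneq a b r p q u v w C) (hC : C ≠ ∞) (S : Setup a b u v w) {x : ℤ → ℝ}
    {ω : ℤ → ℝ≥0∞} (hx : Dyadic a b w x ω) (k : ℤ) : V r v (x (k - 1)) (x k) ≠ ∞ := by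
  by_cases hk : a < x k
  · have hW : integ w (x (k - 1)) b ≠ ∞ := by
      rw [hx.tail_pred k hk]; exact ENNReal.mul_ne_top (by norm_num) (hx.halving.ne_top k)
    have h1 := H.tail_V_le hr hr1 hp hq hC S.hv.meas S.hw.meas (hx.left_le _) (hx.pred_lt hk)
      (hx.lt_right k) hW
    intro hT
    have hU : integ u (x k) b ^ (1 / q) ≠ 0 := by
      have := S.hU (x k) ⟨by exact_mod_cast hk, hx.lt_right k⟩
      exact (ENNReal.rpow_pos this.1 this.2.ne).ne'
    rw [hT, ENNReal.mul_top hU, top_le_iff] at h1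
    exact ENNReal.mul_ne_top hC (ENNReal.rpow_ne_top_of_nonneg (by positivity) hW) h1
  · rw [V_of_le hr hr1]
    · simp
    · exact_mod_cast (not_lt.1 hk).trans (hx.left_le _)

/-- Testing with functions that are concentrated on one interval in each block of `w`. -/
lemma test_chain (hr : 0 < r) (hr1 : r ≤ 1) (hp : 0 < p) (hq : 0 < q) :
    ∃ K : ℝ≥0∞, K ≠ ∞ ∧ ∀ (a : ℝ) (b : EReal) (u v w : ℝ → ℝ≥0∞) (C : ℝ≥0∞),
      HardyIneq a b r p q u v w C → C ≠ ∞ → Setup a b u v w → ∀ (x : ℤ → ℝ) (ω : ℤ → ℝ≥0∞),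
        Dyadic a b w x ω → ∀ s e : ℤ → ℝ, (∀ k, x (k - 1) ≤ s k) → (∀ k, e k ≤ x k) →
          ∀ z : ℤ → ℝ≥0∞,
            ∫⁻ t : ℝ, atoms (fun k => (ω k ^ (-(1 / p)) * V r v (s k) (e k) * z k) ^ r) e
                (ival a t) ^ (q / r) * u t ∂(leb a b) ≤
              (K * C) ^ q * (∑' k, z k ^ p) ^ (q / p) := by
  obtain ⟨K, hK, h⟩ := hardyInt_le_tsum hp hq
  refine ⟨2 * K, ENNReal.mul_ne_top (by norm_num) hK,
    fun a b u v w C H hC S x ω hx s e hs he z => ?_⟩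
  have hsub : ∀ k, Ioc (s k) (e k) ⊆ Ioc (x (k - 1)) (x k) := fun k =>
    Ioc_subset_Ioc (hs k) (he k)
  have hdis : Pairwise (Function.onFun Disjoint fun n => Ioc (s n) (e n)) := fun i j hij =>
    (hx.pairwise_disjoint hij).mono (hsub i) (hsub j)
  have hle : ∀ k, leb (s k) (e k) ≤ leb (x (k - 1)) (x k) := fun k =>
    leb_mono (by exact_mod_cast hs k) (by exact_mod_cast he k)
  obtain ⟨f, hf, hf1, hf2⟩ := exists_glue (v := v) hr hr1 hdis
    (fun n => S.hv.meas.mono_measure ((hle n).trans (hx.leb_block_le n)))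
    (fun n => ne_top_of_le_ne_top (V_block_ne_top hr hr1 hp hq H hC S hx n)
      (V_mono hr hr1 (by exact_mod_cast hs n) (by exact_mod_cast he n)))
    (fun k => ω k ^ (-(1 / p)) * z k)
  have h1 := h r a b u v w C x ω H S.hw.meas hx f hf
  -- Only the k-th interval meets the k-th block, and its mass ω_k^(-1/p) z_k is normalized so that
  -- the weight cancels.
  have hY : ∑' k, ω k * (∫⁻ s in Ioc (x (k - 1)) (x k), f s) ^ p ≤ ∑' k, z k ^ p := by
    refine ENNReal.tsum_le_tsum fun k => ?_
    have h2 : ∫⁻ s in Ioc (x (k - 1)) (x k), f s ≤ ω k ^ (-(1 / p)) * z k := by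
      refine (hf1 _ measurableSet_Ioc).trans ?_
      rw [tsum_eq_single k]
      · exact indicator_le_self _ _ _
      · intro n hn
        refine indicator_of_notMem ?_ _
        rintro ⟨y, hy1, hy2⟩
        exact Set.disjoint_left.1 (hx.pairwise_disjoint hn) (hsub n hy2) hy1
    calc _ ≤ ω k * (ω k ^ (-(1 / p)) * z k) ^ p := by gcongr
      _ = z k ^ p := by
        rw [ENNReal.mul_rpow_of_nonneg _ _ hp.le, ← ENNReal.rpow_mul, ← mul_assoc,
          show -(1 / p) * p = -1 by field_simp, ENNReal.rpow_neg_one,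
          ENNReal.mul_inv_cancel (hx.halving.ne_zero k) (hx.halving.ne_top k), one_mul]
  -- Up to the factor 2^r, the atom at e k is paid for by f on (s k, e k], which lies in (a, t) as
  -- soon as e k < t.
  have hat : ∀ t : ℝ, atoms (fun k => (ω k ^ (-(1 / p)) * V r v (s k) (e k) * z k) ^ r) e (ival a t)
      ≤ 2 ^ r * ∫⁻ y, f y ^ r * v y ∂(leb a t) := by
    intro t
    rw [atoms_apply _ _ (measurableSet_ival _ _)]
    calc _ ≤ ∑' k, 2 ^ r * ∫⁻ y in Ioc (s k) (e k) ∩ ival a t, f y ^ r * v y := by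
          refine ENNReal.tsum_le_tsum fun k => ?_
          by_cases hk : k ∈ {k | e k ∈ ival a t}
          · rw [indicator_of_mem hk, inter_eq_left.2, ← leb_coe]
            · refine le_trans (le_of_eq ?_) (mul_le_mul_right (hf2 k) _)
              rw [← ENNReal.mul_rpow_of_nonneg _ _ hr.le, ← mul_assoc,
                ENNReal.mul_div_cancel (by norm_num) (by norm_num)]
              congr 1; ring
            · intro y hy
              refine ⟨?_, lt_of_le_of_lt (by exact_mod_cast hy.2) hk.2⟩
              exact_mod_cast ((hx.left_le _).trans (hs k)).trans_lt hy.1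
          · rw [indicator_of_notMem hk]; exact zero_le
      _ = 2 ^ r * ∫⁻ y in ⋃ k, Ioc (s k) (e k) ∩ ival a t, f y ^ r * v y := by
          rw [ENNReal.tsum_mul_left, lintegral_iUnion]
          · exact fun k => measurableSet_Ioc.inter (measurableSet_ival _ _)
          · exact fun i j hij => (hdis hij).mono inter_subset_left inter_subset_left
      _ ≤ _ := by
          gcongr
          exact Measure.restrict_mono (iUnion_subset fun k => inter_subset_right) le_rfl
  calc _ ≤ ∫⁻ t : ℝ, 2 ^ q * ((∫⁻ y, f y ^ r * v y ∂(leb a t)) ^ (q / r) * u t) ∂(leb a b) := by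
        refine lintegral_mono fun t => ?_
        rw [← mul_assoc]
        gcongr
        refine (ENNReal.rpow_le_rpow (hat t) (show 0 ≤ q / r by positivity)).trans (le_of_eq ?_)
        rw [ENNReal.mul_rpow_of_nonneg _ _ (by positivity), ← ENNReal.rpow_mul,
          show r * (q / r) = q by field_simp]
    _ = 2 ^ q * hardyInt r q u v a b f := lintegral_const_mul' _ _ (two_rpow_ne_top q)
    _ ≤ 2 ^ q * ((K * C) ^ q * (∑' k, z k ^ p) ^ (q / p)) := by
        refine mul_le_mul_right (h1.trans ?_) _
        gcongr
    _ = _ := by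
        rw [← mul_assoc, ← ENNReal.mul_rpow_of_nonneg _ _ hq.le, mul_assoc 2]

end necessity

/-- The power r/q turns the estimate for a single block of `u` into a bound for a multiplier from
ℓ^p to ℓ^r. -/
lemma mul_mulNorm_le_of_forall {p q r : ℝ} (hp : 0 < p) (hq : 0 < q) (hr : 0 < r) {θ C : ℝ≥0∞}
    {μ : ℤ → ℝ≥0∞} (h : ∀ z : ℤ → ℝ≥0∞, θ * (∑' k, (μ k * z k) ^ r) ^ (q / r) ≤
      C ^ q * (∑' k, z k ^ p) ^ (q / p)) : θ ^ (1 / q) * mulNorm p r μ ≤ C := by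
  rw [← mulNorm_const_mul hp hr]
  refine mulNorm_le_of_forall hp hr fun z => ?_
  have h2 := ENNReal.rpow_le_rpow (h z) (z := r / q) (by positivity)
  rw [ENNReal.mul_rpow_of_nonneg _ _ (by positivity), ENNReal.mul_rpow_of_nonneg _ _ (by positivity),
    ← ENNReal.rpow_mul, ← ENNReal.rpow_mul, ← ENNReal.rpow_mul, show q / r * (r / q) = 1 by field_simp,
    show q * (r / q) = r by field_simp, show q / p * (r / q) = r / p by field_simp,
    ENNReal.rpow_one, ← ENNReal.tsum_mul_left] at h2
  refine le_trans (le_of_eq (tsum_congr fun k => ?_)) h2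
  rw [mul_assoc, mul_rpow_mul_rpow hr.le]

/-! ### Chains of cells as test functions, and the necessity of `C3`. -/

section necessity
variable {r p q : ℝ}

/-- The multiplier `ω_k^{-1/p} V(x_{k-1}, e_k)`. -/
noncomputable def subcell (r p : ℝ) (v : ℝ → ℝ≥0∞) (x : ℤ → ℝ) (ω : ℤ → ℝ≥0∞) (e : ℤ → ℝ) (k : ℤ) :
    ℝ≥0∞ := ω k ^ (-(1 / p)) * V r v (x (k - 1)) (e k)

lemma subcell_eq_zero (hr : 0 < r) (hr1 : r ≤ 1) {v : ℝ → ℝ≥0∞} {x : ℤ → ℝ} {ω : ℤ → ℝ≥0∞}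
    {e : ℤ → ℝ} {k : ℤ} (h : e k ≤ x (k - 1)) : subcell r p v x ω e k = 0 := by
  rw [subcell, V_of_le hr hr1 (by exact_mod_cast h), mul_zero]

/-- `test_chain` is discretized along `u` and resolved by `mulNorm_comp_le`. The right ends e k are
left free, because cells cut off at a given point or at a chosen point of the block are needed
besides whole cells. -/
lemma mulNorm_chain_le (hr : 0 < r) (hr1 : r ≤ 1) (hp : 0 < p) (hq : 0 < q) :
    ∃ K : ℝ≥0∞, K ≠ ∞ ∧ ∀ (a : ℝ) (b : EReal) (u v w : ℝ → ℝ≥0∞) (C : ℝ≥0∞),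
      HardyIneq a b r p q u v w C → C ≠ ∞ → Setup a b u v w → ∀ (x t : ℤ → ℝ) (ω θ : ℤ → ℝ≥0∞),
        Dyadic a b w x ω → Dyadic a b u t θ → ∀ e : ℤ → ℝ, (∀ k, e k ≤ x k) →
          mulNorm p q (fun n => θ n ^ (1 / q) * mulNorm p r
            ({j | e j ∈ Ioc (t (n - 1)) (t n)}.indicator (subcell r p v x ω e))) ≤ K * C := by
  obtain ⟨K, hK, h⟩ := test_chain hr hr1 hp hq
  refine ⟨2 * (2 ^ (1 / q) * K), ENNReal.mul_ne_top (by norm_num)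
    (ENNReal.mul_ne_top (two_rpow_ne_top _) hK),
    fun a b u v w C H hC S x t ω θ hx ht e he => ?_⟩
  rw [mul_assoc]
  refine mulNorm_comp_le hp hq hr ht.halving (ht.pairwise_disjoint_preimage e)
    (ENNReal.mul_ne_top (ENNReal.mul_ne_top (two_rpow_ne_top _) hK) hC) fun z => ?_
  have h1 := h a b u v w C H hC S x ω hx (fun k => x (k - 1)) e (fun k => le_rfl) he z
  have h2 := ht.lower (β := q / r) (γ := 0) (by positivity) le_rfl
    (atoms (fun k => (subcell r p v x ω e k * z k) ^ r) e)
  simp only [add_zero, ENNReal.rpow_one, ENNReal.rpow_zero, one_mul] at h2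
  calc _ = ∑' n, θ n * atoms (fun k => (subcell r p v x ω e k * z k) ^ r) e
        (Ioc (t (n - 1)) (t n)) ^ (q / r) := by
        refine tsum_congr fun n => ?_
        rw [atoms_apply _ _ measurableSet_Ioc]
        congr 2
        refine tsum_congr fun j => ?_
        by_cases hj : j ∈ {j | e j ∈ Ioc (t (n - 1)) (t n)}
        · rw [indicator_of_mem hj, indicator_of_mem hj]
        · rw [indicator_of_notMem hj, indicator_of_notMem hj, zero_mul, ENNReal.zero_rpow_of_pos hr]
    _ ≤ _ := h2
    _ ≤ 2 * ((K * C) ^ q * (∑' k, z k ^ p) ^ (q / p)) := by gcongr; exact h1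
    _ = _ := by
        rw [← mul_assoc, mul_assoc (2 ^ (1 / q)), mul_rpow_mul_rpow hq.le, div_self hq.ne',
          ENNReal.rpow_one]

/-- For y in the n-th block of `u`, the cells ending before y are sorted by the block that contains
their right end. The suitable power of `mulNorm` is subadditive over these blocks, and `geom_hardy`
leaves the n-th one. Cells with e k ≤ a vanish. -/
lemma lintegral_chain_le (hr : 0 < r) (hr1 : r ≤ 1) (hp : 0 < p) (hq : 0 < q) (hqp : q < p) :
    ∃ K : ℝ≥0∞, K ≠ ∞ ∧ ∀ (a : ℝ) (b : EReal) (u v w : ℝ → ℝ≥0∞) (C : ℝ≥0∞),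
      HardyIneq a b r p q u v w C → C ≠ ∞ → Setup a b u v w → ∀ (x : ℤ → ℝ) (ω : ℤ → ℝ≥0∞),
        Dyadic a b w x ω → ∀ e : ℤ → ℝ, (∀ k, e k ≤ x k) →
          ∫⁻ y : ℝ, mulNorm p r ({j | e j < y}.indicator (subcell r p v x ω e)) ^ (p * q / (p - q)) *
            (integ u y b ^ (q / (p - q)) * u y) ∂(leb a b) ≤ K * C ^ (p * q / (p - q)) := by
  obtain ⟨e1, e2, hγ, -⟩ := rho_exponents hp hq hqp
  have hρ := rho_pos hp hq hqp
  have hE := mulExp_pos hp hr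
  set γ := q / (p - q)
  set ρ := p * q / (p - q)
  set E := mulExp p r
  obtain ⟨K, hK, h⟩ := mulNorm_chain_le hr hr1 hp hq
  obtain ⟨K', hK', h'⟩ := geom_hardy (α := 1 + γ) (β := ρ / E) (by linarith) (by positivity)
  refine ⟨2 ^ γ * (K' * K ^ ρ), ENNReal.mul_ne_top (two_rpow_ne_top _)
    (ENNReal.mul_ne_top hK' (ENNReal.rpow_ne_top_of_nonneg hρ.le hK)),
    fun a b u v w C H hC S x ω hx e he => ?_⟩
  obtain ⟨t, θ, ht⟩ := S.hU.exists_dyadic S.hab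
  set N : ℤ → ℝ≥0∞ := fun n => mulNorm p r
    ({j | e j ∈ Ioc (t (n - 1)) (t n)}.indicator (subcell r p v x ω e)) with hN
  calc _ ≤ 2 ^ γ * ∑' n, θ n ^ (1 + γ) * (∑' i : ℕ, N (n - i) ^ E) ^ (ρ / E) := by
        refine ht.step_upper S.hu.meas hγ.le fun n y hy => ?_
        rw [show ρ = E * (ρ / E) by field_simp, ENNReal.rpow_mul,
          show E * (ρ / E) / E = ρ / E by field_simp]
        refine ENNReal.rpow_le_rpow ?_ (by positivity)
        refine mulNorm_rpow_le_tsum hp hr _ _ fun k => ?_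
        by_cases hk : k ∈ {j | e j < y}
        · rw [indicator_of_mem hk]
          by_cases hk' : a < e k
          · right
            obtain ⟨m, hm⟩ := ht.exists_mem (t := e k) ⟨by exact_mod_cast hk',
              lt_of_le_of_lt (by exact_mod_cast he k) (hx.lt_right k)⟩
            have hmn : m ≤ n := by
              have := ht.le_of_lt (hm.1.trans (hk.trans_le hy.2))
              omega
            obtain ⟨i, rfl⟩ := Int.le.dest hmn
            refine ⟨i, ?_⟩
            rw [add_sub_cancel_right, indicator_of_mem (show k ∈ {j | e j ∈ Ioc _ _} from hm)]
          · left
            exact subcell_eq_zero hr hr1 ((not_lt.1 hk').trans (hx.left_le _))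
        · exact Or.inl (indicator_of_notMem hk _)
    _ ≤ 2 ^ γ * (K' * ∑' n, θ n ^ (1 + γ) * (N n ^ E) ^ (ρ / E)) := by
        gcongr
        exact h' (fun n => θ n ^ (1 + γ)) (fun n i => ht.geom n i) (fun n => N n ^ E)
    _ = 2 ^ γ * (K' * mulNorm p q (fun n => θ n ^ (1 / q) * N n) ^ ρ) := by
        rw [mulNorm_rpow hp hq hqp]
        congr 2
        refine tsum_congr fun n => ?_
        rw [mul_rpow_mul_rpow hρ.le, e1, ← ENNReal.rpow_mul, show E * (ρ / E) = ρ by field_simp]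
    _ ≤ 2 ^ γ * (K' * (K * C) ^ ρ) := by
        gcongr
        exact h a b u v w C H hC S x t ω θ hx ht e he
    _ = _ := by rw [ENNReal.mul_rpow_of_nonneg _ _ hρ.le]; ring

/-- The interval (t, y) is covered by the blocks from k on, cut off at y; those beyond y become
empty. -/
lemma Dyadic.V_rpow_le_min {a : ℝ} {b : EReal} {v w : ℝ → ℝ≥0∞} {x : ℤ → ℝ} {ω : ℤ → ℝ≥0∞}
    (hx : Dyadic a b w x ω) (hr : 0 < r) (hr1 : r ≤ 1) {k : ℤ} {t y : ℝ} (ht : x (k - 1) ≤ t)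
    (hy : (y : EReal) < b) :
    V r v t y ^ kap r ≤
      ∑' i : ℕ, V r v (x (k + i - 1)) ((min (x (k + i)) y : ℝ)) ^ kap r := by
  refine V_rpow_kap_le hr hr1 fun s hs => ?_
  have hts : t < s := by exact_mod_cast hs.1
  have hsy : s < y := by exact_mod_cast hs.2
  have hm0 : s ∈ ival a b :=
    ⟨by exact_mod_cast ((hx.left_le _).trans ht).trans_lt hts, hs.2.trans hy⟩
  obtain ⟨m, hm⟩ := hx.exists_mem hm0
  have hkm : k ≤ m := by
    have := hx.le_of_lt ((ht.trans_lt hts).trans_le hm.2)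
    omega
  obtain ⟨i, rfl⟩ := Int.le.dest hkm
  exact mem_iUnion.2 ⟨i, hm.1, le_min hm.2 hsy.le⟩

/-- On block k the factor V (t, y) is resolved into the cells to its right. The weights ω^(-σ/p)
grow geometrically with k, so the reversed inequality `geom_hardy_rev` leaves the cell of index k.
-/
lemma gInt_le (hr : 0 < r) (hr1 : r ≤ 1) (hrp : r < p) :
    ∃ K : ℝ≥0∞, K ≠ ∞ ∧ ∀ (a : ℝ) (b : EReal) (v w : ℝ → ℝ≥0∞) (x : ℤ → ℝ) (ω : ℤ → ℝ≥0∞),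
      AEMeasurable w (leb a b) → Dyadic a b w x ω → ∀ y : ℝ, (y : EReal) < b →
        gInt r p v w a b y ≤
          K * ∑' k, subcell r p v x ω (fun k => min (x k) y) k ^ (p * r / (p - r)) := by
  have hp : 0 < p := hr.trans hrp
  have hd : 0 < p - r := by linarith
  have hσ0 := rho_pos hp hr hrp
  have hκ := kap_pos hr
  set σ := p * r / (p - r) with hσ
  set τ := p / (p - r) with hτ
  have hτ0 : 0 < τ := by positivity
  have e1 : -τ + 1 = -(σ / p) := by rw [hσ, hτ]; field_simp; ring
  obtain ⟨K, hK, h⟩ := geom_hardy_rev (α := σ / p) (β := σ / kap r) (by positivity) (by positivity)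
  refine ⟨K, hK, fun a b v w x ω hw hx y hy => ?_⟩
  set c : ℤ → ℝ≥0∞ := fun k => V r v (x (k - 1)) ((min (x k) y : ℝ)) ^ kap r with hc
  calc _ ≤ ∫⁻ t : ℝ, integ w t b ^ (-τ) * w t * V r v t y ^ σ ∂(leb a b) :=
        lintegral_mono' (leb_mono le_rfl hy.le) le_rfl
    _ ≤ ∑' k, ω k ^ (-(σ / p)) * (∑' i : ℕ, c (k + i)) ^ (σ / kap r) := by
        rw [hx.lintegral_eq]
        refine ENNReal.tsum_le_tsum fun k => ?_
        calc _ ≤ ∫⁻ t in Ioc (x (k - 1)) (x k),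
              (ω k ^ (-τ) * (∑' i : ℕ, c (k + i)) ^ (σ / kap r)) * w t := by
              refine setLIntegral_mono_ae' measurableSet_Ioc
                (Filter.Eventually.of_forall fun t ht => ?_)
              rw [mul_right_comm]
              refine mul_le_mul_left (mul_le_mul' (rpow_neg_anti (hx.le_tail ht) hτ0.le) ?_) _
              rw [show σ = kap r * (σ / kap r) by field_simp, ENNReal.rpow_mul,
                show kap r * (σ / kap r) / kap r = σ / kap r by field_simp]
              refine ENNReal.rpow_le_rpow ?_ (by positivity)
              exact hx.V_rpow_le_min hr hr1 ht.1.le hy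
          _ ≤ (ω k ^ (-τ) * (∑' i : ℕ, c (k + i)) ^ (σ / kap r)) * ω k := by
              rw [lintegral_const_mul'' _ (hx.aemeasurable_block hw k)]
              gcongr
              exact hx.block_le k
          _ = _ := by
              rw [mul_right_comm]
              congr 1
              rw [← e1, ENNReal.rpow_add _ _ (hx.halving.ne_zero k) (hx.halving.ne_top k),
                ENNReal.rpow_one]
    _ ≤ K * ∑' k, ω k ^ (-(σ / p)) * c k ^ (σ / kap r) :=
        h (fun k => ω k ^ (-(σ / p))) (fun n i => (hx.halving.rpow_sub_nat _ n i).le) c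
    _ = _ := by
        congr 1
        refine tsum_congr fun k => ?_
        rw [subcell, hc, ENNReal.mul_rpow_of_nonneg _ _ hσ0.le, ← ENNReal.rpow_mul, ← ENNReal.rpow_mul,
          show kap r * (σ / kap r) = σ by field_simp]
        congr 2
        ring

/-- The cells are cut off at y. All atoms of the test function then lie to the left of every t > y,
and the left-hand side is at least the tail of `u` at y times a single ℓ^r sum. -/
lemma C3_le (hr : 0 < r) (hr1 : r ≤ 1) (hrp : r < p) (hq : 0 < q) :
    ∃ K : ℝ≥0∞, K ≠ ∞ ∧ ∀ (a : ℝ) (b : EReal) (u v w : ℝ → ℝ≥0∞) (C : ℝ≥0∞),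
      HardyIneq a b r p q u v w C → C ≠ ∞ → Setup a b u v w → C3 a b r p q u v w ≤ K * C := by
  have hp : 0 < p := hr.trans hrp
  have hσ0 := rho_pos hp hr hrp
  obtain ⟨K, hK, h⟩ := gInt_le hr hr1 hrp
  obtain ⟨K', hK', h'⟩ := test_chain hr hr1 hp hq
  refine ⟨K ^ ((p - r) / (p * r)) * K', ENNReal.mul_ne_top (ENNReal.rpow_ne_top_of_nonneg
    (by rw [rho_inv]; positivity) hK) hK', fun a b u v w C H hC S => iSup₂_le fun y hy => ?_⟩
  obtain ⟨x, ω, hx⟩ := S.hW.exists_dyadic S.hab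
  set e : ℤ → ℝ := fun k => min (x k) y with he
  have h1 : integ u y b ^ (1 / q) * mulNorm p r (subcell r p v x ω e) ≤ K' * C := by
    refine mul_mulNorm_le_of_forall hp hq hr fun z => ?_
    refine le_trans ?_ (h' a b u v w C H hC S x ω hx (fun k => x (k - 1)) e (fun _ => le_rfl)
      (fun k => min_le_left _ _) z)
    refine le_trans ?_ (lintegral_mono' (leb_mono hy.1.le le_rfl) le_rfl)
    rw [mul_comm, integ]
    refine (lintegral_const_mul_le _ _).trans ?_
    refine setLIntegral_mono_ae' (measurableSet_ival _ _)
      (Filter.Eventually.of_forall fun t ht => ?_)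
    gcongr
    rw [atoms_apply _ _ (measurableSet_ival _ _)]
    refine ENNReal.tsum_le_tsum fun k => ?_
    by_cases hk : a < e k
    · rw [indicator_of_mem]
      · rfl
      · exact ⟨by exact_mod_cast hk, lt_of_le_of_lt (by exact_mod_cast min_le_right _ _) ht.1⟩
    · rw [subcell_eq_zero hr hr1 ((not_lt.1 hk).trans (hx.left_le _)), zero_mul,
        ENNReal.zero_rpow_of_pos hr]
      exact zero_le
  rw [mulNorm_of_lt hrp] at h1
  calc _ ≤ integ u y b ^ (1 / q) *
        (K * ∑' k, subcell r p v x ω e k ^ (p * r / (p - r))) ^ ((p - r) / (p * r)) := by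
        refine mul_le_mul_right (ENNReal.rpow_le_rpow (h a b v w x ω S.hw.meas hx y hy.2) ?_) _
        rw [rho_inv]; positivity
    _ = K ^ ((p - r) / (p * r)) * (integ u y b ^ (1 / q) *
        (∑' k, subcell r p v x ω e k ^ (p * r / (p - r))) ^ ((p - r) / (p * r))) := by
        rw [ENNReal.mul_rpow_of_nonneg _ _ (by rw [rho_inv]; positivity)]; ring
    _ ≤ K ^ ((p - r) / (p * r)) * (K' * C) := by gcongr
    _ = _ := by ring

end necessity

/-! ### Near-extremals of the local inequality, and the necessity of the block constant. -/

section necessity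
variable {r p q : ℝ}

lemma rpow_mul_hardyInt_le (hr : 0 < r) (hq : 0 < q) (u v : ℝ → ℝ≥0∞) (c : ℝ) (d : EReal) (k : ℝ≥0∞)
    {f g : ℝ → ℝ≥0∞} (h : ∀ s ∈ ival c d, k * f s ≤ g s) :
    k ^ q * hardyInt r q u v c d f ≤ hardyInt r q u v c d g := by
  unfold hardyInt
  refine (lintegral_const_mul_le _ _).trans ?_
  refine setLIntegral_mono_ae' (measurableSet_ival _ _)
    (Filter.Eventually.of_forall fun t ht => ?_)
  rw [← mul_assoc]
  gcongr
  calc k ^ q * (∫⁻ s, f s ^ r * v s ∂(leb c t)) ^ (q / r) =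
        (k ^ r * ∫⁻ s, f s ^ r * v s ∂(leb c t)) ^ (q / r) := by
        rw [ENNReal.mul_rpow_of_nonneg _ _ (by positivity), ← ENNReal.rpow_mul,
          show r * (q / r) = q by field_simp]
    _ ≤ _ := by
        gcongr
        refine (lintegral_const_mul_le _ _).trans ?_
        refine setLIntegral_mono_ae' (measurableSet_ival _ _)
          (Filter.Eventually.of_forall fun s hs => ?_)
        rw [← mul_assoc, ← ENNReal.mul_rpow_of_nonneg _ _ hr.le]
        gcongr
        exact h s ⟨hs.1, hs.2.trans ht.2⟩

/-- If every normalized f failed, homogeneity would give the local inequality with constant B = L/κ,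
and `locConst_le` would yield L ≤ K B. -/
lemma exists_near_locConst (hr : 0 < r) (hr1 : r ≤ 1) (hq : 0 < q) :
    ∃ K : ℝ≥0∞, K ≠ ∞ ∧ ∀ (u v : ℝ → ℝ≥0∞) (c : ℝ) (d : EReal), (c : EReal) < d → TailOK c d u →
      AEMeasurable u (leb c d) → AEMeasurable v (leb c d) → locConst r q u v c d ≠ ∞ →
        ∃ f, Measurable f ∧ ∫⁻ s, f s ∂(leb c d) ≤ 1 ∧
          locConst r q u v c d ^ q ≤ K * hardyInt r q u v c d f := by
  obtain ⟨K, hK, h⟩ := locConst_le hr hr1 hq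
  -- Any finite κ > K produces the contradiction L = κ B ≤ K B.
  set κ : ℝ≥0∞ := 2 * (K + 1) with hκ
  have hκT : κ ≠ ∞ := ENNReal.mul_ne_top (by norm_num) (ENNReal.add_ne_top.2 ⟨hK, by norm_num⟩)
  have hκ0 : κ ≠ 0 := by rw [hκ]; simp
  refine ⟨κ ^ q, ENNReal.rpow_ne_top_of_nonneg hq.le hκT, fun u v c d hcd hT hu hv hL => ?_⟩
  set L := locConst r q u v c d with hLd
  rcases eq_or_ne L 0 with h0 | h0
  · refine ⟨fun _ => 0, measurable_const, by simp, ?_⟩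
    rw [h0, ENNReal.zero_rpow_of_pos hq]; exact zero_le
  by_contra! hcon
  set B := L / κ with hB
  have hB0 : B ≠ 0 := by rw [hB]; simp [h0, hκT]
  have hBT : B ≠ ∞ := ENNReal.div_ne_top hL hκ0
  have hsmall : ∀ f, Measurable f → ∫⁻ s, f s ∂(leb c d) ≤ 1 → hardyInt r q u v c d f ≤ B ^ q := by
    intro f hf hf1
    rw [hB, ENNReal.div_rpow_of_nonneg _ _ hq.le, ENNReal.le_div_iff_mul_le, mul_comm]
    · exact (hcon f hf hf1).le
    · exact Or.inl (ENNReal.rpow_pos (pos_iff_ne_zero.2 hκ0) hκT).ne'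
    · exact Or.inl (ENNReal.rpow_ne_top_of_nonneg hq.le hκT)
  have hall : ∀ f, Measurable f →
      hardyInt r q u v c d f ≤ (B * ∫⁻ t, f t ∂(leb c d)) ^ q := by
    intro f hf
    set F := ∫⁻ t, f t ∂(leb c d) with hF
    rcases eq_or_ne F ∞ with hFT | hFT
    · rw [hFT, ENNReal.mul_top hB0, ENNReal.top_rpow_of_pos hq]; exact le_top
    rcases eq_or_ne F 0 with hF0 | hF0
    · have hz : f =ᵐ[leb c d] 0 := (lintegral_eq_zero_iff hf).1 hF0
      have : hardyInt r q u v c d f = 0 := by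
        rw [hardyInt, leb, setLIntegral_congr_fun (g := fun _ => 0) (measurableSet_ival _ _),
          lintegral_zero]
        intro t ht
        have h2 : ∫⁻ s, f s ^ r * v s ∂(leb c t) = 0 := by
          rw [lintegral_congr_ae (g := fun _ => 0), lintegral_zero]
          filter_upwards [ae_mono (leb_mono le_rfl ht.2.le) hz] with s hs
          rw [hs]; simp [hr]
        simp only
        rw [h2, ENNReal.zero_rpow_of_pos (by positivity), zero_mul]
      rw [this]; exact zero_le
    · have h1 := hsmall (fun s => F⁻¹ * f s) (hf.const_mul _) (by
        rw [lintegral_const_mul _ hf, ENNReal.inv_mul_cancel hF0 hFT])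
      have h2 := rpow_mul_hardyInt_le hr hq u v c d F⁻¹ (f := f) (g := fun s => F⁻¹ * f s)
        fun _ _ => le_rfl
      calc hardyInt r q u v c d f = F ^ q * (F⁻¹ ^ q * hardyInt r q u v c d f) := by
            rw [← mul_assoc, ← ENNReal.mul_rpow_of_nonneg _ _ hq.le, ENNReal.mul_inv_cancel hF0 hFT,
              ENNReal.one_rpow, one_mul]
        _ ≤ F ^ q * B ^ q := by gcongr; exact h2.trans h1
        _ = _ := by rw [← ENNReal.mul_rpow_of_nonneg _ _ hq.le, mul_comm]
  have h1 := h u v c d hcd hT hu hv B hBT hall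
  have h2 : κ * B = L := by rw [hB, ENNReal.mul_div_cancel hκ0 hκT]
  have h3 : κ * B ≤ K * B := by rw [h2]; exact h1
  have h4 : κ ≤ K := (ENNReal.mul_le_mul_iff_left hB0 hBT).1 h3
  have h5 : K + 1 ≤ K := le_trans (by rw [hκ, two_mul]; exact le_self_add) h4
  exact (ENNReal.lt_add_right hK one_ne_zero).not_ge h5

/-- Near-extremals of the local inequalities on the blocks of `w` are glued with coefficients
ω_k^(-1/p) z_k. Dropping the interaction between blocks only decreases the left-hand side. -/
lemma blockConst_le (hr : 0 < r) (hr1 : r ≤ 1) (hp : 0 < p) (hq : 0 < q) :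
    ∃ K : ℝ≥0∞, K ≠ ∞ ∧ ∀ (a : ℝ) (b : EReal) (u v w : ℝ → ℝ≥0∞) (C : ℝ≥0∞),
      HardyIneq a b r p q u v w C → C ≠ ∞ → Setup a b u v w → ∀ (x : ℤ → ℝ) (ω : ℤ → ℝ≥0∞),
        Dyadic a b w x ω → blockConst r p q u v x ω ≤ K * C := by
  obtain ⟨K, hK, h⟩ := exists_near_locConst hr hr1 hq
  obtain ⟨K', hK', h'⟩ := hardyInt_le_tsum hp hq
  obtain ⟨K₂, hK₂, h₂⟩ := locConst_tail_le hr hr1 hp hq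
  refine ⟨K ^ (1 / q) * K', ENNReal.mul_ne_top (ENNReal.rpow_ne_top_of_nonneg (by positivity) hK) hK',
    fun a b u v w C H hC S x ω hx => ?_⟩
  have hloc : ∀ k, ∃ f, Measurable f ∧ ∫⁻ s, f s ∂(leb (x (k - 1)) (x k)) ≤ 1 ∧
      locConst r q u v (x (k - 1)) (x k) ^ q ≤ K * hardyInt r q u v (x (k - 1)) (x k) f := by
    intro k
    by_cases hk : a < x k
    · refine h u v _ _ (by exact_mod_cast hx.pred_lt hk)
        (S.tailOK (hx.left_le _) (hx.lt_right k).le) (S.hu.meas.mono_measure (hx.leb_block_le k))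
        (S.hv.meas.mono_measure (hx.leb_block_le k)) ?_
      have hW : integ w (x (k - 1)) b ≠ ∞ := by
        rw [hx.tail_pred k hk]; exact ENNReal.mul_ne_top (by norm_num) (hx.halving.ne_top k)
      refine ne_top_of_le_ne_top ?_ ((locConst_mono hr hr1 hq le_rfl (hx.lt_right k).le).trans
        (h₂ a b u v w C H hC S _ (hx.left_le _) (hx.lt_right (k - 1)) hW))
      exact ENNReal.mul_ne_top (ENNReal.mul_ne_top hK₂ hC)
        (ENNReal.rpow_ne_top_of_nonneg (by positivity) hW)
    · refine ⟨fun _ => 0, measurable_const, by simp, ?_⟩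
      rw [locConst_of_le hq, ENNReal.zero_rpow_of_pos hq]
      · exact zero_le
      · exact_mod_cast (not_lt.1 hk).trans (hx.left_le _)
  choose φ hφ1 hφ2 hφ3 using hloc
  refine mulNorm_le_of_forall hp hq fun z => ?_
  set f := glue (fun k => Ioc (x (k - 1)) (x k)) (fun k => ω k ^ (-(1 / p)) * z k) φ with hf
  have hglue : ∀ k, ∀ s ∈ Ioc (x (k - 1)) (x k), f s = ω k ^ (-(1 / p)) * z k * φ k s :=
    fun k s hs => glue_eq hx.pairwise_disjoint hs
  have hfm : Measurable f := measurable_glue (fun _ => measurableSet_Ioc) hφ1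
  have h1 := h' r a b u v w C x ω H S.hw.meas hx f hfm
  have hY : ∑' k, ω k * (∫⁻ s in Ioc (x (k - 1)) (x k), f s) ^ p ≤ ∑' k, z k ^ p := by
    refine ENNReal.tsum_le_tsum fun k => ?_
    have h2 : ∫⁻ s in Ioc (x (k - 1)) (x k), f s ≤ ω k ^ (-(1 / p)) * z k := by
      rw [setLIntegral_congr_fun measurableSet_Ioc (hglue k), lintegral_const_mul _ (hφ1 k), ← leb_coe]
      exact mul_le_of_le_one_right' (hφ2 k)
    calc _ ≤ ω k * (ω k ^ (-(1 / p)) * z k) ^ p := by gcongr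
      _ = z k ^ p := by
        rw [ENNReal.mul_rpow_of_nonneg _ _ hp.le, ← ENNReal.rpow_mul, ← mul_assoc,
          show -(1 / p) * p = -1 by field_simp, ENNReal.rpow_neg_one,
          ENNReal.mul_inv_cancel (hx.halving.ne_zero k) (hx.halving.ne_top k), one_mul]
  have hsum : ∑' k, hardyInt r q u v (x (k - 1)) (x k) f ≤ hardyInt r q u v a b f := by
    conv_rhs => rw [hardyInt, hx.lintegral_eq]
    refine ENNReal.tsum_le_tsum fun k => ?_
    rw [hardyInt, leb_coe]
    refine lintegral_mono fun t => ?_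
    gcongr
    exact leb_mono (by exact_mod_cast hx.left_le _) le_rfl
  calc _ ≤ ∑' k, K * hardyInt r q u v (x (k - 1)) (x k) f := by
        refine ENNReal.tsum_le_tsum fun k => ?_
        calc _ = (ω k ^ (-(1 / p)) * z k) ^ q * locConst r q u v (x (k - 1)) (x k) ^ q := by
              rw [← ENNReal.mul_rpow_of_nonneg _ _ hq.le]; congr 1; ring
          _ ≤ (ω k ^ (-(1 / p)) * z k) ^ q * (K * hardyInt r q u v (x (k - 1)) (x k) (φ k)) := by
              gcongr
              exact hφ3 k
          _ = K * ((ω k ^ (-(1 / p)) * z k) ^ q * hardyInt r q u v (x (k - 1)) (x k) (φ k)) := by ring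
          _ ≤ _ := by
              gcongr
              refine rpow_mul_hardyInt_le hr hq u v _ _ _ fun s hs => (hglue k s ?_).ge
              rw [ival_coe] at hs
              exact ⟨hs.1, hs.2.le⟩
    _ ≤ K * ((K' * C) ^ q * (∑' k, z k ^ p) ^ (q / p)) := by
        rw [ENNReal.tsum_mul_left]
        gcongr
        refine hsum.trans (h1.trans ?_)
        gcongr
    _ = _ := by
        rw [mul_assoc (K ^ (1 / q)), mul_rpow_mul_rpow hq.le, div_self hq.ne', ENNReal.rpow_one,
          mul_assoc]

end necessity

/-! ### Necessity of `C4`. -/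

section necessity
variable {r p q : ℝ}

/-- Sums of `V` over the blocks to the right are dominated by the largest cell. -/
lemma rpow_neg_mul_V_le (hr : 0 < r) (hr1 : r ≤ 1) (hp : 0 < p) :
    ∃ K : ℝ≥0∞, K ≠ ∞ ∧ ∀ (a : ℝ) (b : EReal) (v w : ℝ → ℝ≥0∞) (x : ℤ → ℝ) (ω : ℤ → ℝ≥0∞),
      Dyadic a b w x ω → ∀ (j : ℤ) (t y : ℝ) (M : ℝ≥0∞), x (j - 1) ≤ t → (y : EReal) < b →
        (∀ i, j ≤ i → subcell r p v x ω (fun i => min (x i) y) i ≤ M) →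
          ω j ^ (-(1 / p)) * V r v t y ≤ K * M := by
  have hκ := kap_pos hr
  refine ⟨(∑' i : ℕ, (2 : ℝ≥0∞) ^ (-(kap r / p * i))) ^ (1 / kap r),
    ENNReal.rpow_ne_top_of_nonneg (by positivity) (tsum_two_rpow_ne_top (by positivity)),
    fun a b v w x ω hx j t y M ht hy hM => ?_⟩
  -- The bound M on the cells makes V^κ (κ = `kap r`) on the blocks decay like ω_(j+i)^(κ/p), so the
  -- series is geometric.
  have hterm : ∀ i : ℕ, V r v (x (j + i - 1)) ((min (x (j + i)) y : ℝ)) ^ kap r ≤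
      2 ^ (-(kap r / p * i)) * (ω j ^ (1 / p) * M) ^ kap r := by
    intro i
    have h1 := ENNReal.rpow_le_rpow (mul_le_mul_right (hM (j + i) (by omega)) (ω (j + i) ^ (1 / p)))
      hκ.le
    have h2 : ω (j + i) ^ (1 / p) * subcell r p v x ω (fun i => min (x i) y) (j + i) =
        V r v (x (j + i - 1)) ((min (x (j + i)) y : ℝ)) := by
      rw [subcell, ← mul_assoc, mul_comm (ω (j + i) ^ (1 / p)), hx.halving.neg_mul_cancel, one_mul]
    rw [h2] at h1
    refine h1.trans (le_of_eq ?_)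
    rw [mul_rpow_mul_rpow hκ.le, mul_rpow_mul_rpow hκ.le, hx.halving.rpow_add_nat, mul_assoc]
  have h3 : V r v t y ≤ (∑' i : ℕ, (2 : ℝ≥0∞) ^ (-(kap r / p * i))) ^ (1 / kap r) *
      (ω j ^ (1 / p) * M) := by
    rw [← ENNReal.rpow_le_rpow_iff hκ, ENNReal.mul_rpow_of_nonneg _ _ hκ.le, ← ENNReal.rpow_mul,
      one_div_mul_cancel hκ.ne', ENNReal.rpow_one, ← ENNReal.tsum_mul_right]
    exact (hx.V_rpow_le_min hr hr1 ht hy).trans (ENNReal.tsum_le_tsum hterm)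
  calc _ ≤ ω j ^ (-(1 / p)) * (_ * (ω j ^ (1 / p) * M)) := mul_le_mul_right h3 _
    _ = _ := by
      rw [mul_left_comm, ← mul_assoc (ω j ^ (-(1 / p))), hx.halving.neg_mul_cancel, one_mul]

/-- The largest multiplier of the intersections of the blocks of `w` with the `n`-th block of `u`. -/
noncomputable def crossCell (r p : ℝ) (v : ℝ → ℝ≥0∞) (x : ℤ → ℝ) (ω : ℤ → ℝ≥0∞) (t : ℤ → ℝ) (n : ℤ) :
    ℝ≥0∞ :=
  ⨆ i, ω i ^ (-(1 / p)) * V r v ((max (x (i - 1)) (t (n - 1)) : ℝ)) ((min (x i) (t n) : ℝ))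

lemma rpow_mul_crossCell_le {a : ℝ} {b : EReal} {u v w : ℝ → ℝ≥0∞} {C : ℝ≥0∞} {x t : ℤ → ℝ}
    {ω θ : ℤ → ℝ≥0∞} (hr : 0 < r) (hr1 : r ≤ 1) (hp : 0 < p) (hq : 0 < q)
    (H : HardyIneq a b r p q u v w C) (hC : C ≠ ∞) (S : Setup a b u v w) (hx : Dyadic a b w x ω)
    (ht : Dyadic a b u t θ) (n : ℤ) :
    θ n ^ (1 / q) * crossCell r p v x ω t n ≤ 2 ^ (1 / p) * C := by
  rw [crossCell, ENNReal.mul_iSup]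
  refine iSup_le fun i => ?_
  set m := min (x i) (t n) with hm
  by_cases h : max (x (i - 1)) (t (n - 1)) < m
  · have h1 : x (i - 1) < m := (le_max_left _ _).trans_lt h
    have h2 : t (n - 1) < m := (le_max_right _ _).trans_lt h
    have hai : a < x i := ((hx.left_le _).trans_lt h1).trans_le (min_le_left _ _)
    have hW : integ w (x (i - 1)) b ≠ ∞ := by
      rw [hx.tail_pred i hai]; exact ENNReal.mul_ne_top (by norm_num) (hx.halving.ne_top i)
    have hmb : (m : EReal) < b := lt_of_le_of_lt (by exact_mod_cast min_le_left _ _) (hx.lt_right i)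
    have h3 := H.tail_V_le hr hr1 hp hq hC S.hv.meas S.hw.meas (hx.left_le _) h1 hmb hW
    calc _ ≤ integ u m b ^ (1 / q) * (ω i ^ (-(1 / p)) * V r v (x (i - 1)) m) := by
          gcongr
          · exact ht.le_tail ⟨h2, min_le_right _ _⟩
          · exact V_mono hr hr1 (by exact_mod_cast le_max_left _ _) le_rfl
      _ = 2 ^ (1 / p) * (integ w (x (i - 1)) b ^ (-(1 / p)) *
            (integ u m b ^ (1 / q) * V r v (x (i - 1)) m)) := by
          rw [hx.rpow_neg_eq _ hai]; ring
      _ ≤ _ := by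
          gcongr
          refine rpow_neg_mul_le ?_ hW h3
          rw [hx.tail_pred i hai]; simp [hx.halving.ne_zero i]
  · rw [V_of_le hr hr1 (by exact_mod_cast not_lt.1 h), mul_zero, mul_zero]; exact zero_le

/-- In each block n of `u` a nearly largest piece is chosen, lying in block j n of `w`. The pieces
are disjoint, but several may share a block of `w`. -/
lemma mulNorm_crossCell_le (hr : 0 < r) (hr1 : r ≤ 1) (hp : 0 < p) (hp1 : p ≤ 1) (hq : 0 < q) :
    ∃ K : ℝ≥0∞, K ≠ ∞ ∧ ∀ (a : ℝ) (b : EReal) (u v w : ℝ → ℝ≥0∞) (C : ℝ≥0∞),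
      HardyIneq a b r p q u v w C → C ≠ ∞ → Setup a b u v w → ∀ (x t : ℤ → ℝ) (ω θ : ℤ → ℝ≥0∞),
        Dyadic a b w x ω → Dyadic a b u t θ →
          mulNorm p q (fun n => θ n ^ (1 / q) * crossCell r p v x ω t n) ≤ K * C := by
  obtain ⟨K, hK, h⟩ := hardyInt_le_tsum hp hq
  refine ⟨2 ^ (1 / q) * (4 * K), ENNReal.mul_ne_top (two_rpow_ne_top _)
    (ENNReal.mul_ne_top (by norm_num) hK), fun a b u v w C H hC S x t ω θ hx ht => ?_⟩
  have hfin : ∀ n, crossCell r p v x ω t n ≠ ∞ := by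
    intro n hn
    have h1 := rpow_mul_crossCell_le hr hr1 hp hq H hC S hx ht n
    rw [hn, ENNReal.mul_top (ht.halving.rpow_pos n _).ne', top_le_iff] at h1
    exact ENNReal.mul_ne_top (two_rpow_ne_top _) hC h1
  have hch : ∀ n, ∃ j, crossCell r p v x ω t n / 2 ≤ ω j ^ (-(1 / p)) *
      V r v ((max (x (j - 1)) (t (n - 1)) : ℝ)) ((min (x j) (t n) : ℝ)) := by
    intro n
    rcases eq_or_ne (crossCell r p v x ω t n) 0 with h0 | h0
    · exact ⟨0, by rw [h0, ENNReal.zero_div]; exact zero_le⟩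
    · obtain ⟨j, hj⟩ := lt_iSup_iff.1 (ENNReal.half_lt_self h0 (hfin n))
      exact ⟨j, hj.le⟩
  choose j hj using hch
  set s : ℤ → ℝ := fun n => max (x (j n - 1)) (t (n - 1)) with hs
  set e : ℤ → ℝ := fun n => min (x (j n)) (t n) with he
  have hsubt : ∀ n, Ioc (s n) (e n) ⊆ Ioc (t (n - 1)) (t n) := fun n =>
    Ioc_subset_Ioc (le_max_right _ _) (min_le_right _ _)
  have hsubx : ∀ n, Ioc (s n) (e n) ⊆ Ioc (x (j n - 1)) (x (j n)) := fun n =>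
    Ioc_subset_Ioc (le_max_left _ _) (min_le_left _ _)
  have hdis : Pairwise (Function.onFun Disjoint fun n => Ioc (s n) (e n)) := fun i k hik =>
    (ht.pairwise_disjoint hik).mono (hsubt i) (hsubt k)
  have hle : ∀ n, leb (s n) (e n) ≤ leb (x (j n - 1)) (x (j n)) := fun n =>
    leb_mono (by exact_mod_cast le_max_left _ _) (by exact_mod_cast min_le_left _ _)
  refine mulNorm_le_of_forall hp hq fun z => ?_
  obtain ⟨f, hf, hf1, hf2⟩ := exists_glue (v := v) hr hr1 hdis
    (fun n => S.hv.meas.mono_measure ((hle n).trans (hx.leb_block_le _)))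
    (fun n => ne_top_of_le_ne_top (V_block_ne_top hr hr1 hp hq H hC S hx (j n))
      (V_mono hr hr1 (by exact_mod_cast le_max_left _ _) (by exact_mod_cast min_le_left _ _)))
    (fun n => ω (j n) ^ (-(1 / p)) * z n)
  have h1 := h r a b u v w C x ω H S.hw.meas hx f hf
  have hY : ∑' k, ω k * (∫⁻ s in Ioc (x (k - 1)) (x k), f s) ^ p ≤ ∑' n, z n ^ p := by
    calc _ ≤ ∑' k, ∑' n, if k = j n then z n ^ p else 0 := by
          refine ENNReal.tsum_le_tsum fun k => ?_
          calc _ ≤ ω k * (∑' n, if k = j n then ω (j n) ^ (-(1 / p)) * z n else 0) ^ p := by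
                gcongr
                refine (hf1 _ measurableSet_Ioc).trans (ENNReal.tsum_le_tsum fun n => ?_)
                by_cases hn : n ∈ {n | (Ioc (x (k - 1)) (x k) ∩ Ioc (s n) (e n)).Nonempty}
                · have hk : k = j n := by
                    obtain ⟨y, hy1, hy2⟩ := hn
                    by_contra hne
                    exact Set.disjoint_left.1 (hx.pairwise_disjoint hne) hy1 (hsubx n hy2)
                  rw [if_pos hk]; exact indicator_le_self _ _ _
                · rw [indicator_of_notMem hn]; exact zero_le
            -- This is where p ≤ 1 enters: the masses of all pieces in the same block of `w` add up
            -- before the power p is taken.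
            _ ≤ ω k * ∑' n, (if k = j n then ω (j n) ^ (-(1 / p)) * z n else 0) ^ p := by
                gcongr
                exact rpow_tsum_le_tsum_rpow _ hp hp1
            _ = _ := by
                rw [← ENNReal.tsum_mul_left]
                refine tsum_congr fun n => ?_
                split_ifs with hk
                · rw [hk, ENNReal.mul_rpow_of_nonneg _ _ hp.le, ← ENNReal.rpow_mul, ← mul_assoc,
                    show -(1 / p) * p = -1 by field_simp, ENNReal.rpow_neg_one,
                    ENNReal.mul_inv_cancel (hx.halving.ne_zero _) (hx.halving.ne_top _), one_mul]
                · rw [ENNReal.zero_rpow_of_pos hp, mul_zero]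
      _ = _ := by
          rw [ENNReal.tsum_comm]
          refine tsum_congr fun n => ?_
          rw [tsum_eq_single (j n) fun k hk => if_neg hk, if_pos rfl]
  have h2 := ht.lower (β := q / r) (γ := 0) (by positivity) le_rfl
    (volume.withDensity fun s => f s ^ r * v s)
  rw [← hardyInt_eq] at h2
  simp only [add_zero, ENNReal.rpow_one] at h2
  calc _ ≤ ∑' n, 4 ^ q * (θ n * volume.withDensity (fun s => f s ^ r * v s)
        (Ioc (t (n - 1)) (t n)) ^ (q / r)) := by
        refine ENNReal.tsum_le_tsum fun n => ?_
        rw [mul_assoc, mul_rpow_mul_rpow hq.le, div_self hq.ne', ENNReal.rpow_one, mul_left_comm]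
        gcongr
        have h3 : (crossCell r p v x ω t n / 4 * z n) ^ r ≤
            volume.withDensity (fun s => f s ^ r * v s) (Ioc (t (n - 1)) (t n)) := by
          rw [withDensity_apply _ measurableSet_Ioc]
          refine le_trans (ENNReal.rpow_le_rpow ?_ hr.le) ((hf2 n).trans ?_)
          · calc crossCell r p v x ω t n / 4 * z n = crossCell r p v x ω t n / 2 / 2 * z n := by
                  congr 1
                  rw [div_eq_mul_inv, div_eq_mul_inv, div_eq_mul_inv, mul_assoc,
                    ← ENNReal.mul_inv (by norm_num) (by norm_num)]
                  norm_num
              _ ≤ _ := mul_le_mul_left (ENNReal.div_le_div_right (hj n) 2) _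
              _ = _ := by
                  change ω (j n) ^ (-(1 / p)) * V r v (s n) (e n) / 2 * z n = _
                  generalize V r v (s n) (e n) = Z
                  simp only [div_eq_mul_inv]; ring
          · rw [leb_coe]; exact lintegral_mono_set (hsubt n)
        calc _ = 4 ^ q * (crossCell r p v x ω t n / 4 * z n) ^ q := by
              rw [← ENNReal.mul_rpow_of_nonneg _ _ hq.le, ← mul_assoc,
                ENNReal.mul_div_cancel (by norm_num) (by norm_num)]
          _ = 4 ^ q * ((crossCell r p v x ω t n / 4 * z n) ^ r) ^ (q / r) := by
              rw [← ENNReal.rpow_mul, show r * (q / r) = q by field_simp]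
          _ ≤ _ := by gcongr
    _ ≤ 4 ^ q * (2 * ((K * C) ^ q * (∑' n, z n ^ p) ^ (q / p))) := by
        rw [ENNReal.tsum_mul_left]
        gcongr
        refine h2.trans ?_
        gcongr
        refine h1.trans ?_
        gcongr
    _ = _ := by
        rw [mul_assoc (2 ^ (1 / q)), mul_rpow_mul_rpow hq.le, div_self hq.ne', ENNReal.rpow_one,
          mul_assoc 4, ENNReal.mul_rpow_of_nonneg 4 _ hq.le]
        ring

/-- For y in the n-th block of `u`, V (z, y) is controlled by the largest cell cut off at y
(`rpow_neg_mul_V_le`). Each such cell is cut along the blocks of `u` into pieces bounded by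
`crossCell`, and `geom_hardy` leaves the piece in block n. -/
lemma C4_le (hr : 0 < r) (hr1 : r ≤ 1) (hp : 0 < p) (hp1 : p ≤ 1) (hq : 0 < q) (hqp : q < p) :
    ∃ K : ℝ≥0∞, K ≠ ∞ ∧ ∀ (a : ℝ) (b : EReal) (u v w : ℝ → ℝ≥0∞) (C : ℝ≥0∞),
      HardyIneq a b r p q u v w C → C ≠ ∞ → Setup a b u v w → C4 a b r p q u v w ≤ K * C := by
  obtain ⟨e1, e2, hγ, -⟩ := rho_exponents hp hq hqp
  have hρ := rho_pos hp hq hqp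
  have hκ := kap_pos hr
  set γ := q / (p - q) with hγd
  set ρ := p * q / (p - q) with hρd
  obtain ⟨K₁, hK₁, h₁⟩ := rpow_neg_mul_V_le hr hr1 hp
  obtain ⟨K₂, hK₂, h₂⟩ := mulNorm_crossCell_le hr hr1 hp hp1 hq
  obtain ⟨K₃, hK₃, h₃⟩ := geom_hardy (α := 1 + γ) (β := ρ / kap r) (by linarith) (by positivity)
  refine ⟨(2 ^ γ * (K₁ ^ ρ * K₃)) ^ ρ⁻¹ * K₂, ENNReal.mul_ne_top (ENNReal.rpow_ne_top_of_nonneg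
    (by positivity) (ENNReal.mul_ne_top (two_rpow_ne_top _) (ENNReal.mul_ne_top
      (ENNReal.rpow_ne_top_of_nonneg hρ.le hK₁) hK₃))) hK₂,
    fun a b u v w C H hC S => ?_⟩
  obtain ⟨x, ω, hx⟩ := S.hW.exists_dyadic S.hab
  obtain ⟨t, θ, ht⟩ := S.hU.exists_dyadic S.hab
  set h := crossCell r p v x ω t with hh
  rw [← ENNReal.rpow_le_rpow_iff hρ, C4, rho_inv, ← hρd, ENNReal.rpow_inv_rpow hρ.ne', mul_assoc,
    ENNReal.mul_rpow_of_nonneg _ _ hρ.le, ENNReal.rpow_inv_rpow hρ.ne']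
  have hsub : ∀ n, ∀ y ∈ Ioc (t (n - 1)) (t n), ∀ i,
      subcell r p v x ω (fun i => min (x i) y) i ≤ (∑' m : ℕ, h (n - m) ^ kap r) ^ (1 / kap r) := by
    intro n y hy i
    rw [one_div, ENNReal.le_rpow_inv_iff hκ, subcell, ENNReal.mul_rpow_of_nonneg _ _ hκ.le]
    have hV : V r v (x (i - 1)) ((min (x i) y : ℝ)) ^ kap r ≤ ∑' m : ℕ,
        V r v ((max (x (i - 1)) (t (n - m - 1)) : ℝ)) ((min (x i) (t (n - m)) : ℝ)) ^ kap r := by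
      refine V_rpow_kap_le hr hr1 fun s hs => ?_
      have hs1 : x (i - 1) < s := by exact_mod_cast hs.1
      have hs2 : s < min (x i) y := by exact_mod_cast hs.2
      have hs3 : s < y := hs2.trans_le (min_le_right _ _)
      obtain ⟨m, hm⟩ := ht.exists_mem (t := s) ⟨by exact_mod_cast (hx.left_le _).trans_lt hs1,
        lt_trans (by exact_mod_cast hs2.trans_le (min_le_left _ _)) (hx.lt_right i)⟩
      have hmn : m ≤ n := by
        have := ht.le_of_lt (hm.1.trans (hs3.trans_le hy.2))
        omega
      obtain ⟨l, rfl⟩ := Int.le.dest hmn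
      refine mem_iUnion.2 ⟨l, ?_⟩
      rw [add_sub_cancel_right]
      exact ⟨max_lt hs1 hm.1, le_min (hs2.trans_le (min_le_left _ _)).le hm.2⟩
    refine (mul_le_mul_right hV _).trans ?_
    rw [← ENNReal.tsum_mul_left]
    refine ENNReal.tsum_le_tsum fun m => ?_
    rw [← ENNReal.mul_rpow_of_nonneg _ _ hκ.le]
    refine ENNReal.rpow_le_rpow ?_ hκ.le
    exact le_iSup (fun i => ω i ^ (-(1 / p)) *
      V r v ((max (x (i - 1)) (t (n - m - 1)) : ℝ)) ((min (x i) (t (n - m)) : ℝ))) i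
  calc _ = ∫⁻ y : ℝ, essSup (fun t : ℝ => integ w t b ^ (-γ) * V r v t y ^ ρ) (leb a y) *
        (integ u y b ^ γ * u y) ∂(leb a b) := lintegral_congr fun y => mul_comm _ _
    _ ≤ 2 ^ γ * ∑' n, θ n ^ (1 + γ) * (K₁ ^ ρ * (∑' m : ℕ, h (n - m) ^ kap r) ^ (ρ / kap r)) := by
        refine ht.step_upper S.hu.meas hγ.le fun n y hy => essSup_leb_le fun z hz => ?_
        have hyb : (y : EReal) < b := lt_of_le_of_lt (by exact_mod_cast hy.2) (ht.lt_right n)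
        obtain ⟨k, hk⟩ := hx.exists_mem (t := z) ⟨hz.1, hz.2.trans hyb⟩
        have h4 := h₁ a b v w x ω hx k z y _ hk.1.le hyb fun i _ => hsub n y hy i
        calc _ = (integ w z b ^ (-(1 / p)) * V r v z y) ^ ρ := by
              rw [ENNReal.mul_rpow_of_nonneg _ _ hρ.le, ← ENNReal.rpow_mul,
                show -(1 / p) * ρ = -γ by rw [← e2]; ring]
          _ ≤ (ω k ^ (-(1 / p)) * V r v z y) ^ ρ :=
              ENNReal.rpow_le_rpow (mul_le_mul_left (rpow_neg_anti (hx.le_tail hk) (by positivity)) _)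
                hρ.le
          _ ≤ _ := ENNReal.rpow_le_rpow h4 hρ.le
          _ = _ := by
              rw [ENNReal.mul_rpow_of_nonneg _ _ hρ.le, ← ENNReal.rpow_mul]
              congr 2; ring
    _ = 2 ^ γ * (K₁ ^ ρ * ∑' n, θ n ^ (1 + γ) * (∑' m : ℕ, h (n - m) ^ kap r) ^ (ρ / kap r)) := by
        congr 1
        rw [← ENNReal.tsum_mul_left]
        exact tsum_congr fun n => mul_left_comm _ _ _
    _ ≤ 2 ^ γ * (K₁ ^ ρ * (K₃ * ∑' n, θ n ^ (1 + γ) * (h n ^ kap r) ^ (ρ / kap r))) := by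
        gcongr
        exact h₃ (fun n => θ n ^ (1 + γ)) (fun n i => ht.geom n i) (fun n => h n ^ kap r)
    _ = 2 ^ γ * (K₁ ^ ρ * (K₃ * mulNorm p q (fun n => θ n ^ (1 / q) * h n) ^ ρ)) := by
        rw [mulNorm_rpow hp hq hqp]
        congr 3
        refine tsum_congr fun n => ?_
        rw [mul_rpow_mul_rpow hρ.le, e1, ← ENNReal.rpow_mul, show kap r * (ρ / kap r) = ρ by field_simp]
    _ ≤ 2 ^ γ * (K₁ ^ ρ * (K₃ * (K₂ * C) ^ ρ)) := by
        gcongr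
        exact h₂ a b u v w C H hC S x t ω θ hx ht
    _ = _ := by ring

end necessity

/-! ### Necessity of `C5` and `C7`. -/

section necessity
variable {r p q : ℝ}

lemma tsum_indicator_Icc_le (d : ℤ → ℝ≥0∞) (j k : ℤ) :
    ∑' l, {l | j ≤ l ∧ l ≤ k}.indicator d l ≤ ∑' i : ℕ, d (k - i) := by
  have h0 : Function.support ({l | j ≤ l ∧ l ≤ k}.indicator d) ⊆
      Set.range fun i : ℕ => k - (i : ℤ) := by
    intro l hl
    have hm : l ∈ {l | j ≤ l ∧ l ≤ k} := by
      by_contra hc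
      exact hl (indicator_of_notMem hc _)
    exact ⟨(k - l).toNat, by have := hm.2; simp only; omega⟩
  have hinj : Function.Injective fun i : ℕ => k - (i : ℤ) := fun i j h => by
    simp only at h; omega
  rw [← hinj.tsum_eq h0]
  exact ENNReal.tsum_le_tsum fun i => indicator_le_self _ _ _

/-- The local constant on a union of consecutive blocks. -/
lemma locConst_chain_le (hr : 0 < r) (hr1 : r ≤ 1) (hq : 0 < q) :
    ∃ K : ℝ≥0∞, K ≠ ∞ ∧ ∀ (a : ℝ) (b : EReal) (u v w : ℝ → ℝ≥0∞) (x : ℤ → ℝ) (ω : ℤ → ℝ≥0∞),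
      Setup a b u v w → Dyadic a b w x ω → ∀ j k : ℤ, a < x j → j ≤ k →
        locConst r q u v (x (j - 1)) (x k) ^ q ≤ K * ∑' l, {l | j ≤ l ∧ l ≤ k}.indicator
          (fun l => locConst r q u v (x (l - 1)) (x l) ^ q +
            (∫⁻ t in Ioc (x (l - 1)) (x l), u t) * V r v (x (j - 1)) (x (l - 1)) ^ q) l := by
  obtain ⟨K₀, hK₀, h₀⟩ := locConst_le hr hr1 hq
  obtain ⟨K₁, hK₁, h₁⟩ := hardyInt_le hr hr1 hq
  have hqr : 0 < q / r := by positivity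
  set κ : ℝ≥0∞ := 2 ^ (q / r) * (K₁ + 1) with hκ
  have hκT : κ ≠ ∞ := ENNReal.mul_ne_top (two_rpow_ne_top _) (ENNReal.add_ne_top.2 ⟨hK₁, by norm_num⟩)
  have hκ0 : κ ≠ 0 := by
    rw [hκ]
    exact mul_ne_zero (ENNReal.rpow_pos (by norm_num) (by norm_num)).ne' (by simp)
  refine ⟨(K₀ + 1) ^ q * κ, ENNReal.mul_ne_top (ENNReal.rpow_ne_top_of_nonneg hq.le
    (ENNReal.add_ne_top.2 ⟨hK₀, by norm_num⟩)) hκT, fun a b u v w x ω S hx j k hj hjk => ?_⟩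
  set D : ℤ → ℝ≥0∞ := fun l => locConst r q u v (x (l - 1)) (x l) ^ q +
    (∫⁻ t in Ioc (x (l - 1)) (x l), u t) * V r v (x (j - 1)) (x (l - 1)) ^ q with hD
  set T := ∑' l, {l | j ≤ l ∧ l ≤ k}.indicator D l with hT
  rcases eq_or_ne T ∞ with hTT | hTT
  · rw [hTT, ENNReal.mul_top]
    · exact le_top
    · refine mul_ne_zero ?_ hκ0
      rw [Ne, ENNReal.rpow_eq_zero_iff_of_pos hq]; simp
  have hjk' : x (j - 1) < x k := (hx.pred_lt hj).trans_le (hx.mono hjk)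
  have hle : leb (x (j - 1)) (x k) ≤ leb a b :=
    leb_mono (by exact_mod_cast hx.left_le _) (hx.lt_right k).le
  have hB : (κ * T) ^ (1 / q) ≠ ∞ :=
    ENNReal.rpow_ne_top_of_nonneg (by positivity) (ENNReal.mul_ne_top hκT hTT)
  -- It suffices to prove the local inequality on the union for every f. On block l the inner
  -- integral consists of a part inside the block, governed by its own local constant, and a
  -- complete part before it, governed by V (x (j-1), x (l-1)).
  have hmain := h₀ u v (x (j - 1)) (x k) (by exact_mod_cast hjk')
    (S.tailOK (hx.left_le _) (hx.lt_right k).le) (S.hu.meas.mono_measure hle)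
    (S.hv.meas.mono_measure hle) _ hB fun f hf => by
      set F := ∫⁻ t, f t ∂(leb (x (j - 1)) (x k)) with hF
      rw [mul_rpow_mul_rpow hq.le, div_self hq.ne', ENNReal.rpow_one]
      have hcov : Ioc (x (j - 1)) (x k) ⊆ ⋃ l : {l // j ≤ l ∧ l ≤ k}, Ioc (x (l - 1)) (x l) := by
        intro y hy
        obtain ⟨l, hl⟩ := hx.exists_mem (t := y) ⟨by exact_mod_cast (hx.left_le _).trans_lt hy.1,
          lt_of_le_of_lt (by exact_mod_cast hy.2) (hx.lt_right k)⟩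
        have h1 := hx.le_of_lt (hy.1.trans_le hl.2)
        have h2 := hx.le_of_lt (hl.1.trans_le hy.2)
        exact mem_iUnion.2 ⟨⟨l, by omega, by omega⟩, hl⟩
      calc hardyInt r q u v (x (j - 1)) (x k) f
          ≤ ∑' l : {l // j ≤ l ∧ l ≤ k}, ∫⁻ t in Ioc (x (l - 1)) (x l),
            (∫⁻ s, f s ^ r * v s ∂(leb (x (j - 1)) t)) ^ (q / r) * u t := by
            rw [hardyInt, leb_coe]
            exact (lintegral_mono_set hcov).trans (lintegral_iUnion_le _ _)
        _ ≤ ∑' l : {l // j ≤ l ∧ l ≤ k}, κ * F ^ q * D l := by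
            refine ENNReal.tsum_le_tsum fun ⟨l, hl1, hl2⟩ => ?_
            have hal : a < x l := hj.trans_le (hx.mono hl1)
            set A := (∫⁻ s in Ioc (x (j - 1)) (x (l - 1)), f s ^ r * v s) ^ (q / r) with hA
            have hjl : x (j - 1) ≤ x (l - 1) := hx.mono (by omega)
            have hAle : A ≤ V r v (x (j - 1)) (x (l - 1)) ^ q * F ^ q := by
              have hle' : leb (x (j - 1)) (x (l - 1)) ≤ leb (x (j - 1)) (x k) :=
                leb_mono le_rfl (by exact_mod_cast hx.mono (by omega))
              have h2 := lintegral_le_V (v := v) hr hr1 (S.hv.meas.mono_measure (hle'.trans hle))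
                (hf.aemeasurable (μ := leb (x (j - 1)) (x (l - 1))))
              rw [hA, ← leb_coe]
              refine (ENNReal.rpow_le_rpow h2 hqr.le).trans ?_
              rw [← ENNReal.rpow_mul, show r * (q / r) = q by field_simp,
                ENNReal.mul_rpow_of_nonneg _ _ hq.le]
              exact mul_le_mul_right (ENNReal.rpow_le_rpow (lintegral_mono' hle' le_rfl) hq.le) _
            have hblk : hardyInt r q u v (x (l - 1)) (x l) f ≤
                K₁ * (locConst r q u v (x (l - 1)) (x l) ^ q * F ^ q) := by
              refine (h₁ u v _ _ (by exact_mod_cast hx.pred_lt hal)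
                (S.tailOK (hx.left_le _) (hx.lt_right l).le)
                (S.hu.meas.mono_measure (hx.leb_block_le l))
                (S.hv.meas.mono_measure (hx.leb_block_le l)) f hf.aemeasurable).trans ?_
              rw [ENNReal.mul_rpow_of_nonneg _ _ hq.le]
              have hle' : leb (x (l - 1)) (x l) ≤ leb (x (j - 1)) (x k) :=
                leb_mono (by exact_mod_cast hjl) (by exact_mod_cast hx.mono hl2)
              exact mul_le_mul_right (mul_le_mul_right
                (ENNReal.rpow_le_rpow (lintegral_mono' hle' le_rfl) hq.le) _) _
            calc _ ≤ ∫⁻ t in Ioc (x (l - 1)) (x l), 2 ^ (q / r) *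
                  ((∫⁻ s, f s ^ r * v s ∂(leb (x (l - 1)) t)) ^ (q / r) * u t + A * u t) := by
                  refine setLIntegral_mono_ae' measurableSet_Ioc
                    (Filter.Eventually.of_forall fun t ht => ?_)
                  rw [← add_mul, ← mul_assoc]
                  gcongr
                  refine le_trans ?_ (ENNReal.add_rpow_le_two_rpow_mul_rpow_add_rpow _ _ hqr.le)
                  rw [lintegral_leb_split hjl (by exact_mod_cast ht.1), add_comm]
              _ = 2 ^ (q / r) * (hardyInt r q u v (x (l - 1)) (x l) f +
                    A * ∫⁻ t in Ioc (x (l - 1)) (x l), u t) := by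
                  have hum := hx.aemeasurable_block S.hu.meas l
                  rw [lintegral_const_mul' _ _ (two_rpow_ne_top _),
                    lintegral_add_right' _ (hum.const_mul A), lintegral_const_mul'' _ hum, hardyInt,
                    leb_coe]
              _ ≤ 2 ^ (q / r) * (K₁ * (locConst r q u v (x (l - 1)) (x l) ^ q * F ^ q) +
                    V r v (x (j - 1)) (x (l - 1)) ^ q * F ^ q *
                      ∫⁻ t in Ioc (x (l - 1)) (x l), u t) := by gcongr
              _ ≤ 2 ^ (q / r) * ((K₁ + 1) * (locConst r q u v (x (l - 1)) (x l) ^ q * F ^ q) +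
                    (K₁ + 1) * (V r v (x (j - 1)) (x (l - 1)) ^ q * F ^ q *
                      ∫⁻ t in Ioc (x (l - 1)) (x l), u t)) := by
                  refine mul_le_mul_right (add_le_add (mul_le_mul_left le_self_add _) ?_) _
                  exact le_mul_of_one_le_left' le_add_self
              _ = κ * F ^ q * D l := by rw [hκ, hD]; ring
        _ = κ * T * F ^ q := by
            rw [ENNReal.tsum_mul_left, hT, ← tsum_subtype {l | j ≤ l ∧ l ≤ k} D]
            exact mul_right_comm _ _ _
  calc _ ≤ ((K₀ + 1) * (κ * T) ^ (1 / q)) ^ q := by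
        refine ENNReal.rpow_le_rpow (hmain.trans ?_) hq.le
        gcongr
        exact le_self_add
    _ = _ := by
        rw [ENNReal.mul_rpow_of_nonneg _ _ hq.le, ← ENNReal.rpow_mul, one_div_mul_cancel hq.ne',
          ENNReal.rpow_one]
        exact (mul_assoc _ _ _).symm

/-- The mass of `u` on block k to the power 1 + q/(p-q) is bounded through `integ_rpow_le` by an
integral over the block. The cells i < k end by x (k-1), hence before every t in the block, and
`lintegral_chain_le` applies with whole cells. -/
lemma tsum_block_rpow_le (hr : 0 < r) (hr1 : r ≤ 1) (hp : 0 < p) (hq : 0 < q) (hqp : q < p) :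
    ∃ K : ℝ≥0∞, K ≠ ∞ ∧ ∀ (a : ℝ) (b : EReal) (u v w : ℝ → ℝ≥0∞) (C : ℝ≥0∞),
      HardyIneq a b r p q u v w C → C ≠ ∞ → Setup a b u v w → ∀ (x : ℤ → ℝ) (ω : ℤ → ℝ≥0∞),
        Dyadic a b w x ω →
          ∑' k, (∫⁻ t in Ioc (x (k - 1)) (x k), u t) ^ (p * q / (p - q) / q) *
            mulNorm p r ({i | i < k}.indicator (cell r p v x ω)) ^ (p * q / (p - q)) ≤
              K * C ^ (p * q / (p - q)) := by
  obtain ⟨e1, e2, hγ, -⟩ := rho_exponents hp hq hqp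
  have hρ := rho_pos hp hq hqp
  obtain ⟨K, hK, h⟩ := lintegral_chain_le hr hr1 hp hq hqp
  set γ := q / (p - q) with hγd
  set ρ := p * q / (p - q) with hρd
  refine ⟨2 ^ (1 + γ) * K, ENNReal.mul_ne_top (two_rpow_ne_top _) hK,
    fun a b u v w C H hC S x ω hx => ?_⟩
  rw [mul_assoc]
  refine le_trans ?_ (mul_le_mul_right (h a b u v w C H hC S x ω hx x fun _ => le_rfl) _)
  rw [hx.lintegral_eq, ← ENNReal.tsum_mul_left]
  refine ENNReal.tsum_le_tsum fun k => ?_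
  set Q := mulNorm p r ({i | i < k}.indicator (cell r p v x ω)) with hQ
  by_cases hk : a < x (k - 1)
  · have hU : integ u (x (k - 1)) (x k) ≠ ∞ := ne_top_of_le_ne_top
      (S.hU (x (k - 1)) ⟨by exact_mod_cast hk, hx.lt_right _⟩).2.ne
      (integ_mono le_rfl (hx.lt_right k).le u)
    have hkk : x (k - 1) < x k := hx.pred_lt (hk.trans_le (hx.mono (by omega)))
    have h1 := integ_rpow_le (by exact_mod_cast hkk) hγ.le
      (S.tailOK (hx.left_le (k - 1)) (hx.lt_right k).le) hU
    rw [e1, ← leb_coe]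
    calc _ ≤ 2 ^ (1 + γ) * (∫⁻ t : ℝ, integ u t (x k) ^ γ * u t ∂(leb (x (k - 1)) (x k))) * Q ^ ρ :=
          mul_le_mul_left h1 _
      _ = 2 ^ (1 + γ) * (Q ^ ρ * ∫⁻ t : ℝ, integ u t (x k) ^ γ * u t ∂(leb (x (k - 1)) (x k))) := by
          rw [mul_assoc, mul_comm (Q ^ ρ)]
      _ ≤ _ := by
          refine mul_le_mul_right ((lintegral_const_mul_le _ _).trans ?_) _
          rw [leb_coe]
          refine setLIntegral_mono_ae' measurableSet_Ioc
            (Filter.Eventually.of_forall fun t ht => ?_)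
          refine mul_le_mul' (ENNReal.rpow_le_rpow (mulNorm_mono hp hr fun i => ?_) hρ.le)
            (mul_le_mul_left (ENNReal.rpow_le_rpow (integ_mono le_rfl (hx.lt_right k).le u) hγ.le) _)
          refine indicator_le_indicator_of_subset ?_ (fun _ => zero_le) i
          exact fun i hi => (hx.mono (by have : i < k := hi; omega : i ≤ k - 1)).trans_lt ht.1
  · have hQ0 : Q = 0 := by
      rw [hQ, ← mulNorm_zero hp hr]
      congr 1
      ext i
      by_cases hi : i ∈ {i | i < k}
      · rw [indicator_of_mem hi, cell, V_of_le hr hr1, mul_zero]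
        have : i ≤ k - 1 := by have : i < k := hi; omega
        exact_mod_cast (hx.mono this).trans ((not_lt.1 hk).trans (hx.left_le _))
      · exact indicator_of_notMem hi _
    rw [hQ0, ENNReal.zero_rpow_of_pos hρ, mul_zero]
    exact zero_le

/-- The hypothesis on E is what an essential supremum over y satisfies; this treats `C5` and `C7` at
once. The local constant on (x (j-1), x k) is resolved into the blocks by `locConst_chain_le`: local
constants of single blocks, summed by `blockConst_le`, and jump terms, summed by
`tsum_block_rpow_le`. -/
lemma lintegral_locConst_le (hr : 0 < r) (hr1 : r ≤ 1) (hp : 0 < p) (hq : 0 < q) (hqp : q < p) :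
    ∃ K : ℝ≥0∞, K ≠ ∞ ∧ ∀ (a : ℝ) (b : EReal) (u v w : ℝ → ℝ≥0∞) (C : ℝ≥0∞),
      HardyIneq a b r p q u v w C → C ≠ ∞ → Setup a b u v w → ∀ E : ℝ → ℝ≥0∞,
        (∀ x ∈ ival a b, ∀ M, (∀ y ∈ ival a x, integ w (y : ℝ) b ^ (-(p / (p - q))) *
          locConst r q u v y (x : ℝ) ^ (p * q / (p - q)) ≤ M) → E x ≤ M) →
        (∫⁻ x, w x * E x ∂(leb a b)) ^ ((p - q) / (p * q)) ≤ K * C := by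
  obtain ⟨e1, e2, hγ, e3⟩ := rho_exponents hp hq hqp
  have hρ := rho_pos hp hq hqp
  have hd : 0 < p - q := by linarith
  obtain ⟨K₁, hK₁, h₁⟩ := locConst_chain_le hr hr1 hq
  obtain ⟨K₂, hK₂, h₂⟩ := blockConst_le hr hr1 hp hq
  obtain ⟨K₃, hK₃, h₃⟩ := tsum_block_rpow_le hr hr1 hp hq hqp
  obtain ⟨K₄, hK₄, h₄⟩ := rpow_neg_mul_V_le hr hr1 hp
  set ρ := p * q / (p - q) with hρd
  set β := ρ / q with hβd
  have hβ : 0 < β := by positivity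
  have eβ : p / (p - q) = β := by rw [← e3, ← e1]
  obtain ⟨K₅, hK₅, h₅⟩ := geom_hardy (α := 1) (β := β) one_pos hβ
  refine ⟨(K₁ ^ β * (K₅ * (2 ^ β * (K₂ ^ ρ + K₄ ^ ρ * K₃)))) ^ ρ⁻¹,
    ENNReal.rpow_ne_top_of_nonneg (by positivity) (ENNReal.mul_ne_top
      (ENNReal.rpow_ne_top_of_nonneg hβ.le hK₁) (ENNReal.mul_ne_top hK₅ (ENNReal.mul_ne_top
        (two_rpow_ne_top _) (ENNReal.add_ne_top.2 ⟨ENNReal.rpow_ne_top_of_nonneg hρ.le hK₂,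
          ENNReal.mul_ne_top (ENNReal.rpow_ne_top_of_nonneg hρ.le hK₄) hK₃⟩)))),
    fun a b u v w C H hC S E hE => ?_⟩
  obtain ⟨x, ω, hx⟩ := S.hW.exists_dyadic S.hab
  rw [rho_inv, ← hρd, ← ENNReal.rpow_le_rpow_iff hρ, ENNReal.rpow_inv_rpow hρ.ne',
    ENNReal.mul_rpow_of_nonneg _ _ hρ.le, ENNReal.rpow_inv_rpow hρ.ne']
  set L : ℤ → ℝ≥0∞ := fun l => locConst r q u v (x (l - 1)) (x l) with hL
  set Q : ℤ → ℝ≥0∞ := fun l => mulNorm p r ({i | i < l}.indicator (cell r p v x ω)) with hQ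
  set ul : ℤ → ℝ≥0∞ := fun l => ∫⁻ t in Ioc (x (l - 1)) (x l), u t with hul
  -- The factor ω_j^(-1) is split as ω_j^(-(1-q/p)) ω_j^(-q/p). The second factor goes with V^q and
  -- is absorbed by `rpow_neg_mul_V_le`; the first increases when j is replaced by l ≥ j, because q
  -- < p. So d depends on l alone.
  set d : ℤ → ℝ≥0∞ := fun l => ω l ^ (-1 : ℝ) * L l ^ q +
    ω l ^ (-(1 - q / p)) * (ul l * (K₄ * Q l) ^ q) with hdd
  have hqp1 : 0 ≤ 1 - q / p := by rw [sub_nonneg, div_le_one hp]; exact hqp.le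
  have hchain : ∀ j k, a < x j → j ≤ k →
      ω j ^ (-1 : ℝ) * locConst r q u v (x (j - 1)) (x k) ^ q ≤ K₁ * ∑' i : ℕ, d (k - i) := by
    intro j k hj hjk
    refine (mul_le_mul_right (h₁ a b u v w x ω S hx j k hj hjk) _).trans ?_
    rw [mul_left_comm, ← ENNReal.tsum_mul_left]
    refine mul_le_mul_right (le_trans (ENNReal.tsum_le_tsum fun l => ?_)
      (tsum_indicator_Icc_le d j k)) _
    by_cases hl : l ∈ {l | j ≤ l ∧ l ≤ k}
    · rw [indicator_of_mem hl, indicator_of_mem hl, mul_add]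
      have hω : ω l ≤ ω j := hx.halving.anti hl.1
      refine add_le_add (mul_le_mul_left (rpow_neg_anti hω zero_le_one) _) ?_
      have hV : ω j ^ (-(1 / p)) * V r v (x (j - 1)) (x (l - 1)) ≤ K₄ * Q l := by
        refine h₄ a b v w x ω hx j _ _ _ le_rfl (hx.lt_right _) fun i _ => ?_
        by_cases hil : i < l
        · refine le_trans (le_of_eq ?_) (le_mulNorm hp hr _ i)
          rw [indicator_of_mem (show i ∈ {i | i < l} from hil), subcell, cell,
            min_eq_left (hx.mono (by omega))]
        · rw [subcell_eq_zero hr hr1]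
          · exact zero_le
          · exact (min_le_right _ _).trans (hx.mono (by omega))
      calc _ = ω j ^ (-(1 - q / p)) *
            (ul l * (ω j ^ (-(1 / p)) * V r v (x (j - 1)) (x (l - 1))) ^ q) := by
            rw [ENNReal.mul_rpow_of_nonneg _ _ hq.le, ← ENNReal.rpow_mul,
              show (-1 : ℝ) = -(1 - q / p) + -(1 / p) * q by ring,
              ENNReal.rpow_add _ _ (hx.halving.ne_zero j) (hx.halving.ne_top j)]
            ring
        _ ≤ _ := mul_le_mul' (rpow_neg_anti hω hqp1)
            (mul_le_mul_right (ENNReal.rpow_le_rpow hV hq.le) _)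
    · rw [indicator_of_notMem hl, mul_zero]; exact zero_le
  have hup := hx.step_upper S.hw.meas le_rfl (f := E)
    (a := fun k => (K₁ * ∑' i : ℕ, d (k - i)) ^ β) fun k y hy => by
      have hyb : y ∈ ival a b := hx.block_subset k hy
      refine hE y hyb _ fun z hz => ?_
      have hzy : z < y := by exact_mod_cast hz.2
      obtain ⟨j, hj⟩ := hx.exists_mem (t := z) ⟨hz.1, hz.2.trans hyb.2⟩
      have hjk : j ≤ k := by
        have := hx.le_of_lt (hj.1.trans (hzy.trans_le hy.2))
        omega
      rw [eβ]
      calc _ ≤ ω j ^ (-β) * locConst r q u v (x (j - 1)) (x k) ^ ρ :=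
            mul_le_mul' (rpow_neg_anti (hx.le_tail hj) hβ.le) (ENNReal.rpow_le_rpow
              (locConst_mono hr hr1 hq hj.1.le (by exact_mod_cast hy.2)) hρ.le)
        _ = (ω j ^ (-1 : ℝ) * locConst r q u v (x (j - 1)) (x k) ^ q) ^ β := by
            rw [ENNReal.mul_rpow_of_nonneg _ _ hβ.le, ← ENNReal.rpow_mul, ← ENNReal.rpow_mul,
              neg_one_mul, show q * β = ρ by rw [hβd]; field_simp]
        _ ≤ _ := ENNReal.rpow_le_rpow (hchain j k (hx.left_lt_of_mem hj) hjk) hβ.le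
  simp only [ENNReal.rpow_zero, one_mul, add_zero, ENNReal.rpow_one] at hup
  have hA := ENNReal.rpow_le_rpow (h₂ a b u v w C H hC S x ω hx) hρ.le
  rw [blockConst, mulNorm_rpow hp hq hqp, ← hρd, ENNReal.mul_rpow_of_nonneg _ _ hρ.le] at hA
  have hB := h₃ a b u v w C H hC S x ω hx
  calc _ = ∫⁻ y, E y * w y ∂(leb a b) := lintegral_congr fun y => mul_comm _ _
    _ ≤ _ := hup
    _ = K₁ ^ β * ∑' k, ω k * (∑' i : ℕ, d (k - i)) ^ β := by
        rw [← ENNReal.tsum_mul_left]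
        refine tsum_congr fun k => ?_
        rw [ENNReal.mul_rpow_of_nonneg _ _ hβ.le, mul_left_comm]
    _ ≤ K₁ ^ β * (K₅ * ∑' k, ω k * d k ^ β) := by
        refine mul_le_mul_right (h₅ ω (fun n i => ?_) d) _
        have := hx.geom (α := 1) n i
        simpa only [ENNReal.rpow_one] using this
    -- The outer weight `ω k` completes the first summand to the block multiplier and cancels in the
    -- second, because (1 - q/p) β = 1.
    _ ≤ K₁ ^ β * (K₅ * ∑' k, 2 ^ β * ((ω k ^ (-(1 / p)) * L k) ^ ρ +
          K₄ ^ ρ * (ul k ^ β * Q k ^ ρ))) := by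
        refine mul_le_mul_right (mul_le_mul_right (ENNReal.tsum_le_tsum fun k => ?_) _) _
        refine (mul_le_mul_right (ENNReal.add_rpow_le_two_rpow_mul_rpow_add_rpow _ _ hβ.le) _).trans
          (le_of_eq ?_)
        have hqβ : q * β = ρ := by rw [hβd]; field_simp
        have hone : ∀ s : ℝ, ω k * ω k ^ s = ω k ^ (1 + s) := fun s => by
          rw [ENNReal.rpow_add _ _ (hx.halving.ne_zero k) (hx.halving.ne_top k), ENNReal.rpow_one]
        rw [mul_left_comm, mul_add]
        congr 2
        · rw [ENNReal.mul_rpow_of_nonneg _ _ hβ.le, ← ENNReal.rpow_mul, ← ENNReal.rpow_mul, hqβ,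
            ENNReal.mul_rpow_of_nonneg _ _ hρ.le, ← ENNReal.rpow_mul, ← mul_assoc, hone]
          congr 2
          rw [hβd, hρd]; field_simp; ring
        · rw [ENNReal.mul_rpow_of_nonneg _ _ hβ.le, ← ENNReal.rpow_mul, ← mul_assoc, hone,
            show 1 + -(1 - q / p) * β = 0 by rw [hβd, hρd]; field_simp; ring, ENNReal.rpow_zero,
            one_mul, ENNReal.mul_rpow_of_nonneg _ _ hβ.le, ← ENNReal.rpow_mul, hqβ,
            ENNReal.mul_rpow_of_nonneg _ _ hρ.le]
          ring
    _ = K₁ ^ β * (K₅ * (2 ^ β * ((∑' k, (ω k ^ (-(1 / p)) * L k) ^ ρ) +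
          K₄ ^ ρ * ∑' k, ul k ^ β * Q k ^ ρ))) := by
        rw [ENNReal.tsum_mul_left, ENNReal.tsum_add, ENNReal.tsum_mul_left]
    _ ≤ K₁ ^ β * (K₅ * (2 ^ β * (K₂ ^ ρ * C ^ ρ + K₄ ^ ρ * (K₃ * C ^ ρ)))) := by gcongr
    _ = _ := by ring

lemma C5_le (hr : 0 < r) (hr1 : r ≤ 1) (hp : 0 < p) (hq : 0 < q) (hqp : q < p) (hq1 : q < 1) :
    ∃ K : ℝ≥0∞, K ≠ ∞ ∧ ∀ (a : ℝ) (b : EReal) (u v w : ℝ → ℝ≥0∞) (C : ℝ≥0∞),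
      HardyIneq a b r p q u v w C → C ≠ ∞ → Setup a b u v w → C5 a b r p q u v w ≤ K * C := by
  obtain ⟨K, hK, h⟩ := lintegral_locConst_le hr hr1 hp hq hqp
  refine ⟨K, hK, fun a b u v w C H hC S => h a b u v w C H hC S _ fun x _ M hM => ?_⟩
  refine essSup_leb_le fun y hy => le_trans (le_of_eq ?_) (hM y hy)
  have h1 : 0 < p - q := by linarith
  rw [locConst, if_pos hq1, intConst, ← ENNReal.rpow_mul,
    show (1 - q) / q * (p * q / (p - q)) = p * (1 - q) / (p - q) by field_simp]

lemma C7_le (hr : 0 < r) (hr1 : r ≤ 1) (hp : 0 < p) (hq : 1 ≤ q) (hqp : q < p) :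
    ∃ K : ℝ≥0∞, K ≠ ∞ ∧ ∀ (a : ℝ) (b : EReal) (u v w : ℝ → ℝ≥0∞) (C : ℝ≥0∞),
      HardyIneq a b r p q u v w C → C ≠ ∞ → Setup a b u v w → C7 a b r p q u v w ≤ K * C := by
  have hq0 : 0 < q := by linarith
  have hρ := rho_pos hp hq0 hqp
  have h1 : 0 < p - q := by linarith
  obtain ⟨K, hK, h⟩ := lintegral_locConst_le hr hr1 hp hq0 hqp
  refine ⟨K, hK, fun a b u v w C H hC S => h a b u v w C H hC S _ fun x _ M hM => ?_⟩
  refine essSup_leb_le fun y hy => le_trans (mul_le_mul_right ?_ _) (hM y hy)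
  refine essSup_leb_le fun t ht => ?_
  rw [locConst, if_neg hq.not_gt, show p / (p - q) = p * q / (p - q) / q by field_simp,
    ← mul_rpow_mul_rpow hρ.le]
  exact ENNReal.rpow_le_rpow (le_iSup₂ (f := fun (t : ℝ) (_ : t ∈ ival y x) =>
    integ u (t : ℝ) x ^ (1 / q) * V r v y t) t ht) hρ.le

end necessity

/-! ### Necessity of `C6`. -/

section necessity
variable {r p q : ℝ}

/-- `∫_y^z U^{q/(p-q)} u`. -/
noncomputable def phiInt (p q : ℝ) (u : ℝ → ℝ≥0∞) (b : EReal) (y z : ℝ) : ℝ≥0∞ :=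
  ∫⁻ t : ℝ, integ u t b ^ (q / (p - q)) * u t ∂(leb y z)

lemma phiInt_le (hp : 0 < p) (hq : 0 < q) (hqp : q < p) {u : ℝ → ℝ≥0∞} {b : EReal} {y z : ℝ}
    (hu : AEMeasurable u (leb y b)) (hz : (z : EReal) ≤ b) :
    phiInt p q u b y z ≤ integ u y b ^ (p * q / (p - q) / q) := by
  obtain ⟨e1, -, hγ, -⟩ := rho_exponents hp hq hqp
  have hle : leb y z ≤ leb y b := leb_mono le_rfl hz
  calc _ ≤ ∫⁻ t, integ u y b ^ (q / (p - q)) * u t ∂(leb y b) := by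
        refine (lintegral_mono' hle le_rfl).trans ?_
        refine setLIntegral_mono_ae' (measurableSet_ival _ _)
          (Filter.Eventually.of_forall fun t ht => ?_)
        exact mul_le_mul_left (ENNReal.rpow_le_rpow (integ_mono ht.1.le le_rfl u) hγ.le) _
    _ = _ := by
        rw [lintegral_const_mul'' _ hu, e1, ENNReal.rpow_add_of_nonneg _ _ zero_le_one hγ.le,
          ENNReal.rpow_one, mul_comm]
        rfl

/-- A point of each block at which `Φ(y, x_j) V(x_{j-1}, y)^ρ` is nearly maximal. -/
lemma exists_near_max (hr : 0 < r) (hr1 : r ≤ 1) (hp : 0 < p) (hq : 0 < q) (hqp : q < p)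
    {a : ℝ} {b : EReal} {u v w : ℝ → ℝ≥0∞} {C : ℝ≥0∞} {x : ℤ → ℝ} {ω : ℤ → ℝ≥0∞}
    (H : HardyIneq a b r p q u v w C) (hC : C ≠ ∞) (S : Setup a b u v w) (hx : Dyadic a b w x ω)
    (j : ℤ) : ∃ y : ℝ, y ≤ x j ∧ x (j - 1) ≤ y ∧ ∀ z ∈ Ioc (x (j - 1)) (x j),
      phiInt p q u b z (x j) * V r v (x (j - 1)) z ^ (p * q / (p - q)) ≤
        2 * (phiInt p q u b y (x j) * V r v (x (j - 1)) y ^ (p * q / (p - q))) := by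
  have hρ := rho_pos hp hq hqp
  set ρ := p * q / (p - q) with hρd
  by_cases hj : a < x j
  swap
  · refine ⟨x j, le_rfl, hx.mono (by omega), fun z hz => ?_⟩
    rw [hx.block_eq_empty hj] at hz
    exact absurd hz (by simp)
  set M := ⨆ z ∈ Ioc (x (j - 1)) (x j), phiInt p q u b z (x j) * V r v (x (j - 1)) z ^ ρ with hM
  have hle : ∀ z ∈ Ioc (x (j - 1)) (x j), phiInt p q u b z (x j) * V r v (x (j - 1)) z ^ ρ ≤ M :=
    fun z hz => le_iSup₂ (f := fun z (_ : z ∈ Ioc (x (j - 1)) (x j)) =>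
      phiInt p q u b z (x j) * V r v (x (j - 1)) z ^ ρ) z hz
  -- A near-maximal point exists because M is finite, by `phiInt_le` and the supremal condition with
  -- left end x (j-1).
  have hMT : M ≠ ∞ := by
    have hW : integ w (x (j - 1)) b ≠ ∞ := by
      rw [hx.tail_pred j hj]; exact ENNReal.mul_ne_top (by norm_num) (hx.halving.ne_top j)
    refine ne_top_of_le_ne_top (b := (C * integ w (x (j - 1)) b ^ (1 / p)) ^ ρ)
      (ENNReal.rpow_ne_top_of_nonneg hρ.le (ENNReal.mul_ne_top hC
        (ENNReal.rpow_ne_top_of_nonneg (by positivity) hW))) (iSup₂_le fun z hz => ?_)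
    have hzb : (z : EReal) < b := lt_of_le_of_lt (by exact_mod_cast hz.2) (hx.lt_right j)
    have h1 := H.tail_V_le hr hr1 hp hq hC S.hv.meas S.hw.meas (hx.left_le _) hz.1 hzb hW
    refine le_trans ?_ (ENNReal.rpow_le_rpow h1 hρ.le)
    rw [mul_rpow_mul_rpow hρ.le]
    refine mul_le_mul_left (phiInt_le hp hq hqp (S.hu.meas.mono_measure
      (leb_mono ?_ le_rfl)) (hx.lt_right j).le) _
    exact_mod_cast (hx.left_le _).trans hz.1.le
  rcases eq_or_ne M 0 with h0 | h0
  · exact ⟨x j, le_rfl, hx.mono (by omega), fun z hz => ((hle z hz).trans h0.le).trans zero_le⟩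
  · obtain ⟨y, hy⟩ := lt_iSup_iff.1 (ENNReal.half_lt_self h0 hMT)
    obtain ⟨hym, hy⟩ := lt_iSup_iff.1 hy
    refine ⟨y, hym.2, hym.1.le, fun z hz => (hle z hz).trans ?_⟩
    rw [mul_comm]
    exact (ENNReal.div_le_iff (by norm_num) (by norm_num)).1 hy.le

/-- For z in block j of `w` the integral over (z, s) is cut along the blocks. In blocks after j,
`gInt` at z involves only cells that end by x j, and a chain of whole cells suffices. In block j
itself `gInt` also contains the cell cut off at z, which moves with z; it is replaced by the cell
cut off at the near-maximal point y j, independent of z. So two chains of test functions are used,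
one with ends x and one with ends y. -/
lemma C6_le (hr : 0 < r) (hr1 : r ≤ 1) (hrp : r < p) (hq : 0 < q) (hqp : q < p) :
    ∃ K : ℝ≥0∞, K ≠ ∞ ∧ ∀ (a : ℝ) (b : EReal) (u v w : ℝ → ℝ≥0∞) (C : ℝ≥0∞),
      HardyIneq a b r p q u v w C → C ≠ ∞ → Setup a b u v w → C6 a b r p q u v w ≤ K * C := by
  have hp : 0 < p := hr.trans hrp
  have hρ := rho_pos hp hq hqp
  have hσ := rho_pos hp hr hrp
  have hd1 : 0 < p - q := by linarith
  have hd2 : 0 < p - r := by linarith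
  obtain ⟨K₁, hK₁, h₁⟩ := lintegral_chain_le hr hr1 hp hq hqp
  obtain ⟨K₂, hK₂, h₂⟩ := gInt_le hr hr1 hrp
  obtain ⟨K₃, hK₃, h₃⟩ := geom_hardy (α := 1) (β := 1) one_pos one_pos
  set ρ := p * q / (p - q) with hρd
  set σ := p * r / (p - r) with hσd
  set τ := q * (p - r) / (r * (p - q)) with hτ
  have hτ0 : 0 < τ := by positivity
  have hστ : σ * τ = ρ := by rw [hσd, hρd, hτ]; field_simp
  set κ : ℝ≥0∞ := K₂ ^ τ * (2 ^ τ * 2) with hκ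
  have hκT : κ ≠ ∞ := ENNReal.mul_ne_top (ENNReal.rpow_ne_top_of_nonneg hτ0.le hK₂)
    (ENNReal.mul_ne_top (two_rpow_ne_top _) (by norm_num))
  refine ⟨(κ * (K₃ * (2 * K₁))) ^ ρ⁻¹, ENNReal.rpow_ne_top_of_nonneg (by positivity)
    (ENNReal.mul_ne_top hκT (ENNReal.mul_ne_top hK₃ (ENNReal.mul_ne_top (by norm_num) hK₁))),
    fun a b u v w C H hC S => ?_⟩
  obtain ⟨x, ω, hx⟩ := S.hW.exists_dyadic S.hab
  choose y hy1 hy2 hy3 using exists_near_max hr hr1 hp hq hqp H hC S hx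
  set G : ℝ → ℝ≥0∞ := fun s => mulNorm p r ({j | x j < s}.indicator (subcell r p v x ω x)) ^ ρ with hG
  set G' : ℝ → ℝ≥0∞ := fun s => mulNorm p r ({j | y j < s}.indicator (subcell r p v x ω y)) ^ ρ
    with hG'
  set γ := q / (p - q) with hγ
  -- G belongs to the chain of whole cells, G' to the cells cut off at the near-maximal points; ψ k
  -- is what both integrals contribute on block k, and its sum is controlled by
  -- `lintegral_chain_le`.
  set ψ : ℤ → ℝ≥0∞ := fun k => (∫⁻ s in Ioc (x (k - 1)) (x k), G s * (integ u s b ^ γ * u s)) +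
    ∫⁻ s in Ioc (x (k - 1)) (x k), G' s * (integ u s b ^ γ * u s) with hψ
  have hψsum : ∑' k, ψ k ≤ 2 * K₁ * C ^ ρ := by
    rw [ENNReal.tsum_add, ← hx.lintegral_eq, ← hx.lintegral_eq, two_mul, add_mul]
    exact add_le_add (h₁ a b u v w C H hC S x ω hx x fun _ => le_rfl)
      (h₁ a b u v w C H hC S x ω hx y hy1)
  rw [C6, rho_inv, ← hρd, ← ENNReal.rpow_le_rpow_iff hρ, ENNReal.rpow_inv_rpow hρ.ne',
    ENNReal.mul_rpow_of_nonneg _ _ hρ.le, ENNReal.rpow_inv_rpow hρ.ne']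
  -- the sum of the cells to the left of a point
  have hcellsum : ∀ s : ℝ, (∑' i, {i | x i < s}.indicator (fun i => cell r p v x ω i ^ σ) i) ^ τ =
      G s := by
    intro s
    rw [hG]
    simp only
    rw [← hστ, ENNReal.rpow_mul, mulNorm_rpow hp hr hrp]
    congr 1
    refine tsum_congr fun i => ?_
    by_cases hi : i ∈ {i | x i < s}
    · rw [indicator_of_mem hi, indicator_of_mem hi]; rfl
    · rw [indicator_of_notMem hi, indicator_of_notMem hi, ENNReal.zero_rpow_of_pos hσ]
  have hlate : ∀ j i, j < i → ∀ z ∈ Ioc (x (j - 1)) (x j),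
      (∫⁻ s in Ioc (x (i - 1)) (x i), integ u s b ^ γ * u s) * gInt r p v w a b z ^ τ ≤
        κ * ψ i := by
    intro j i hji z hz
    have hzb : (z : EReal) < b := lt_of_le_of_lt (by exact_mod_cast hz.2) (hx.lt_right j)
    have hg : ∀ s ∈ Ioc (x (i - 1)) (x i), gInt r p v w a b z ^ τ ≤ K₂ ^ τ * G s := by
      intro s hs
      rw [← hcellsum, ← ENNReal.mul_rpow_of_nonneg _ _ hτ0.le]
      refine ENNReal.rpow_le_rpow ((h₂ a b v w x ω S.hw.meas hx z hzb).trans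
        (mul_le_mul_right (ENNReal.tsum_le_tsum fun k => ?_) _)) hτ0.le
      by_cases hk : k ≤ j
      · rw [indicator_of_mem (show k ∈ {k | x k < s} from
          (hx.mono (by omega : k ≤ i - 1)).trans_lt hs.1)]
        refine ENNReal.rpow_le_rpow (mul_le_mul_right (V_mono hr hr1 le_rfl ?_) _) hσ.le
        exact_mod_cast min_le_left _ _
      · rw [subcell_eq_zero hr hr1, ENNReal.zero_rpow_of_pos hσ]
        · exact zero_le
        · exact (min_le_right _ _).trans (hz.2.trans (hx.mono (by omega)))
    calc _ ≤ ∫⁻ s in Ioc (x (i - 1)) (x i), K₂ ^ τ * (G s * (integ u s b ^ γ * u s)) := by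
          rw [mul_comm]
          refine (lintegral_const_mul_le _ _).trans (setLIntegral_mono_ae' measurableSet_Ioc
            (Filter.Eventually.of_forall fun s hs => ?_))
          rw [← mul_assoc (K₂ ^ τ)]
          exact mul_le_mul_left (hg s hs) _
      _ = K₂ ^ τ * ∫⁻ s in Ioc (x (i - 1)) (x i), G s * (integ u s b ^ γ * u s) :=
          lintegral_const_mul' _ _ (ENNReal.rpow_ne_top_of_nonneg hτ0.le hK₂)
      _ ≤ _ := by
          refine mul_le_mul' (le_mul_of_one_le_right' ?_) le_self_add
          refine one_le_mul ?_ (by norm_num)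
          exact ENNReal.one_le_rpow (by norm_num) hτ0
  have hearly : ∀ j, ∀ z ∈ Ioc (x (j - 1)) (x j),
      phiInt p q u b z (x j) * gInt r p v w a b z ^ τ ≤ κ * ψ j := by
    intro j z hz
    have hzb : (z : EReal) < b := lt_of_le_of_lt (by exact_mod_cast hz.2) (hx.lt_right j)
    -- `gInt` at z is bounded by the whole cells before block j, collected in A, and the cell of
    -- block j cut off at z, namely m.
    set A := ∑' i, {i | i < j}.indicator (fun i => cell r p v x ω i ^ σ) i with hA
    set m := ω j ^ (-(1 / p)) * V r v (x (j - 1)) z with hm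
    have hg : gInt r p v w a b z ≤ K₂ * (A + m ^ σ) := by
      refine (h₂ a b v w x ω S.hw.meas hx z hzb).trans (mul_le_mul_right ?_ _)
      have hs : ∑' i, (if i = j then m ^ σ else 0) = m ^ σ := by
        rw [tsum_eq_single j fun i hi => if_neg hi, if_pos rfl]
      rw [← hs, hA, ← ENNReal.tsum_add]
      refine ENNReal.tsum_le_tsum fun i => ?_
      rcases lt_trichotomy i j with hij | rfl | hij
      · refine le_trans ?_ le_self_add
        rw [indicator_of_mem (show i ∈ {i | i < j} from hij)]
        refine ENNReal.rpow_le_rpow (mul_le_mul_right (V_mono hr hr1 le_rfl ?_) _) hσ.le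
        exact_mod_cast min_le_left _ _
      · refine le_trans ?_ le_add_self
        rw [if_pos rfl, subcell, min_eq_right hz.2]
      · rw [subcell_eq_zero hr hr1, ENNReal.zero_rpow_of_pos hσ]
        · exact zero_le
        · exact (min_le_right _ _).trans (hz.2.trans (hx.mono (by omega)))
    have hgτ : gInt r p v w a b z ^ τ ≤ K₂ ^ τ * (2 ^ τ * (A ^ τ + m ^ ρ)) := by
      refine (ENNReal.rpow_le_rpow hg hτ0.le).trans ?_
      rw [ENNReal.mul_rpow_of_nonneg _ _ hτ0.le]
      refine mul_le_mul_right
        ((ENNReal.add_rpow_le_two_rpow_mul_rpow_add_rpow _ _ hτ0.le).trans ?_) _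
      rw [← ENNReal.rpow_mul, hστ]
    have hpart : ∀ (s : ℝ) (c : ℝ≥0∞) (g : ℝ → ℝ≥0∞), x (j - 1) ≤ s →
        (∀ t ∈ Ioc s (x j), c ≤ g t) → phiInt p q u b s (x j) * c ≤
          ∫⁻ t in Ioc (x (j - 1)) (x j), g t * (integ u t b ^ γ * u t) := by
      intro s c g hs hc
      rw [mul_comm, phiInt, leb_coe]
      refine (lintegral_const_mul_le _ _).trans ?_
      refine le_trans (setLIntegral_mono_ae' measurableSet_Ioc
        (Filter.Eventually.of_forall fun t ht => ?_))
        (lintegral_mono_set (Ioc_subset_Ioc hs le_rfl))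
      exact mul_le_mul_left (hc t ht) _
    have hAle : phiInt p q u b z (x j) * A ^ τ ≤
        ∫⁻ t in Ioc (x (j - 1)) (x j), G t * (integ u t b ^ γ * u t) := by
      refine hpart z _ G hz.1.le fun t ht => ?_
      rw [← hcellsum]
      refine ENNReal.rpow_le_rpow (ENNReal.tsum_le_tsum fun i => ?_) hτ0.le
      refine indicator_le_indicator_of_subset ?_ (fun _ => zero_le) i
      exact fun i hi => (hx.mono (by have : i < j := hi; omega : i ≤ j - 1)).trans_lt
        (hz.1.trans ht.1)
    have hmle : phiInt p q u b z (x j) * m ^ ρ ≤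
        2 * ∫⁻ t in Ioc (x (j - 1)) (x j), G' t * (integ u t b ^ γ * u t) := by
      calc _ = (ω j ^ (-(1 / p))) ^ ρ *
            (phiInt p q u b z (x j) * V r v (x (j - 1)) z ^ ρ) := by
            rw [hm, ENNReal.mul_rpow_of_nonneg _ _ hρ.le]; ring
        _ ≤ (ω j ^ (-(1 / p))) ^ ρ *
            (2 * (phiInt p q u b (y j) (x j) * V r v (x (j - 1)) (y j) ^ ρ)) :=
            mul_le_mul_right (hy3 j z hz) _
        _ = 2 * (phiInt p q u b (y j) (x j) * subcell r p v x ω y j ^ ρ) := by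
            rw [subcell, ENNReal.mul_rpow_of_nonneg _ _ hρ.le]; ring
        _ ≤ _ := by
            refine mul_le_mul_right (hpart (y j) _ G' (hy2 j) fun t ht => ?_) _
            refine ENNReal.rpow_le_rpow (le_trans (le_of_eq ?_) (le_mulNorm hp hr _ j)) hρ.le
            rw [indicator_of_mem (show j ∈ {j | y j < t} from ht.1)]
    calc _ ≤ phiInt p q u b z (x j) * (K₂ ^ τ * (2 ^ τ * (A ^ τ + m ^ ρ))) :=
          mul_le_mul_right hgτ _
      _ = K₂ ^ τ * (2 ^ τ * (phiInt p q u b z (x j) * A ^ τ + phiInt p q u b z (x j) * m ^ ρ)) := by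
          ring
      _ ≤ K₂ ^ τ * (2 ^ τ * (2 * (∫⁻ t in Ioc (x (j - 1)) (x j), G t * (integ u t b ^ γ * u t)) +
            2 * ∫⁻ t in Ioc (x (j - 1)) (x j), G' t * (integ u t b ^ γ * u t))) :=
          mul_le_mul_right (mul_le_mul_right (add_le_add
            (hAle.trans (le_mul_of_one_le_left' (by norm_num))) hmle) _) _
      _ = _ := by rw [hκ, hψ]; ring
  -- Since j ≤ l, the factor 1/𝒲(z) ≤ ω_j^(-1) may be replaced by ω_l^(-1) under the sum over l; the
  -- bound then no longer depends on j.
  have hinner : ∀ j k, j ≤ k → ∀ z ∈ Ioc (x (j - 1)) (x j), ∀ s ∈ Ioc (x (k - 1)) (x k),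
      integ w z b ^ (-1 : ℝ) * phiInt p q u b z s * gInt r p v w a b z ^ τ ≤
        κ * ∑' i : ℕ, ω (k - i) ^ (-1 : ℝ) * ψ (k - i) := by
    intro j k hjk z hz s hs
    have hcov : Ioc z s ⊆ ⋃ l : {l // j ≤ l ∧ l ≤ k}, Ioc (x (l - 1)) (x l) ∩ Ioi z := by
      intro t ht
      obtain ⟨l, hl⟩ := hx.exists_mem (t := t)
        ⟨by exact_mod_cast ((hx.left_le _).trans_lt hz.1).trans ht.1,
          lt_of_le_of_lt (by exact_mod_cast ht.2.trans hs.2) (hx.lt_right k)⟩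
      have h4 := hx.le_of_lt ((hz.1.trans ht.1).trans_le hl.2)
      have h5 := hx.le_of_lt (hl.1.trans_le (ht.2.trans hs.2))
      exact mem_iUnion.2 ⟨⟨l, by omega, by omega⟩, hl, ht.1⟩
    have hsum : phiInt p q u b z s * gInt r p v w a b z ^ τ ≤
        ∑' l : {l // j ≤ l ∧ l ≤ k}, κ * ψ l := by
      calc _ ≤ (∑' l : {l // j ≤ l ∧ l ≤ k}, ∫⁻ t in Ioc (x (l - 1)) (x l) ∩ Ioi z,
            integ u t b ^ γ * u t) * gInt r p v w a b z ^ τ := by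
            refine mul_le_mul_left ?_ _
            rw [phiInt, leb_coe]
            exact (lintegral_mono_set hcov).trans (lintegral_iUnion_le _ _)
        _ ≤ _ := by
            rw [← ENNReal.tsum_mul_right]
            refine ENNReal.tsum_le_tsum fun ⟨l, hl1, hl2⟩ => ?_
            rcases hl1.eq_or_lt with rfl | hl
            · refine le_trans (mul_le_mul_left ?_ _) (hearly j z hz)
              rw [phiInt, leb_coe]
              exact lintegral_mono_set fun t ht => ⟨ht.2, ht.1.2⟩
            · exact le_trans (mul_le_mul_left (lintegral_mono_set inter_subset_left) _)
                (hlate j l hl z hz)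
    calc _ = integ w z b ^ (-1 : ℝ) * (phiInt p q u b z s * gInt r p v w a b z ^ τ) :=
          mul_assoc _ _ _
      _ ≤ ω j ^ (-1 : ℝ) * ∑' l : {l // j ≤ l ∧ l ≤ k}, κ * ψ l :=
          mul_le_mul' (rpow_neg_anti (hx.le_tail hz) zero_le_one) hsum
      _ ≤ κ * ∑' l : {l // j ≤ l ∧ l ≤ k}, ω l ^ (-1 : ℝ) * ψ l := by
          rw [← ENNReal.tsum_mul_left, ← ENNReal.tsum_mul_left]
          refine ENNReal.tsum_le_tsum fun ⟨l, hl1, hl2⟩ => ?_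
          rw [mul_left_comm]
          exact mul_le_mul_right (mul_le_mul_left
            (rpow_neg_anti (hx.halving.anti hl1) zero_le_one) _) _
      _ ≤ _ := by
          refine mul_le_mul_right ?_ _
          refine le_trans (le_of_eq ?_)
            (tsum_indicator_Icc_le (fun l => ω l ^ (-1 : ℝ) * ψ l) j k)
          exact tsum_subtype {l | j ≤ l ∧ l ≤ k} fun l => ω l ^ (-1 : ℝ) * ψ l
  have hup := hx.step_upper S.hw.meas le_rfl
    (f := fun s => essSup (fun y : ℝ => integ w y b ^ (-1 : ℝ) *
      (∫⁻ t : ℝ, integ u t b ^ γ * u t ∂(leb y s)) *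
      (∫⁻ t : ℝ, integ w t b ^ (-(p / (p - r))) * w t * V r v t y ^ σ ∂(leb a y)) ^ τ) (leb a s))
    (a := fun k => κ * ∑' i : ℕ, ω (k - i) ^ (-1 : ℝ) * ψ (k - i)) fun k s hs => by
      have hsb : s ∈ ival a b := hx.block_subset k hs
      refine essSup_leb_le fun z hz => ?_
      have hzs : z < s := by exact_mod_cast hz.2
      obtain ⟨j, hj⟩ := hx.exists_mem (t := z) ⟨hz.1, hz.2.trans hsb.2⟩
      have hjk : j ≤ k := by
        have := hx.le_of_lt (hj.1.trans (hzs.trans_le hs.2))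
        omega
      exact hinner j k hjk z hj s hs
  simp only [ENNReal.rpow_zero, one_mul, add_zero, ENNReal.rpow_one] at hup
  calc _ = _ := lintegral_congr fun s => mul_comm _ _
    _ ≤ _ := hup
    _ = κ * ∑' k, ω k * (∑' i : ℕ, ω (k - i) ^ (-1 : ℝ) * ψ (k - i)) ^ (1 : ℝ) := by
        rw [← ENNReal.tsum_mul_left]
        refine tsum_congr fun k => ?_
        rw [ENNReal.rpow_one, mul_left_comm]
    _ ≤ κ * (K₃ * ∑' k, ω k * (ω k ^ (-1 : ℝ) * ψ k) ^ (1 : ℝ)) := by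
        refine mul_le_mul_right (h₃ ω (fun n i => ?_) fun k => ω k ^ (-1 : ℝ) * ψ k) _
        have := hx.geom (α := 1) n i
        simpa only [ENNReal.rpow_one] using this
    _ = κ * (K₃ * ∑' k, ψ k) := by
        congr 2
        refine tsum_congr fun k => ?_
        rw [ENNReal.rpow_one, ← mul_assoc, ENNReal.rpow_neg_one,
          ENNReal.mul_inv_cancel (hx.halving.ne_zero k) (hx.halving.ne_top k), one_mul]
    _ ≤ κ * (K₃ * (2 * K₁ * C ^ ρ)) := by gcongr
    _ = _ := by ring

end necessity

/-! ### Finiteness of the tails of `u` -/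

section finiteness
variable {r p q : ℝ} {a : ℝ} {b : EReal} {u v w : ℝ → ℝ≥0∞}

lemma lintegral_leb_eq_top {F : ℝ → ℝ≥0∞} {y z : EReal} (h : y < z)
    (hF : ∀ᵐ t ∂(leb y z), F t = ∞) : ∫⁻ t, F t ∂(leb y z) = ∞ := by
  rw [lintegral_congr_ae (g := fun _ => ∞) hF, lintegral_const, ENNReal.top_mul]
  rw [Ne, Measure.measure_univ_eq_zero]
  exact leb_ne_zero h

lemma IsWeight.V_pos (hv : IsWeight a b v) (hr : 0 < r) (hr1 : r ≤ 1) {y z : EReal} (hy : a ≤ y)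
    (hyz : y < z) (hz : z ≤ b) : 0 < V r v y z :=
  CesHardy.V_pos hr hr1 hyz (hv.meas.mono_measure (leb_mono hy hz)) (ae_mono (leb_mono hy hz) hv.pos)

lemma TailOK.rpow_pos (hW : TailOK a b w) {y : ℝ} (hy : y ∈ ival a b) (s : ℝ) :
    0 < integ w y b ^ s := ENNReal.rpow_pos (hW y hy).1 (hW y hy).2.ne

/-- The sufficiency argument needs dyadic points for `u`, so finiteness of the characterizing
quantity must first exclude infinite tails. The auxiliary y leaves room for an interval on which V
is positive, which makes that quantity infinite. -/
lemma tailOK_of_ne_top (hu : IsWeight a b u)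
    (h : ∀ y z : ℝ, (a : EReal) < y → y < z → (z : EReal) < b → integ u z b = ∞ → False) :
    TailOK a b u := by
  intro z hz
  refine ⟨hu.integ_pos hz.1.le hz.2 le_rfl, lt_top_iff_ne_top.2 fun hT => ?_⟩
  obtain ⟨y, hy1, hy2⟩ := exists_real_btwn hz.1
  exact h y z hy1 (by exact_mod_cast hy2) hz.2 hT

lemma tailOK_of_C1 (hr : 0 < r) (hr1 : r ≤ 1) (hp : 0 < p) (hq : 0 < q) (hu : IsWeight a b u)
    (hv : IsWeight a b v) (hW : TailOK a b w) (h : C1 a b r p q u v w ≠ ∞) : TailOK a b u := by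
  refine tailOK_of_ne_top hu fun y z hay hyz hzb hT => h ?_
  have hyz' : (y : EReal) < z := by exact_mod_cast hyz
  have h1 := C1_lower (u := u) (v := v) (w := w) hr hr1 hp hq (show a ≤ y by exact_mod_cast hay.le) hzb
  rwa [hT, ENNReal.top_rpow_of_pos (by positivity), ENNReal.top_mul
    (hv.V_pos hr hr1 hay.le hyz' hzb.le).ne',
    ENNReal.mul_top (hW.rpow_pos ⟨hay, hyz'.trans hzb⟩ _).ne', top_le_iff] at h1

lemma tailOK_of_C2 (hr : 0 < r) (hr1 : r ≤ 1) (hp : 0 < p) (hq : 0 < q) (hq1 : q < 1)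
    (hu : IsWeight a b u) (hv : IsWeight a b v) (hW : TailOK a b w)
    (h : C2 a b r p q u v w ≠ ∞) : TailOK a b u := by
  refine tailOK_of_ne_top hu fun y z hay hyz hzb hT => h ?_
  have hd : 0 < 1 - q := by linarith
  have hyz' : (y : EReal) < z := by exact_mod_cast hyz
  have h1 := C2_lower (v := v) (w := w) hr hr1 hp hq hq1 hu.meas
    (show a ≤ y by exact_mod_cast hay.le) (hyz'.trans hzb)
  have hint : ∫⁻ t : ℝ, integ u t b ^ (q / (1 - q)) * u t * V r v y t ^ (q / (1 - q)) ∂(leb y b) =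
      ∞ := by
    rw [← top_le_iff]
    refine le_trans (ge_of_eq (lintegral_leb_eq_top hyz' ?_))
      (lintegral_mono' (leb_mono le_rfl hzb.le) le_rfl)
    filter_upwards [ae_mono (leb_mono hay.le hzb.le) hu.pos,
      ae_restrict_mem (measurableSet_ival y z)] with t hut ht
    have hUt : integ u t b = ∞ := top_le_iff.1 (hT.ge.trans (integ_mono ht.2.le le_rfl u))
    have hV := hv.V_pos hr hr1 hay.le ht.1 (ht.2.trans hzb).le
    rw [hUt, ENNReal.top_rpow_of_pos (by positivity), ENNReal.top_mul hut.ne', ENNReal.top_mul]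
    rw [Ne, ENNReal.rpow_eq_zero_iff_of_pos (by positivity)]
    exact hV.ne'
  rwa [intConst, hint, ENNReal.top_rpow_of_pos (by positivity),
    ENNReal.mul_top (hW.rpow_pos ⟨hay, hyz'.trans hzb⟩ _).ne', top_le_iff] at h1

lemma tailOK_of_C4 (hr : 0 < r) (hr1 : r ≤ 1) (hp : 0 < p) (hq : 0 < q) (hqp : q < p)
    (hu : IsWeight a b u) (hv : IsWeight a b v) (hW : TailOK a b w)
    (h : C4 a b r p q u v w ≠ ∞) : TailOK a b u := by
  refine tailOK_of_ne_top hu fun y z hay hyz hzb hT => h ?_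
  have hρ := rho_pos hp hq hqp
  have hd : 0 < p - q := by linarith
  have hyz' : (y : EReal) < z := by exact_mod_cast hyz
  rw [C4, ← top_le_iff]
  refine le_trans (le_of_eq (ENNReal.top_rpow_of_pos (y := (p - q) / (p * q)) ?_).symm)
    (ENNReal.rpow_le_rpow ?_ ?_)
  · rw [rho_inv]; positivity
  swap
  · rw [rho_inv]; positivity
  refine le_trans (ge_of_eq (lintegral_leb_eq_top hyz' ?_))
    (lintegral_mono' (leb_mono hay.le hzb.le) le_rfl)
  filter_upwards [ae_mono (leb_mono hay.le hzb.le) hu.pos,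
    ae_restrict_mem (measurableSet_ival y z)] with t hut ht
  have hUt : integ u t b = ∞ := top_le_iff.1 (hT.ge.trans (integ_mono ht.2.le le_rfl u))
  have hV := hv.V_pos hr hr1 hay.le ht.1 (ht.2.trans hzb).le
  have h1 := le_essSup_V (v := v) (a := a) (s := y) (x := t) hr hr1 (by exact_mod_cast hay.le)
    (A := fun s : ℝ => integ w s b ^ (-(q / (p - q))))
    (fun s hs _ => integ_rpow_neg_mono (by positivity) hs.le) hρ
  rw [hUt, ENNReal.top_rpow_of_pos (by positivity), ENNReal.top_mul hut.ne', ENNReal.top_mul]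
  refine (lt_of_lt_of_le ?_ h1).ne'
  refine ENNReal.mul_pos (hW.rpow_pos ⟨hay, hyz'.trans hzb⟩ _).ne' ?_
  rw [Ne, ENNReal.rpow_eq_zero_iff_of_pos hρ]
  exact hV.ne'

end finiteness

/-! ### The characterization in the seven cases -/

/-- The quantity `D` characterizes the inequality, with constant `K`. -/
def Characterizes (r p q : ℝ) (D : EReal → EReal → (ℝ → ℝ≥0∞) → (ℝ → ℝ≥0∞) → (ℝ → ℝ≥0∞) → ℝ≥0∞)
    (K : ℝ≥0) : Prop :=
  ∀ (a b : EReal) (u v w : ℝ → ℝ≥0∞), 0 ≤ a → a < b →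
    IsWeight a b u → IsWeight a b v → IsWeight a b w →
    (∀ x ∈ ival a b, 0 < integ w (x : ℝ) b ∧ integ w (x : ℝ) b < ∞) →
      (HardyHolds a b r p q u v w ↔ D a b u v w < ∞) ∧
        EquivWith K (bestConst a b r p q u v w) (D a b u v w)

section cases
variable {r p q : ℝ} {D : EReal → EReal → (ℝ → ℝ≥0∞) → (ℝ → ℝ≥0∞) → (ℝ → ℝ≥0∞) → ℝ≥0∞}

lemma Characterizes.mono {K K' : ℝ≥0} (h : Characterizes r p q D K) (hK : K ≤ K') :
    Characterizes r p q D K' := by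
  intro a b u v w ha hab hu hv hw hW
  obtain ⟨h1, h2, h3⟩ := h a b u v w ha hab hu hv hw hW
  have hK' : (K : ℝ≥0∞) ≤ K' := by exact_mod_cast hK
  exact ⟨h1, h2.trans (mul_le_mul_left hK' _), h3.trans (mul_le_mul_left hK' _)⟩

lemma HardyIneq.mono {a b : EReal} {u v w : ℝ → ℝ≥0∞} {C C' : ℝ≥0∞}
    (h : HardyIneq a b r p q u v w C) (hC : C ≤ C') : HardyIneq a b r p q u v w C' :=
  fun f hf => (h f hf).trans (mul_le_mul_left hC _)

/-- The common frame of the seven cases. Sufficiency goes through the block and chain constants once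
D < ∞ has provided finite tails of `u`; for necessity the tails are finite by `HardyIneq.tailOK`. -/
lemma exists_characterizes (hr : 0 < r) (hr1 : r ≤ 1) (hp : 0 < p) (hq : 0 < q)
    (hfin : ∀ (a : ℝ) (b : EReal) (u v w : ℝ → ℝ≥0∞), IsWeight a b u → IsWeight a b v →
      TailOK a b w → D a b u v w ≠ ∞ → TailOK a b u)
    (hblock : ∃ K : ℝ≥0∞, K ≠ ∞ ∧ ∀ (a : ℝ) (b : EReal) (u v w : ℝ → ℝ≥0∞) (x : ℤ → ℝ)
      (ω : ℤ → ℝ≥0∞), Setup a b u v w → Dyadic a b w x ω →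
        blockConst r p q u v x ω ≤ K * D a b u v w)
    (hchain : ∃ K : ℝ≥0∞, K ≠ ∞ ∧ ∀ (a : ℝ) (b : EReal) (u v w : ℝ → ℝ≥0∞) (x t : ℤ → ℝ)
      (ω θ : ℤ → ℝ≥0∞), Setup a b u v w → Dyadic a b w x ω → Dyadic a b u t θ →
        chainConst r p q v x ω t θ ≤ K * D a b u v w)
    (hnec : ∃ K : ℝ≥0∞, K ≠ ∞ ∧ ∀ (a : ℝ) (b : EReal) (u v w : ℝ → ℝ≥0∞) (C : ℝ≥0∞),
      HardyIneq a b r p q u v w C → C ≠ ∞ → Setup a b u v w → D a b u v w ≤ K * C) :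
    ∃ K : ℝ≥0, Characterizes r p q D K := by
  obtain ⟨K₁, hK₁, h₁⟩ := hblock
  obtain ⟨K₂, hK₂, h₂⟩ := hchain
  obtain ⟨K₃, hK₃, h₃⟩ := hnec
  obtain ⟨K₀, hK₀, h₀⟩ := hardyInt_le_blocks hr hr1 hp hq
  have hsT : K₀ * (K₁ + K₂) ≠ ∞ := ENNReal.mul_ne_top hK₀ (ENNReal.add_ne_top.2 ⟨hK₁, hK₂⟩)
  have hKT : K₀ * (K₁ + K₂) + K₃ + 1 ≠ ∞ :=
    ENNReal.add_ne_top.2 ⟨ENNReal.add_ne_top.2 ⟨hsT, hK₃⟩, by norm_num⟩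
  refine ⟨(K₀ * (K₁ + K₂) + K₃ + 1).toNNReal, fun a b u v w ha hab hu hv hw hW => ?_⟩
  rw [EquivWith, ENNReal.coe_toNNReal hKT]
  set K := K₀ * (K₁ + K₂) + K₃ + 1 with hK
  have hK0 : K ≠ 0 := by rw [hK]; simp
  -- The assumption 0 ≤ a < b makes a finite, as the arguments with a real left end point require.
  have haB : a ≠ ⊥ := (lt_of_lt_of_le (by simp) ha).ne'
  have haT : a ≠ ⊤ := hab.ne_top
  lift a to ℝ using ⟨haT, haB⟩
  have hsuf : D a b u v w ≠ ∞ → HardyIneq a b r p q u v w (K₀ * (K₁ + K₂) * D a b u v w) := by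
    intro hD
    have S : Setup a b u v w := ⟨hab, hu, hv, hw, hW, hfin a b u v w hu hv hW hD⟩
    obtain ⟨x, ω, hx⟩ := S.hW.exists_dyadic S.hab
    obtain ⟨t, θ, ht⟩ := S.hU.exists_dyadic S.hab
    refine (h₀ a b u v w x t ω θ S hx ht).mono ?_
    rw [mul_assoc, add_mul]
    exact mul_le_mul_right (add_le_add (h₁ a b u v w x ω S hx) (h₂ a b u v w x t ω θ S hx ht)) _
  have hnec : ∀ C, C ≠ ∞ → HardyIneq a b r p q u v w C → D a b u v w ≤ K₃ * C := fun C hC H =>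
    h₃ a b u v w C H hC ⟨hab, hu, hv, hw, hW, H.tailOK hr hr1 hp hq hC hu hv hw.meas hW⟩
  refine ⟨⟨fun ⟨C, hC⟩ => ?_, fun hD => ?_⟩, ?_, ?_⟩
  · exact (hnec C ENNReal.coe_ne_top hC).trans_lt
      (lt_top_iff_ne_top.2 (ENNReal.mul_ne_top hK₃ ENNReal.coe_ne_top))
  · refine ⟨(K₀ * (K₁ + K₂) * D a b u v w).toNNReal, ?_⟩
    rw [ENNReal.coe_toNNReal (ENNReal.mul_ne_top hsT hD.ne)]
    exact hsuf hD.ne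
  · rcases eq_or_ne (D a b u v w) ∞ with hD | hD
    · rw [hD, ENNReal.mul_top hK0]; exact le_top
    · refine (sInf_le (hsuf hD)).trans (mul_le_mul_left ?_ _)
      rw [hK, add_assoc]
      exact le_self_add
  · rw [mul_comm, ← ENNReal.div_le_iff hK0 hKT]
    refine le_sInf fun C hC => ?_
    rw [ENNReal.div_le_iff hK0 hKT]
    rcases eq_or_ne C ∞ with rfl | hCT
    · rw [ENNReal.top_mul hK0]; exact le_top
    · refine (hnec C hCT hC).trans ?_
      rw [mul_comm]
      refine mul_le_mul_right ?_ _
      rw [hK, add_assoc, add_left_comm]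
      exact le_self_add

end cases

section sevenCases
variable {r p q : ℝ}

lemma exists_le_mul_add {D E : ℝ → EReal → (ℝ → ℝ≥0∞) → (ℝ → ℝ≥0∞) → (ℝ → ℝ≥0∞) → ℝ≥0∞}
    (hD : ∃ K : ℝ≥0∞, K ≠ ∞ ∧ ∀ (a : ℝ) (b : EReal) (u v w : ℝ → ℝ≥0∞) (C : ℝ≥0∞),
      HardyIneq a b r p q u v w C → C ≠ ∞ → Setup a b u v w → D a b u v w ≤ K * C)
    (hE : ∃ K : ℝ≥0∞, K ≠ ∞ ∧ ∀ (a : ℝ) (b : EReal) (u v w : ℝ → ℝ≥0∞) (C : ℝ≥0∞),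
      HardyIneq a b r p q u v w C → C ≠ ∞ → Setup a b u v w → E a b u v w ≤ K * C) :
    ∃ K : ℝ≥0∞, K ≠ ∞ ∧ ∀ (a : ℝ) (b : EReal) (u v w : ℝ → ℝ≥0∞) (C : ℝ≥0∞),
      HardyIneq a b r p q u v w C → C ≠ ∞ → Setup a b u v w →
        D a b u v w + E a b u v w ≤ K * C := by
  obtain ⟨K, hK, h⟩ := hD
  obtain ⟨L, hL, h'⟩ := hE
  refine ⟨K + L, ENNReal.add_ne_top.2 ⟨hK, hL⟩, fun a b u v w C H hC S => ?_⟩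
  rw [add_mul]
  exact add_le_add (h a b u v w C H hC S) (h' a b u v w C H hC S)

lemma exists_C1_le (hr : 0 < r) (hr1 : r ≤ 1) (hp : 0 < p) (hq : 0 < q) :
    ∃ K : ℝ≥0∞, K ≠ ∞ ∧ ∀ (a : ℝ) (b : EReal) (u v w : ℝ → ℝ≥0∞) (C : ℝ≥0∞),
      HardyIneq a b r p q u v w C → C ≠ ∞ → Setup a b u v w → C1 a b r p q u v w ≤ K * C :=
  ⟨1, by norm_num, fun a b u v w C H hC S => by
    rw [one_mul]; exact C1_le hr hr1 hp hq H hC S⟩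

lemma mul_add_mul_le (K A L B : ℝ≥0∞) : K * (A + L * B) ≤ K * (1 + L) * (B + A) := by
  calc K * (A + L * B) ≤ K * (A + L * B + (B + L * A)) := mul_le_mul_right le_self_add _
    _ = _ := by ring

lemma mul_one_add_ne_top {K L : ℝ≥0∞} (hK : K ≠ ∞) (hL : L ≠ ∞) : K * (1 + L) ≠ ∞ :=
  ENNReal.mul_ne_top hK (ENNReal.add_ne_top.2 ⟨by norm_num, hL⟩)

lemma two_mul_two_rpow_rpow_ne_top {s : ℝ} (hs : 0 ≤ s) (c : ℝ) :
    ((2 : ℝ≥0∞) * 2 ^ c) ^ s ≠ ∞ :=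
  ENNReal.rpow_ne_top_of_nonneg hs (ENNReal.mul_ne_top (by norm_num) (two_rpow_ne_top _))

lemma exists_characterizes_C1 (hr : 0 < r) (hr1 : r ≤ 1) (hp : 0 < p) (hq : 1 ≤ q) (hpr : p ≤ r) :
    ∃ K : ℝ≥0, Characterizes r p q (fun a b u v w => C1 a b r p q u v w) K := by
  have hq0 : 0 < q := by linarith
  have hpq : p ≤ q := by linarith
  refine exists_characterizes hr hr1 hp hq0
    (fun a b u v w hu hv hW h => tailOK_of_C1 hr hr1 hp hq0 hu hv hW h)
    ⟨_, two_rpow_ne_top (1 / p), fun a b u v w x ω S hx => blockConst_le_C1 hr hr1 hp hq hpq hx⟩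
    ⟨_, two_rpow_ne_top (1 / p), fun a b u v w x t ω θ S hx ht =>
      chainConst_le_of_le hq0 hpq hpr ht fun j hj => cell_le_C1 hr hr1 hp hq0 hx j hj⟩
    (exists_C1_le hr hr1 hp hq0)

lemma exists_characterizes_C2 (hr : 0 < r) (hr1 : r ≤ 1) (hp : 0 < p) (hq : 0 < q) (hpq : p ≤ q)
    (hq1 : q < 1) (hpr : p ≤ r) :
    ∃ K : ℝ≥0, Characterizes r p q (fun a b u v w => C2 a b r p q u v w) K := by
  refine exists_characterizes hr hr1 hp hq
    (fun a b u v w hu hv hW h => tailOK_of_C2 hr hr1 hp hq hq1 hu hv hW h)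
    ⟨_, two_rpow_ne_top (1 / p), fun a b u v w x ω S hx =>
      blockConst_le_C2 hr hr1 hp hq hq1 hpq S.hu.meas hx⟩
    ⟨_, ENNReal.mul_ne_top (two_rpow_ne_top (1 / q)) (two_rpow_ne_top (1 / p)),
      fun a b u v w x t ω θ S hx ht =>
      chainConst_le_of_le hq hpq hpr ht fun j hj => cell_le_C2 hr hr1 hp hq hq1 S hx j hj⟩
    (C2_le hr hr1 hp hq hq1)

lemma exists_characterizes_C1_C3 (hr : 0 < r) (hr1 : r ≤ 1) (hrp : r < p) (hpq : p ≤ q)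
    (hq : 1 ≤ q) : ∃ K : ℝ≥0, Characterizes r p q
      (fun a b u v w => C1 a b r p q u v w + C3 a b r p q u v w) K := by
  have hq0 : 0 < q := by linarith
  have hp : 0 < p := by linarith
  obtain ⟨K, hK, h⟩ := chainConst_le_C3 hr hr1 hrp hq0 hpq
  refine exists_characterizes hr hr1 hp hq0
    (fun a b u v w hu hv hW h => tailOK_of_C1 hr hr1 hp hq0 hu hv hW (ENNReal.add_ne_top.1 h).1)
    ⟨_, two_rpow_ne_top (1 / p), fun a b u v w x ω S hx =>
      (blockConst_le_C1 hr hr1 hp hq hpq hx).trans (mul_le_mul_right le_self_add _)⟩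
    ⟨_, mul_one_add_ne_top hK (two_rpow_ne_top (1 / p)), fun a b u v w x t ω θ S hx ht =>
      (h a b u v w x t ω θ hx ht _ fun j hj => cell_le_C1 hr hr1 hp hq0 hx j hj).trans
        (mul_add_mul_le _ _ _ _)⟩
    (exists_le_mul_add (exists_C1_le hr hr1 hp hq0) (C3_le hr hr1 hrp hq0))

lemma exists_characterizes_C2_C3 (hr : 0 < r) (hr1 : r ≤ 1) (hrp : r < p) (hpq : p ≤ q)
    (hq1 : q < 1) : ∃ K : ℝ≥0, Characterizes r p q
      (fun a b u v w => C2 a b r p q u v w + C3 a b r p q u v w) K := by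
  have hp : 0 < p := by linarith
  have hq : 0 < q := by linarith
  obtain ⟨K, hK, h⟩ := chainConst_le_C3 hr hr1 hrp hq hpq
  refine exists_characterizes hr hr1 hp hq
    (fun a b u v w hu hv hW h =>
      tailOK_of_C2 hr hr1 hp hq hq1 hu hv hW (ENNReal.add_ne_top.1 h).1)
    ⟨_, two_rpow_ne_top (1 / p), fun a b u v w x ω S hx =>
      (blockConst_le_C2 hr hr1 hp hq hq1 hpq S.hu.meas hx).trans (mul_le_mul_right le_self_add _)⟩
    ⟨_, mul_one_add_ne_top hK
        (ENNReal.mul_ne_top (two_rpow_ne_top (1 / q)) (two_rpow_ne_top (1 / p))),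
      fun a b u v w x t ω θ S hx ht =>
      (h a b u v w x t ω θ hx ht _ fun j hj => cell_le_C2 hr hr1 hp hq hq1 S hx j hj).trans
        (mul_add_mul_le _ _ _ _)⟩
    (exists_le_mul_add (C2_le hr hr1 hp hq hq1) (C3_le hr hr1 hrp hq))

lemma exists_characterizes_C4_C5 (hr : 0 < r) (hr1 : r ≤ 1) (hq : 0 < q) (hqp : q < p)
    (hpr : p ≤ r) : ∃ K : ℝ≥0, Characterizes r p q
      (fun a b u v w => C4 a b r p q u v w + C5 a b r p q u v w) K := by
  have hp : 0 < p := by linarith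
  have hq1 : q < 1 := by linarith
  have hρ : 0 ≤ (p - q) / (p * q) := by rw [rho_inv]; exact (inv_pos.2 (rho_pos hp hq hqp)).le
  refine exists_characterizes hr hr1 hp hq
    (fun a b u v w hu hv hW h =>
      tailOK_of_C4 hr hr1 hp hq hqp hu hv hW (ENNReal.add_ne_top.1 h).1)
    ⟨_, two_mul_two_rpow_rpow_ne_top hρ (p / (p - q)), fun a b u v w x ω S hx =>
      (blockConst_le_C5 hr hr1 hp hq hqp hq1 S.hu.meas hx).trans (mul_le_mul_right le_add_self _)⟩
    ⟨_, ENNReal.rpow_ne_top_of_nonneg hρ (ENNReal.mul_ne_top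
        (two_rpow_ne_top (1 + q / (p - q))) (two_rpow_ne_top (q / (p - q)))),
      fun a b u v w x t ω θ S hx ht =>
      (chainConst_le_C4 hr hr1 hp hq hqp hpr hx ht).trans (mul_le_mul_right le_self_add _)⟩
    (exists_le_mul_add (C4_le hr hr1 hp (hpr.trans hr1) hq hqp) (C5_le hr hr1 hp hq hqp hq1))

lemma exists_characterizes_C1_C5_C6 (hr : 0 < r) (hr1 : r ≤ 1) (hq : 0 < q) (hqp : q < p)
    (hq1 : q < 1) (hrp : r < p) : ∃ K : ℝ≥0, Characterizes r p q
      (fun a b u v w => C1 a b r p q u v w + C5 a b r p q u v w + C6 a b r p q u v w) K := by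
  have hp : 0 < p := by linarith
  have hρ : 0 ≤ (p - q) / (p * q) := by rw [rho_inv]; exact (inv_pos.2 (rho_pos hp hq hqp)).le
  obtain ⟨K, hK, h⟩ := chainConst_le_C6 hr hr1 hrp hq hqp
  refine exists_characterizes hr hr1 hp hq
    (fun a b u v w hu hv hW h => tailOK_of_C1 hr hr1 hp hq hu hv hW
      (ENNReal.add_ne_top.1 (ENNReal.add_ne_top.1 h).1).1)
    ⟨_, two_mul_two_rpow_rpow_ne_top hρ (p / (p - q)), fun a b u v w x ω S hx =>
      (blockConst_le_C5 hr hr1 hp hq hqp hq1 S.hu.meas hx).trans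
        (mul_le_mul_right (le_add_self.trans le_self_add) _)⟩
    ⟨_, mul_one_add_ne_top hK (two_rpow_ne_top (1 / p)), fun a b u v w x t ω θ S hx ht =>
      (h a b u v w x t ω θ S.hu.meas hx ht _
        fun j hj => cell_le_C1 hr hr1 hp hq hx j hj).trans ((mul_add_mul_le _ _ _ _).trans
          (mul_le_mul_right (add_le_add_left le_self_add _) _))⟩
    (exists_le_mul_add (exists_le_mul_add (exists_C1_le hr hr1 hp hq) (C5_le hr hr1 hp hq hqp hq1))
      (C6_le hr hr1 hrp hq hqp))

lemma exists_characterizes_C1_C6_C7 (hr : 0 < r) (hr1 : r ≤ 1) (hq : 1 ≤ q) (hqp : q < p) :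
    ∃ K : ℝ≥0, Characterizes r p q
      (fun a b u v w => C1 a b r p q u v w + C6 a b r p q u v w + C7 a b r p q u v w) K := by
  have hp : 0 < p := by linarith
  have hq0 : 0 < q := by linarith
  have hrp : r < p := by linarith
  have hρ : 0 ≤ (p - q) / (p * q) := by rw [rho_inv]; exact (inv_pos.2 (rho_pos hp hq0 hqp)).le
  obtain ⟨K, hK, h⟩ := chainConst_le_C6 hr hr1 hrp hq0 hqp
  refine exists_characterizes hr hr1 hp hq0
    (fun a b u v w hu hv hW h => tailOK_of_C1 hr hr1 hp hq0 hu hv hW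
      (ENNReal.add_ne_top.1 (ENNReal.add_ne_top.1 h).1).1)
    ⟨_, two_mul_two_rpow_rpow_ne_top hρ (p / (p - q)), fun a b u v w x ω S hx =>
      (blockConst_le_C7 hr hr1 hp hq hqp hx).trans (mul_le_mul_right le_add_self _)⟩
    ⟨_, mul_one_add_ne_top hK (two_rpow_ne_top (1 / p)), fun a b u v w x t ω θ S hx ht =>
      (h a b u v w x t ω θ S.hu.meas hx ht _
        fun j hj => cell_le_C1 hr hr1 hp hq0 hx j hj).trans ((mul_add_mul_le _ _ _ _).trans
          (mul_le_mul_right le_self_add _))⟩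
    (exists_le_mul_add (exists_le_mul_add (exists_C1_le hr hr1 hp hq0) (C6_le hr hr1 hrp hq0 hqp))
      (C7_le hr hr1 hp hq hqp))

/-- Each case has a constant only under its own conditions on p, q, r; outside of them any number
will do, so that one constant serves all cases. -/
lemma exists_nnreal_forall_ge {P : Prop} {Q : ℝ≥0 → Prop} (h : P → ∃ K, Q K)
    (hmono : ∀ K K', K ≤ K' → Q K → Q K') : ∃ K, ∀ K', K ≤ K' → P → Q K' := by
  by_cases hP : P
  · obtain ⟨K, hK⟩ := h hP
    exact ⟨K, fun K' hK' _ => hmono K K' hK' hK⟩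
  · exact ⟨0, fun _ _ h' => absurd h' hP⟩

end sevenCases


/-! ### Embeddings between weighted Cesàro spaces -/

section embedding
variable {a b : EReal} {p₁ q₁ p₂ q₂ : ℝ} {u₁ v₁ u₂ v₂ : ℝ → ℝ≥0∞}

lemma lintegral_rpow_lintegral_congr {g g' : ℝ → ℝ≥0∞} (h : g =ᵐ[leb a b] g') (s : ℝ)
    (u : ℝ → ℝ≥0∞) :
    ∫⁻ t : ℝ, (∫⁻ s, g s ∂(leb a t)) ^ s * u t ∂(leb a b) =
      ∫⁻ t : ℝ, (∫⁻ s, g' s ∂(leb a t)) ^ s * u t ∂(leb a b) := by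
  refine lintegral_congr_ae ?_
  filter_upwards [ae_restrict_mem (measurableSet_ival a b)] with t ht
  rw [lintegral_congr_ae (ae_mono (leb_mono le_rfl ht.2.le) h)]

lemma cesNorm_rpow (hp : 0 < p₁) {p q : ℝ} {u v f g : ℝ → ℝ≥0∞}
    (h : (fun s => f s ^ p * v s ^ p) =ᵐ[leb a b] g) :
    cesNorm a b p q u v f ^ p₁ =
      (∫⁻ t : ℝ, (∫⁻ s, g s ∂(leb a t)) ^ (q / p₁ / (p / p₁)) * u t ^ q ∂(leb a b)) ^
        (1 / (q / p₁)) := by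
  rw [cesNorm, lintegral_rpow_lintegral_congr h, ← ENNReal.rpow_mul,
    div_div_div_cancel_right₀ hp.ne', one_div_div, one_div_mul_eq_div]

lemma quotient_weight_mul_rpow (hp₁ : 0 < p₁) (hp₂ : 0 < p₂) {x y z : ℝ≥0∞} (hy : y ≠ 0)
    (hy' : y ≠ ∞) : (x ^ p₁ * y ^ p₁) ^ (p₂ / p₁) * (z / y) ^ p₂ = x ^ p₂ * z ^ p₂ := by
  rw [← ENNReal.mul_rpow_of_nonneg _ _ hp₁.le, ← ENNReal.rpow_mul, mul_div_cancel₀ _ hp₁.ne',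
    ← ENNReal.mul_rpow_of_nonneg _ _ hp₂.le, ← ENNReal.mul_rpow_of_nonneg _ _ hp₂.le, mul_assoc,
    ENNReal.mul_div_cancel hy hy']

/-- With g = (f v₁)^p₁ the p₁-th power of the embedding inequality is the Hardy inequality for g.
Since v₁ is positive and finite almost everywhere, every g arises in this way. -/
lemma cesIneq_iff (hp₁ : 0 < p₁) (hp₂ : 0 < p₂) (hv₁ : IsWeight a b v₁) {c : ℝ≥0∞} :
    CesIneq a b p₁ q₁ p₂ q₂ u₁ v₁ u₂ v₂ c ↔
      HardyIneq a b (p₂ / p₁) (q₁ / p₁) (q₂ / p₁)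
        (fun t => u₂ t ^ q₂) (fun t => (v₂ t / v₁ t) ^ p₂) (fun t => u₁ t ^ q₁) (c ^ p₁) := by
  have key : ∀ f g : ℝ → ℝ≥0∞, (fun s => f s ^ p₁ * v₁ s ^ p₁) =ᵐ[leb a b] g →
      (cesNorm a b p₂ q₂ u₂ v₂ f ≤ c * cesNorm a b p₁ q₁ u₁ v₁ f ↔
        (∫⁻ t : ℝ, (∫⁻ s, g s ^ (p₂ / p₁) * (v₂ s / v₁ s) ^ p₂ ∂(leb a t)) ^
          (q₂ / p₁ / (p₂ / p₁)) * u₂ t ^ q₂ ∂(leb a b)) ^ (1 / (q₂ / p₁)) ≤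
        c ^ p₁ * (∫⁻ t : ℝ, (∫⁻ s, g s ∂(leb a t)) ^ (q₁ / p₁) * u₁ t ^ q₁ ∂(leb a b)) ^
          (1 / (q₁ / p₁))) := by
    intro f g hg
    have h2 : (fun s => f s ^ p₂ * v₂ s ^ p₂) =ᵐ[leb a b]
        fun s => g s ^ (p₂ / p₁) * (v₂ s / v₁ s) ^ p₂ := by
      filter_upwards [hg, hv₁.pos, hv₁.fin] with s hs h0 hT
      rw [← hs, quotient_weight_mul_rpow hp₁ hp₂ h0.ne' hT.ne]
    rw [← ENNReal.rpow_le_rpow_iff hp₁, ENNReal.mul_rpow_of_nonneg _ _ hp₁.le,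
      cesNorm_rpow hp₁ h2, cesNorm_rpow hp₁ hg, div_self hp₁.ne', div_one]
  constructor
  · intro H g hg
    have hfg : (fun s => (g s ^ p₁⁻¹ / v₁ s) ^ p₁ * v₁ s ^ p₁) =ᵐ[leb a b] g := by
      filter_upwards [hv₁.pos, hv₁.fin] with s h0 hT
      rw [← ENNReal.mul_rpow_of_nonneg _ _ hp₁.le, ENNReal.div_mul_cancel h0.ne' hT.ne,
        ENNReal.rpow_inv_rpow hp₁.ne']
    exact (key _ g hfg).1 (H _ ((AEMeasurable.pow_const hg _).div hv₁.meas))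
  · intro H f hf
    exact (key f _ (ae_eq_refl _)).2
      (H _ ((AEMeasurable.pow_const hf _).mul (hv₁.meas.pow_const _)))

lemma cesEmbeds_iff (hp₁ : 0 < p₁) (hp₂ : 0 < p₂) (hv₁ : IsWeight a b v₁) :
    CesEmbeds a b p₁ q₁ p₂ q₂ u₁ v₁ u₂ v₂ ↔
      HardyHolds a b (p₂ / p₁) (q₁ / p₁) (q₂ / p₁)
        (fun t => u₂ t ^ q₂) (fun t => (v₂ t / v₁ t) ^ p₂) (fun t => u₁ t ^ q₁) := by
  constructor
  · rintro ⟨c, hc⟩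
    refine ⟨c ^ p₁, ?_⟩
    rw [ENNReal.coe_rpow_of_nonneg _ hp₁.le]
    exact (cesIneq_iff hp₁ hp₂ hv₁).1 hc
  · rintro ⟨C, hC⟩
    refine ⟨C ^ p₁⁻¹, (cesIneq_iff hp₁ hp₂ hv₁).2 ?_⟩
    rwa [ENNReal.coe_rpow_of_nonneg _ (inv_nonneg.2 hp₁.le), ENNReal.rpow_inv_rpow hp₁.ne']

lemma cesConst_rpow (hp₁ : 0 < p₁) (hp₂ : 0 < p₂) (hv₁ : IsWeight a b v₁) :
    cesConst a b p₁ q₁ p₂ q₂ u₁ v₁ u₂ v₂ ^ p₁ =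
      bestConst a b (p₂ / p₁) (q₁ / p₁) (q₂ / p₁)
        (fun t => u₂ t ^ q₂) (fun t => (v₂ t / v₁ t) ^ p₂) (fun t => u₁ t ^ q₁) := by
  refine le_antisymm (le_sInf fun C hC => ?_) ?_
  · rw [← ENNReal.le_rpow_inv_iff hp₁]
    refine sInf_le ((cesIneq_iff hp₁ hp₂ hv₁).2 ?_)
    rwa [ENNReal.rpow_inv_rpow hp₁.ne']
  · rw [← ENNReal.rpow_inv_le_iff hp₁]
    refine le_sInf fun c hc => ?_
    rw [ENNReal.rpow_inv_le_iff hp₁]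
    exact sInf_le ((cesIneq_iff hp₁ hp₂ hv₁).1 hc)

/-- For f = 1_E / v₁ the inner integrand is 1_E: the inner integral is at most |E| and vanishes for
t ≤ c. -/
lemma cesNorm_indicator_le (hp : 0 < p₁) (hq : 0 < q₁) (hv : IsWeight a b v₁) {c : ℝ}
    (hac : a < c) {E : Set ℝ} (hE : MeasurableSet E) (hT : volume E ≠ ∞) (hEc : E ⊆ Ioi c) :
    cesNorm a b p₁ q₁ u₁ v₁ (E.indicator fun s => (v₁ s)⁻¹) ≤
      integ (fun t => u₁ t ^ q₁) c b ^ (1 / q₁) * volume E ^ (1 / p₁) := by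
  have hg : (fun s => E.indicator (fun s => (v₁ s)⁻¹) s ^ p₁ * v₁ s ^ p₁) =ᵐ[leb a b]
      E.indicator 1 := by
    filter_upwards [hv.pos, hv.fin] with s h0 hT
    by_cases hs : s ∈ E
    · rw [indicator_of_mem hs, indicator_of_mem hs, ← ENNReal.mul_rpow_of_nonneg _ _ hp.le,
        ENNReal.inv_mul_cancel h0.ne' hT.ne, ENNReal.one_rpow, Pi.one_apply]
    · rw [indicator_of_notMem hs, indicator_of_notMem hs, ENNReal.zero_rpow_of_pos hp, zero_mul]
  have hin : ∀ t : ℝ, ∫⁻ s, E.indicator 1 s ∂(leb a t) = volume (E ∩ ival a t) := fun t => by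
    rw [lintegral_indicator_one hE, leb, Measure.restrict_apply hE]
  rw [cesNorm, lintegral_rpow_lintegral_congr hg]
  have hbd : ∫⁻ t : ℝ, (∫⁻ s, E.indicator 1 s ∂(leb a t)) ^ (q₁ / p₁) * u₁ t ^ q₁ ∂(leb a b) ≤
      volume E ^ (q₁ / p₁) * integ (fun t => u₁ t ^ q₁) c b := by
    have hsub : ∫⁻ t : ℝ, (∫⁻ s, E.indicator 1 s ∂(leb a t)) ^ (q₁ / p₁) * u₁ t ^ q₁ ∂(leb a b) ≤
        ∫⁻ t : ℝ, (Ioi c).indicator (fun t => volume E ^ (q₁ / p₁) * u₁ t ^ q₁) t ∂(leb a b) := by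
      refine lintegral_mono fun t => ?_
      rw [hin]
      by_cases ht : t ∈ Ioi c
      · rw [indicator_of_mem ht]
        exact mul_le_mul_left (ENNReal.rpow_le_rpow (measure_mono inter_subset_left)
          (by positivity)) _
      · have : E ∩ ival a t = ∅ := by
          refine eq_empty_of_forall_notMem fun s hs => ht ?_
          have h1 : c < s := hEc hs.1
          have h2 : s < t := by exact_mod_cast hs.2.2
          exact h1.trans h2
        rw [this, measure_empty, ENNReal.zero_rpow_of_pos (by positivity), zero_mul]
        exact zero_le
    refine hsub.trans ?_
    have hres : (leb a b).restrict (Ioi c) = leb c b := by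
      rw [leb, leb, Measure.restrict_restrict measurableSet_Ioi]
      congr 1
      ext t
      simp only [mem_inter_iff, mem_Ioi, mem_ival, EReal.coe_lt_coe_iff]
      exact ⟨fun h => ⟨h.1, h.2.2⟩, fun h => ⟨h.1, hac.trans (by exact_mod_cast h.1), h.2⟩⟩
    rw [lintegral_indicator measurableSet_Ioi, hres, integ]
    rw [lintegral_const_mul' _ _ (ENNReal.rpow_ne_top_of_nonneg (by positivity) hT)]
  refine (ENNReal.rpow_le_rpow hbd (by positivity)).trans (le_of_eq ?_)
  rw [ENNReal.mul_rpow_of_nonneg _ _ (by positivity), ← ENNReal.rpow_mul, mul_comm]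
  congr 2
  field_simp

/-- For t > d the inner integral is complete and at least δ^p₂ |E|. Against `cesNorm_indicator_le`
only the power of |E| differs. -/
lemma le_cesNorm_indicator (hp : 0 < p₂) (hq : 0 < q₂) {d : ℝ} (had : a ≤ d)
    {E : Set ℝ} (hE : MeasurableSet E) (hEd : E ⊆ ival a d) {δ : ℝ≥0∞}
    (hδ : ∀ᵐ s ∂(leb a b), s ∈ E → δ ≤ v₂ s / v₁ s) (hδT : δ ≠ ∞) (hT : volume E ≠ ∞) :
    integ (fun t => u₂ t ^ q₂) d b ^ (1 / q₂) * δ * volume E ^ (1 / p₂) ≤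
      cesNorm a b p₂ q₂ u₂ v₂ (E.indicator fun s => (v₁ s)⁻¹) := by
  have hlow : (δ ^ p₂ * volume E) ^ (q₂ / p₂) * integ (fun t => u₂ t ^ q₂) d b ≤
      ∫⁻ t : ℝ, (∫⁻ s, E.indicator (fun s => (v₁ s)⁻¹) s ^ p₂ * v₂ s ^ p₂ ∂(leb a t)) ^ (q₂ / p₂) *
        u₂ t ^ q₂ ∂(leb a b) := by
    rw [integ, ← lintegral_const_mul' _ _ (ENNReal.rpow_ne_top_of_nonneg (by positivity)
      (ENNReal.mul_ne_top (ENNReal.rpow_ne_top_of_nonneg hp.le hδT) hT))]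
    refine le_trans (lintegral_mono_ae ?_) (lintegral_mono' (leb_mono had le_rfl) le_rfl)
    filter_upwards [ae_restrict_mem (measurableSet_ival d b)] with t ht
    refine mul_le_mul_left (ENNReal.rpow_le_rpow ?_ (by positivity)) _
    have hEt : E ∩ ival a t = E := inter_eq_left.2 (hEd.trans (ival_mono le_rfl ht.1.le))
    calc δ ^ p₂ * volume E = ∫⁻ s, E.indicator (fun _ => δ ^ p₂) s ∂(leb a t) := by
          rw [lintegral_indicator_const hE, leb, Measure.restrict_apply hE, hEt]
      _ ≤ _ := by
          refine lintegral_mono_ae ?_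
          filter_upwards [ae_mono (leb_mono le_rfl ht.2.le) hδ] with s hs
          by_cases hsE : s ∈ E
          · rw [indicator_of_mem hsE, indicator_of_mem hsE, ← ENNReal.mul_rpow_of_nonneg _ _ hp.le,
              mul_comm, ← div_eq_mul_inv]
            exact ENNReal.rpow_le_rpow (hs hsE) hp.le
          · rw [indicator_of_notMem hsE]
            exact zero_le
  rw [cesNorm]
  refine le_trans (le_of_eq ?_) (ENNReal.rpow_le_rpow hlow (by positivity))
  rw [ENNReal.mul_rpow_of_nonneg _ _ (by positivity), ← ENNReal.rpow_mul,
    show q₂ / p₂ * (1 / q₂) = 1 / p₂ by field_simp, ENNReal.mul_rpow_of_nonneg _ _ (by positivity),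
    ← ENNReal.rpow_mul, mul_one_div_cancel hp.ne', ENNReal.rpow_one]
  ring

/-- Points have open neighbourhoods of measure below ε, so F is locally null. -/
lemma measure_eq_zero_of_forall_small {F : Set ℝ} {ε : ℝ≥0∞} (hε : ε ≠ 0)
    (h : ∀ U : Set ℝ, IsOpen U → volume U < ε → volume (F ∩ U) = 0) : volume F = 0 := by
  refine measure_null_of_locally_null F fun x _ => ?_
  obtain ⟨U, hU, hUo, hUε⟩ := Set.exists_isOpen_lt_of_lt ({x} : Set ℝ) ε
    (μ := volume) (by rw [measure_singleton]; exact pos_iff_ne_zero.2 hε)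
  exact ⟨F ∩ U, inter_mem_nhdsWithin F (hUo.mem_nhds (hU rfl)), h U hUo hUε⟩

lemma exists_pos_forall_mul_rpow_lt {A B : ℝ≥0∞} {s : ℝ} (hA : A ≠ 0) (hB : B ≠ ∞) (hs : 0 < s) :
    ∃ ε : ℝ≥0∞, ε ≠ 0 ∧ ∀ m < ε, B * m ^ s < A := by
  have h : Filter.Tendsto (fun m : ℝ≥0∞ => B * m ^ s) (nhds 0) (nhds 0) := by
    have := ENNReal.Tendsto.const_mul (a := B)
      ((ENNReal.continuous_rpow_const (y := s)).tendsto 0) (Or.inr hB)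
    rwa [ENNReal.zero_rpow_of_pos hs, mul_zero] at this
  obtain ⟨ε, hε, h'⟩ := ENNReal.nhds_zero_basis.eventually_iff.1
    (h.eventually_lt_const (pos_iff_ne_zero.2 hA))
  exact ⟨ε, hε.ne', fun m hm => h' hm⟩

lemma IsWeight.rpow {u : ℝ → ℝ≥0∞} (hu : IsWeight a b u) {q : ℝ} (hq : 0 < q) :
    IsWeight a b fun t => u t ^ q where
  meas := hu.meas.pow_const q
  pos := by
    filter_upwards [hu.pos] with t ht
    rwa [pos_iff_ne_zero, Ne, ENNReal.rpow_eq_zero_iff_of_pos hq, ← Ne, ← pos_iff_ne_zero]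
  fin := by
    filter_upwards [hu.fin] with t ht
    exact ENNReal.rpow_lt_top_of_nonneg hq.le ht.ne

/-- Since p₁ < p₂, the test functions 1_E / v₁ with |E| small exclude sets of positive measure on
which v₂/v₁ ≥ δ. As δ > 0 is arbitrary, v₂/v₁ would vanish almost everywhere on (c, d). -/
lemma not_cesEmbeds (hp₁ : 0 < p₁) (hq₁ : 0 < q₁) (hq₂ : 0 < q₂) (hp : p₁ < p₂) (hab : a < b)
    (hv₁ : IsWeight a b v₁) (hu₂ : IsWeight a b u₂) (hv₂ : IsWeight a b v₂)
    (hW : ∀ x ∈ ival a b, integ (fun t => u₁ t ^ q₁) (x : ℝ) b ≠ ∞) :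
    ¬ CesEmbeds a b p₁ q₁ p₂ q₂ u₁ v₁ u₂ v₂ := by
  rintro ⟨K, hK⟩
  have hp₂ : 0 < p₂ := hp₁.trans hp
  obtain ⟨c, hac, hcb⟩ := exists_real_btwn hab
  obtain ⟨d, hcd, hdb⟩ := exists_real_btwn hcb
  have hm : AEMeasurable (fun s => v₂ s / v₁ s) (leb a b) := hv₂.meas.div hv₁.meas
  set g := hm.mk with hg
  have hs : 0 < 1 / p₁ - 1 / p₂ := sub_pos.2 (one_div_lt_one_div_of_lt hp₁ hp)
  have hU : integ (fun t => u₂ t ^ q₂) d b ≠ 0 :=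
    ((hu₂.rpow hq₂).integ_pos (hac.trans hcd).le hdb le_rfl).ne'
  have hsub : Ioo c d ⊆ ival a d := by
    rw [← ival_coe]; exact ival_mono hac.le le_rfl
  have hnull : ∀ n : ℕ, volume ({s | ((n : ℝ≥0∞) + 1)⁻¹ ≤ g s} ∩ Ioo c d) = 0 := by
    intro n
    set δ : ℝ≥0∞ := ((n : ℝ≥0∞) + 1)⁻¹ with hδ
    have hδ0 : δ ≠ 0 := by simp [hδ]
    have hδT : δ ≠ ∞ := by simp [hδ]
    obtain ⟨ε, hε, hlt⟩ := exists_pos_forall_mul_rpow_lt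
      (A := integ (fun t => u₂ t ^ q₂) d b ^ (1 / q₂) * δ)
      (B := K * integ (fun t => u₁ t ^ q₁) c b ^ (1 / q₁))
      (mul_ne_zero (by rwa [Ne, ENNReal.rpow_eq_zero_iff_of_pos (by positivity)]) hδ0)
      (ENNReal.mul_ne_top ENNReal.coe_ne_top (ENNReal.rpow_ne_top_of_nonneg (by positivity)
        (hW c ⟨hac, hcb⟩))) hs
    refine measure_eq_zero_of_forall_small hε fun U hUo hUε => ?_
    set E := {s | δ ≤ g s} ∩ Ioo c d ∩ U with hE
    have hEm : MeasurableSet E :=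
      ((measurableSet_le measurable_const hm.measurable_mk).inter measurableSet_Ioo).inter
        hUo.measurableSet
    have hEε : volume E < ε := (measure_mono inter_subset_right).trans_lt hUε
    have hET : volume E ≠ ∞ := hEε.ne_top
    by_contra hE0
    have h1 := le_cesNorm_indicator (u₂ := u₂) (v₁ := v₁) (v₂ := v₂) hp₂ hq₂ (hac.trans hcd).le
      hEm ((inter_subset_left.trans inter_subset_right).trans hsub) (δ := δ)
      (by filter_upwards [hm.ae_eq_mk] with s hs hsE; rw [hs]; exact hsE.1.1) hδT hET
    have h2 := cesNorm_indicator_le (u₁ := u₁) hp₁ hq₁ hv₁ hac hEm hET fun s hs => hs.1.2.1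
    have hf : MPlus a b (E.indicator fun s => (v₁ s)⁻¹) := hv₁.meas.inv.indicator hEm
    have h3 := h1.trans ((hK _ hf).trans (mul_le_mul_right h2 _))
    -- If |E| > 0, cancelling |E|^(1/p₂) leaves a positive constant bounded by a multiple of
    -- |E|^(1/p₁ - 1/p₂), which the choice of ε forbids.
    rw [show 1 / p₁ = (1 / p₁ - 1 / p₂) + 1 / p₂ by ring, ENNReal.rpow_add _ _ hE0 hET,
      ← mul_assoc, ← mul_assoc, ENNReal.mul_le_mul_iff_left] at h3
    · exact (hlt _ hEε).not_ge h3
    · rwa [Ne, ENNReal.rpow_eq_zero_iff_of_pos (by positivity)]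
    · exact ENNReal.rpow_ne_top_of_nonneg (by positivity) hET
  have hall : ∀ᵐ s ∂(leb c d), False := by
    have hgpos : ∀ᵐ s ∂(leb a b), 0 < g s := by
      filter_upwards [hm.ae_eq_mk, hv₂.pos, hv₁.fin] with s hs h2 h1
      rw [hg, ← hs]
      exact ENNReal.div_pos h2.ne' h1.ne
    have hn : ∀ᵐ s ∂(leb c d), ∀ n : ℕ, ¬ ((n : ℝ≥0∞) + 1)⁻¹ ≤ g s := by
      rw [ae_all_iff]
      intro n
      rw [leb, ival_coe, ae_iff, Measure.restrict_apply' measurableSet_Ioo]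
      simpa only [not_not] using hnull n
    filter_upwards [ae_mono (leb_mono hac.le hdb.le) hgpos, hn] with s h0 hs
    obtain ⟨n, hn⟩ := ENNReal.exists_inv_nat_lt h0.ne'
    exact hs n ((ENNReal.inv_le_inv.2 le_self_add).trans hn.le)
  exact leb_ne_zero hcd (ae_eq_bot.1 (Filter.eventually_false_iff_eq_bot.1 hall))

end embedding

end CesHardy

/-! ### Assembly of the theorem. -/

open CesHardy in
theorem theorem2p1 :
    (∀ r p q : ℝ, 0 < r → r ≤ 1 → 0 < p → 0 < q →
      ∃ K : ℝ≥0, 0 < K ∧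
        ∀ (a b : EReal) (u v w : ℝ → ℝ≥0∞), 0 ≤ a → a < b →
          IsWeight a b u → IsWeight a b v → IsWeight a b w →
          (∀ x ∈ ival a b, 0 < integ w (x : ℝ) b ∧ integ w (x : ℝ) b < ∞) →
          -- (i)
          (p ≤ r → 1 ≤ q →
            (HardyHolds a b r p q u v w ↔ C1 a b r p q u v w < ∞) ∧
            EquivWith K (bestConst a b r p q u v w) (C1 a b r p q u v w)) ∧
          -- (ii)
          (p ≤ q → q < 1 → p ≤ r →
            (HardyHolds a b r p q u v w ↔ C2 a b r p q u v w < ∞) ∧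
            EquivWith K (bestConst a b r p q u v w) (C2 a b r p q u v w)) ∧
          -- (iii)
          (r < p → p ≤ q → 1 ≤ q →
            (HardyHolds a b r p q u v w ↔
              max (C1 a b r p q u v w) (C3 a b r p q u v w) < ∞) ∧
            EquivWith K (bestConst a b r p q u v w)
              (C1 a b r p q u v w + C3 a b r p q u v w)) ∧
          -- (iv)
          (r < p → p ≤ q → q < 1 →
            (HardyHolds a b r p q u v w ↔
              max (C2 a b r p q u v w) (C3 a b r p q u v w) < ∞) ∧
            EquivWith K (bestConst a b r p q u v w)
              (C2 a b r p q u v w + C3 a b r p q u v w)) ∧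
          -- (v)
          (q < p → p ≤ r →
            (HardyHolds a b r p q u v w ↔
              max (C4 a b r p q u v w) (C5 a b r p q u v w) < ∞) ∧
            EquivWith K (bestConst a b r p q u v w)
              (C4 a b r p q u v w + C5 a b r p q u v w)) ∧
          -- (vi)
          (q < p → q < 1 → r < p →
            (HardyHolds a b r p q u v w ↔
              max (C1 a b r p q u v w)
                (max (C5 a b r p q u v w) (C6 a b r p q u v w)) < ∞) ∧
            EquivWith K (bestConst a b r p q u v w)
              (C1 a b r p q u v w + C5 a b r p q u v w + C6 a b r p q u v w)) ∧
          -- (vii)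
          (1 ≤ q → q < p →
            (HardyHolds a b r p q u v w ↔
              max (C1 a b r p q u v w)
                (max (C6 a b r p q u v w) (C7 a b r p q u v w)) < ∞) ∧
            EquivWith K (bestConst a b r p q u v w)
              (C1 a b r p q u v w + C6 a b r p q u v w + C7 a b r p q u v w))) ∧
    -- the embedding between weighted Cesàro spaces
    (∀ p₁ q₁ p₂ q₂ : ℝ, 0 < p₁ → 0 < q₁ → 0 < p₂ → 0 < q₂ →
      ∀ (a b : EReal) (u₁ v₁ u₂ v₂ : ℝ → ℝ≥0∞), 0 ≤ a → a < b →
        IsWeight a b u₁ → IsWeight a b v₁ → IsWeight a b u₂ → IsWeight a b v₂ →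
        (∀ x ∈ ival a b, 0 < integ (fun t => u₁ t ^ q₁) (x : ℝ) b ∧
          integ (fun t => u₁ t ^ q₁) (x : ℝ) b < ∞) →
        (p₂ ≤ p₁ →
          (CesEmbeds a b p₁ q₁ p₂ q₂ u₁ v₁ u₂ v₂ ↔
            HardyHolds a b (p₂ / p₁) (q₁ / p₁) (q₂ / p₁)
              (fun t => u₂ t ^ q₂) (fun t => (v₂ t / v₁ t) ^ p₂) (fun t => u₁ t ^ q₁)) ∧
          cesConst a b p₁ q₁ p₂ q₂ u₁ v₁ u₂ v₂ ^ p₁ =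
            bestConst a b (p₂ / p₁) (q₁ / p₁) (q₂ / p₁)
              (fun t => u₂ t ^ q₂) (fun t => (v₂ t / v₁ t) ^ p₂) (fun t => u₁ t ^ q₁)) ∧
        (p₁ < p₂ → ¬ CesEmbeds a b p₁ q₁ p₂ q₂ u₁ v₁ u₂ v₂)) := by
  refine ⟨fun r p q hr hr1 hp hq => ?_, fun p₁ q₁ p₂ q₂ hp₁ hq₁ hp₂ hq₂ a b u₁ v₁ u₂ v₂ _ hab _ hv₁
    hu₂ hv₂ hW => ⟨fun _ => ⟨cesEmbeds_iff hp₁ hp₂ hv₁, cesConst_rpow hp₁ hp₂ hv₁⟩,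
      fun hp => not_cesEmbeds hp₁ hq₁ hq₂ hp hab hv₁ hu₂ hv₂ fun x hx => (hW x hx).2.ne⟩⟩
  obtain ⟨K₁, h₁⟩ := exists_nnreal_forall_ge
    (fun h : p ≤ r ∧ 1 ≤ q => exists_characterizes_C1 hr hr1 hp h.2 h.1)
    fun K K' hK h => h.mono hK
  obtain ⟨K₂, h₂⟩ := exists_nnreal_forall_ge
    (fun h : p ≤ q ∧ q < 1 ∧ p ≤ r => exists_characterizes_C2 hr hr1 hp hq h.1 h.2.1 h.2.2)
    fun K K' hK h => h.mono hK
  obtain ⟨K₃, h₃⟩ := exists_nnreal_forall_ge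
    (fun h : r < p ∧ p ≤ q ∧ 1 ≤ q => exists_characterizes_C1_C3 hr hr1 h.1 h.2.1 h.2.2)
    fun K K' hK h => h.mono hK
  obtain ⟨K₄, h₄⟩ := exists_nnreal_forall_ge
    (fun h : r < p ∧ p ≤ q ∧ q < 1 => exists_characterizes_C2_C3 hr hr1 h.1 h.2.1 h.2.2)
    fun K K' hK h => h.mono hK
  obtain ⟨K₅, h₅⟩ := exists_nnreal_forall_ge
    (fun h : q < p ∧ p ≤ r => exists_characterizes_C4_C5 hr hr1 hq h.1 h.2)
    fun K K' hK h => h.mono hK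
  obtain ⟨K₆, h₆⟩ := exists_nnreal_forall_ge
    (fun h : q < p ∧ q < 1 ∧ r < p => exists_characterizes_C1_C5_C6 hr hr1 hq h.1 h.2.1 h.2.2)
    fun K K' hK h => h.mono hK
  obtain ⟨K₇, h₇⟩ := exists_nnreal_forall_ge
    (fun h : 1 ≤ q ∧ q < p => exists_characterizes_C1_C6_C7 hr hr1 h.1 h.2)
    fun K K' hK h => h.mono hK
  set L := K₁ ⊔ K₂ ⊔ K₃ ⊔ K₄ ⊔ K₅ ⊔ K₆ ⊔ K₇ with hL
  have hle : K₁ ≤ L + 1 ∧ K₂ ≤ L + 1 ∧ K₃ ≤ L + 1 ∧ K₄ ≤ L + 1 ∧ K₅ ≤ L + 1 ∧ K₆ ≤ L + 1 ∧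
      K₇ ≤ L + 1 := by
    refine ⟨?_, ?_, ?_, ?_, ?_, ?_, ?_⟩ <;> refine le_trans ?_ le_self_add <;> simp [hL]
  obtain ⟨l₁, l₂, l₃, l₄, l₅, l₆, l₇⟩ := hle
  refine ⟨L + 1, by positivity, fun a b u v w ha hab hu hv hw hW => ?_⟩
  -- A maximum is finite exactly when the sum is, so the finiteness conditions take the form used in
  -- `Characterizes`.
  simp only [max_lt_iff, ← ENNReal.add_lt_top, ← add_assoc]
  exact ⟨fun x y => h₁ _ l₁ ⟨x, y⟩ a b u v w ha hab hu hv hw hW,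
    fun x y z => h₂ _ l₂ ⟨x, y, z⟩ a b u v w ha hab hu hv hw hW,
    fun x y z => h₃ _ l₃ ⟨x, y, z⟩ a b u v w ha hab hu hv hw hW,
    fun x y z => h₄ _ l₄ ⟨x, y, z⟩ a b u v w ha hab hu hv hw hW,
    fun x y => h₅ _ l₅ ⟨x, y⟩ a b u v w ha hab hu hv hw hW,
    fun x y z => h₆ _ l₆ ⟨x, y, z⟩ a b u v w ha hab hu hv hw hW,
    fun x y => h₇ _ l₇ ⟨x, y⟩ a b u v w ha hab hu hv hw hW⟩
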